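/- **Conventions.** A 2-category is a strict 2-category; a $(2,1)$-category is a 2-category all of whose 2-cells are invertible; a 2-functor is strict. A 2-functor is *2-fully faithful* if it induces isomorphisms between the categories of 1-cells and 2-cells. A *2-faithful subcategory* $\mathcal A$ of a 2-category $\mathcal C$ with $\mathrm{Ob}\,\mathcal A=\mathrm{Ob}\,\mathcal C$ is given by a class of 1-cells containing identities and closed under composition, together with all 2-cells of $\mathcal C$ between them. By a *square* we mean 1-cells $j\colon X\to Y$, $q\colon X\to Z$, $p\colon Y\to W$, $i\colon Z\to W$ and a 2-cell $\alpha\colon iq\Rightarrow pj$. *2-Cartesian squares.* 2-fiber products are taken in the sense of pseudo-bilimits: a square is 2-Cartesian in a 2-faithful subcategory $\mathcal P$ of the $(2,1)$-category $\mathcal C$ if its 1-cells are in $\mathcal P$ and, for every object $T$, the functor $\mathcal P(T,X)\to\{(u,v,\theta)\mid u\in\mathcal P(T,Y),\ v\in\mathcal P(T,Z),\ \theta\colon iv\Rightarrow pu\}$ is an equivalence of categories. "2-fiber products exist in $\mathcal P$ and are 2-fiber products in $\mathcal Q$" means that every pair of 1-cells of $\mathcal P$ with the same target is part of a square that is 2-Cartesian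 in $\mathcal P$, and that all squares that are 2-Cartesian in $\mathcal P$ are 2-Cartesian in $\mathcal Q$. In a square that is 2-Cartesian in $\mathcal C$, the 1-cell $j$ is called a 2-base change of $i$ by $p$ in $\mathcal C$. *Generation.* $\mathcal P$ and $\mathcal Q$ *generate* $\mathcal R$ if every 1-cell of $\mathcal R$ is isomorphic to a composite $p_1a_1\cdots p_ka_k$ with $a_l\in\mathcal P$, $p_l\in\mathcal Q$. *Squaring.* $\mathcal P$ and $\mathcal Q$ are *squaring* in $\mathcal C$ if every square $\alpha$ with $i,j\in\mathcal P$ and $p,q\in\mathcal Q$ is the pasting of a square $\beta\colon ir\Rightarrow pk$ that is 2-Cartesian in $\mathcal C$, with $k\colon X'\to Y$ in $\mathcal P$ and $r\colon X'\to Z$ in $\mathcal Q$, and of 2-cells $\gamma\colon q\Rightarrow rf$ and $\delta\colon kf\Rightarrow j$, where $f\colon X\to X'$ is in $\mathcal P\cap\mathcal Q$. *Cubing.* A cube has bottom face $K\colon aq\Rightarrow pb$ on $X,Y,Z,W$, top face $K'\colon a'q'\Rightarrow p'b'$ on $X',Y',Z',W'$, vertical 1-cells $x,y,z,w$ (with $x\colon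 X'\to X$, etc.), left face $I'\colon qx\Rightarrow zq'$, front face $J\colon az\Rightarrow wa'$, back face $J'\colon bx\Rightarrow yb'$ and right face $I\colon py\Rightarrow wp'$, and the two pasted 2-cells $aqx\Rightarrow wp'b'$ (via $I',J,K'$ and via $K,J',I$) coincide. It is of type $(\mathcal P,\mathcal Q,\mathcal R)$ if $a,b,a',b'\in\mathcal P$, $p,q,p',q'\in\mathcal Q$, $x,y,z,w\in\mathcal R$. Subcategories $\mathcal P_1,\dots,\mathcal P_m$ are *cubing* in $\mathcal C$ if for $i\ne j$ both $(\mathcal P_i,\mathcal P_j)$ and $(\mathcal P_i,\mathcal P_i\cap\mathcal P_j)$ are squaring, and for pairwise distinct $i,j,k$ every cube of type $(\mathcal P_i,\mathcal P_j,\mathcal P_k)$ decomposes as follows: there are 1-cells $f\colon X\to V$, $f'\colon X'\to V'$ in $\mathcal P_i\cap\mathcal P_j$, $c\colon V\to Y$, $c'\colon V'\to Y'$ in $\mathcal P_i$, $r\colon V\to Z$, $r'\colon V'\to Z'$ in $\mathcal P_j$, $v\colon V'\to V$ in $\mathcal P_k$, 2-cells $L\colon ar\Rightarrow pc$, $L'\colon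 a'r'\Rightarrow p'c'$ forming squares 2-Cartesian in $\mathcal C$, 2-cells $\gamma\colon q\Rightarrow rf$, $\delta\colon cf\Rightarrow b$, $\gamma'\colon q'\Rightarrow r'f'$, $\delta'\colon c'f'\Rightarrow b'$, $M\colon fx\Rightarrow vf'$, $I''\colon rv\Rightarrow zr'$, $J''\colon cv\Rightarrow yc'$, such that the inner cube with faces $L,L',I'',J,J'',I$ commutes, $K$ is the pasting of $\gamma,L,\delta$, $K'$ is the pasting of $\gamma',L',\delta'$, the pasting of $I'$ and $\gamma'$ equals that of $\gamma$, $M$ and $I''$, and the pasting of $\delta$ and $J'$ equals that of $M$, $J''$ and $\delta'$. *Gluing data.* Let $\mathcal C$ be a $(2,1)$-category, $\mathcal D$ a 2-category and $\mathcal A_1,\dots,\mathcal A_n$ 2-faithful subcategories of $\mathcal C$ with the same objects as $\mathcal C$. An object of the 2-category $\mathrm{GD}_{\mathcal A_1,\dots,\mathcal A_n}(\mathcal C,\mathcal D)$ consists of pseudo-functors $F_i\colon\mathcal A_i\to\mathcal D$ with a common action on objects and, for $i<j$ and each square $D$ with horizontal 1-cells $a\colon Z\to W$, $b\colon X\to Y$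 in $\mathcal A_i$ and vertical 1-cells $q\colon X\to Z$, $p\colon Y\to W$ in $\mathcal A_j$, an invertible 2-cell $G_{ijD}\colon F_i(a)F_j(q)\Rightarrow F_j(p)F_i(b)$, such that: if $p,q$ (resp. $a,b$) are identities, then, up to the coherence 2-cells of $F_i$ and $F_j$, $G_{ijD}$ is the image under $F_i$ (resp. $F_j$) of the 2-cell of $D$; $G_{ij}$ is compatible with horizontal and with vertical pasting of squares; and for $i<j<k$ and every cube of type $(\mathcal A_i,\mathcal A_j,\mathcal A_k)$ the 2-cells $G$ attached to its six faces form a commutative cube, i.e. the two composites $F_i(a)F_j(q)F_k(x)\Rightarrow F_k(w)F_j(p')F_i(b')$ coincide. A 1-cell is a family of pseudo-natural transformations $\alpha_i\colon F_i\to F_i'$ with common components, compatible with $G$ and $G'$; a 2-cell is a family of modifications $\alpha_i\Rightarrow\alpha'_i$ with common components. $\mathrm{2Fun}(\mathrm{Ob}\,\mathcal C,\mathcal D)$ is the 2-category of families of objects, 1-cells and 2-cells of $\mathcal D$ indexed by $\mathrm{Ob}\,\mathcal C$; $\mathrm{GD}$ has a forgetful 2-functor to it. *Comparison 2-functor.*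 Let $n\ge2$ and let $\mathcal B$ be a 2-faithful subcategory of $\mathcal C$ with $\mathrm{Ob}\,\mathcal B=\mathrm{Ob}\,\mathcal C$ containing $\mathcal A_1$ and $\mathcal A_2$. Restricting pseudo-functors, pseudo-natural transformations and gluing data from $\mathcal B$ to $\mathcal A_1$ and to $\mathcal A_2$, and defining $G_{12D}$, for a square $D$ with 2-cell $\alpha\colon iq\Rightarrow pj$, as $F_{\mathcal B}(i)F_{\mathcal B}(q)\cong F_{\mathcal B}(iq)\Rightarrow F_{\mathcal B}(pj)\cong F_{\mathcal B}(p)F_{\mathcal B}(j)$ (the middle map being $F_{\mathcal B}(\alpha)$), gives a 2-functor over $\mathrm{2Fun}(\mathrm{Ob}\,\mathcal C,\mathcal D)$ $$\Phi\colon \mathrm{GD}_{\mathcal B,\mathcal A_3,\dots,\mathcal A_n}(\mathcal C,\mathcal D)\to\mathrm{GD}_{\mathcal A_1,\dots,\mathcal A_n}(\mathcal C,\mathcal D).$$ *Equivalences over $\mathcal S$.* A 2-functor $G\colon\mathcal X\to\mathcal Y$ over a 2-category $\mathcal S$ (it commutes strictly with given 2-functors to $\mathcal S$) is an *$\mathcal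 S$-equivalence* if there are a 2-functor $H\colon\mathcal Y\to\mathcal X$ over $\mathcal S$ and 2-natural transformations $1_{\mathcal Y}\Rightarrow GH$ and $HG\Rightarrow1_{\mathcal X}$ whose components are invertible 1-cells mapped to identities in $\mathcal S$. **Theorem.** Let $\mathcal C$ be a $(2,1)$-category, $n\ge2$, $\mathcal A_1,\dots,\mathcal A_n,\mathcal B$ 2-faithful subcategories of $\mathcal C$ with the same objects as $\mathcal C$, $\mathcal A_1,\mathcal A_2\subset\mathcal B$, and $\mathcal D$ a 2-category. Assume: * (i) Every 1-cell of $\mathcal B$ is isomorphic to $pa$ for some 1-cells $a$ of $\mathcal A_1$ and $p$ of $\mathcal A_2$. * (ii) 2-fiber products exist in $\mathcal A_2$ and are 2-fiber products in $\mathcal B$. * (iii) For $3\le i\le n$, 2-base changes of 1-cells of $\mathcal A_i$ by 1-cells of $\mathcal A_2$ in $\mathcal C$ exist and are 1-cells of $\mathcal A_i$. * (iv) For $i=1,2$ and $3\le j\le n$, 1-cells of $\mathcal A_i$ are stable under 2-base change by 1-cells of $\mathcal A_j$ in $\mathcal C$, whenever the 2-base change exists. * (v) For $3\le i\le n$, $\mathcal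 B$ and $\mathcal A_i$ are squaring in $\mathcal C$. * (vi) For $3\le i\le n$, $\mathcal A_1\cap\mathcal A_i$ and $\mathcal A_2\cap\mathcal A_i$ generate $\mathcal B\cap\mathcal A_i$. Then $\Phi$ is 2-fully faithful. Moreover, $\Phi$ is a $\mathrm{2Fun}(\mathrm{Ob}\,\mathcal C,\mathcal D)$-equivalence under the following additional assumptions: * (iv') For $i=1,2$ and $3\le j\le n$, $\mathcal A_i$ and $\mathcal A_j$ are squaring in $\mathcal C$. * (v') $\mathcal B,\mathcal A_3,\dots,\mathcal A_n$ are cubing in $\mathcal C$. * (vi') For $3\le i\le n$, every 1-cell of $\mathcal B\cap\mathcal A_i$ is isomorphic to $pa$ for some 1-cells $a$ of $\mathcal A_1\cap\mathcal A_i$ and $p$ of $\mathcal A_2\cap\mathcal A_i$. * (vii) For $3\le i\le n$, 2-fiber products exist in $\mathcal A_2\cap\mathcal A_i$ and are 2-fiber products in $\mathcal B\cap\mathcal A_i$. * (viii) For $3\le i\le n$, 2-base changes of 1-cells of $\mathcal A_2\cap\mathcal A_i$ by 1-cells of $\mathcal A_1$ in $\mathcal C$ exist. * (ix) For $i=1,2$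 and $3\le j\le n$, 1-cells of $\mathcal A_i\cap\mathcal A_j$ are stable under 2-base change by 1-cells of $\mathcal B$ and by 1-cells of $\mathcal A_j$ in $\mathcal C$, whenever the 2-base change exists. * (x) For $3\le i<j\le n$, $\mathcal A_1\cap\mathcal A_i\cap\mathcal A_j$ and $\mathcal A_2\cap\mathcal A_i\cap\mathcal A_j$ generate $\mathcal B\cap\mathcal A_i\cap\mathcal A_j$. -/

import Mathlib

open CategoryTheory Bicategory

universe w v u w' v' u'

namespace TwoGlue

section Sub

/-- A 2-faithful subcategory of `C` with the same objects as `C`: it is given by a class of 1-cells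
that contains the identities and is closed under composition, and contains all 2-cells of `C`
between these 1-cells. The class need not be closed under isomorphism. -/
structure WideSub (C : Type u) [Bicategory.{w, v} C] where
  mem : ∀ {X Y : C}, (X ⟶ Y) → Prop
  id_mem : ∀ X : C, mem (𝟙 X)
  comp_mem : ∀ {X Y Z : C} {f : X ⟶ Y} {g : Y ⟶ Z}, mem f → mem g → mem (f ≫ g)

variable {C : Type u} [Bicategory.{w, v} C]

namespace WideSub

/-- Inclusion of subcategories. -/
instance : LE (WideSub C) := ⟨fun A B => ∀ ⦃X Y : C⦄ (f : X ⟶ Y), A.mem f → B.mem f⟩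

/-- The intersection `A ⊓ B` of two subcategories. -/
instance : Min (WideSub C) := ⟨fun A B =>
  { mem := fun f => A.mem f ∧ B.mem f
    id_mem := fun X => ⟨A.id_mem X, B.id_mem X⟩
    comp_mem := fun hf hg => ⟨A.comp_mem hf.1 hg.1, B.comp_mem hf.2 hg.2⟩ }⟩

/-- The whole of `C`, as a subcategory of itself. -/
instance : Top (WideSub C) := ⟨
  { mem := fun _ => True
    id_mem := fun _ => trivial
    comp_mem := fun _ _ => trivial }⟩

end WideSub

/-- Pasting of two squares along a horizontal edge. Here and below, composition is written in
diagrammatic order, and a 2-cell `α : q ≫ i ⟶ j ≫ p` stands for a square with top edge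
`j : X ⟶ Y`, bottom edge `i : Z ⟶ W`, left edge `q : X ⟶ Z` and right edge `p : Y ⟶ W`. -/
def vpaste {X₁ X₂ X₃ Y₁ Y₂ Y₃ : C} {i₁ : X₁ ⟶ Y₁} {i₂ : X₂ ⟶ Y₂} {i₃ : X₃ ⟶ Y₃}
    {q : X₁ ⟶ X₂} {p : Y₁ ⟶ Y₂} {q' : X₂ ⟶ X₃} {p' : Y₂ ⟶ Y₃}
    (α : q ≫ i₂ ⟶ i₁ ≫ p) (α' : q' ≫ i₃ ⟶ i₂ ≫ p') :
    (q ≫ q') ≫ i₃ ⟶ i₁ ≫ (p ≫ p') :=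
  (α_ q q' i₃).hom ≫ q ◁ α' ≫ (α_ q i₂ p').inv ≫ α ▷ p' ≫ (α_ i₁ p p').hom

/-- Pasting of two squares along a vertical edge. -/
def hpaste {X₁ X₂ X₃ Y₁ Y₂ Y₃ : C} {p₁ : X₁ ⟶ Y₁} {p₂ : X₂ ⟶ Y₂} {p₃ : X₃ ⟶ Y₃}
    {j : X₁ ⟶ X₂} {i : Y₁ ⟶ Y₂} {j' : X₂ ⟶ X₃} {i' : Y₂ ⟶ Y₃}
    (α : p₁ ≫ i ⟶ j ≫ p₂) (α' : p₂ ≫ i' ⟶ j' ≫ p₃) :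
    p₁ ≫ (i ≫ i') ⟶ (j ≫ j') ≫ p₃ :=
  (α_ p₁ i i').inv ≫ α ▷ i' ≫ (α_ j p₂ i').hom ≫ j ◁ α' ≫ (α_ j j' p₃).inv

end Sub

section PsFun

variable {C : Type u} [Bicategory.{w, v} C] {D : Type u'} [Bicategory.{w', v'} D]

/-- A pseudofunctor from the subcategory `A` of `C` to `D` whose action on objects is `F₀`. The
fields are those of `CategoryTheory.Pseudofunctor`, see `pseudofunctorEquiv`. -/
structure PsFun (A : WideSub C) (F₀ : C → D) where
  map : ∀ {X Y : C} (f : X ⟶ Y), A.mem f → (F₀ X ⟶ F₀ Y)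
  map₂ : ∀ {X Y : C} {f g : X ⟶ Y} (hf : A.mem f) (hg : A.mem g), (f ⟶ g) → (map f hf ⟶ map g hg)
  mapId : ∀ X : C, map (𝟙 X) (A.id_mem X) ≅ 𝟙 (F₀ X)
  mapComp : ∀ {X Y Z : C} (f : X ⟶ Y) (g : Y ⟶ Z) (hf : A.mem f) (hg : A.mem g),
    map (f ≫ g) (A.comp_mem hf hg) ≅ map f hf ≫ map g hg
  map₂_id : ∀ {X Y : C} (f : X ⟶ Y) (hf : A.mem f), map₂ hf hf (𝟙 f) = 𝟙 (map f hf)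
  map₂_comp : ∀ {X Y : C} {f g h : X ⟶ Y} (hf : A.mem f) (hg : A.mem g) (hh : A.mem h)
    (η : f ⟶ g) (θ : g ⟶ h), map₂ hf hh (η ≫ θ) = map₂ hf hg η ≫ map₂ hg hh θ
  map₂_whiskerLeft : ∀ {X Y Z : C} (f : X ⟶ Y) {g h : Y ⟶ Z} (hf : A.mem f) (hg : A.mem g)
    (hh : A.mem h) (η : g ⟶ h),
    map₂ (A.comp_mem hf hg) (A.comp_mem hf hh) (f ◁ η) =
      (mapComp f g hf hg).hom ≫ map f hf ◁ map₂ hg hh η ≫ (mapComp f h hf hh).inv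
  map₂_whiskerRight : ∀ {X Y Z : C} {f g : X ⟶ Y} (hf : A.mem f) (hg : A.mem g) (η : f ⟶ g)
    (h : Y ⟶ Z) (hh : A.mem h),
    map₂ (A.comp_mem hf hh) (A.comp_mem hg hh) (η ▷ h) =
      (mapComp f h hf hh).hom ≫ map₂ hf hg η ▷ map h hh ≫ (mapComp g h hg hh).inv
  map₂_associator : ∀ {W X Y Z : C} (f : W ⟶ X) (g : X ⟶ Y) (h : Y ⟶ Z) (hf : A.mem f)
    (hg : A.mem g) (hh : A.mem h),
    map₂ (A.comp_mem (A.comp_mem hf hg) hh) (A.comp_mem hf (A.comp_mem hg hh)) (α_ f g h).hom =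
      (mapComp (f ≫ g) h (A.comp_mem hf hg) hh).hom ≫ (mapComp f g hf hg).hom ▷ map h hh ≫
        (α_ (map f hf) (map g hg) (map h hh)).hom ≫ map f hf ◁ (mapComp g h hg hh).inv ≫
        (mapComp f (g ≫ h) hf (A.comp_mem hg hh)).inv
  map₂_leftUnitor : ∀ {X Y : C} (f : X ⟶ Y) (hf : A.mem f),
    map₂ (A.comp_mem (A.id_mem X) hf) hf (λ_ f).hom =
      (mapComp (𝟙 X) f (A.id_mem X) hf).hom ≫ (mapId X).hom ▷ map f hf ≫ (λ_ (map f hf)).hom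
  map₂_rightUnitor : ∀ {X Y : C} (f : X ⟶ Y) (hf : A.mem f),
    map₂ (A.comp_mem hf (A.id_mem Y)) hf (ρ_ f).hom =
      (mapComp f (𝟙 Y) hf (A.id_mem Y)).hom ≫ map f hf ◁ (mapId Y).hom ≫ (ρ_ (map f hf)).hom

/-- Restriction of a pseudofunctor to a smaller subcategory. -/
abbrev PsFun.restrict {A B : WideSub C} {F₀ : C → D} (F : PsFun B F₀) (h : A ≤ B) :
    PsFun A F₀ where
  map f hf := F.map f (h f hf)
  map₂ hf hg η := F.map₂ (h _ hf) (h _ hg) η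
  mapId X := F.mapId X
  mapComp f g hf hg := F.mapComp f g (h _ hf) (h _ hg)
  map₂_id f hf := F.map₂_id f (h _ hf)
  map₂_comp hf hg hh η θ := F.map₂_comp (h _ hf) (h _ hg) (h _ hh) η θ
  map₂_whiskerLeft f _ _ hf hg hh η := F.map₂_whiskerLeft f (h _ hf) (h _ hg) (h _ hh) η
  map₂_whiskerRight hf hg η k hk := F.map₂_whiskerRight (h _ hf) (h _ hg) η k (h _ hk)
  map₂_associator f g k hf hg hk := F.map₂_associator f g k (h _ hf) (h _ hg) (h _ hk)
  map₂_leftUnitor f hf := F.map₂_leftUnitor f (h _ hf)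
  map₂_rightUnitor f hf := F.map₂_rightUnitor f (h _ hf)

/-- A pseudonatural transformation between pseudofunctors `A ⥤ D` whose components are the 1-cells
`α X`. The fields are those of `CategoryTheory.Pseudofunctor.StrongTrans`, see
`strongTransEquiv`. -/
structure PsTrans {A : WideSub C} {F₀ F₀' : C → D} (F : PsFun A F₀) (F' : PsFun A F₀')
    (α : ∀ X, F₀ X ⟶ F₀' X) where
  nat : ∀ {X Y : C} (f : X ⟶ Y) (hf : A.mem f), F.map f hf ≫ α Y ≅ α X ≫ F'.map f hf
  nat_naturality : ∀ {X Y : C} {f g : X ⟶ Y} (hf : A.mem f) (hg : A.mem g) (η : f ⟶ g),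
    F.map₂ hf hg η ▷ α Y ≫ (nat g hg).hom = (nat f hf).hom ≫ α X ◁ F'.map₂ hf hg η
  nat_id : ∀ X : C, (nat (𝟙 X) (A.id_mem X)).hom ≫ α X ◁ (F'.mapId X).hom =
    (F.mapId X).hom ▷ α X ≫ (λ_ (α X)).hom ≫ (ρ_ (α X)).inv
  nat_comp : ∀ {X Y Z : C} (f : X ⟶ Y) (g : Y ⟶ Z) (hf : A.mem f) (hg : A.mem g),
    (nat (f ≫ g) (A.comp_mem hf hg)).hom ≫ α X ◁ (F'.mapComp f g hf hg).hom =
      (F.mapComp f g hf hg).hom ▷ α Z ≫ vpaste (nat f hf).hom (nat g hg).hom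

/-- Restriction of a pseudonatural transformation to a smaller subcategory. -/
abbrev PsTrans.restrict {A B : WideSub C} {F₀ F₀' : C → D} {F : PsFun B F₀} {F' : PsFun B F₀'}
    {α : ∀ X, F₀ X ⟶ F₀' X} (t : PsTrans F F' α) (h : A ≤ B) :
    PsTrans (F.restrict h) (F'.restrict h) α where
  nat f hf := t.nat f (h _ hf)
  nat_naturality hf hg η := t.nat_naturality (h _ hf) (h _ hg) η
  nat_id X := t.nat_id X
  nat_comp f g hf hg := t.nat_comp f g (h _ hf) (h _ hg)

/-- A gluing datum on two pseudofunctors `F : A ⥤ D` and `F' : B ⥤ D` with the same action on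
objects: an invertible 2-cell of `D` for every square of `C` whose horizontal edges are in `A` and
whose vertical edges are in `B`, compatible with squares whose vertical (`ax_a`) or horizontal
(`ax_a'`) edges are identities and with the pasting of squares (`ax_b` and `ax_b'`). -/
structure Gluing {A B : WideSub C} {F₀ : C → D} (F : PsFun A F₀) (F' : PsFun B F₀) where
  iso : ∀ {X Y Z W : C} {j : X ⟶ Y} {q : X ⟶ Z} {p : Y ⟶ W} {i : Z ⟶ W}
    (hj : A.mem j) (hq : B.mem q) (hp : B.mem p) (hi : A.mem i), (q ≫ i ⟶ j ≫ p) →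
    (F'.map q hq ≫ F.map i hi ≅ F.map j hj ≫ F'.map p hp)
  ax_a : ∀ {X Y : C} {i j : X ⟶ Y} (hi : A.mem i) (hj : A.mem j) (α : i ⟶ j),
    (iso hj (B.id_mem X) (B.id_mem Y) hi ((λ_ i).hom ≫ α ≫ (ρ_ j).inv)).hom =
      (F'.mapId X).hom ▷ F.map i hi ≫ (λ_ (F.map i hi)).hom ≫ F.map₂ hi hj α ≫
        (ρ_ (F.map j hj)).inv ≫ F.map j hj ◁ (F'.mapId Y).inv
  ax_a' : ∀ {X Y : C} {q p : X ⟶ Y} (hq : B.mem q) (hp : B.mem p) (α : q ⟶ p),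
    (iso (A.id_mem X) hq hp (A.id_mem Y) ((ρ_ q).hom ≫ α ≫ (λ_ p).inv)).hom =
      F'.map q hq ◁ (F.mapId Y).hom ≫ (ρ_ (F'.map q hq)).hom ≫ F'.map₂ hq hp α ≫
        (λ_ (F'.map p hp)).inv ≫ (F.mapId X).inv ▷ F'.map p hp
  ax_b : ∀ {X₁ X₂ X₃ Y₁ Y₂ Y₃ : C} {i₁ : X₁ ⟶ Y₁} {i₂ : X₂ ⟶ Y₂} {i₃ : X₃ ⟶ Y₃}
    {q : X₁ ⟶ X₂} {p : Y₁ ⟶ Y₂} {q' : X₂ ⟶ X₃} {p' : Y₂ ⟶ Y₃}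
    (hi₁ : A.mem i₁) (hi₂ : A.mem i₂) (hi₃ : A.mem i₃)
    (hq : B.mem q) (hp : B.mem p) (hq' : B.mem q') (hp' : B.mem p')
    (α : q ≫ i₂ ⟶ i₁ ≫ p) (α' : q' ≫ i₃ ⟶ i₂ ≫ p'),
    (iso hi₁ (B.comp_mem hq hq') (B.comp_mem hp hp') hi₃ (vpaste α α')).hom =
      (F'.mapComp q q' hq hq').hom ▷ F.map i₃ hi₃ ≫
        vpaste (iso hi₁ hq hp hi₂ α).hom (iso hi₂ hq' hp' hi₃ α').hom ≫
        F.map i₁ hi₁ ◁ (F'.mapComp p p' hp hp').inv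
  ax_b' : ∀ {X₁ X₂ X₃ Y₁ Y₂ Y₃ : C} {p₁ : X₁ ⟶ Y₁} {p₂ : X₂ ⟶ Y₂} {p₃ : X₃ ⟶ Y₃}
    {j : X₁ ⟶ X₂} {i : Y₁ ⟶ Y₂} {j' : X₂ ⟶ X₃} {i' : Y₂ ⟶ Y₃}
    (hp₁ : B.mem p₁) (hp₂ : B.mem p₂) (hp₃ : B.mem p₃)
    (hj : A.mem j) (hi : A.mem i) (hj' : A.mem j') (hi' : A.mem i')
    (α : p₁ ≫ i ⟶ j ≫ p₂) (α' : p₂ ≫ i' ⟶ j' ≫ p₃),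
    (iso (A.comp_mem hj hj') hp₁ hp₃ (A.comp_mem hi hi') (hpaste α α')).hom =
      F'.map p₁ hp₁ ◁ (F.mapComp i i' hi hi').hom ≫
        hpaste (iso hj hp₁ hp₂ hi α).hom (iso hj' hp₂ hp₃ hi' α').hom ≫
        (F.mapComp j j' hj hj').inv ▷ F'.map p₃ hp₃

/-- Restriction of a gluing datum to smaller subcategories. -/
abbrev Gluing.restrict {A A' B B' : WideSub C} {F₀ : C → D} {F : PsFun A' F₀} {F' : PsFun B' F₀}
    (G : Gluing F F') (hA : A ≤ A') (hB : B ≤ B') :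
    Gluing (F.restrict hA) (F'.restrict hB) where
  iso hj hq hp hi α := G.iso (hA _ hj) (hB _ hq) (hB _ hp) (hA _ hi) α
  ax_a hi hj α := G.ax_a (hA _ hi) (hA _ hj) α
  ax_a' hq hp α := G.ax_a' (hB _ hq) (hB _ hp) α
  ax_b h₁ h₂ h₃ hq hp hq' hp' α α' :=
    G.ax_b (hA _ h₁) (hA _ h₂) (hA _ h₃) (hB _ hq) (hB _ hp) (hB _ hq') (hB _ hp') α α'
  ax_b' h₁ h₂ h₃ hj hi hj' hi' α α' :=
    G.ax_b' (hB _ h₁) (hB _ h₂) (hB _ h₃) (hA _ hj) (hA _ hi) (hA _ hj') (hA _ hi') α α'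

namespace PsFun

variable {A : WideSub C} {F₀ : C → D} (F : PsFun A F₀)

lemma map₂_hom_inv {X Y : C} {f g : X ⟶ Y} (hf : A.mem f) (hg : A.mem g) (η : f ≅ g) :
    F.map₂ hf hg η.hom ≫ F.map₂ hg hf η.inv = 𝟙 (F.map f hf) := by
  rw [← F.map₂_comp, η.hom_inv_id, F.map₂_id]

lemma map₂_leftUnitor_inv {X Y : C} (f : X ⟶ Y) (hf : A.mem f) :
    F.map₂ hf (A.comp_mem (A.id_mem X) hf) (λ_ f).inv =
      (λ_ (F.map f hf)).inv ≫ (F.mapId X).inv ▷ F.map f hf ≫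
        (F.mapComp (𝟙 X) f (A.id_mem X) hf).inv := by
  have h := F.map₂_hom_inv (A.comp_mem (A.id_mem X) hf) hf (λ_ f)
  rw [F.map₂_leftUnitor] at h
  simp only [Category.assoc] at h
  rw [← cancel_epi (F.mapComp (𝟙 X) f (A.id_mem X) hf).inv] at h
  simp only [Iso.inv_hom_id_assoc, Category.comp_id] at h
  rw [← h]; simp

lemma map₂_rightUnitor_inv {X Y : C} (f : X ⟶ Y) (hf : A.mem f) :
    F.map₂ hf (A.comp_mem hf (A.id_mem Y)) (ρ_ f).inv =
      (ρ_ (F.map f hf)).inv ≫ F.map f hf ◁ (F.mapId Y).inv ≫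
        (F.mapComp f (𝟙 Y) hf (A.id_mem Y)).inv := by
  have h := F.map₂_hom_inv (A.comp_mem hf (A.id_mem Y)) hf (ρ_ f)
  rw [F.map₂_rightUnitor] at h
  simp only [Category.assoc] at h
  rw [← cancel_epi (F.mapComp f (𝟙 Y) hf (A.id_mem Y)).inv] at h
  simp only [Iso.inv_hom_id_assoc, Category.comp_id] at h
  rw [← h]; simp

lemma map₂_associator_inv {W X Y Z : C} (f : W ⟶ X) (g : X ⟶ Y) (h : Y ⟶ Z)
    (hf : A.mem f) (hg : A.mem g) (hh : A.mem h) :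
    F.map₂ (A.comp_mem hf (A.comp_mem hg hh)) (A.comp_mem (A.comp_mem hf hg) hh) (α_ f g h).inv =
      (F.mapComp f (g ≫ h) hf (A.comp_mem hg hh)).hom ≫
        F.map f hf ◁ (F.mapComp g h hg hh).hom ≫
        (α_ (F.map f hf) (F.map g hg) (F.map h hh)).inv ≫
        (F.mapComp f g hf hg).inv ▷ F.map h hh ≫
        (F.mapComp (f ≫ g) h (A.comp_mem hf hg) hh).inv := by
  have e := F.map₂_hom_inv (A.comp_mem (A.comp_mem hf hg) hh) (A.comp_mem hf (A.comp_mem hg hh))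
    (α_ f g h)
  rw [F.map₂_associator f g h hf hg hh] at e
  rw [← cancel_epi ((F.mapComp (f ≫ g) h (A.comp_mem hf hg) hh).hom ≫
        (F.mapComp f g hf hg).hom ▷ F.map h hh ≫
        (α_ (F.map f hf) (F.map g hg) (F.map h hh)).hom ≫
        F.map f hf ◁ (F.mapComp g h hg hh).inv ≫
        (F.mapComp f (g ≫ h) hf (A.comp_mem hg hh)).inv), e]
  simp

/-- The image of an (automatically invertible) 2-cell. -/
noncomputable def map₂Iso [IsLocallyGroupoid C] {X Y : C} {f g : X ⟶ Y} (hf : A.mem f)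
    (hg : A.mem g) (η : f ⟶ g) : F.map f hf ≅ F.map g hg where
  hom := F.map₂ hf hg η
  inv := F.map₂ hg hf (inv η)
  hom_inv_id := by rw [← F.map₂_comp, IsIso.hom_inv_id, F.map₂_id]
  inv_hom_id := by rw [← F.map₂_comp, IsIso.inv_hom_id, F.map₂_id]

/-- The canonical gluing datum of a pseudofunctor with itself: the 2-cell attached to a square `α`
is the composite `F q ≫ F i ≅ F (q ≫ i) ≅ F (j ≫ p) ≅ F j ≫ F p`. -/
noncomputable def selfGluing [IsLocallyGroupoid C] : Gluing F F where
  iso {X Y Z W j q p i} hj hq hp hi α := (F.mapComp q i hq hi).symm ≪≫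
    F.map₂Iso (A.comp_mem hq hi) (A.comp_mem hj hp) α ≪≫ F.mapComp j p hj hp
  ax_a {X Y i j} hi hj α := by
    dsimp only [Iso.trans_hom, Iso.symm_hom, map₂Iso]
    rw [F.map₂_comp _ hi, F.map₂_comp hi hj, F.map₂_leftUnitor, F.map₂_rightUnitor_inv]
    simp
  ax_a' {X Y q p} hq hp α := by
    dsimp only [Iso.trans_hom, Iso.symm_hom, map₂Iso]
    rw [F.map₂_comp _ hq, F.map₂_comp hq hp, F.map₂_rightUnitor, F.map₂_leftUnitor_inv]
    simp
  ax_b {X₁ X₂ X₃ Y₁ Y₂ Y₃ i₁ i₂ i₃ q p q' p'} h₁ h₂ h₃ hq hp hq' hp' α α' := by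
    dsimp only [Iso.trans_hom, Iso.symm_hom, map₂Iso, vpaste]
    rw [F.map₂_comp _ (A.comp_mem hq (A.comp_mem hq' h₃)),
      F.map₂_comp _ (A.comp_mem hq (A.comp_mem h₂ hp')),
      F.map₂_comp _ (A.comp_mem (A.comp_mem hq h₂) hp'),
      F.map₂_comp _ (A.comp_mem (A.comp_mem h₁ hp) hp'),
      F.map₂_associator _ _ _ hq hq' h₃, F.map₂_associator _ _ _ h₁ hp hp',
      F.map₂_associator_inv _ _ _ hq h₂ hp',
      F.map₂_whiskerLeft q hq (A.comp_mem hq' h₃) (A.comp_mem h₂ hp'),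
      F.map₂_whiskerRight (A.comp_mem hq h₂) (A.comp_mem h₁ hp) α p' hp']
    simp
  ax_b' {X₁ X₂ X₃ Y₁ Y₂ Y₃ p₁ p₂ p₃ j i j' i'} h₁ h₂ h₃ hj hi hj' hi' α α' := by
    dsimp only [Iso.trans_hom, Iso.symm_hom, map₂Iso, hpaste]
    rw [F.map₂_comp _ (A.comp_mem (A.comp_mem h₁ hi) hi'),
      F.map₂_comp _ (A.comp_mem (A.comp_mem hj h₂) hi'),
      F.map₂_comp _ (A.comp_mem hj (A.comp_mem h₂ hi')),
      F.map₂_comp _ (A.comp_mem hj (A.comp_mem hj' h₃)),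
      F.map₂_associator _ _ _ hj h₂ hi', F.map₂_associator_inv _ _ _ h₁ hi hi',
      F.map₂_associator_inv _ _ _ hj hj' h₃,
      F.map₂_whiskerLeft j hj (A.comp_mem h₂ hi') (A.comp_mem hj' h₃),
      F.map₂_whiskerRight (A.comp_mem h₁ hi) (A.comp_mem hj h₂) α i' hi']
    simp

end PsFun

section Paste

variable {C : Type u} [Bicategory.{w, v} C]

lemma hpaste_vpaste {X₁ X₂ X₃ Y₁ Y₂ Y₃ Z₁ Z₂ Z₃ : C}
    {i₁ : X₁ ⟶ Y₁} {i₂ : X₂ ⟶ Y₂} {i₃ : X₃ ⟶ Y₃}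
    {j₁ : Y₁ ⟶ Z₁} {j₂ : Y₂ ⟶ Z₂} {j₃ : Y₃ ⟶ Z₃}
    {q : X₁ ⟶ X₂} {p : Y₁ ⟶ Y₂} {r : Z₁ ⟶ Z₂}
    {q' : X₂ ⟶ X₃} {p' : Y₂ ⟶ Y₃} {r' : Z₂ ⟶ Z₃}
    (α : q ≫ i₂ ⟶ i₁ ≫ p) (α' : q' ≫ i₃ ⟶ i₂ ≫ p')
    (β : p ≫ j₂ ⟶ j₁ ≫ r) (β' : p' ≫ j₃ ⟶ j₂ ≫ r') :
    hpaste (vpaste α α') (vpaste β β') = vpaste (hpaste α β) (hpaste α' β') := by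
  dsimp only [vpaste, hpaste]
  calc _ = 𝟙 _ ⊗≫ q ◁ α' ▷ j₃ ⊗≫ (α ▷ (p' ≫ j₃) ≫ (i₁ ≫ p) ◁ β') ⊗≫ i₁ ◁ β ▷ r' ⊗≫ 𝟙 _ := by
        bicategory
    _ = 𝟙 _ ⊗≫ q ◁ α' ▷ j₃ ⊗≫ ((q ≫ i₂) ◁ β' ≫ α ▷ (j₂ ≫ r')) ⊗≫ i₁ ◁ β ▷ r' ⊗≫ 𝟙 _ := by
        rw [whisker_exchange]
    _ = _ := by bicategory

lemma whisker_hpaste {X₁ X₂ X₃ Y₁ Y₂ Y₃ : C} {p₁ p₁' : X₁ ⟶ Y₁} {p₂ : X₂ ⟶ Y₂} {p₃ : X₃ ⟶ Y₃}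
    {j : X₁ ⟶ X₂} {i : Y₁ ⟶ Y₂} {j' : X₂ ⟶ X₃} {i' : Y₂ ⟶ Y₃} (θ : p₁' ⟶ p₁)
    (α : p₁ ≫ i ⟶ j ≫ p₂) (α' : p₂ ≫ i' ⟶ j' ≫ p₃) :
    θ ▷ (i ≫ i') ≫ hpaste α α' = hpaste (θ ▷ i ≫ α) α' := by
  dsimp only [hpaste]
  bicategory

lemma hpaste_whisker_mid {X₁ X₂ X₃ Y₁ Y₂ Y₃ : C} {p₁ : X₁ ⟶ Y₁} {p₂ p₂' : X₂ ⟶ Y₂} {p₃ : X₃ ⟶ Y₃}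
    {j : X₁ ⟶ X₂} {i : Y₁ ⟶ Y₂} {j' : X₂ ⟶ X₃} {i' : Y₂ ⟶ Y₃}
    (α : p₁ ≫ i ⟶ j ≫ p₂) (θ : p₂ ⟶ p₂') (α' : p₂' ≫ i' ⟶ j' ≫ p₃) :
    hpaste (α ≫ j ◁ θ) α' = hpaste α (θ ▷ i' ≫ α') := by
  dsimp only [hpaste]
  bicategory

lemma hpaste_whisker {X₁ X₂ X₃ Y₁ Y₂ Y₃ : C} {p₁ : X₁ ⟶ Y₁} {p₂ : X₂ ⟶ Y₂} {p₃ p₃' : X₃ ⟶ Y₃}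
    {j : X₁ ⟶ X₂} {i : Y₁ ⟶ Y₂} {j' : X₂ ⟶ X₃} {i' : Y₂ ⟶ Y₃}
    (α : p₁ ≫ i ⟶ j ≫ p₂) (α' : p₂ ≫ i' ⟶ j' ≫ p₃) (θ : p₃ ⟶ p₃') :
    hpaste α α' ≫ (j ≫ j') ◁ θ = hpaste α (α' ≫ j' ◁ θ) := by
  dsimp only [hpaste]
  bicategory

/-- The horizontal pasting of two invertible squares. -/
def hpasteIso {X₁ X₂ X₃ Y₁ Y₂ Y₃ : C} {p₁ : X₁ ⟶ Y₁} {p₂ : X₂ ⟶ Y₂} {p₃ : X₃ ⟶ Y₃}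
    {j : X₁ ⟶ X₂} {i : Y₁ ⟶ Y₂} {j' : X₂ ⟶ X₃} {i' : Y₂ ⟶ Y₃}
    (α : p₁ ≫ i ≅ j ≫ p₂) (α' : p₂ ≫ i' ≅ j' ≫ p₃) :
    p₁ ≫ (i ≫ i') ≅ (j ≫ j') ≫ p₃ :=
  (α_ p₁ i i').symm ≪≫ whiskerRightIso α i' ≪≫ α_ j p₂ i' ≪≫ whiskerLeftIso j α' ≪≫
    (α_ j j' p₃).symm

@[simp]
lemma hpasteIso_hom {X₁ X₂ X₃ Y₁ Y₂ Y₃ : C} {p₁ : X₁ ⟶ Y₁} {p₂ : X₂ ⟶ Y₂} {p₃ : X₃ ⟶ Y₃}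
    {j : X₁ ⟶ X₂} {i : Y₁ ⟶ Y₂} {j' : X₂ ⟶ X₃} {i' : Y₂ ⟶ Y₃}
    (α : p₁ ≫ i ≅ j ≫ p₂) (α' : p₂ ≫ i' ≅ j' ≫ p₃) :
    (hpasteIso α α').hom = hpaste α.hom α'.hom := rfl

end Paste

namespace PsTrans

variable {A : WideSub C} {F₀ F₀' F₀'' : C → D} {F : PsFun A F₀} {F' : PsFun A F₀'}
  {F'' : PsFun A F₀''} {α : ∀ X, F₀ X ⟶ F₀' X} {β : ∀ X, F₀' X ⟶ F₀'' X}

lemma ext' {s t : PsTrans F F' α}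
    (h : ∀ {X Y : C} (f : X ⟶ Y) (hf : A.mem f), (s.nat f hf).hom = (t.nat f hf).hom) : s = t := by
  cases s with
  | mk s1 _ _ _ =>
    cases t with
    | mk t1 _ _ _ =>
      have : @s1 = @t1 := by
        funext X Y f hf
        exact Iso.ext (h f hf)
      subst this
      rfl

/-- The identity transformation. -/
def id (F : PsFun A F₀) : PsTrans F F (fun X => 𝟙 (F₀ X)) where
  nat f hf := ρ_ (F.map f hf) ≪≫ (λ_ (F.map f hf)).symm
  nat_naturality hf hg η := by simp
  nat_id X := by simp
  nat_comp f g hf hg := by simp [vpaste]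

/-- Composition of pseudonatural transformations. -/
def comp (s : PsTrans F F' α) (t : PsTrans F' F'' β) : PsTrans F F'' (fun X => α X ≫ β X) where
  nat f hf := hpasteIso (s.nat f hf) (t.nat f hf)
  nat_naturality {X Y f g} hf hg η := by
    rw [hpasteIso_hom, hpasteIso_hom, whisker_hpaste, s.nat_naturality hf hg,
      hpaste_whisker_mid, t.nat_naturality, hpaste_whisker]
  nat_id X := by
    rw [hpasteIso_hom, hpaste_whisker, t.nat_id, ← hpaste_whisker_mid, s.nat_id, hpaste]
    simp
  nat_comp f g hf hg := by
    rw [hpasteIso_hom, hpaste_whisker, t.nat_comp, ← hpaste_whisker_mid, s.nat_comp,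
      ← whisker_hpaste, hpaste_vpaste]
    rfl

end PsTrans

end PsFun

section Bridge

variable {C : Type u} [Bicategory.{w, v} C] {D : Type u'} [Bicategory.{w', v'} D]

/-- The type of objects of the bicategory corresponding to a subcategory `A` of `C`. -/
structure WideSub.Carrier (A : WideSub C) where
  of : C

/-- The 1-cells of the bicategory corresponding to a subcategory of `C`. -/
structure WideSub.Cell {A : WideSub C} (X Y : A.Carrier) where
  hom : X.of ⟶ Y.of
  mem : A.mem hom

instance {A : WideSub C} (X Y : A.Carrier) : Category (WideSub.Cell X Y) where
  Hom f g := f.hom ⟶ g.hom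
  id f := 𝟙 f.hom
  comp η θ := η ≫ θ
  id_comp _ := Category.id_comp _
  comp_id _ := Category.comp_id _
  assoc _ _ _ := Category.assoc _ _ _

instance (A : WideSub C) : Bicategory A.Carrier where
  Hom X Y := WideSub.Cell X Y
  id X := ⟨𝟙 X.of, A.id_mem X.of⟩
  comp f g := ⟨f.hom ≫ g.hom, A.comp_mem f.mem g.mem⟩
  whiskerLeft f _ _ η := Bicategory.whiskerLeft f.hom η
  whiskerRight η h := Bicategory.whiskerRight η h.hom
  associator f g h := ⟨(α_ f.hom g.hom h.hom).hom, (α_ f.hom g.hom h.hom).inv, Iso.hom_inv_id _,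
    Iso.inv_hom_id _⟩
  leftUnitor f := ⟨(λ_ f.hom).hom, (λ_ f.hom).inv, Iso.hom_inv_id _, Iso.inv_hom_id _⟩
  rightUnitor f := ⟨(ρ_ f.hom).hom, (ρ_ f.hom).inv, Iso.hom_inv_id _, Iso.inv_hom_id _⟩
  whiskerLeft_id _ _ := Bicategory.whiskerLeft_id _ _
  whiskerLeft_comp _ _ _ _ _ _ := Bicategory.whiskerLeft_comp _ _ _
  id_whiskerLeft _ := Bicategory.id_whiskerLeft _
  comp_whiskerLeft _ _ _ _ _ := Bicategory.comp_whiskerLeft _ _ _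
  id_whiskerRight _ _ := Bicategory.id_whiskerRight _ _
  comp_whiskerRight _ _ _ := Bicategory.comp_whiskerRight _ _ _
  whiskerRight_id _ := Bicategory.whiskerRight_id _
  whiskerRight_comp _ _ _ := Bicategory.whiskerRight_comp _ _ _
  whisker_assoc _ _ _ _ _ := Bicategory.whisker_assoc _ _ _
  whisker_exchange _ _ := Bicategory.whisker_exchange _ _
  pentagon _ _ _ _ := Bicategory.pentagon _ _ _ _
  triangle _ _ := Bicategory.triangle _ _

/-- The associated pseudofunctor. -/
def PsFun.toPseudofunctor {A : WideSub C} {F₀ : C → D} (F : PsFun A F₀) :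
    Pseudofunctor A.Carrier D where
  obj X := F₀ X.of
  map f := F.map f.hom f.mem
  map₂ {_ _ f g} η := F.map₂ f.mem g.mem η
  map₂_id f := F.map₂_id f.hom f.mem
  map₂_comp {_ _ f g h} η θ := F.map₂_comp f.mem g.mem h.mem η θ
  mapId X := F.mapId X.of
  mapComp f g := F.mapComp f.hom g.hom f.mem g.mem
  map₂_whisker_left f g h η := F.map₂_whiskerLeft f.hom f.mem g.mem h.mem η
  map₂_whisker_right {_ _ _ f g} η h := F.map₂_whiskerRight f.mem g.mem η h.hom h.mem
  map₂_associator f g h := F.map₂_associator f.hom g.hom h.hom f.mem g.mem h.mem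
  map₂_left_unitor f := F.map₂_leftUnitor f.hom f.mem
  map₂_right_unitor f := F.map₂_rightUnitor f.hom f.mem

/-- The converse construction. -/
def PsFun.ofPseudofunctor {A : WideSub C} (P : Pseudofunctor A.Carrier D) :
    PsFun A (fun X => P.obj ⟨X⟩) where
  map f hf := P.map (X := ⟨_⟩) (Y := ⟨_⟩) ⟨f, hf⟩
  map₂ {_ _ f g} hf hg η := P.map₂ (a := ⟨_⟩) (b := ⟨_⟩) (f := ⟨f, hf⟩) (g := ⟨g, hg⟩) η
  mapId X := P.mapId ⟨X⟩
  mapComp f g hf hg := P.mapComp (a := ⟨_⟩) (b := ⟨_⟩) (c := ⟨_⟩) ⟨f, hf⟩ ⟨g, hg⟩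
  map₂_id f hf := P.map₂_id (a := ⟨_⟩) (b := ⟨_⟩) ⟨f, hf⟩
  map₂_comp {_ _ f g h} hf hg hh η θ := P.map₂_comp (a := ⟨_⟩) (b := ⟨_⟩) (f := ⟨f, hf⟩)
    (g := ⟨g, hg⟩) (h := ⟨h, hh⟩) η θ
  map₂_whiskerLeft {_ _ _} f {g h} hf hg hh η := P.map₂_whisker_left (a := ⟨_⟩) (b := ⟨_⟩) (c := ⟨_⟩)
    ⟨f, hf⟩ (g := ⟨g, hg⟩) (h := ⟨h, hh⟩) η
  map₂_whiskerRight {_ _ _ f g} hf hg η h hh := P.map₂_whisker_right (a := ⟨_⟩) (b := ⟨_⟩)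
    (c := ⟨_⟩) (f := ⟨f, hf⟩) (g := ⟨g, hg⟩) η ⟨h, hh⟩
  map₂_associator f g h hf hg hh := P.map₂_associator (a := ⟨_⟩) (b := ⟨_⟩) (c := ⟨_⟩) (d := ⟨_⟩)
    ⟨f, hf⟩ ⟨g, hg⟩ ⟨h, hh⟩
  map₂_leftUnitor f hf := P.map₂_left_unitor (a := ⟨_⟩) (b := ⟨_⟩) ⟨f, hf⟩
  map₂_rightUnitor f hf := P.map₂_right_unitor (a := ⟨_⟩) (b := ⟨_⟩) ⟨f, hf⟩

/-- Pseudofunctors from the bicategory `A` are the same as pairs of a map on objects and a term of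
`PsFun`. -/
def pseudofunctorEquiv (A : WideSub C) :
    Pseudofunctor A.Carrier D ≃ Σ F₀ : C → D, PsFun A F₀ where
  toFun P := ⟨_, .ofPseudofunctor P⟩
  invFun F := F.2.toPseudofunctor
  left_inv _ := rfl
  right_inv _ := rfl

/-- The strong transformations are the same as pairs of a family of 1-cells and a term of
`PsTrans`. -/
def strongTransEquiv {A : WideSub C} {F₀ F₀' : C → D} (F : PsFun A F₀) (F' : PsFun A F₀') :
    Pseudofunctor.StrongTrans F.toPseudofunctor F'.toPseudofunctor ≃
      Σ α : ∀ X, F₀ X ⟶ F₀' X, PsTrans F F' α where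
  toFun t := ⟨fun X => t.app ⟨X⟩,
    { nat := fun f hf => t.naturality (a := ⟨_⟩) (b := ⟨_⟩) ⟨f, hf⟩
      nat_naturality := fun {_ _ f g} hf hg η => t.naturality_naturality (a := ⟨_⟩) (b := ⟨_⟩)
        (f := ⟨f, hf⟩) (g := ⟨g, hg⟩) η
      nat_id := fun X => t.naturality_id ⟨X⟩
      nat_comp := fun f g hf hg => t.naturality_comp (a := ⟨_⟩) (b := ⟨_⟩) (c := ⟨_⟩)
        ⟨f, hf⟩ ⟨g, hg⟩ }⟩
  invFun t :=
    { app := fun X => t.1 X.of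
      naturality := fun f => t.2.nat f.hom f.mem
      naturality_naturality := fun {_ _ f g} η => t.2.nat_naturality f.mem g.mem η
      naturality_id := fun X => t.2.nat_id X.of
      naturality_comp := fun f g => t.2.nat_comp f.hom g.hom f.mem g.mem }
  left_inv _ := rfl
  right_inv _ := rfl

end Bridge

section Paste

variable {C : Type u} [Bicategory.{w, v} C]

lemma whiskerLeft_hpaste_right {X₁ X₂ X₃ Y₁ Y₂ Y₃ : C} {p₁ : X₁ ⟶ Y₁} {p₂ : X₂ ⟶ Y₂}
    {p₃ : X₃ ⟶ Y₃} {j : X₁ ⟶ X₂} {i : Y₁ ⟶ Y₂} {j' : X₂ ⟶ X₃} {i' i'' : Y₂ ⟶ Y₃}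
    (α : p₁ ≫ i ⟶ j ≫ p₂) (η : i'' ⟶ i') (α' : p₂ ≫ i' ⟶ j' ≫ p₃) :
    p₁ ◁ i ◁ η ≫ hpaste α α' = hpaste α (p₂ ◁ η ≫ α') := by
  dsimp only [hpaste]
  calc _ = 𝟙 _ ⊗≫ ((p₁ ≫ i) ◁ η ≫ α ▷ i') ⊗≫ j ◁ α' ⊗≫ 𝟙 _ := by bicategory
    _ = 𝟙 _ ⊗≫ (α ▷ i'' ≫ (j ≫ p₂) ◁ η) ⊗≫ j ◁ α' ⊗≫ 𝟙 _ := by rw [whisker_exchange]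
    _ = _ := by bicategory

lemma whiskerLeft_hpaste_left {X₁ X₂ X₃ Y₁ Y₂ Y₃ : C} {p₁ : X₁ ⟶ Y₁} {p₂ : X₂ ⟶ Y₂}
    {p₃ : X₃ ⟶ Y₃} {j : X₁ ⟶ X₂} {i i₀ : Y₁ ⟶ Y₂} {j' : X₂ ⟶ X₃} {i' : Y₂ ⟶ Y₃}
    (η : i₀ ⟶ i) (α : p₁ ≫ i ⟶ j ≫ p₂) (α' : p₂ ≫ i' ⟶ j' ≫ p₃) :
    p₁ ◁ η ▷ i' ≫ hpaste α α' = hpaste (p₁ ◁ η ≫ α) α' := by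
  dsimp only [hpaste]
  bicategory

lemma hpaste_whiskerRight_right {X₁ X₂ X₃ Y₁ Y₂ Y₃ : C} {p₁ : X₁ ⟶ Y₁} {p₂ : X₂ ⟶ Y₂}
    {p₃ : X₃ ⟶ Y₃} {j : X₁ ⟶ X₂} {i : Y₁ ⟶ Y₂} {j' j'' : X₂ ⟶ X₃} {i' : Y₂ ⟶ Y₃}
    (α : p₁ ≫ i ⟶ j ≫ p₂) (α' : p₂ ≫ i' ⟶ j' ≫ p₃) (η : j' ⟶ j'') :
    hpaste α α' ≫ (j ◁ η) ▷ p₃ = hpaste α (α' ≫ η ▷ p₃) := by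
  dsimp only [hpaste]
  bicategory

lemma hpaste_whiskerRight_left {X₁ X₂ X₃ Y₁ Y₂ Y₃ : C} {p₁ : X₁ ⟶ Y₁} {p₂ : X₂ ⟶ Y₂}
    {p₃ : X₃ ⟶ Y₃} {j j₀ : X₁ ⟶ X₂} {i : Y₁ ⟶ Y₂} {j' : X₂ ⟶ X₃} {i' : Y₂ ⟶ Y₃}
    (α : p₁ ≫ i ⟶ j ≫ p₂) (η : j ⟶ j₀) (α' : p₂ ≫ i' ⟶ j' ≫ p₃) :
    hpaste α α' ≫ (η ▷ j') ▷ p₃ = hpaste (α ≫ η ▷ p₂) α' := by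
  dsimp only [hpaste]
  calc _ = 𝟙 _ ⊗≫ α ▷ i' ⊗≫ (j ◁ α' ≫ η ▷ (j' ≫ p₃)) ⊗≫ 𝟙 _ := by bicategory
    _ = 𝟙 _ ⊗≫ α ▷ i' ⊗≫ (η ▷ (p₂ ≫ i') ≫ j₀ ◁ α') ⊗≫ 𝟙 _ := by rw [whisker_exchange]
    _ = _ := by bicategory

/-- Commutativity of a cube of 2-cells with vertical edges `x`, `y`, `z`, `w`, bottom face with
edges `b : X ⟶ Y`, `q : X ⟶ Z`, `p : Y ⟶ W`, `a : Z ⟶ W`, and top face with edges `b'`, `q'`, `p'`,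
`a'`. The left, front, top, bottom, back and right faces are filled by the 2-cells `I'`, `J`, `K'`,
`K`, `J'` and `I` respectively. -/
def CubeCommutes {X' Y' Z' W' X Y Z W : C} {a : Z ⟶ W} {b : X ⟶ Y} {a' : Z' ⟶ W'} {b' : X' ⟶ Y'}
    {p : Y ⟶ W} {q : X ⟶ Z} {p' : Y' ⟶ W'} {q' : X' ⟶ Z'}
    {x : X' ⟶ X} {y : Y' ⟶ Y} {z : Z' ⟶ Z} {w : W' ⟶ W}
    (I' : x ≫ q ⟶ q' ≫ z) (J : z ≫ a ⟶ a' ≫ w) (K' : q' ≫ a' ⟶ b' ≫ p')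
    (K : q ≫ a ⟶ b ≫ p) (J' : x ≫ b ⟶ b' ≫ y) (I : y ≫ p ⟶ p' ≫ w) : Prop :=
  hpaste I' J ≫ K' ▷ w = x ◁ K ≫ hpaste J' I

/-- A 2-commutative cube in `C` whose edges in the three directions lie in `P`, `Q` and `R`. -/
structure Cube (P Q R : WideSub C) where
  {X' Y' Z' W' X Y Z W : C}
  {a : Z ⟶ W}
  {b : X ⟶ Y}
  {a' : Z' ⟶ W'}
  {b' : X' ⟶ Y'}
  {p : Y ⟶ W}
  {q : X ⟶ Z}
  {p' : Y' ⟶ W'}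
  {q' : X' ⟶ Z'}
  {x : X' ⟶ X}
  {y : Y' ⟶ Y}
  {z : Z' ⟶ Z}
  {w : W' ⟶ W}
  ha : P.mem a
  hb : P.mem b
  ha' : P.mem a'
  hb' : P.mem b'
  hp : Q.mem p
  hq : Q.mem q
  hp' : Q.mem p'
  hq' : Q.mem q'
  hx : R.mem x
  hy : R.mem y
  hz : R.mem z
  hw : R.mem w
  I' : x ≫ q ⟶ q' ≫ z
  J : z ≫ a ⟶ a' ≫ w
  K' : q' ≫ a' ⟶ b' ≫ p'
  K : q ≫ a ⟶ b ≫ p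
  J' : x ≫ b ⟶ b' ≫ y
  I : y ≫ p ⟶ p' ≫ w
  comm : CubeCommutes I' J K' K J' I

end Paste

section GluingData

variable {C : Type u} [Bicategory.{w, v} C]

/-- Gluing data from `C` to `D` relative to a finite family of subcategories `A i` of `C`:
pseudofunctors `ps i` on the `A i` with the same action on objects, together with gluing data
`G` on all pairs `i < j`, such that, for `i < j < k`, the 2-cells attached to the six faces of a
cube form a commutative cube of 2-cells in `D`. -/
structure GD (D : Type u') [Bicategory.{w', v'} D] {n : ℕ} (A : Fin n → WideSub C) where
  obj : C → D
  ps : ∀ i : Fin n, PsFun (A i) obj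
  G : ∀ {i j : Fin n}, i < j → Gluing (ps i) (ps j)
  cube : ∀ {i j k : Fin n} (hij : i < j) (hjk : j < k) (c : Cube (A i) (A j) (A k)),
    CubeCommutes ((G hjk).iso c.hq' c.hx c.hz c.hq c.I').hom
      ((G (hij.trans hjk)).iso c.ha' c.hz c.hw c.ha c.J).hom
      ((G hij).iso c.hb' c.hq' c.hp' c.ha' c.K').hom
      ((G hij).iso c.hb c.hq c.hp c.ha c.K).hom
      ((G (hij.trans hjk)).iso c.hb' c.hx c.hy c.hb c.J').hom
      ((G hjk).iso c.hp' c.hy c.hw c.hp c.I).hom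

variable {D : Type u'} [Bicategory.{w', v'} D] {n : ℕ} {A : Fin n → WideSub C}

namespace GD

/-- 1-cells between gluing data: pseudonatural transformations `tr i` with common components
`app X`, compatible with the gluing data. -/
structure Hom (E E' : GD D A) where
  app : ∀ X : C, E.obj X ⟶ E'.obj X
  tr : ∀ i : Fin n, PsTrans (E.ps i) (E'.ps i) app
  compat : ∀ {i j : Fin n} (hij : i < j) {X Y Z W : C} {b : X ⟶ Y} {q : X ⟶ Z} {p : Y ⟶ W}
    {a : Z ⟶ W} (hb : (A i).mem b) (hq : (A j).mem q) (hp : (A j).mem p) (ha : (A i).mem a)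
    (α : q ≫ a ⟶ b ≫ p),
    vpaste ((tr j).nat q hq).hom ((tr i).nat a ha).hom ≫
        app X ◁ ((E'.G hij).iso hb hq hp ha α).hom =
      ((E.G hij).iso hb hq hp ha α).hom ▷ app W ≫
        vpaste ((tr i).nat b hb).hom ((tr j).nat p hp).hom

/-- 2-cells between 1-cells of gluing data: families of 2-cells of `D` that are modifications for
every `i`. -/
@[ext]
structure Hom₂ {E E' : GD D A} (s t : Hom E E') where
  app : ∀ X : C, s.app X ⟶ t.app X
  nat : ∀ (i : Fin n) {X Y : C} (f : X ⟶ Y) (hf : (A i).mem f),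
    (E.ps i).map f hf ◁ app Y ≫ ((t.tr i).nat f hf).hom =
      ((s.tr i).nat f hf).hom ≫ app X ▷ (E'.ps i).map f hf

instance {E E' : GD D A} : Category (Hom E E') where
  Hom s t := Hom₂ s t
  id s := { app := fun X => 𝟙 (s.app X), nat := by simp }
  comp Ξ Θ :=
    { app := fun X => Ξ.app X ≫ Θ.app X
      nat := fun i X Y f hf => by
        rw [whiskerLeft_comp, Category.assoc, Θ.nat, ← Category.assoc, Ξ.nat, Category.assoc,
          comp_whiskerRight] }
  id_comp Ξ := Hom₂.ext (funext fun X => Category.id_comp _)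
  comp_id Ξ := Hom₂.ext (funext fun X => Category.comp_id _)
  assoc Ξ Θ Ψ := Hom₂.ext (funext fun X => Category.assoc _ _ _)

lemma hom₂_ext {E E' : GD D A} {s t : Hom E E'} {Ξ Θ : s ⟶ t}
    (h : ∀ X, Hom₂.app Ξ X = Hom₂.app Θ X) : Ξ = Θ := Hom₂.ext (funext h)

@[simp]
lemma id_app {E E' : GD D A} (s : Hom E E') (X : C) : Hom₂.app (𝟙 s) X = 𝟙 (s.app X) := rfl

@[simp]
lemma comp_app {E E' : GD D A} {s t r : Hom E E'} (Ξ : s ⟶ t) (Θ : t ⟶ r) (X : C) :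
    Hom₂.app (Ξ ≫ Θ) X = Hom₂.app Ξ X ≫ Hom₂.app Θ X := rfl

/-- Invertible 2-cells from invertible components. -/
@[simps]
def isoMk {E E' : GD D A} {s t : Hom E E'} (e : ∀ X, s.app X ≅ t.app X)
    (nat : ∀ (i : Fin n) {X Y : C} (f : X ⟶ Y) (hf : (A i).mem f),
      (E.ps i).map f hf ◁ (e Y).hom ≫ ((t.tr i).nat f hf).hom =
        ((s.tr i).nat f hf).hom ≫ (e X).hom ▷ (E'.ps i).map f hf) : s ≅ t where
  hom := { app := fun X => (e X).hom, nat := nat }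
  inv :=
    { app := fun X => (e X).inv
      nat := fun i X Y f hf => by
        rw [← cancel_epi ((E.ps i).map f hf ◁ (e Y).hom), reassoc_of% nat i f hf,
          ← Category.assoc, ← whiskerLeft_comp, ← comp_whiskerRight]
        simp }
  hom_inv_id := hom₂_ext fun X => (e X).hom_inv_id
  inv_hom_id := hom₂_ext fun X => (e X).inv_hom_id

/-- The identity 1-cell. -/
def Hom.id (E : GD D A) : Hom E E where
  app X := 𝟙 (E.obj X)
  tr i := PsTrans.id (E.ps i)
  compat _ := by intros; simp [PsTrans.id, vpaste]

/-- Composition of 1-cells. -/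
def Hom.comp {E E' E'' : GD D A} (s : Hom E E') (t : Hom E' E'') : Hom E E'' where
  app X := s.app X ≫ t.app X
  tr i := (s.tr i).comp (t.tr i)
  compat {i j} hij {X Y Z W b q p a} hb hq hp ha α := by
    dsimp only [PsTrans.comp, hpasteIso_hom]
    rw [← hpaste_vpaste, ← hpaste_vpaste, hpaste_whisker, t.compat hij,
      ← hpaste_whisker_mid, s.compat hij, ← whisker_hpaste]

/-- Left whiskering of 2-cells. -/
def whiskerLeft' {E E' E'' : GD D A} (s : Hom E E') {t t' : Hom E' E''} (Ξ : t ⟶ t') :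
    s.comp t ⟶ s.comp t' :=
  Hom₂.mk (fun X => s.app X ◁ Hom₂.app Ξ X) fun i X Y f hf => by
    dsimp only [Hom.comp, PsTrans.comp, hpasteIso_hom]
    rw [whiskerLeft_hpaste_right, Hom₂.nat Ξ, hpaste_whiskerRight_right]

/-- Right whiskering of 2-cells. -/
def whiskerRight' {E E' E'' : GD D A} {s s' : Hom E E'} (Ξ : s ⟶ s') (t : Hom E' E'') :
    s.comp t ⟶ s'.comp t :=
  Hom₂.mk (fun X => Hom₂.app Ξ X ▷ t.app X) fun i X Y f hf => by
    dsimp only [Hom.comp, PsTrans.comp, hpasteIso_hom]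
    rw [whiskerLeft_hpaste_left, Hom₂.nat Ξ, hpaste_whiskerRight_left]

/-- The associator. -/
def assoc' {E₁ E₂ E₃ E₄ : GD D A} (s : Hom E₁ E₂) (t : Hom E₂ E₃) (r : Hom E₃ E₄) :
    (s.comp t).comp r ≅ s.comp (t.comp r) :=
  isoMk (fun X => α_ (s.app X) (t.app X) (r.app X)) fun i X Y f hf => by
    dsimp only [Hom.comp, PsTrans.comp, hpasteIso_hom, hpaste]
    bicategory

/-- The left unitor. -/
def leftUnitor' {E E' : GD D A} (s : Hom E E') : (Hom.id E).comp s ≅ s :=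
  isoMk (fun X => λ_ (s.app X)) fun i X Y f hf => by
    dsimp only [Hom.comp, Hom.id, PsTrans.comp, PsTrans.id, hpasteIso_hom, hpaste]
    simp

/-- The right unitor. -/
def rightUnitor' {E E' : GD D A} (s : Hom E E') : s.comp (Hom.id E') ≅ s :=
  isoMk (fun X => ρ_ (s.app X)) fun i X Y f hf => by
    dsimp only [Hom.comp, Hom.id, PsTrans.comp, PsTrans.id, hpasteIso_hom, hpaste]
    simp

/-- The 2-category of gluing data; all operations are componentwise. -/
instance : Bicategory (GD D A) where
  Hom E E' := Hom E E'
  id E := Hom.id E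
  comp s t := Hom.comp s t
  whiskerLeft s _ _ Ξ := whiskerLeft' s Ξ
  whiskerRight Ξ t := whiskerRight' Ξ t
  associator s t r := assoc' s t r
  leftUnitor s := leftUnitor' s
  rightUnitor s := rightUnitor' s
  whiskerLeft_id _ _ := hom₂_ext fun _ => Bicategory.whiskerLeft_id _ _
  whiskerLeft_comp _ _ _ _ _ _ := hom₂_ext fun _ => Bicategory.whiskerLeft_comp _ _ _
  id_whiskerLeft _ := hom₂_ext fun _ => Bicategory.id_whiskerLeft _
  comp_whiskerLeft _ _ _ _ _ := hom₂_ext fun _ => Bicategory.comp_whiskerLeft _ _ _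
  id_whiskerRight _ _ := hom₂_ext fun _ => Bicategory.id_whiskerRight _ _
  comp_whiskerRight _ _ _ := hom₂_ext fun _ => Bicategory.comp_whiskerRight _ _ _
  whiskerRight_id _ := hom₂_ext fun _ => Bicategory.whiskerRight_id _
  whiskerRight_comp _ _ _ := hom₂_ext fun _ => Bicategory.whiskerRight_comp _ _ _
  whisker_assoc _ _ _ _ _ := hom₂_ext fun _ => Bicategory.whisker_assoc _ _ _
  whisker_exchange _ _ := hom₂_ext fun _ => Bicategory.whisker_exchange _ _
  pentagon _ _ _ _ := hom₂_ext fun _ => Bicategory.pentagon _ _ _ _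
  triangle _ _ := hom₂_ext fun _ => Bicategory.triangle _ _

lemma hom_eq {E E' : GD D A} {s t : Hom E E'} (e : s ⟶ t) (h : ∀ X, s.app X = t.app X)
    (he : ∀ X, Hom₂.app e X = eqToHom (h X)) : s = t := by
  obtain ⟨e, nat⟩ := e
  obtain ⟨sa, st, sc⟩ := s
  obtain ⟨ta, tt, tc⟩ := t
  obtain rfl : sa = ta := funext h
  have : st = tt := by
    funext i
    refine PsTrans.ext' fun f hf => ?_
    have h₁ := nat i f hf
    have h₂ : ∀ X, e X = 𝟙 _ := he
    rw [h₂, h₂] at h₁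
    simpa using h₁.symm
  subst this
  rfl

lemma eqToIso_hom_app {E E' : GD D A} {s t : Hom E E'} (h : s = t) (X : C)
    (h' : s.app X = t.app X) : Hom₂.app (eqToIso h).hom X = (eqToIso h').hom := by
  subst h
  rfl

instance [Strict D] : Strict (GD D A) where
  id_comp s := hom_eq (leftUnitor' s).hom (fun X => Strict.id_comp (s.app X)) fun X =>
    congrArg Iso.hom (Strict.leftUnitor_eqToIso (s.app X))
  comp_id s := hom_eq (rightUnitor' s).hom (fun X => Strict.comp_id (s.app X)) fun X =>
    congrArg Iso.hom (Strict.rightUnitor_eqToIso (s.app X))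
  assoc s t r := hom_eq (assoc' s t r).hom
    (fun X => Strict.assoc (s.app X) (t.app X) (r.app X)) fun X =>
    congrArg Iso.hom (Strict.associator_eqToIso (s.app X) (t.app X) (r.app X))
  leftUnitor_eqToIso s := Iso.ext <| hom₂_ext fun X =>
    (congrArg Iso.hom (Strict.leftUnitor_eqToIso (s.app X))).trans
      (eqToIso_hom_app (s := (Hom.id _).comp s) (t := s) _ X _).symm
  rightUnitor_eqToIso s := Iso.ext <| hom₂_ext fun X =>
    (congrArg Iso.hom (Strict.rightUnitor_eqToIso (s.app X))).trans
      (eqToIso_hom_app (s := s.comp (Hom.id _)) (t := s) _ X _).symm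
  associator_eqToIso s t r := Iso.ext <| hom₂_ext fun X =>
    (congrArg Iso.hom (Strict.associator_eqToIso (s.app X) (t.app X) (r.app X))).trans
      (eqToIso_hom_app (s := (s.comp t).comp r) (t := s.comp (t.comp r)) _ X _).symm

end GD

end GluingData

section TwoFun

variable {C : Type u} {D : Type u'} [Bicategory.{w', v'} D]

/-- The objects of the 2-category of 2-functors from the set `C`, viewed as a discrete 2-category,
to `D`: families of objects of `D`. The 1-cells and the 2-cells are families of 1-cells and of
2-cells of `D`. -/
structure TwoFun (C : Type u) (D : Type u') where
  obj : C → D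

namespace TwoFun

instance : Bicategory (TwoFun C D) where
  Hom F F' := ∀ X : C, F.obj X ⟶ F'.obj X
  id F := fun X => 𝟙 (F.obj X)
  comp s t := fun X => s X ≫ t X
  homCategory F F' := inferInstanceAs (Category (∀ X : C, F.obj X ⟶ F'.obj X))
  whiskerLeft s _ _ Ξ := fun X => s X ◁ Ξ X
  whiskerRight Ξ t := fun X => Ξ X ▷ t X
  associator s t r := Pi.isoMk fun X => α_ (s X) (t X) (r X)
  leftUnitor s := Pi.isoMk fun X => λ_ (s X)
  rightUnitor s := Pi.isoMk fun X => ρ_ (s X)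
  whiskerLeft_id _ _ := funext fun _ => Bicategory.whiskerLeft_id _ _
  whiskerLeft_comp _ _ _ _ _ _ := funext fun _ => Bicategory.whiskerLeft_comp _ _ _
  id_whiskerLeft _ := funext fun _ => Bicategory.id_whiskerLeft _
  comp_whiskerLeft _ _ _ _ _ := funext fun _ => Bicategory.comp_whiskerLeft _ _ _
  id_whiskerRight _ _ := funext fun _ => Bicategory.id_whiskerRight _ _
  comp_whiskerRight _ _ _ := funext fun _ => Bicategory.comp_whiskerRight _ _ _
  whiskerRight_id _ := funext fun _ => Bicategory.whiskerRight_id _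
  whiskerRight_comp _ _ _ := funext fun _ => Bicategory.whiskerRight_comp _ _ _
  whisker_assoc _ _ _ _ _ := funext fun _ => Bicategory.whisker_assoc _ _ _
  whisker_exchange _ _ := funext fun _ => Bicategory.whisker_exchange _ _
  pentagon _ _ _ _ := funext fun _ => Bicategory.pentagon _ _ _ _
  triangle _ _ := funext fun _ => Bicategory.triangle _ _

lemma eqToIso_hom_apply {F F' : TwoFun C D} {s t : F ⟶ F'} (h : s = t) (X : C)
    (h' : s X = t X) : (eqToIso h).hom X = (eqToIso h').hom := by
  subst h
  rfl

instance [Strict D] : Strict (TwoFun C D) where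
  id_comp s := funext fun X => Strict.id_comp (s X)
  comp_id s := funext fun X => Strict.comp_id (s X)
  assoc s t r := funext fun X => Strict.assoc (s X) (t X) (r X)
  leftUnitor_eqToIso s := Iso.ext <| funext fun X =>
    (congrArg Iso.hom (Strict.leftUnitor_eqToIso (s X))).trans
      (eqToIso_hom_apply (s := 𝟙 _ ≫ s) (t := s) _ X _).symm
  rightUnitor_eqToIso s := Iso.ext <| funext fun X =>
    (congrArg Iso.hom (Strict.rightUnitor_eqToIso (s X))).trans
      (eqToIso_hom_apply (s := s ≫ 𝟙 _) (t := s) _ X _).symm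
  associator_eqToIso s t r := Iso.ext <| funext fun X =>
    (congrArg Iso.hom (Strict.associator_eqToIso (s X) (t X) (r X))).trans
      (eqToIso_hom_apply (s := (s ≫ t) ≫ r) (t := s ≫ t ≫ r) _ X _).symm

end TwoFun

end TwoFun

section Comparison

variable {C : Type u} [Bicategory.{w, v} C] {D : Type u'} [Bicategory.{w', v'} D] {n : ℕ}
  {A : Fin n → WideSub C}

lemma eqToHom_rfl_comp {X : Type u} [Category.{v} X] {a b : X} (f : a ⟶ b) :
    f = eqToHom rfl ≫ f ≫ eqToHom rfl := by
  simp

/-- The forgetful 2-functor from gluing data, which remembers the action on objects, the components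
of the 1-cells and the components of the 2-cells. -/
def forgetGD [Strict D] (A : Fin n → WideSub C) :
    StrictPseudofunctor (GD D A) (TwoFun C D) := .mk''
  { obj := fun E => ⟨E.obj⟩
    map := fun s => GD.Hom.app s
    map₂ := fun Ξ => GD.Hom₂.app Ξ
    map₂_id := fun _ => rfl
    map₂_comp := fun _ _ => rfl
    map_id := fun _ => rfl
    map_comp := fun _ _ => rfl
    map₂_whisker_left := fun {E _ E''} s {t t'} Ξ =>
      eqToHom_rfl_comp (X := (⟨E.obj⟩ : TwoFun C D) ⟶ ⟨E''.obj⟩)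
        (a := GD.Hom.app (GD.Hom.comp s t)) (b := GD.Hom.app (GD.Hom.comp s t'))
        (GD.whiskerLeft' s Ξ).app
    map₂_whisker_right := fun {E _ E'' s s'} Ξ t =>
      eqToHom_rfl_comp (X := (⟨E.obj⟩ : TwoFun C D) ⟶ ⟨E''.obj⟩)
        (a := GD.Hom.app (GD.Hom.comp s t)) (b := GD.Hom.app (GD.Hom.comp s' t))
        (GD.whiskerRight' Ξ t).app }

section Paste

variable {C : Type u} [Bicategory.{w, v} C]

lemma vpaste_top {X Y Z W : C} {e : X ⟶ X} {e' : Y ⟶ Y} {j j' : X ⟶ Y} {q : X ⟶ Z} {p : Y ⟶ W}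
    {i : Z ⟶ W} (r : e ⟶ 𝟙 X) (t : 𝟙 Y ⟶ e') (η : j ⟶ j') (β : q ≫ i ⟶ j ≫ p) :
    vpaste (r ▷ j ≫ (λ_ j).hom ≫ η ≫ (ρ_ j').inv ≫ j' ◁ t) β =
      (r ▷ q ≫ (λ_ q).hom) ▷ i ≫ (β ≫ η ▷ p) ≫ j' ◁ ((λ_ p).inv ≫ t ▷ p) := by
  dsimp only [vpaste]
  calc _ = 𝟙 _ ⊗≫ (e ◁ β ≫ r ▷ (j ≫ p)) ⊗≫ η ▷ p ⊗≫ j' ◁ t ▷ p ⊗≫ 𝟙 _ := by bicategory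
    _ = 𝟙 _ ⊗≫ (r ▷ (q ≫ i) ≫ 𝟙 X ◁ β) ⊗≫ η ▷ p ⊗≫ j' ◁ t ▷ p ⊗≫ 𝟙 _ := by rw [whisker_exchange]
    _ = _ := by bicategory

lemma vpaste_bot {X Y Z W : C} {e : Z ⟶ Z} {e' : W ⟶ W} {j : X ⟶ Y} {q : X ⟶ Z} {p : Y ⟶ W}
    {i i' : Z ⟶ W} (r : e ⟶ 𝟙 Z) (t : 𝟙 W ⟶ e') (η : i' ⟶ i) (β : q ≫ i ⟶ j ≫ p) :
    vpaste β (r ▷ i' ≫ (λ_ i').hom ≫ η ≫ (ρ_ i).inv ≫ i ◁ t) =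
      (q ◁ r ≫ (ρ_ q).hom) ▷ i' ≫ (q ◁ η ≫ β) ≫ j ◁ ((ρ_ p).inv ≫ p ◁ t) := by
  dsimp only [vpaste]
  calc _ = 𝟙 _ ⊗≫ q ◁ r ▷ i' ⊗≫ q ◁ η ⊗≫ ((q ≫ i) ◁ t ≫ β ▷ e') ⊗≫ 𝟙 _ := by bicategory
    _ = 𝟙 _ ⊗≫ q ◁ r ▷ i' ⊗≫ q ◁ η ⊗≫ (β ▷ 𝟙 W ≫ (j ≫ p) ◁ t) ⊗≫ 𝟙 _ := by rw [whisker_exchange]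
    _ = _ := by bicategory

end Paste

namespace Gluing

variable {B : WideSub C} {A : WideSub C} {F₀ : C → D} {F : PsFun A F₀} {F' : PsFun B F₀}
  (G : Gluing F F')

lemma iso_whiskerRight {X Y Z W : C} {j j' : X ⟶ Y} {q : X ⟶ Z} {p : Y ⟶ W} {i : Z ⟶ W}
    (hj : A.mem j) (hj' : A.mem j') (hq : B.mem q) (hp : B.mem p) (hi : A.mem i)
    (α : q ≫ i ⟶ j ≫ p) (η : j ⟶ j') :
    (G.iso hj' hq hp hi (α ≫ η ▷ p)).hom =
      (G.iso hj hq hp hi α).hom ≫ F.map₂ hj hj' η ▷ F'.map p hp := by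
  have e : vpaste ((λ_ j).hom ≫ η ≫ (ρ_ j').inv) α =
      vpaste ((λ_ j').hom ≫ 𝟙 j' ≫ (ρ_ j').inv) (α ≫ η ▷ p) := by
    have h₁ := vpaste_top (𝟙 (𝟙 X)) (𝟙 (𝟙 Y)) η α
    have h₂ := vpaste_top (𝟙 (𝟙 X)) (𝟙 (𝟙 Y)) (𝟙 j') (α ≫ η ▷ p)
    simp only [id_whiskerRight, whiskerLeft_id, Category.id_comp, Category.comp_id] at h₁ h₂ ⊢
    rw [h₁, h₂]
  have h := congrArg (fun γ => (G.iso hj' (B.comp_mem (B.id_mem X) hq)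
    (B.comp_mem (B.id_mem Y) hp) hi γ).hom) e
  rw [G.ax_b hj' hj hi (B.id_mem X) (B.id_mem Y) hq hp,
    G.ax_b hj' hj' hi (B.id_mem X) (B.id_mem Y) hq hp, G.ax_a hj hj', G.ax_a hj' hj',
    F.map₂_id, vpaste_top, vpaste_top] at h
  simp only [Category.assoc, cancel_epi] at h
  simp only [← Category.assoc, cancel_mono] at h
  simpa using h.symm

lemma iso_whiskerLeft {X Y Z W : C} {j : X ⟶ Y} {q : X ⟶ Z} {p : Y ⟶ W} {i i' : Z ⟶ W}
    (hj : A.mem j) (hq : B.mem q) (hp : B.mem p) (hi : A.mem i) (hi' : A.mem i')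
    (η : i' ⟶ i) (α : q ≫ i ⟶ j ≫ p) :
    (G.iso hj hq hp hi' (q ◁ η ≫ α)).hom =
      F'.map q hq ◁ F.map₂ hi' hi η ≫ (G.iso hj hq hp hi α).hom := by
  have e : vpaste α ((λ_ i').hom ≫ η ≫ (ρ_ i).inv) =
      vpaste (q ◁ η ≫ α) ((λ_ i').hom ≫ 𝟙 i' ≫ (ρ_ i').inv) := by
    have h₁ := vpaste_bot (𝟙 (𝟙 Z)) (𝟙 (𝟙 W)) η α
    have h₂ := vpaste_bot (𝟙 (𝟙 Z)) (𝟙 (𝟙 W)) (𝟙 i') (q ◁ η ≫ α)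
    simp only [id_whiskerRight, whiskerLeft_id, Category.id_comp, Category.comp_id] at h₁ h₂ ⊢
    rw [h₁, h₂]
  have h := congrArg (fun γ => (G.iso hj (B.comp_mem hq (B.id_mem Z))
    (B.comp_mem hp (B.id_mem W)) hi' γ).hom) e
  rw [G.ax_b hj hi hi' hq hp (B.id_mem Z) (B.id_mem W),
    G.ax_b hj hi' hi' hq hp (B.id_mem Z) (B.id_mem W), G.ax_a hi' hi, G.ax_a hi' hi',
    F.map₂_id, vpaste_bot, vpaste_bot] at h
  simp only [Category.assoc, cancel_epi] at h
  simp only [← Category.assoc, cancel_mono] at h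
  simpa using h.symm

/-- The cubes with two directions in `A` commute for the canonical gluing datum. -/
lemma cube_self [IsLocallyGroupoid C] (c : Cube A A B) :
    CubeCommutes (G.iso c.hq' c.hx c.hz c.hq c.I').hom
      (G.iso c.ha' c.hz c.hw c.ha c.J).hom
      (F.selfGluing.iso c.hb' c.hq' c.hp' c.ha' c.K').hom
      (F.selfGluing.iso c.hb c.hq c.hp c.ha c.K).hom
      (G.iso c.hb' c.hx c.hy c.hb c.J').hom
      (G.iso c.hp' c.hy c.hw c.hp c.I).hom := by
  have h := congrArg (fun γ => (G.iso (A.comp_mem c.hb' c.hp') c.hx c.hw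
    (A.comp_mem c.hq c.ha) γ).hom) c.comm
  rw [G.iso_whiskerRight (A.comp_mem c.hq' c.ha') (A.comp_mem c.hb' c.hp'),
    G.iso_whiskerLeft (A.comp_mem c.hb' c.hp') c.hx c.hw (A.comp_mem c.hb c.hp)
      (A.comp_mem c.hq c.ha),
    G.ax_b' c.hx c.hz c.hw c.hq' c.hq c.ha' c.ha, G.ax_b' c.hx c.hy c.hw c.hb' c.hb c.hp' c.hp] at h
  dsimp only [CubeCommutes, PsFun.selfGluing, Iso.trans_hom, Iso.symm_hom, PsFun.map₂Iso]
  rw [← cancel_epi (F'.map c.x c.hx ◁ (F.mapComp c.q c.a c.hq c.ha).hom),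
    ← cancel_mono ((F.mapComp c.b' c.p' c.hb' c.hp').inv ▷ F'.map c.w c.hw)]
  simpa using h

end Gluing

/-- Pseudonatural transformations are compatible with the canonical gluing data. -/
lemma PsTrans.selfGluing_compat [IsLocallyGroupoid C] {B : WideSub C} {F₀ F₀' : C → D}
    {F : PsFun B F₀} {F' : PsFun B F₀'} {α₀ : ∀ X, F₀ X ⟶ F₀' X} (t : PsTrans F F' α₀)
    {X Y Z W : C} {b : X ⟶ Y} {q : X ⟶ Z} {p : Y ⟶ W}
    {a : Z ⟶ W} (hb : B.mem b) (hq : B.mem q) (hp : B.mem p) (ha : B.mem a)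
    (α : q ≫ a ⟶ b ≫ p) :
    vpaste (t.nat q hq).hom (t.nat a ha).hom ≫
        α₀ X ◁ (F'.selfGluing.iso hb hq hp ha α).hom =
      (F.selfGluing.iso hb hq hp ha α).hom ▷ α₀ W ≫
        vpaste (t.nat b hb).hom (t.nat p hp).hom := by
  have h₁ := t.nat_comp q a hq ha
  have h₂ := t.nat_comp b p hb hp
  have h₃ := t.nat_naturality (B.comp_mem hq ha) (B.comp_mem hb hp) α
  dsimp only [PsFun.selfGluing, Iso.trans_hom, Iso.symm_hom, PsFun.map₂Iso]
  rw [← cancel_epi ((F.mapComp q a hq ha).hom ▷ α₀ W), ← reassoc_of% h₁]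
  simp only [whiskerLeft_comp, comp_whiskerRight, Category.assoc]
  rw [← h₂, reassoc_of% h₃]
  simp

lemma strictPseudofunctor_ext {X : Type u} [Bicategory.{w, v} X] {Y : Type u'}
    [Bicategory.{w', v'} Y] {F G : StrictPseudofunctor X Y}
    (h : F.toPrelaxFunctor = G.toPrelaxFunctor) : F = G := by
  obtain ⟨⟨⟨F, Fid, Fcomp, _, _, _, _, _⟩, Fi, hFi⟩, Fc, hFc⟩ := F
  obtain ⟨⟨⟨G, Gid, Gcomp, _, _, _, _, _⟩, Gi, hGi⟩, Gc, hGc⟩ := G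
  dsimp only at h
  subst h
  obtain rfl : Fid = Gid := funext fun x => (hFi x).trans (hGi x).symm
  obtain rfl : @Fcomp = @Gcomp := by
    funext x y z f g
    exact (hFc f g).trans (hGc f g).symm
  rfl

section Merge

variable {m : ℕ}

/-- The map on indices that sends `0` and `1` to `0` and `k + 2` to `k + 1`. -/
def merge : Fin (m + 2) → Fin (m + 1) := Fin.cases 0 fun i => i

lemma merge_mono {i j : Fin (m + 2)} (h : i ≤ j) : merge i ≤ merge j := by
  induction i using Fin.cases <;> induction j using Fin.cases
  · exact le_refl _
  · exact Fin.zero_le _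
  · simp at h
  · simpa [merge] using h

lemma eq_zero_of_merge_eq {i j : Fin (m + 2)} (h : i < j) (e : merge i = merge j) :
    i = 0 ∧ j = 1 := by
  induction i using Fin.cases <;> induction j using Fin.cases
  · simp at h
  · simp only [merge, Fin.cases_zero, Fin.cases_succ] at e
    subst e
    simp
  · simp at h
  · simp only [merge, Fin.cases_succ] at e
    subst e
    simp at h

/-- The family `B, A 2, A 3, …` obtained from `A 0, A 1, A 2, …` on replacing `A 0, A 1` by `B`. -/
def coarsen (B : WideSub C) (A : Fin (m + 2) → WideSub C) : Fin (m + 1) → WideSub C :=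
  Fin.cons B fun i : Fin m => A i.succ.succ

lemma le_coarsen {B : WideSub C} {A : Fin (m + 2) → WideSub C} (h₀ : A 0 ≤ B) (h₁ : A 1 ≤ B)
    (i : Fin (m + 2)) : A i ≤ coarsen B A (merge i) := by
  induction i using Fin.cases with
  | zero => exact h₀
  | succ i =>
    induction i using Fin.cases with
    | zero => exact h₁
    | succ i => exact fun _ _ _ h => h

end Merge

namespace GD

variable [IsLocallyGroupoid C]

/-- The gluing data extended to all pairs `i ≤ j` by the canonical ones for `i = j`. -/
noncomputable def full (E : GD D A) {i j : Fin n} (h : i ≤ j) : Gluing (E.ps i) (E.ps j) :=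
  if e : i = j then e ▸ (E.ps i).selfGluing else E.G (lt_of_le_of_ne h e)

lemma full_self (E : GD D A) (i : Fin n) : E.full (le_refl i) = (E.ps i).selfGluing := by
  simp [full]

lemma full_of_lt (E : GD D A) {i j : Fin n} (h : i < j) : E.full h.le = E.G h := by
  simp [full, h.ne]

lemma Hom.full_compat {E E' : GD D A} (s : Hom E E') {i j : Fin n} (hij : i ≤ j) {X Y Z W : C}
    {b : X ⟶ Y} {q : X ⟶ Z} {p : Y ⟶ W} {a : Z ⟶ W} (hb : (A i).mem b) (hq : (A j).mem q)
    (hp : (A j).mem p) (ha : (A i).mem a) (α : q ≫ a ⟶ b ≫ p) :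
    vpaste ((s.tr j).nat q hq).hom ((s.tr i).nat a ha).hom ≫
        s.app X ◁ ((E'.full hij).iso hb hq hp ha α).hom =
      ((E.full hij).iso hb hq hp ha α).hom ▷ s.app W ≫
        vpaste ((s.tr i).nat b hb).hom ((s.tr j).nat p hp).hom := by
  obtain rfl | h := hij.eq_or_lt
  · rw [full_self, full_self]
    exact (s.tr i).selfGluing_compat hb hq hp ha α
  · rw [full_of_lt _ h, full_of_lt _ h]
    exact s.compat h hb hq hp ha α

lemma full_cube (E : GD D A) {i j k : Fin n} (hij : i ≤ j) (hjk : j < k)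
    (c : Cube (A i) (A j) (A k)) :
    CubeCommutes ((E.full hjk.le).iso c.hq' c.hx c.hz c.hq c.I').hom
      ((E.full (hij.trans hjk.le)).iso c.ha' c.hz c.hw c.ha c.J).hom
      ((E.full hij).iso c.hb' c.hq' c.hp' c.ha' c.K').hom
      ((E.full hij).iso c.hb c.hq c.hp c.ha c.K).hom
      ((E.full (hij.trans hjk.le)).iso c.hb' c.hx c.hy c.hb c.J').hom
      ((E.full hjk.le).iso c.hp' c.hy c.hw c.hp c.I).hom := by
  obtain rfl | h := hij.eq_or_lt
  · rw [full_self]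
    exact (E.full hjk.le).cube_self c
  · rw [full_of_lt _ h, full_of_lt _ hjk, full_of_lt _ (h.trans hjk)]
    exact E.cube h hjk c

end GD

/-- Enlarging the subcategories of a cube. -/
abbrev Cube.mono {P Q R P' Q' R' : WideSub C} (c : Cube P Q R) (hP : P ≤ P') (hQ : Q ≤ Q')
    (hR : R ≤ R') : Cube P' Q' R' where
  ha := hP _ c.ha
  hb := hP _ c.hb
  ha' := hP _ c.ha'
  hb' := hP _ c.hb'
  hp := hQ _ c.hp
  hq := hQ _ c.hq
  hp' := hQ _ c.hp'
  hq' := hQ _ c.hq'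
  hx := hR _ c.hx
  hy := hR _ c.hy
  hz := hR _ c.hz
  hw := hR _ c.hw
  I' := c.I'
  J := c.J
  K' := c.K'
  K := c.K
  J' := c.J'
  I := c.I
  comm := c.comm

section Comparison

variable [IsLocallyGroupoid C] {m : ℕ} (B : WideSub C) (A : Fin (m + 2) → WideSub C)
  (h₀ : A 0 ≤ B) (h₁ : A 1 ≤ B)

/-- The comparison on objects: restrict the pseudofunctor on `B` to `A 0` and to `A 1`, with its
canonical gluing datum, and restrict the gluing data on the pairs `(B, A j)` to `(A 0, A j)` and
`(A 1, A j)`. -/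
noncomputable def comparisonObj (E : GD D (coarsen B A)) : GD D A where
  obj := E.obj
  ps i := (E.ps (merge i)).restrict (le_coarsen h₀ h₁ i)
  G {i j} hij := (E.full (merge_mono hij.le)).restrict (le_coarsen h₀ h₁ i) (le_coarsen h₀ h₁ j)
  cube {i j k} hij hjk c := by
    have hjk' : merge j < merge k := (merge_mono hjk.le).lt_of_ne fun e => by
      have := eq_zero_of_merge_eq hjk e
      rw [this.1] at hij
      simp at hij
    exact E.full_cube (merge_mono hij.le) hjk'
      (c.mono (le_coarsen h₀ h₁ i) (le_coarsen h₀ h₁ j) (le_coarsen h₀ h₁ k))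

/-- The comparison on 1-cells. -/
noncomputable def comparisonMap {E E' : GD D (coarsen B A)} (s : GD.Hom E E') :
    GD.Hom (comparisonObj B A h₀ h₁ E) (comparisonObj B A h₀ h₁ E') where
  app := s.app
  tr i := (s.tr (merge i)).restrict (le_coarsen h₀ h₁ i)
  compat {i j} hij {_ _ _ _ _ _ _ _} hb hq hp ha α :=
    s.full_compat (merge_mono hij.le) (le_coarsen h₀ h₁ i _ hb) (le_coarsen h₀ h₁ j _ hq)
      (le_coarsen h₀ h₁ j _ hp) (le_coarsen h₀ h₁ i _ ha) α

/-- The comparison on 2-cells. -/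
noncomputable def comparisonMap₂ {E E' : GD D (coarsen B A)} {s t : GD.Hom E E'} (Ξ : s ⟶ t) :
    comparisonMap B A h₀ h₁ s ⟶ comparisonMap B A h₀ h₁ t :=
  GD.Hom₂.mk Ξ.app fun i _ _ f hf => Ξ.nat (merge i) f (le_coarsen h₀ h₁ i f hf)

/-- The comparison 2-functor from gluing data relative to `B, A 2, …` to gluing data relative to
`A 0, A 1, A 2, …`. -/
noncomputable def comparison [Strict D] : StrictPseudofunctor (GD D (coarsen B A)) (GD D A) := .mk''
  { obj := comparisonObj B A h₀ h₁
    map := comparisonMap B A h₀ h₁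
    map₂ := comparisonMap₂ B A h₀ h₁
    map₂_id := fun _ => rfl
    map₂_comp := fun _ _ => rfl
    map_id := fun _ => rfl
    map_comp := fun _ _ => rfl
    map₂_whisker_left := fun {E _ E''} s {t t'} Ξ =>
      eqToHom_rfl_comp
        (X := GD.Hom (comparisonObj B A h₀ h₁ E) (comparisonObj B A h₀ h₁ E''))
        (a := comparisonMap B A h₀ h₁ (s.comp t)) (b := comparisonMap B A h₀ h₁ (s.comp t'))
        (comparisonMap₂ B A h₀ h₁ (GD.whiskerLeft' s Ξ))
    map₂_whisker_right := fun {E _ E'' s s'} Ξ t =>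
      eqToHom_rfl_comp
        (X := GD.Hom (comparisonObj B A h₀ h₁ E) (comparisonObj B A h₀ h₁ E''))
        (a := comparisonMap B A h₀ h₁ (s.comp t)) (b := comparisonMap B A h₀ h₁ (s'.comp t))
        (comparisonMap₂ B A h₀ h₁ (GD.whiskerRight' Ξ t)) }

lemma comparison_comp_forget [Strict D] :
    (comparison (D := D) B A h₀ h₁).comp (forgetGD A) = forgetGD (coarsen B A) :=
  strictPseudofunctor_ext rfl

end Comparison

end Comparison

section Conditions

variable {C : Type u} [Bicategory.{w, v} C]

/-- The square `α` precomposed with a 1-cell `h` into its corner. -/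
def precompSquare {T X Y Z W : C} {j : X ⟶ Y} {q : X ⟶ Z} {p : Y ⟶ W} {i : Z ⟶ W} (h : T ⟶ X)
    (α : q ≫ i ⟶ j ≫ p) : (h ≫ q) ≫ i ⟶ (h ≫ j) ≫ p :=
  (α_ h q i).hom ≫ h ◁ α ≫ (α_ h j p).inv

/-- The square obtained by pasting the square `β` with corner `X'`, a 1-cell `f : X ⟶ X'` and two
triangles `γ`, `δ`. -/
def pasteTriangles {X X' Y Z W : C} {k : X' ⟶ Y} {r : X' ⟶ Z} {p : Y ⟶ W} {i : Z ⟶ W}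
    {f : X ⟶ X'} {q : X ⟶ Z} {j : X ⟶ Y} (γ : q ⟶ f ≫ r) (β : r ≫ i ⟶ k ≫ p) (δ : f ≫ k ⟶ j) :
    q ≫ i ⟶ j ≫ p :=
  γ ▷ i ≫ precompSquare f β ≫ δ ▷ p

/-- The square `α` lies in the subcategory `P` and is 2-Cartesian in `P`, i.e. it exhibits its
corner as a 2-fiber product in `P` in the bicategorical sense: for every object `T`, the functor
from `P(T, X)` to the category of triples `(u : T ⟶ Y, v : T ⟶ Z, θ : v ≫ i ⟶ u ≫ p)` with `u`, `v`
in `P` is essentially surjective and fully faithful. All 2-cells of the ambient `C` are meant to be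
invertible. -/
structure IsTwoCartesianIn (P : WideSub C) {X Y Z W : C} {j : X ⟶ Y} {q : X ⟶ Z} {p : Y ⟶ W}
    {i : Z ⟶ W} (α : q ≫ i ⟶ j ≫ p) : Prop where
  mem_top : P.mem j
  mem_left : P.mem q
  mem_right : P.mem p
  mem_bot : P.mem i
  essSurj : ∀ {T : C} {u : T ⟶ Y} {v : T ⟶ Z}, P.mem u → P.mem v → ∀ θ : v ≫ i ⟶ u ≫ p,
    ∃ (h : T ⟶ X) (γ : h ≫ q ⟶ v) (δ : h ≫ j ⟶ u), P.mem h ∧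
      precompSquare h α ≫ δ ▷ p = γ ▷ i ≫ θ
  fullyFaithful : ∀ {T : C} {h h' : T ⟶ X}, P.mem h → P.mem h' →
    ∀ (φ : h ≫ q ⟶ h' ≫ q) (ψ : h ≫ j ⟶ h' ≫ j),
      φ ▷ i ≫ precompSquare h' α = precompSquare h α ≫ ψ ▷ p →
      ∃! ξ : h ⟶ h', ξ ▷ q = φ ∧ ξ ▷ j = ψ

/-- The square `α` is 2-Cartesian in `C`. -/
abbrev IsTwoCartesian {X Y Z W : C} {j : X ⟶ Y} {q : X ⟶ Z} {p : Y ⟶ W} {i : Z ⟶ W}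
    (α : q ≫ i ⟶ j ≫ p) : Prop :=
  IsTwoCartesianIn ⊤ α

/-- Every 1-cell of `R` is isomorphic to a 1-cell of `P` followed by a 1-cell of `Q`. -/
def Factors (P Q R : WideSub C) : Prop :=
  ∀ {X Y : C} (f : X ⟶ Y), R.mem f → ∃ (Z : C) (a : X ⟶ Z) (p : Z ⟶ Y),
    P.mem a ∧ Q.mem p ∧ Nonempty (f ≅ a ≫ p)

/-- The 1-cells that are finite alternating composites of 1-cells of `P` and of `Q`, each 1-cell
of `P` being followed by one of `Q`. -/
inductive IsComposite (P Q : WideSub C) : ∀ {X Y : C}, (X ⟶ Y) → Prop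
  | nil (X : C) : IsComposite P Q (𝟙 X)
  | cons {X Y Z W : C} {a : X ⟶ Y} {p : Y ⟶ Z} {f : Z ⟶ W} (ha : P.mem a) (hp : Q.mem p)
      (hf : IsComposite P Q f) : IsComposite P Q ((a ≫ p) ≫ f)

/-- `P` and `Q` generate `R`. -/
def Generates (P Q R : WideSub C) : Prop :=
  ∀ {X Y : C} (f : X ⟶ Y), R.mem f → ∃ g : X ⟶ Y, IsComposite P Q g ∧ Nonempty (f ≅ g)

/-- 2-fiber products exist in `P` and are 2-fiber products in `Q`. -/
def HasFiberProductsAgreeing (P Q : WideSub C) : Prop :=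
  (∀ {Y Z W : C} (p : Y ⟶ W) (i : Z ⟶ W), P.mem p → P.mem i →
    ∃ (X : C) (j : X ⟶ Y) (q : X ⟶ Z) (α : q ≫ i ⟶ j ≫ p), IsTwoCartesianIn P α) ∧
  ∀ {X Y Z W : C} {j : X ⟶ Y} {q : X ⟶ Z} {p : Y ⟶ W} {i : Z ⟶ W} (α : q ≫ i ⟶ j ≫ p),
    IsTwoCartesianIn P α → IsTwoCartesianIn Q α

/-- 2-base changes in `C` of 1-cells of `P` by 1-cells of `Q` exist. -/
def HasBaseChanges (P Q : WideSub C) : Prop :=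
  ∀ {Y Z W : C} (p : Y ⟶ W) (i : Z ⟶ W), Q.mem p → P.mem i →
    ∃ (X : C) (j : X ⟶ Y) (q : X ⟶ Z) (α : q ≫ i ⟶ j ≫ p), IsTwoCartesian α

/-- 1-cells of `P` are stable under 2-base change in `C` by 1-cells of `Q`, whenever the 2-base
change exists. -/
def StableUnderBaseChange (P Q : WideSub C) : Prop :=
  ∀ {X Y Z W : C} {j : X ⟶ Y} {q : X ⟶ Z} {p : Y ⟶ W} {i : Z ⟶ W} (α : q ≫ i ⟶ j ≫ p),
    IsTwoCartesian α → P.mem i → Q.mem p → P.mem j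

/-- `P` and `Q` are squaring in `C`. -/
def Squaring (P Q : WideSub C) : Prop :=
  ∀ {X Y Z W : C} {j : X ⟶ Y} {q : X ⟶ Z} {p : Y ⟶ W} {i : Z ⟶ W} (α : q ≫ i ⟶ j ≫ p),
    P.mem i → P.mem j → Q.mem p → Q.mem q →
    ∃ (X' : C) (f : X ⟶ X') (k : X' ⟶ Y) (r : X' ⟶ Z) (β : r ≫ i ⟶ k ≫ p) (γ : q ⟶ f ≫ r)
      (δ : f ≫ k ⟶ j),
      P.mem k ∧ Q.mem r ∧ (P ⊓ Q).mem f ∧ IsTwoCartesian β ∧ α = pasteTriangles γ β δ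

/-- A decomposition of a cube whose bottom and top faces are decomposed through 2-Cartesian squares
`L` and `L'` by means of 1-cells `f : X ⟶ V` and `f' : X' ⟶ V'`, the remaining 2-cells being those
of the inner cube, with left face `I''` and back face `J''`, and of the square `M` on the edges
`x`, `f`, `f'` and `v`. -/
structure CubeDecomposition {P Q R : WideSub C} (c : Cube P Q R) where
  {V V' : C}
  {f : c.X ⟶ V}
  {f' : c.X' ⟶ V'}
  {k : V ⟶ c.Y}
  {k' : V' ⟶ c.Y'}
  {r : V ⟶ c.Z}
  {r' : V' ⟶ c.Z'}
  {v : V' ⟶ V}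
  mem_f : (P ⊓ Q).mem f
  mem_f' : (P ⊓ Q).mem f'
  mem_k : P.mem k
  mem_k' : P.mem k'
  mem_r : Q.mem r
  mem_r' : Q.mem r'
  mem_v : R.mem v
  L : r ≫ c.a ⟶ k ≫ c.p
  L' : r' ≫ c.a' ⟶ k' ≫ c.p'
  cartesian : IsTwoCartesian L
  cartesian' : IsTwoCartesian L'
  γ : c.q ⟶ f ≫ r
  δ : f ≫ k ⟶ c.b
  γ' : c.q' ⟶ f' ≫ r'
  δ' : f' ≫ k' ⟶ c.b'
  M : c.x ≫ f ⟶ f' ≫ v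
  I'' : v ≫ r ⟶ r' ≫ c.z
  J'' : v ≫ k ⟶ k' ≫ c.y
  inner : CubeCommutes I'' c.J L' L J'' c.I
  bottom : c.K = pasteTriangles γ L δ
  top : c.K' = pasteTriangles γ' L' δ'
  left : c.I' ≫ γ' ▷ c.z = c.x ◁ γ ≫ hpaste M I''
  back : c.x ◁ δ ≫ c.J' = hpaste M J'' ≫ δ' ▷ c.y

/-- The family of subcategories `A` is cubing in `C`. -/
def Cubing {n : ℕ} (A : Fin n → WideSub C) : Prop :=
  (∀ i j, i ≠ j → Squaring (A i) (A j) ∧ Squaring (A i) (A i ⊓ A j)) ∧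
  ∀ i j k, i ≠ j → j ≠ k → i ≠ k →
    ∀ c : Cube (A i) (A j) (A k), Nonempty (CubeDecomposition c)

end Conditions

section Over

variable {X : Type u} [Bicategory.{w, v} X] {Y : Type u'} [Bicategory.{w', v'} Y]

/-- A 2-functor is 2-fully faithful if it induces isomorphisms between the categories of 1-cells
and 2-cells, i.e. functors that are fully faithful and bijective on objects. -/
structure IsTwoFullyFaithful (F : StrictPseudofunctor X Y) : Prop where
  bijective : ∀ a b : X, Function.Bijective fun f : a ⟶ b => F.map f
  full : ∀ a b : X, (F.mapFunctor a b).Full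
  faithful : ∀ a b : X, (F.mapFunctor a b).Faithful

/-- (Strict) 2-natural transformations between 2-functors. -/
structure TwoNatTrans (F G : StrictPseudofunctor X Y) where
  app : ∀ a : X, F.obj a ⟶ G.obj a
  naturality : ∀ {a b : X} (f : a ⟶ b), F.map f ≫ app b = app a ≫ G.map f
  naturality₂ : ∀ {a b : X} {f g : a ⟶ b} (η : f ⟶ g),
    F.map₂ η ▷ app b ≫ eqToHom (naturality g) = eqToHom (naturality f) ≫ app a ◁ G.map₂ η

/-- A 2-natural transformation is a 2-natural equivalence if its components are invertible
1-cells. -/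
def TwoNatTrans.IsEquivalence {F G : StrictPseudofunctor X Y} (α : TwoNatTrans F G) : Prop :=
  ∀ a : X, ∃ β : G.obj a ⟶ F.obj a, α.app a ≫ β = 𝟙 (F.obj a) ∧ β ≫ α.app a = 𝟙 (G.obj a)

/-- The predicate of being an identity 1-cell. -/
inductive IsIdentity : ∀ {a b : X}, (a ⟶ b) → Prop
  | id (a : X) : IsIdentity (𝟙 a)

end Over

section OverEquivalence

variable {X : Type*} [Bicategory X] {Y : Type*} [Bicategory Y] {S : Type*} [Bicategory S]

/-- A 2-natural transformation `α` lies over `S` if its image under `E` is an identity. -/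
def TwoNatTrans.IsOver {F G : StrictPseudofunctor X Y} (α : TwoNatTrans F G)
    (E : StrictPseudofunctor Y S) : Prop :=
  ∀ a : X, IsIdentity (E.map (α.app a))

/-- `G` is an equivalence of 2-categories over `S`, where `X` and `Y` are viewed over `S` by means
of `E` and `F`: it is a 2-functor over `S` that has a quasi-inverse 2-functor over `S`, up to
2-natural equivalences over `S`. -/
def IsOverEquivalence (E : StrictPseudofunctor X S) (F : StrictPseudofunctor Y S)
    (G : StrictPseudofunctor X Y) : Prop :=
  G.comp F = E ∧ ∃ H : StrictPseudofunctor Y X, H.comp E = F ∧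
    (∃ α : TwoNatTrans (StrictPseudofunctor.id Y) (H.comp G), α.IsEquivalence ∧ α.IsOver F) ∧
    ∃ β : TwoNatTrans (G.comp H) (StrictPseudofunctor.id X), β.IsEquivalence ∧ β.IsOver E

end OverEquivalence

end TwoGlue

open TwoGlue

namespace TwoGlue

section Cyl

variable {C : Type u} [Bicategory.{w, v} C]

/-- The 2-cells `η` and `η'` between the horizontal edges of the squares `α` and `β`, which have
the same vertical edges, are compatible with these squares. -/
def Cyl {X Y X' Y' : C} {x : X ⟶ X'} {y : Y ⟶ Y'} {f g : X' ⟶ Y'} {f' g' : X ⟶ Y}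
    (α : x ≫ f ⟶ f' ≫ y) (β : x ≫ g ⟶ g' ≫ y) (η : f ⟶ g) (η' : f' ⟶ g') : Prop :=
  α ≫ η' ▷ y = x ◁ η ≫ β

namespace Cyl

variable {X Y Z W X' Y' Z' W' : C} {x : X ⟶ X'} {y : Y ⟶ Y'} {z : Z ⟶ Z'} {w : W ⟶ W'}

lemma refl {f : X' ⟶ Y'} {f' : X ⟶ Y} (α : x ≫ f ⟶ f' ≫ y) : Cyl α α (𝟙 f) (𝟙 f') := by
  simp [Cyl]

lemma comp {f g h : X' ⟶ Y'} {f' g' h' : X ⟶ Y} {α : x ≫ f ⟶ f' ≫ y} {β : x ≫ g ⟶ g' ≫ y}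
    {γ : x ≫ h ⟶ h' ≫ y} {η : f ⟶ g} {η' : f' ⟶ g'} {θ : g ⟶ h} {θ' : g' ⟶ h'}
    (h₁ : Cyl α β η η') (h₂ : Cyl β γ θ θ') : Cyl α γ (η ≫ θ) (η' ≫ θ') := by
  unfold Cyl at *
  rw [comp_whiskerRight, reassoc_of% h₁, h₂, whiskerLeft_comp, Category.assoc]

lemma symm {f g : X' ⟶ Y'} {f' g' : X ⟶ Y} {α : x ≫ f ⟶ f' ≫ y} {β : x ≫ g ⟶ g' ≫ y}
    {η : f ≅ g} {η' : f' ≅ g'} (h : Cyl α β η.hom η'.hom) : Cyl β α η.inv η'.inv := by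
  unfold Cyl at *
  rw [← cancel_epi (x ◁ η.hom), ← reassoc_of% h]
  simp

lemma of_eq {f g : X' ⟶ Y'} {f' g' : X ⟶ Y} {α : x ≫ f ⟶ f' ≫ y} {β : x ≫ g ⟶ g' ≫ y}
    {η θ : f ⟶ g} {η' θ' : f' ⟶ g'} (h : Cyl α β η η') (e : θ = η) (e' : θ' = η') :
    Cyl α β θ θ' := by
  rwa [e, e']

lemma whiskerLeft {f : X' ⟶ Y'} {f' : X ⟶ Y} (δ : x ≫ f ⟶ f' ≫ y) {g h : Y' ⟶ Z'}
    {g' h' : Y ⟶ Z} {α : y ≫ g ⟶ g' ≫ z} {β : y ≫ h ⟶ h' ≫ z} {η : g ⟶ h} {η' : g' ⟶ h'}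
    (e : Cyl α β η η') : Cyl (hpaste δ α) (hpaste δ β) (f ◁ η) (f' ◁ η') := by
  unfold Cyl at *
  rw [hpaste_whiskerRight_right, e, whiskerLeft_hpaste_right]

lemma whiskerRight {g h : X' ⟶ Y'} {g' h' : X ⟶ Y} {α : x ≫ g ⟶ g' ≫ y} {β : x ≫ h ⟶ h' ≫ y}
    {η : g ⟶ h} {η' : g' ⟶ h'} (e : Cyl α β η η') {f : Y' ⟶ Z'} {f' : Y ⟶ Z}
    (δ : y ≫ f ⟶ f' ≫ z) : Cyl (hpaste α δ) (hpaste β δ) (η ▷ f) (η' ▷ f') := by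
  unfold Cyl at *
  rw [hpaste_whiskerRight_left, e, whiskerLeft_hpaste_left]

lemma associator {f : X' ⟶ Y'} {f' : X ⟶ Y} {g : Y' ⟶ Z'} {g' : Y ⟶ Z} {h : Z' ⟶ W'}
    {h' : Z ⟶ W} (α : x ≫ f ⟶ f' ≫ y) (β : y ≫ g ⟶ g' ≫ z) (γ : z ≫ h ⟶ h' ≫ w) :
    Cyl (hpaste (hpaste α β) γ) (hpaste α (hpaste β γ)) (α_ f g h).hom (α_ f' g' h').hom := by
  dsimp only [Cyl, hpaste]
  bicategory

lemma associator_inv {f : X' ⟶ Y'} {f' : X ⟶ Y} {g : Y' ⟶ Z'} {g' : Y ⟶ Z} {h : Z' ⟶ W'}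
    {h' : Z ⟶ W} (α : x ≫ f ⟶ f' ≫ y) (β : y ≫ g ⟶ g' ≫ z) (γ : z ≫ h ⟶ h' ≫ w) :
    Cyl (hpaste α (hpaste β γ)) (hpaste (hpaste α β) γ) (α_ f g h).inv (α_ f' g' h').inv :=
  (associator α β γ).symm

/-- The identity square on the vertical edge `x`. -/
abbrev one (x : X ⟶ X') : x ≫ 𝟙 X' ⟶ 𝟙 X ≫ x := (ρ_ x).hom ≫ (λ_ x).inv

lemma leftUnitor {f : X' ⟶ Y'} {f' : X ⟶ Y} (α : x ≫ f ⟶ f' ≫ y) :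
    Cyl (hpaste (one x) α) α (λ_ f).hom (λ_ f').hom := by
  simp [Cyl, hpaste, one]

lemma rightUnitor {f : X' ⟶ Y'} {f' : X ⟶ Y} (α : x ≫ f ⟶ f' ≫ y) :
    Cyl (hpaste α (one y)) α (ρ_ f).hom (ρ_ f').hom := by
  simp [Cyl, hpaste, one]

lemma leftUnitor_inv {f : X' ⟶ Y'} {f' : X ⟶ Y} (α : x ≫ f ⟶ f' ≫ y) :
    Cyl α (hpaste (one x) α) (λ_ f).inv (λ_ f').inv :=
  (leftUnitor α).symm

lemma rightUnitor_inv {f : X' ⟶ Y'} {f' : X ⟶ Y} (α : x ≫ f ⟶ f' ≫ y) :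
    Cyl α (hpaste α (one y)) (ρ_ f).inv (ρ_ f').inv :=
  (rightUnitor α).symm

/-- The square is determined by a compatible invertible pair of 2-cells. -/
lemma eq_left {f g : X' ⟶ Y'} {f' g' : X ⟶ Y} {α α' : x ≫ f ⟶ f' ≫ y} {β : x ≫ g ⟶ g' ≫ y}
    {η : f ⟶ g} {η' : f' ⟶ g'} [IsIso η'] (h : Cyl α β η η') (h' : Cyl α' β η η') : α = α' := by
  unfold Cyl at *
  rw [← cancel_mono (η' ▷ y), h, h']

end Cyl

lemma hpaste_inv_hom {X₁ X₂ X₃ Y₁ Y₂ Y₃ : C} {i₁ : X₁ ⟶ Y₁} {i₂ : X₂ ⟶ Y₂} {i₃ : X₃ ⟶ Y₃}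
    {q : X₁ ⟶ X₂} {p : Y₁ ⟶ Y₂} {q' : X₂ ⟶ X₃} {p' : Y₂ ⟶ Y₃}
    (α : q ≫ i₂ ≅ i₁ ≫ p) (α' : q' ≫ i₃ ≅ i₂ ≫ p') :
    hpaste α.inv α'.inv ≫ vpaste α.hom α'.hom = 𝟙 _ := by
  simp [hpaste, vpaste, ← whiskerLeft_comp_assoc, ← comp_whiskerRight_assoc]

lemma vpaste_hom_inv {X₁ X₂ X₃ Y₁ Y₂ Y₃ : C} {i₁ : X₁ ⟶ Y₁} {i₂ : X₂ ⟶ Y₂} {i₃ : X₃ ⟶ Y₃}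
    {q : X₁ ⟶ X₂} {p : Y₁ ⟶ Y₂} {q' : X₂ ⟶ X₃} {p' : Y₂ ⟶ Y₃}
    (α : q ≫ i₂ ≅ i₁ ≫ p) (α' : q' ≫ i₃ ≅ i₂ ≫ p') :
    vpaste α.hom α'.hom ≫ hpaste α.inv α'.inv = 𝟙 _ := by
  simp [hpaste, vpaste, ← whiskerLeft_comp_assoc, ← comp_whiskerRight_assoc]

/-- Vertical pasting of invertible squares, whose inverse is the horizontal pasting of the
inverses. -/
@[simps]
def vpasteIso {X₁ X₂ X₃ Y₁ Y₂ Y₃ : C} {i₁ : X₁ ⟶ Y₁} {i₂ : X₂ ⟶ Y₂} {i₃ : X₃ ⟶ Y₃}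
    {q : X₁ ⟶ X₂} {p : Y₁ ⟶ Y₂} {q' : X₂ ⟶ X₃} {p' : Y₂ ⟶ Y₃}
    (α : q ≫ i₂ ≅ i₁ ≫ p) (α' : q' ≫ i₃ ≅ i₂ ≫ p') :
    (q ≫ q') ≫ i₃ ≅ i₁ ≫ (p ≫ p') where
  hom := vpaste α.hom α'.hom
  inv := hpaste α.inv α'.inv
  hom_inv_id := vpaste_hom_inv α α'
  inv_hom_id := hpaste_inv_hom α α'

end Cyl

section PsTrans

variable {C : Type u} [Bicategory.{w, v} C] {D : Type u'} [Bicategory.{w', v'} D]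
  {A : WideSub C} {F₀ F₀' : C → D} {F : PsFun A F₀} {F' : PsFun A F₀'} {α : ∀ X, F₀ X ⟶ F₀' X}

namespace PsTrans

variable (t : PsTrans F F' α)

/-- The naturality square of a pseudonatural transformation, read from its inverse. -/
abbrev sq {X Y : C} (f : X ⟶ Y) (hf : A.mem f) : α X ≫ F'.map f hf ⟶ F.map f hf ≫ α Y :=
  (t.nat f hf).inv

lemma cyl_map₂ {X Y : C} {f g : X ⟶ Y} (hf : A.mem f) (hg : A.mem g) (η : f ⟶ g) :
    Cyl (t.sq f hf) (t.sq g hg) (F'.map₂ hf hg η) (F.map₂ hf hg η) := by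
  rw [Cyl, Iso.inv_comp_eq, ← reassoc_of% t.nat_naturality hf hg η]
  simp

lemma cyl_mapId (X : C) :
    Cyl (t.sq (𝟙 X) (A.id_mem X)) (Cyl.one (α X)) (F'.mapId X).hom (F.mapId X).hom := by
  rw [Cyl, Iso.inv_comp_eq, reassoc_of% t.nat_id X]
  simp

lemma cyl_mapComp {X Y Z : C} (f : X ⟶ Y) (g : Y ⟶ Z) (hf : A.mem f) (hg : A.mem g) :
    Cyl (t.sq (f ≫ g) (A.comp_mem hf hg)) (hpaste (t.sq f hf) (t.sq g hg))
      (F'.mapComp f g hf hg).hom (F.mapComp f g hf hg).hom := by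
  rw [Cyl, Iso.inv_comp_eq, reassoc_of% t.nat_comp f g hf hg, vpaste_hom_inv, Category.comp_id]

lemma cyl_mapComp_inv {X Y Z : C} (f : X ⟶ Y) (g : Y ⟶ Z) (hf : A.mem f) (hg : A.mem g) :
    Cyl (hpaste (t.sq f hf) (t.sq g hg)) (t.sq (f ≫ g) (A.comp_mem hf hg))
      (F'.mapComp f g hf hg).inv (F.mapComp f g hf hg).inv :=
  (t.cyl_mapComp f g hf hg).symm

lemma cyl_mapId_inv (X : C) :
    Cyl (Cyl.one (α X)) (t.sq (𝟙 X) (A.id_mem X)) (F'.mapId X).inv (F.mapId X).inv :=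
  (t.cyl_mapId X).symm

/-- Construction of a pseudonatural transformation from the inverses of its naturality squares. -/
def ofSq (s : ∀ {X Y : C} (f : X ⟶ Y) (hf : A.mem f), α X ≫ F'.map f hf ≅ F.map f hf ≫ α Y)
    (map₂ : ∀ {X Y : C} {f g : X ⟶ Y} (hf : A.mem f) (hg : A.mem g) (η : f ⟶ g),
      Cyl (s f hf).hom (s g hg).hom (F'.map₂ hf hg η) (F.map₂ hf hg η))
    (mapId : ∀ X : C,
      Cyl (s (𝟙 X) (A.id_mem X)).hom (Cyl.one (α X)) (F'.mapId X).hom (F.mapId X).hom)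
    (mapComp : ∀ {X Y Z : C} (f : X ⟶ Y) (g : Y ⟶ Z) (hf : A.mem f) (hg : A.mem g),
      Cyl (s (f ≫ g) (A.comp_mem hf hg)).hom (hpaste (s f hf).hom (s g hg).hom)
        (F'.mapComp f g hf hg).hom (F.mapComp f g hf hg).hom) : PsTrans F F' α where
  nat f hf := (s f hf).symm
  nat_naturality {_ _ f g} hf hg η := by
    have h := map₂ hf hg η
    rw [Cyl, ← Iso.eq_inv_comp] at h
    simp [h]
  nat_id X := by
    have h := mapId X
    rw [Cyl, ← Iso.eq_inv_comp] at h
    simp [h]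
  nat_comp f g hf hg := by
    have h := mapComp f g hf hg
    have e := hpaste_inv_hom (s f hf).symm (s g hg).symm
    rw [Cyl, ← Iso.eq_inv_comp] at h
    simp only [Iso.symm_hom, Iso.symm_inv] at e ⊢
    rw [h]
    simp only [Category.assoc, e, Category.comp_id]

end PsTrans

end PsTrans

section HCell

variable {C : Type u} [Bicategory.{w, v} C] {D : Type u'} [Bicategory.{w', v'} D]
  {P Q : WideSub C} {F₀ : C → D}

lemma compat_iff_cyl {U₁ U₂ U₃ U₄ U₁' U₂' U₃' U₄' : D} {c₁ : U₁ ⟶ U₁'} {c₂ : U₂ ⟶ U₂'}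
    {c₃ : U₃ ⟶ U₃'} {c₄ : U₄ ⟶ U₄'} {q : U₁ ⟶ U₃} {i : U₃ ⟶ U₄} {j : U₁ ⟶ U₂} {p : U₂ ⟶ U₄}
    {q' : U₁' ⟶ U₃'} {i' : U₃' ⟶ U₄'} {j' : U₁' ⟶ U₂'} {p' : U₂' ⟶ U₄'}
    (nq : q ≫ c₃ ≅ c₁ ≫ q') (ni : i ≫ c₄ ≅ c₃ ≫ i') (nj : j ≫ c₂ ≅ c₁ ≫ j')
    (np : p ≫ c₄ ≅ c₂ ≫ p') (φ : q ≫ i ⟶ j ≫ p) (φ' : q' ≫ i' ⟶ j' ≫ p') :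
    vpaste nq.hom ni.hom ≫ c₁ ◁ φ' = φ ▷ c₄ ≫ vpaste nj.hom np.hom ↔
      Cyl (hpaste nq.inv ni.inv) (hpaste nj.inv np.inv) φ' φ := by
  rw [Cyl, ← vpasteIso_inv, ← vpasteIso_inv, ← vpasteIso_hom, ← vpasteIso_hom,
    Iso.inv_comp_eq, ← Category.assoc (vpasteIso nq ni).hom, Iso.eq_comp_inv, eq_comm]

/-- The horizontal pasting of squares of `D` between images of 1-cells of `C`. -/
abbrev hCell (F : PsFun P F₀) (H : PsFun Q F₀) {X₁ X₂ X₃ Y₁ Y₂ Y₃ : C} {p₁ : X₁ ⟶ Y₁} {p₂ : X₂ ⟶ Y₂}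
    {p₃ : X₃ ⟶ Y₃} {j : X₁ ⟶ X₂} {i : Y₁ ⟶ Y₂} {j' : X₂ ⟶ X₃} {i' : Y₂ ⟶ Y₃}
    {hp₁ : Q.mem p₁} {hp₂ : Q.mem p₂} {hp₃ : Q.mem p₃} {hj : P.mem j} {hi : P.mem i}
    {hj' : P.mem j'} {hi' : P.mem i'}
    (φ : H.map p₁ hp₁ ≫ F.map i hi ⟶ F.map j hj ≫ H.map p₂ hp₂)
    (φ' : H.map p₂ hp₂ ≫ F.map i' hi' ⟶ F.map j' hj' ≫ H.map p₃ hp₃) :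
    H.map p₁ hp₁ ≫ F.map (i ≫ i') (P.comp_mem hi hi') ⟶
      F.map (j ≫ j') (P.comp_mem hj hj') ≫ H.map p₃ hp₃ :=
  H.map p₁ hp₁ ◁ (F.mapComp i i' hi hi').hom ≫ hpaste φ φ' ≫
    (F.mapComp j j' hj hj').inv ▷ H.map p₃ hp₃

/-- The vertical pasting of squares of `D` between images of 1-cells of `C`. -/
abbrev vCell (F : PsFun P F₀) (H : PsFun Q F₀) {X₁ X₂ X₃ Y₁ Y₂ Y₃ : C} {i₁ : X₁ ⟶ Y₁} {i₂ : X₂ ⟶ Y₂}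
    {i₃ : X₃ ⟶ Y₃} {q : X₁ ⟶ X₂} {p : Y₁ ⟶ Y₂} {q' : X₂ ⟶ X₃} {p' : Y₂ ⟶ Y₃}
    {hi₁ : P.mem i₁} {hi₂ : P.mem i₂} {hi₃ : P.mem i₃} {hq : Q.mem q} {hp : Q.mem p}
    {hq' : Q.mem q'} {hp' : Q.mem p'}
    (φ : H.map q hq ≫ F.map i₂ hi₂ ⟶ F.map i₁ hi₁ ≫ H.map p hp)
    (φ' : H.map q' hq' ≫ F.map i₃ hi₃ ⟶ F.map i₂ hi₂ ≫ H.map p' hp') :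
    H.map (q ≫ q') (Q.comp_mem hq hq') ≫ F.map i₃ hi₃ ⟶
      F.map i₁ hi₁ ≫ H.map (p ≫ p') (Q.comp_mem hp hp') :=
  (H.mapComp q q' hq hq').hom ▷ F.map i₃ hi₃ ≫ vpaste φ φ' ≫
    F.map i₁ hi₁ ◁ (H.mapComp p p' hp hp').inv

/-- A square of `D` between images of 1-cells, with its edges changed by images of 2-cells. -/
abbrev adCell (F : PsFun P F₀) (H : PsFun Q F₀) {X Y Z W : C} {j j' : X ⟶ Y} {q q' : X ⟶ Z}
    {p p' : Y ⟶ W} {i i' : Z ⟶ W} {hj : P.mem j} {hq : Q.mem q} {hp : Q.mem p} {hi : P.mem i}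
    (hj' : P.mem j') (hq' : Q.mem q') (hp' : Q.mem p') (hi' : P.mem i')
    (κ : q' ⟶ q) (ι : i' ⟶ i) (φ : H.map q hq ≫ F.map i hi ⟶ F.map j hj ≫ H.map p hp)
    (ζ : j ⟶ j') (ξ : p ⟶ p') :
    H.map q' hq' ≫ F.map i' hi' ⟶ F.map j' hj' ≫ H.map p' hp' :=
  H.map₂ hq' hq κ ▷ F.map i' hi' ≫ H.map q hq ◁ F.map₂ hi' hi ι ≫ φ ≫
    F.map₂ hj hj' ζ ▷ H.map p hp ≫ F.map j' hj' ◁ H.map₂ hp hp' ξ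

end HCell

section Closure

variable {C : Type u} [Bicategory.{w, v} C] {D : Type u'} [Bicategory.{w', v'} D]
  {P Q : WideSub C} {F₀ F₀' : C → D} {F : PsFun P F₀} {F' : PsFun P F₀'} {H : PsFun Q F₀}
  {H' : PsFun Q F₀'} {α : ∀ X, F₀ X ⟶ F₀' X} (t : PsTrans F F' α) (u : PsTrans H H' α)

namespace Cyl

lemma hCell {X₁ X₂ X₃ Y₁ Y₂ Y₃ : C} {p₁ : X₁ ⟶ Y₁} {p₂ : X₂ ⟶ Y₂}
    {p₃ : X₃ ⟶ Y₃} {j : X₁ ⟶ X₂} {i : Y₁ ⟶ Y₂} {j' : X₂ ⟶ X₃} {i' : Y₂ ⟶ Y₃}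
    {hp₁ : Q.mem p₁} {hp₂ : Q.mem p₂} {hp₃ : Q.mem p₃} {hj : P.mem j} {hi : P.mem i}
    {hj' : P.mem j'} {hi' : P.mem i'}
    {φ : H.map p₁ hp₁ ≫ F.map i hi ⟶ F.map j hj ≫ H.map p₂ hp₂}
    {ψ : H.map p₂ hp₂ ≫ F.map i' hi' ⟶ F.map j' hj' ≫ H.map p₃ hp₃}
    {φ' : H'.map p₁ hp₁ ≫ F'.map i hi ⟶ F'.map j hj ≫ H'.map p₂ hp₂}
    {ψ' : H'.map p₂ hp₂ ≫ F'.map i' hi' ⟶ F'.map j' hj' ≫ H'.map p₃ hp₃}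
    (h : Cyl (hpaste (u.sq p₁ hp₁) (t.sq i hi)) (hpaste (t.sq j hj) (u.sq p₂ hp₂)) φ' φ)
    (h' : Cyl (hpaste (u.sq p₂ hp₂) (t.sq i' hi')) (hpaste (t.sq j' hj') (u.sq p₃ hp₃)) ψ' ψ) :
    Cyl (hpaste (u.sq p₁ hp₁) (t.sq (i ≫ i') (P.comp_mem hi hi')))
      (hpaste (t.sq (j ≫ j') (P.comp_mem hj hj')) (u.sq p₃ hp₃)) (TwoGlue.hCell F' H' φ' ψ')
      (TwoGlue.hCell F H φ ψ) := by
  refine ((((((t.cyl_mapComp i i' hi hi').whiskerLeft (u.sq p₁ hp₁)).comp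
    (associator_inv _ _ _)).comp (h.whiskerRight _)).comp (associator _ _ _)).comp
    (h'.whiskerLeft _)).comp ((associator_inv _ _ _).comp
      ((t.cyl_mapComp_inv j j' hj hj').whiskerRight (u.sq p₃ hp₃))) |>.of_eq ?_ ?_ <;>
  simp [hpaste, TwoGlue.hCell]

lemma vCell {X₁ X₂ X₃ Y₁ Y₂ Y₃ : C} {i₁ : X₁ ⟶ Y₁} {i₂ : X₂ ⟶ Y₂}
    {i₃ : X₃ ⟶ Y₃} {q : X₁ ⟶ X₂} {p : Y₁ ⟶ Y₂} {q' : X₂ ⟶ X₃} {p' : Y₂ ⟶ Y₃}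
    {hi₁ : P.mem i₁} {hi₂ : P.mem i₂} {hi₃ : P.mem i₃} {hq : Q.mem q} {hp : Q.mem p}
    {hq' : Q.mem q'} {hp' : Q.mem p'}
    {φ : H.map q hq ≫ F.map i₂ hi₂ ⟶ F.map i₁ hi₁ ≫ H.map p hp}
    {ψ : H.map q' hq' ≫ F.map i₃ hi₃ ⟶ F.map i₂ hi₂ ≫ H.map p' hp'}
    {φ' : H'.map q hq ≫ F'.map i₂ hi₂ ⟶ F'.map i₁ hi₁ ≫ H'.map p hp}
    {ψ' : H'.map q' hq' ≫ F'.map i₃ hi₃ ⟶ F'.map i₂ hi₂ ≫ H'.map p' hp'}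
    (h : Cyl (hpaste (u.sq q hq) (t.sq i₂ hi₂)) (hpaste (t.sq i₁ hi₁) (u.sq p hp)) φ' φ)
    (h' : Cyl (hpaste (u.sq q' hq') (t.sq i₃ hi₃)) (hpaste (t.sq i₂ hi₂) (u.sq p' hp')) ψ' ψ) :
    Cyl (hpaste (u.sq (q ≫ q') (Q.comp_mem hq hq')) (t.sq i₃ hi₃))
      (hpaste (t.sq i₁ hi₁) (u.sq (p ≫ p') (Q.comp_mem hp hp'))) (TwoGlue.vCell F' H' φ' ψ')
      (TwoGlue.vCell F H φ ψ) := by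
  refine ((((((u.cyl_mapComp q q' hq hq').whiskerRight (t.sq i₃ hi₃)).comp
    (associator _ _ _)).comp (h'.whiskerLeft _)).comp (associator_inv _ _ _)).comp
    (h.whiskerRight _)).comp ((associator _ _ _).comp
      ((u.cyl_mapComp_inv p p' hp hp').whiskerLeft (t.sq i₁ hi₁))) |>.of_eq ?_ ?_ <;>
  simp [vpaste, TwoGlue.vCell]

lemma adCell {X Y Z W : C} {j j' : X ⟶ Y} {q q' : X ⟶ Z}
    {p p' : Y ⟶ W} {i i' : Z ⟶ W} {hj : P.mem j} {hq : Q.mem q} {hp : Q.mem p} {hi : P.mem i}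
    (hj' : P.mem j') (hq' : Q.mem q') (hp' : Q.mem p') (hi' : P.mem i')
    (κ : q' ⟶ q) (ι : i' ⟶ i) {φ : H.map q hq ≫ F.map i hi ⟶ F.map j hj ≫ H.map p hp}
    {φ' : H'.map q hq ≫ F'.map i hi ⟶ F'.map j hj ≫ H'.map p hp} (ζ : j ⟶ j') (ξ : p ⟶ p')
    (h : Cyl (hpaste (u.sq q hq) (t.sq i hi)) (hpaste (t.sq j hj) (u.sq p hp)) φ' φ) :
    Cyl (hpaste (u.sq q' hq') (t.sq i' hi')) (hpaste (t.sq j' hj') (u.sq p' hp'))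
      (TwoGlue.adCell F' H' hj' hq' hp' hi' κ ι φ' ζ ξ) (TwoGlue.adCell F H hj' hq' hp' hi' κ ι φ ζ ξ) :=
  ((u.cyl_map₂ hq' hq κ).whiskerRight _).comp <| ((t.cyl_map₂ hi' hi ι).whiskerLeft _).comp <|
    h.comp <| ((t.cyl_map₂ hj hj' ζ).whiskerRight _).comp ((u.cyl_map₂ hp hp' ξ).whiskerLeft _)

/-- Squares whose vertical edges are identities. -/
lemma ax_a (G : Gluing F H) (G' : Gluing F' H') {X Y : C} {i j : X ⟶ Y} (hi : P.mem i)
    (hj : P.mem j) (η : i ⟶ j) :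
    Cyl (hpaste (u.sq (𝟙 X) (Q.id_mem X)) (t.sq i hi)) (hpaste (t.sq j hj) (u.sq _ (Q.id_mem Y)))
      (G'.iso hj (Q.id_mem X) (Q.id_mem Y) hi ((λ_ i).hom ≫ η ≫ (ρ_ j).inv)).hom
      (G.iso hj (Q.id_mem X) (Q.id_mem Y) hi ((λ_ i).hom ≫ η ≫ (ρ_ j).inv)).hom := by
  rw [G.ax_a hi hj, G'.ax_a hi hj]
  exact ((u.cyl_mapId X).whiskerRight _).comp <| (leftUnitor _).comp <|
    (t.cyl_map₂ hi hj η).comp <| (rightUnitor_inv _).comp <| (u.cyl_mapId_inv Y).whiskerLeft _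

/-- Squares whose horizontal edges are identities. -/
lemma ax_a' (G : Gluing F H) (G' : Gluing F' H') {X Y : C} {q p : X ⟶ Y} (hq : Q.mem q)
    (hp : Q.mem p) (η : q ⟶ p) :
    Cyl (hpaste (u.sq q hq) (t.sq _ (P.id_mem Y))) (hpaste (t.sq _ (P.id_mem X)) (u.sq p hp))
      (G'.iso (P.id_mem X) hq hp (P.id_mem Y) ((ρ_ q).hom ≫ η ≫ (λ_ p).inv)).hom
      (G.iso (P.id_mem X) hq hp (P.id_mem Y) ((ρ_ q).hom ≫ η ≫ (λ_ p).inv)).hom := by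
  rw [G.ax_a' hq hp, G'.ax_a' hq hp]
  exact ((t.cyl_mapId Y).whiskerLeft _).comp <| (rightUnitor _).comp <|
    (u.cyl_map₂ hq hp η).comp <| (leftUnitor_inv _).comp <| (t.cyl_mapId_inv X).whiskerRight _

end Cyl

end Closure

section Flip

variable {C : Type u} [Bicategory.{w, v} C] [IsLocallyGroupoid C] {D : Type u'}
  [Bicategory.{w', v'} D] {P Q : WideSub C} {F₀ : C → D} {F : PsFun P F₀} {H : PsFun Q F₀}

lemma inv_vpaste {X₁ X₂ X₃ Y₁ Y₂ Y₃ : C} {i₁ : X₁ ⟶ Y₁} {i₂ : X₂ ⟶ Y₂} {i₃ : X₃ ⟶ Y₃}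
    {q : X₁ ⟶ X₂} {p : Y₁ ⟶ Y₂} {q' : X₂ ⟶ X₃} {p' : Y₂ ⟶ Y₃}
    (α : q ≫ i₂ ⟶ i₁ ≫ p) (α' : q' ≫ i₃ ⟶ i₂ ≫ p') :
    inv (vpaste α α') = hpaste (inv α) (inv α') := by
  simp [hpaste, vpaste]

lemma inv_hpaste {X₁ X₂ X₃ Y₁ Y₂ Y₃ : C} {p₁ : X₁ ⟶ Y₁} {p₂ : X₂ ⟶ Y₂} {p₃ : X₃ ⟶ Y₃}
    {j : X₁ ⟶ X₂} {i : Y₁ ⟶ Y₂} {j' : X₂ ⟶ X₃} {i' : Y₂ ⟶ Y₃}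
    (α : p₁ ≫ i ⟶ j ≫ p₂) (α' : p₂ ≫ i' ⟶ j' ≫ p₃) :
    inv (hpaste α α') = vpaste (inv α) (inv α') := by
  simp [hpaste, vpaste]

/-- The gluing datum with the two directions exchanged. -/
noncomputable def Gluing.flip (G : Gluing F H) : Gluing H F where
  iso hj hq hp hi α := (G.iso hq hj hi hp (inv α)).symm
  ax_a {X Y i j} hi hj α := by
    have e : inv ((λ_ i).hom ≫ α ≫ (ρ_ j).inv) = (ρ_ j).hom ≫ inv α ≫ (λ_ i).inv := by simp
    have h : G.iso (P.id_mem X) hj hi (P.id_mem Y) ((ρ_ j).hom ≫ inv α ≫ (λ_ i).inv) =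
        whiskerLeftIso _ (F.mapId Y) ≪≫ ρ_ _ ≪≫ (H.map₂Iso hi hj α).symm ≪≫ (λ_ _).symm ≪≫
          whiskerRightIso (F.mapId X).symm _ := Iso.ext (G.ax_a' hj hi (inv α))
    rw [e, h]
    simp [PsFun.map₂Iso]
  ax_a' {X Y q p} hq hp α := by
    have e : inv ((ρ_ q).hom ≫ α ≫ (λ_ p).inv) = (λ_ p).hom ≫ inv α ≫ (ρ_ q).inv := by simp
    have h : G.iso hq (Q.id_mem X) (Q.id_mem Y) hp ((λ_ p).hom ≫ inv α ≫ (ρ_ q).inv) =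
        whiskerRightIso (H.mapId X) _ ≪≫ λ_ _ ≪≫ (F.map₂Iso hq hp α).symm ≪≫ (ρ_ _).symm ≪≫
          whiskerLeftIso _ (H.mapId Y).symm := Iso.ext (G.ax_a hp hq (inv α))
    rw [e, h]
    simp [PsFun.map₂Iso]
  ax_b {X₁ X₂ X₃ Y₁ Y₂ Y₃ i₁ i₂ i₃ q p q' p'} h₁ h₂ h₃ hq hp hq' hp' α α' := by
    have h : G.iso (P.comp_mem hq hq') h₁ h₃ (P.comp_mem hp hp') (hpaste (inv α) (inv α')) =
        whiskerLeftIso _ (F.mapComp p p' hp hp') ≪≫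
          (vpasteIso (G.iso hq h₁ h₂ hp (inv α)).symm (G.iso hq' h₂ h₃ hp' (inv α')).symm).symm ≪≫
          whiskerRightIso (F.mapComp q q' hq hq').symm _ :=
      Iso.ext (G.ax_b' h₁ h₂ h₃ hq hp hq' hp' (inv α) (inv α'))
    rw [inv_vpaste, h]
    simp
  ax_b' {X₁ X₂ X₃ Y₁ Y₂ Y₃ p₁ p₂ p₃ j i j' i'} h₁ h₂ h₃ hj hi hj' hi' α α' := by
    have h : G.iso h₁ (Q.comp_mem hj hj') (Q.comp_mem hi hi') h₃ (vpaste (inv α) (inv α')) =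
        whiskerRightIso (H.mapComp j j' hj hj') _ ≪≫
          (hpasteIso (G.iso h₁ hj hi h₂ (inv α)).symm (G.iso h₂ hj' hi' h₃ (inv α')).symm).symm ≪≫
          whiskerLeftIso _ (H.mapComp i i' hi hi').symm := by
      refine Iso.ext ((G.ax_b h₁ h₂ h₃ hj hi hj' hi' (inv α) (inv α')).trans ?_)
      simp [hpasteIso, vpaste]
    rw [inv_hpaste, h]
    simp [hpaste]

lemma Gluing.flip_iso (G : Gluing F H) {X Y Z W : C} {j : X ⟶ Y} {q : X ⟶ Z} {p : Y ⟶ W}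
    {i : Z ⟶ W} (hj : Q.mem j) (hq : P.mem q) (hp : P.mem p) (hi : Q.mem i) (α : q ≫ i ⟶ j ≫ p) :
    G.flip.iso hj hq hp hi α = (G.iso hq hj hi hp (inv α)).symm := rfl

namespace Gluing

variable (G : Gluing F H) {X Y Z W : C} {j j' : X ⟶ Y} {q q' : X ⟶ Z} {p p' : Y ⟶ W}
  {i i' : Z ⟶ W}

lemma iso_vertical_left (hj : P.mem j) (hq : Q.mem q) (hq' : Q.mem q') (hp : Q.mem p)
    (hi : P.mem i) (κ : q' ⟶ q) (α : q ≫ i ⟶ j ≫ p) :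
    (G.iso hj hq' hp hi (κ ▷ i ≫ α)).hom =
      H.map₂ hq' hq κ ▷ F.map i hi ≫ (G.iso hj hq hp hi α).hom := by
  have h := G.flip.iso_whiskerRight hq hq' hj hi hp (inv α) (inv κ)
  simp only [flip_iso, Iso.symm_hom] at h
  have e : inv (inv α ≫ inv κ ▷ i) = κ ▷ i ≫ α := by simp
  rw [e, IsIso.inv_inv] at h
  have e' : H.map₂ hq' hq κ = (H.map₂Iso hq' hq κ).hom := rfl
  have e'' : H.map₂ hq hq' (inv κ) = (H.map₂Iso hq' hq κ).inv := rfl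
  rw [e'']  at h
  rw [e', ← cancel_mono (G.iso hj hq' hp hi (κ ▷ i ≫ α)).inv, Iso.hom_inv_id, h]
  simp

lemma iso_vertical_right (hj : P.mem j) (hq : Q.mem q) (hp : Q.mem p) (hp' : Q.mem p')
    (hi : P.mem i) (α : q ≫ i ⟶ j ≫ p) (ξ : p ⟶ p') :
    (G.iso hj hq hp' hi (α ≫ j ◁ ξ)).hom =
      (G.iso hj hq hp hi α).hom ≫ F.map j hj ◁ H.map₂ hp hp' ξ := by
  have h := G.flip.iso_whiskerLeft hq hj hi hp hp' (inv ξ) (inv α)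
  simp only [flip_iso, Iso.symm_hom] at h
  have e : inv (j ◁ inv ξ ≫ inv α) = α ≫ j ◁ ξ := by simp
  rw [e, IsIso.inv_inv] at h
  have e' : H.map₂ hp hp' ξ = (H.map₂Iso hp hp' ξ).hom := rfl
  have e'' : H.map₂ hp' hp (inv ξ) = (H.map₂Iso hp hp' ξ).inv := rfl
  rw [e'] ; rw [e''] at h
  rw [← cancel_mono (G.iso hj hq hp' hi (α ≫ j ◁ ξ)).inv, Iso.hom_inv_id, h]
  simp

/-- A gluing datum is compatible with changes of the edges of squares. -/
lemma iso_adCell (hj : P.mem j) (hq : Q.mem q) (hp : Q.mem p) (hi : P.mem i) (hj' : P.mem j')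
    (hq' : Q.mem q') (hp' : Q.mem p') (hi' : P.mem i')
    (κ : q' ⟶ q) (ι : i' ⟶ i) (α : q ≫ i ⟶ j ≫ p) (ζ : j ⟶ j') (ξ : p ⟶ p') :
    (G.iso hj' hq' hp' hi' (κ ▷ i' ≫ q ◁ ι ≫ α ≫ ζ ▷ p ≫ j' ◁ ξ)).hom =
      adCell F H hj' hq' hp' hi' κ ι (G.iso hj hq hp hi α).hom ζ ξ := by
  rw [G.iso_vertical_left hj' hq hq' hp' hi', G.iso_whiskerLeft hj' hq hp' hi hi',
    ← Category.assoc α, G.iso_vertical_right hj' hq hp hp' hi, G.iso_whiskerRight hj hj' hq hp hi]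
  simp [adCell]

end Gluing

end Flip

section Roof

variable {C : Type u} [Bicategory.{w, v} C]

/-- Any 2-cell between composites of a 1-cell of `P` and a 1-cell of `Q` is obtained by means of a
common refinement of the two factorizations. -/
def Roofed (P Q : WideSub C) : Prop :=
  ∀ {X Y Z Z' : C} (a : X ⟶ Z) (p : Z ⟶ Y) (a' : X ⟶ Z') (p' : Z' ⟶ Y), P.mem a → Q.mem p →
    P.mem a' → Q.mem p' → ∀ θ : a ≫ p ⟶ a' ≫ p', ∃ (V : C) (b : X ⟶ V) (s : V ⟶ Z) (s' : V ⟶ Z')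
      (σ : a ⟶ b ≫ s) (σ' : a' ⟶ b ≫ s') (τ : s ≫ p ⟶ s' ≫ p'), P.mem b ∧ Q.mem s ∧ Q.mem s' ∧
        σ ▷ p ≫ (α_ b s p).hom ≫ b ◁ τ = θ ≫ σ' ▷ p' ≫ (α_ b s' p').hom

lemma Roofed.of_factors [IsLocallyGroupoid C] {P Q B : WideSub C} (hP : P ≤ B)
    (hfac : Factors P Q B) (hfib : HasFiberProductsAgreeing Q B) : Roofed P Q := by
  intro X Y Z Z' a p a' p' ha hp ha' hp' θ
  obtain ⟨W, j, q, κ, hκ⟩ := hfib.1 p' p hp' hp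
  obtain ⟨h, γ, δ, hh, e⟩ := (hfib.2 κ hκ).essSurj (hP _ ha') (hP _ ha) θ
  obtain ⟨V, b, r, hb, hr, ⟨ν⟩⟩ := hfac h hh
  refine ⟨V, b, r ≫ q, r ≫ j, inv γ ≫ ν.hom ▷ q ≫ (α_ b r q).hom,
    inv δ ≫ ν.hom ▷ j ≫ (α_ b r j).hom, (α_ r q p).hom ≫ r ◁ κ ≫ (α_ r j p').inv, hb,
    Q.comp_mem hr hκ.mem_left, Q.comp_mem hr hκ.mem_top, ?_⟩
  rw [← cancel_epi (γ ▷ p), ← reassoc_of% e]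
  dsimp only [precompSquare]
  calc _ = (γ ≫ inv γ) ▷ p ≫ (𝟙 _ ⊗≫ (ν.hom ▷ (q ≫ p) ≫ (b ≫ r) ◁ κ) ⊗≫ 𝟙 _) := by bicategory
    _ = 𝟙 _ ⊗≫ (h ◁ κ ≫ ν.hom ▷ (j ≫ p')) ⊗≫ 𝟙 _ := by
      rw [← whisker_exchange, IsIso.hom_inv_id, id_whiskerRight, Category.id_comp]
    _ = (α_ h q p).hom ≫ h ◁ κ ≫ (α_ h j p').inv ≫ (δ ≫ inv δ) ▷ p' ≫
          (ν.hom ▷ j) ▷ p' ≫ (α_ b r j).hom ▷ p' ≫ (α_ b (r ≫ j) p').hom := by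
      rw [IsIso.hom_inv_id]; bicategory
    _ = _ := by simp

end Roof

section Extension

variable {C : Type u} [Bicategory.{w, v} C] {D : Type u'} [Bicategory.{w', v'} D]
  {P Q B : WideSub C} {F₀ F₀' : C → D} {F : PsFun B F₀} {F' : PsFun B F₀'}
  {α : ∀ X, F₀ X ⟶ F₀' X}

namespace PsFun

lemma map₂_map₂_assoc (F : PsFun B F₀) {X Y : C} {f g h : X ⟶ Y} (hf : B.mem f) (hg : B.mem g)
    (hh : B.mem h) (η : f ⟶ g) (θ : g ⟶ h) {k : F₀ X ⟶ F₀ Y} (φ : F.map h hh ⟶ k) :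
    F.map₂ hf hg η ≫ F.map₂ hg hh θ ≫ φ = F.map₂ hf hh (η ≫ θ) ≫ φ := by
  rw [F.map₂_comp hf hg hh, Category.assoc]

/-- The image of a 2-cell between composites of two 1-cells. -/
abbrev mapSq (F : PsFun B F₀) {X Y Z W : C} {j : X ⟶ Y} {q : X ⟶ Z} {p : Y ⟶ W} {i : Z ⟶ W}
    (hj : B.mem j) (hq : B.mem q) (hp : B.mem p) (hi : B.mem i) (β : q ≫ i ⟶ j ≫ p) :
    F.map q hq ≫ F.map i hi ⟶ F.map j hj ≫ F.map p hp :=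
  (F.mapComp q i hq hi).inv ≫ F.map₂ (B.comp_mem hq hi) (B.comp_mem hj hp) β ≫
    (F.mapComp j p hj hp).hom

lemma selfGluing_iso_hom [IsLocallyGroupoid C] (F : PsFun B F₀) {X Y Z W : C} {j : X ⟶ Y}
    {q : X ⟶ Z} {p : Y ⟶ W} {i : Z ⟶ W} (hj : B.mem j) (hq : B.mem q) (hp : B.mem p)
    (hi : B.mem i) (β : q ≫ i ⟶ j ≫ p) :
    (F.selfGluing.iso hj hq hp hi β).hom = F.mapSq hj hq hp hi β := rfl

/-- The image of a 2-cell from a 1-cell to a composite. -/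
noncomputable abbrev mapTri [IsLocallyGroupoid C] (F : PsFun B F₀) {X Y Z : C} {a : X ⟶ Z} {b : X ⟶ Y}
    {s : Y ⟶ Z} (ha : B.mem a) (hb : B.mem b) (hs : B.mem s) (σ : a ⟶ b ≫ s) :
    F.map a ha ≅ F.map b hb ≫ F.map s hs :=
  F.map₂Iso ha (B.comp_mem hb hs) σ ≪≫ F.mapComp b s hb hs

end PsFun

variable [IsLocallyGroupoid C] {hP : P ≤ B} {hQ : Q ≤ B}
  (t₁ : PsTrans (F.restrict hP) (F'.restrict hP) α)
  (t₂ : PsTrans (F.restrict hQ) (F'.restrict hQ) α)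
  (compat : ∀ {X Y Z W : C} {j : X ⟶ Y} {q : X ⟶ Z} {p : Y ⟶ W} {i : Z ⟶ W} (hj : P.mem j)
    (hq : Q.mem q) (hp : Q.mem p) (hi : P.mem i) (β : q ≫ i ⟶ j ≫ p),
    Cyl (hpaste (t₂.sq q hq) (t₁.sq i hi)) (hpaste (t₁.sq j hj) (t₂.sq p hp))
      (F'.mapSq (hP _ hj) (hQ _ hq) (hQ _ hp) (hP _ hi) β)
      (F.mapSq (hP _ hj) (hQ _ hq) (hQ _ hp) (hP _ hi) β))

include compat

lemma cyl_mapTri {X Y Z : C} {a : X ⟶ Z} {b : X ⟶ Y} {s : Y ⟶ Z} (ha : P.mem a) (hb : P.mem b)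
    (hs : Q.mem s) (σ : a ⟶ b ≫ s) :
    Cyl (t₁.sq a ha) (hpaste (t₁.sq b hb) (t₂.sq s hs))
      (F'.mapTri (hP _ ha) (hP _ hb) (hQ _ hs) σ).hom
      (F.mapTri (hP _ ha) (hP _ hb) (hQ _ hs) σ).hom := by
  refine (((Cyl.leftUnitor_inv _).comp ((t₂.cyl_mapId_inv X).whiskerRight _)).comp
    (compat hb (Q.id_mem X) hs ha ((λ_ a).hom ≫ σ))).of_eq ?_ ?_
  · rw [PsFun.mapSq, F'.map₂_comp _ (hP _ ha), F'.map₂_leftUnitor]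
    simp [PsFun.map₂Iso]
  · rw [PsFun.mapSq, F.map₂_comp _ (hP _ ha), F.map₂_leftUnitor]
    simp [PsFun.map₂Iso]

omit t₁ t₂ compat in
lemma PsFun.mapSq_roof (F : PsFun B F₀) {X Y Z Z' V : C} {a : X ⟶ Z} {p : Z ⟶ Y} {a' : X ⟶ Z'}
    {p' : Z' ⟶ Y} (ha : B.mem a) (hp : B.mem p) (ha' : B.mem a') (hp' : B.mem p')
    {θ : a ≫ p ⟶ a' ≫ p'} {b : X ⟶ V} {s : V ⟶ Z} {s' : V ⟶ Z'} {σ : a ⟶ b ≫ s}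
    {σ' : a' ⟶ b ≫ s'} {τ : s ≫ p ⟶ s' ≫ p'} (hb : B.mem b) (hs : B.mem s) (hs' : B.mem s')
    (e : σ ▷ p ≫ (α_ b s p).hom ≫ b ◁ τ = θ ≫ σ' ▷ p' ≫ (α_ b s' p').hom) :
    F.mapSq ha' ha hp' hp θ = (F.mapTri ha hb hs σ).hom ▷ F.map p hp ≫ (α_ _ _ _).hom ≫
      F.map b hb ◁ F.mapSq hs' hs hp' hp τ ≫ (α_ _ _ _).inv ≫
        (F.mapTri ha' hb hs' σ').inv ▷ F.map p' hp' := by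
  have e' : θ = σ ▷ p ≫ (α_ b s p).hom ≫ b ◁ τ ≫ (α_ b s' p').inv ≫ inv σ' ▷ p' := by
    rw [reassoc_of% e]; simp
  subst e'
  have m₁ := B.comp_mem (B.comp_mem hb hs) hp
  have m₂ := B.comp_mem hb (B.comp_mem hs hp)
  have m₃ := B.comp_mem hb (B.comp_mem hs' hp')
  have m₄ := B.comp_mem (B.comp_mem hb hs') hp'
  rw [PsFun.mapSq, F.map₂_comp _ m₁, F.map₂_comp _ m₂, F.map₂_comp _ m₃, F.map₂_comp _ m₄,
    F.map₂_whiskerRight ha (B.comp_mem hb hs) σ p hp,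
    F.map₂_whiskerRight (B.comp_mem hb hs') ha' (inv σ') p' hp',
    F.map₂_whiskerLeft b hb (B.comp_mem hs hp) (B.comp_mem hs' hp'),
    F.map₂_associator b s p hb hs hp, F.map₂_associator_inv b s' p' hb hs' hp']
  simp [PsFun.map₂Iso]

lemma cyl_mapSq (hroof : Roofed P Q) {X Y Z Z' : C} {a : X ⟶ Z} {p : Z ⟶ Y} {a' : X ⟶ Z'}
    {p' : Z' ⟶ Y} (ha : P.mem a) (hp : Q.mem p) (ha' : P.mem a') (hp' : Q.mem p')
    (θ : a ≫ p ⟶ a' ≫ p') :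
    Cyl (hpaste (t₁.sq a ha) (t₂.sq p hp)) (hpaste (t₁.sq a' ha') (t₂.sq p' hp'))
      (F'.mapSq (hP _ ha') (hP _ ha) (hQ _ hp') (hQ _ hp) θ)
      (F.mapSq (hP _ ha') (hP _ ha) (hQ _ hp') (hQ _ hp) θ) := by
  obtain ⟨V, b, s, s', σ, σ', τ, hb, hs, hs', e⟩ := hroof a p a' p' ha hp ha' hp' θ
  refine (((cyl_mapTri t₁ t₂ compat ha hb hs σ).whiskerRight (t₂.sq p hp)).comp <|
    (Cyl.associator _ _ _).comp <| (Cyl.whiskerLeft _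
      (((t₂.cyl_mapComp_inv s p hs hp).comp (t₂.cyl_map₂ (Q.comp_mem hs hp)
        (Q.comp_mem hs' hp') τ)).comp (t₂.cyl_mapComp s' p' hs' hp'))).comp <|
    (Cyl.associator_inv _ _ _).comp <|
      (cyl_mapTri t₁ t₂ compat ha' hb hs' σ').symm.whiskerRight (t₂.sq p' hp')).of_eq ?_ ?_
  · rw [F'.mapSq_roof _ _ _ _ (hP _ hb) (hQ _ hs) (hQ _ hs') e]
    simp
  · rw [F.mapSq_roof _ _ _ _ (hP _ hb) (hQ _ hs) (hQ _ hs') e]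
    simp

lemma exists_sq (hroof : Roofed P Q) (hfac : Factors P Q B) {X Y : C} (f : X ⟶ Y)
    (hf : B.mem f) : ∃ c : α X ≫ F'.map f hf ≅ F.map f hf ≫ α Y,
    ∀ {Z : C} (a : X ⟶ Z) (p : Z ⟶ Y) (ha : P.mem a) (hp : Q.mem p) (ν : f ⟶ a ≫ p),
      Cyl c.hom (hpaste (t₁.sq a ha) (t₂.sq p hp)) (F'.mapTri hf (hP _ ha) (hQ _ hp) ν).hom
        (F.mapTri hf (hP _ ha) (hQ _ hp) ν).hom := by
  obtain ⟨Z, a, p, ha, hp, ⟨ν⟩⟩ := hfac f hf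
  let c : α X ≫ F'.map f hf ≅ F.map f hf ≫ α Y :=
    whiskerLeftIso _ (F'.mapTri hf (hP _ ha) (hQ _ hp) ν.hom) ≪≫
      (vpasteIso (t₁.nat a ha) (t₂.nat p hp)).symm ≪≫
        whiskerRightIso (F.mapTri hf (hP _ ha) (hQ _ hp) ν.hom).symm _
  have hc : Cyl c.hom (hpaste (t₁.sq a ha) (t₂.sq p hp))
      (F'.mapTri hf (hP _ ha) (hQ _ hp) ν.hom).hom
      (F.mapTri hf (hP _ ha) (hQ _ hp) ν.hom).hom := by
    simp only [Cyl, c, Iso.trans_hom, whiskerRightIso_hom, Category.assoc, ← comp_whiskerRight,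
      Iso.symm_hom, vpasteIso_inv, whiskerLeftIso_hom]
    simp
  refine ⟨c, fun a' p' ha' hp' ν' => (hc.comp (cyl_mapSq t₁ t₂ compat hroof ha hp ha' hp'
    (ν.inv ≫ ν'))).of_eq ?_ ?_⟩
  · simp [PsFun.map₂Iso, PsFun.mapSq, F'.map₂_map₂_assoc]
  · simp [PsFun.map₂Iso, PsFun.mapSq, F.map₂_map₂_assoc]

omit t₁ t₂ compat in
/-- The factorization of a composite deduced from factorizations of its factors. -/
abbrev compRefinement {X Y Z U V W : C} {f : X ⟶ Y} {g : Y ⟶ Z} {a : X ⟶ U} {p : U ⟶ Y}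
    {b : Y ⟶ V} {q : V ⟶ Z} {d : U ⟶ W} {r : W ⟶ V} (ν : f ≅ a ≫ p) (μ : g ≅ b ≫ q)
    (κ : p ≫ b ≅ d ≫ r) : f ≫ g ⟶ (a ≫ d) ≫ r ≫ q :=
  ν.hom ▷ g ≫ (α_ a p g).hom ≫ a ◁ p ◁ μ.hom ≫ a ◁ (α_ p b q).inv ≫
    a ◁ κ.hom ▷ q ≫ a ◁ (α_ d r q).hom ≫ (α_ a d (r ≫ q)).inv

omit t₁ t₂ compat in
lemma PsFun.mapComp_eq_compRefinement (F : PsFun B F₀) {X Y Z U V W : C} {f : X ⟶ Y} {g : Y ⟶ Z}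
    {a : X ⟶ U} {p : U ⟶ Y} {b : Y ⟶ V} {q : V ⟶ Z} {d : U ⟶ W} {r : W ⟶ V}
    (hf : B.mem f) (hg : B.mem g) (ha : B.mem a) (hp : B.mem p) (hb : B.mem b) (hq : B.mem q)
    (hd : B.mem d) (hr : B.mem r) (ν : f ≅ a ≫ p) (μ : g ≅ b ≫ q) (κ : p ≫ b ≅ d ≫ r) :
    (F.mapComp f g hf hg).hom =
      (F.mapTri (B.comp_mem hf hg) (B.comp_mem ha hd) (B.comp_mem hr hq)
        (compRefinement ν μ κ)).hom ≫ (F.mapComp a d ha hd).hom ▷ F.map (r ≫ q) _ ≫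
      (F.map a ha ≫ F.map d hd) ◁ (F.mapComp r q hr hq).hom ≫ (α_ _ _ _).hom ≫
      F.map a ha ◁ (α_ _ _ _).inv ≫
      F.map a ha ◁ (F.selfGluing.iso hd hp hr hb κ.hom).inv ▷ F.map q hq ≫
      F.map a ha ◁ (α_ _ _ _).hom ≫ (α_ _ _ _).inv ≫
      (F.map a ha ≫ F.map p hp) ◁ (F.mapTri hg hb hq μ.hom).inv ≫
      (F.mapTri hf ha hp ν.hom).inv ▷ F.map g hg := by
  have hap := B.comp_mem ha hp
  have hbq := B.comp_mem hb hq
  have hdr := B.comp_mem hd hr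
  have hpb := B.comp_mem hp hb
  have e : (F.map₂Iso (B.comp_mem hf hg) (B.comp_mem (B.comp_mem ha hd) (B.comp_mem hr hq))
    (compRefinement ν μ κ)).hom = F.map₂ _ _ (compRefinement ν μ κ) := rfl
  rw [Iso.trans_hom, e, compRefinement]
  rw [F.map₂_comp _ (B.comp_mem hap hg), F.map₂_comp _ (B.comp_mem ha (B.comp_mem hp hg)),
    F.map₂_comp _ (B.comp_mem ha (B.comp_mem hp hbq)),
    F.map₂_comp _ (B.comp_mem ha (B.comp_mem hpb hq)),
    F.map₂_comp _ (B.comp_mem ha (B.comp_mem hdr hq)),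
    F.map₂_comp _ (B.comp_mem ha (B.comp_mem hd (B.comp_mem hr hq))),
    F.map₂_whiskerRight hf hap ν.hom g hg, F.map₂_associator a p _ ha hp hg,
    F.map₂_whiskerLeft a ha (B.comp_mem hp hg) (B.comp_mem hp hbq),
    F.map₂_whiskerLeft p hp hg hbq,
    F.map₂_whiskerLeft a ha (B.comp_mem hp hbq) (B.comp_mem hpb hq), F.map₂_associator_inv p b q hp hb hq,
    F.map₂_whiskerLeft a ha (B.comp_mem hpb hq) (B.comp_mem hdr hq),
    F.map₂_whiskerRight hpb hdr κ.hom q hq,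
    F.map₂_whiskerLeft a ha (B.comp_mem hdr hq) (B.comp_mem hd (B.comp_mem hr hq)),
    F.map₂_associator d r q hd hr hq, F.map₂_associator_inv a d _ ha hd (B.comp_mem hr hq)]
  have e₁ : F.map₂ hpb hdr κ.hom = (F.map₂Iso hpb hdr κ.hom).hom := rfl
  have e₂ : F.map₂ hg hbq μ.hom = (F.map₂Iso hg hbq μ.hom).hom := rfl
  have e₃ : F.map₂ hf hap ν.hom = (F.map₂Iso hf hap ν.hom).hom := rfl
  rw [e₁, e₂, e₃]
  simp [selfGluing]

/-- Pseudonatural transformations on `P` and on `Q` that are compatible on squares extend to a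
pseudonatural transformation on `B`. -/
theorem PsTrans.exists_extension (hroof : Roofed P Q) (hfac : Factors P Q B) :
    ∃ t : PsTrans F F' α, t.restrict hP = t₁ ∧ t.restrict hQ = t₂ := by
  choose c hc using fun (X Y : C) (f : X ⟶ Y) (hf : B.mem f) =>
    exists_sq t₁ t₂ compat hroof hfac f hf
  have hc' : ∀ {X Y : C} {f g : X ⟶ Y} (hf : B.mem f) (hg : B.mem g) (η : f ⟶ g),
      Cyl (c X Y f hf).hom (c X Y g hg).hom (F'.map₂ hf hg η) (F.map₂ hf hg η) := by
    intro X Y f g hf hg η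
    obtain ⟨Z, a, p, ha, hp, ⟨ν⟩⟩ := hfac g hg
    refine ((hc _ _ f hf a p ha hp (η ≫ ν.hom)).comp (hc _ _ g hg a p ha hp ν.hom).symm).of_eq ?_ ?_
    · simp [PsFun.map₂Iso, PsFun.map₂_map₂_assoc, ← PsFun.map₂_comp]
    · simp [PsFun.map₂Iso, PsFun.map₂_map₂_assoc, ← PsFun.map₂_comp]
  refine ⟨PsTrans.ofSq (fun f hf => c _ _ f hf) hc' (fun X => ?_)
    (fun {X Y Z} f g hf hg => ?_), ?_, ?_⟩
  · refine ((hc _ _ _ (B.id_mem X) (𝟙 X) (𝟙 X) (P.id_mem X) (Q.id_mem X) (λ_ (𝟙 X)).inv).comp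
      (((t₁.cyl_mapId X).whiskerRight _).comp (((t₂.cyl_mapId X).whiskerLeft _).comp
        (Cyl.leftUnitor _)))).of_eq ?_ ?_
    · simp [PsFun.map₂Iso, F'.map₂_leftUnitor_inv, -unitors_inv_equal]
      simp
    · simp [PsFun.map₂Iso, F.map₂_leftUnitor_inv, -unitors_inv_equal]
      simp
  · obtain ⟨U, a, p, ha, hp, ⟨ν⟩⟩ := hfac f hf
    obtain ⟨V, b, q, hb, hq, ⟨μ⟩⟩ := hfac g hg
    obtain ⟨W, d, r, hd, hr, ⟨κ⟩⟩ := hfac (p ≫ b) (B.comp_mem (hQ _ hp) (hP _ hb))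
    have had := P.comp_mem ha hd
    have hrq := Q.comp_mem hr hq
    refine ((hc _ _ _ (B.comp_mem hf hg) _ _ had hrq (compRefinement ν μ κ)).comp <|
      ((t₁.cyl_mapComp a d ha hd).whiskerRight _).comp <|
      ((t₂.cyl_mapComp r q hr hq).whiskerLeft _).comp <| (Cyl.associator _ _ _).comp <|
      (Cyl.whiskerLeft _ ((Cyl.associator_inv _ _ _).comp <|
        ((Cyl.symm (η := F'.selfGluing.iso _ _ _ _ κ.hom) (η' := F.selfGluing.iso _ _ _ _ κ.hom)
          (compat hd hp hr hb κ.hom)).whiskerRight _).comp (Cyl.associator _ _ _))).comp <|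
      (Cyl.associator_inv _ _ _).comp <|
      ((hc _ _ g hg b q hb hq μ.hom).symm.whiskerLeft _).comp
        ((hc _ _ f hf a p ha hp ν.hom).symm.whiskerRight _)).of_eq ?_ ?_
    · simpa using F'.mapComp_eq_compRefinement hf hg (hP _ ha) (hQ _ hp) (hP _ hb) (hQ _ hq)
        (hP _ hd) (hQ _ hr) ν μ κ
    · simpa using F.mapComp_eq_compRefinement hf hg (hP _ ha) (hQ _ hp) (hP _ hb) (hQ _ hq)
        (hP _ hd) (hQ _ hr) ν μ κ
  · refine PsTrans.ext' fun {X Y} f hf => congrArg Iso.hom (Iso.ext_inv (Cyl.eq_left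
      (hc _ _ f (hP _ hf) f (𝟙 Y) hf (Q.id_mem Y) (ρ_ f).inv)
      (((Cyl.rightUnitor_inv _).comp ((t₂.cyl_mapId_inv Y).whiskerLeft _)).of_eq ?_ ?_)))
    · simp [PsFun.map₂Iso, F'.map₂_rightUnitor_inv]
    · simp [PsFun.map₂Iso, F.map₂_rightUnitor_inv]
  · refine PsTrans.ext' fun {X Y} f hf => congrArg Iso.hom (Iso.ext_inv (Cyl.eq_left
      (hc _ _ f (hQ _ hf) (𝟙 X) f (P.id_mem X) hf (λ_ f).inv)
      (((Cyl.leftUnitor_inv _).comp ((t₁.cyl_mapId_inv X).whiskerRight _)).of_eq ?_ ?_)))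
    · simp [PsFun.map₂Iso, F'.map₂_leftUnitor_inv]
    · simp [PsFun.map₂Iso, F.map₂_leftUnitor_inv]

end Extension

section Cartesian

variable {C : Type u} [Bicategory.{w, v} C]

lemma whiskerRight_precompSquare {T X Y Z W : C} {j : X ⟶ Y} {q : X ⟶ Z} {p : Y ⟶ W} {i : Z ⟶ W}
    {h h' : T ⟶ X} (ξ : h ⟶ h') (α : q ≫ i ⟶ j ≫ p) :
    (ξ ▷ q) ▷ i ≫ precompSquare h' α = precompSquare h α ≫ (ξ ▷ j) ▷ p := by
  dsimp only [precompSquare]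
  calc _ = 𝟙 _ ⊗≫ (ξ ▷ (q ≫ i) ≫ h' ◁ α) ⊗≫ 𝟙 _ := by bicategory
    _ = 𝟙 _ ⊗≫ (h ◁ α ≫ ξ ▷ (j ≫ p)) ⊗≫ 𝟙 _ := by rw [whisker_exchange]
    _ = _ := by bicategory

lemma hpaste_eq_precompSquare {X₁ X₂ X₃ Y₁ Y₂ Y₃ : C} {p₁ : X₁ ⟶ Y₁} {p₂ : X₂ ⟶ Y₂}
    {p₃ : X₃ ⟶ Y₃} {j : X₁ ⟶ X₂} {i : Y₁ ⟶ Y₂} {j' : X₂ ⟶ X₃} {i' : Y₂ ⟶ Y₃}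
    (α : p₁ ≫ i ⟶ j ≫ p₂) (α' : p₂ ≫ i' ⟶ j' ≫ p₃) :
    hpaste α α' = (α_ p₁ i i').inv ≫ α ▷ i' ≫ precompSquare j α' := by
  simp [hpaste, precompSquare]

lemma precompSquare_hpaste {T X₁ X₂ X₃ Y₁ Y₂ Y₃ : C} {p₁ : X₁ ⟶ Y₁} {p₂ : X₂ ⟶ Y₂}
    {p₃ : X₃ ⟶ Y₃} {j : X₁ ⟶ X₂} {i : Y₁ ⟶ Y₂} {j' : X₂ ⟶ X₃} {i' : Y₂ ⟶ Y₃} (h : T ⟶ X₁)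
    (α : p₁ ≫ i ⟶ j ≫ p₂) (α' : p₂ ≫ i' ⟶ j' ≫ p₃) :
    precompSquare h (hpaste α α') = (α_ (h ≫ p₁) i i').inv ≫ precompSquare h α ▷ i' ≫
      precompSquare (h ≫ j) α' ≫ (α_ h j j').hom ▷ p₃ := by
  dsimp only [hpaste, precompSquare]
  bicategory

instance {T X Y Z W : C} {j : X ⟶ Y} {q : X ⟶ Z} {p : Y ⟶ W} {i : Z ⟶ W}
    (h : T ⟶ X) (α : q ≫ i ⟶ j ≫ p) [IsIso α] : IsIso (precompSquare h α) := by
  unfold precompSquare; infer_instance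

lemma precompSquare_inv {T X Y Z W : C} {j : X ⟶ Y} {q : X ⟶ Z} {p : Y ⟶ W} {i : Z ⟶ W}
    (h : T ⟶ X) (α : q ≫ i ⟶ j ≫ p) [IsIso α] :
    precompSquare h (inv α) = inv (precompSquare h α) := by
  simp [precompSquare]

lemma IsTwoCartesian.mk' {X Y Z W : C} {j : X ⟶ Y} {q : X ⟶ Z} {p : Y ⟶ W} {i : Z ⟶ W}
    {α : q ≫ i ⟶ j ≫ p}
    (lift : ∀ {T : C} {u : T ⟶ Y} {v : T ⟶ Z} (θ : v ≫ i ⟶ u ≫ p),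
      ∃ (h : T ⟶ X) (γ : h ≫ q ⟶ v) (δ : h ≫ j ⟶ u), precompSquare h α ≫ δ ▷ p = γ ▷ i ≫ θ)
    (full : ∀ {T : C} {h h' : T ⟶ X} (φ : h ≫ q ⟶ h' ≫ q) (ψ : h ≫ j ⟶ h' ≫ j),
      φ ▷ i ≫ precompSquare h' α = precompSquare h α ≫ ψ ▷ p →
      ∃ ξ : h ⟶ h', ξ ▷ q = φ ∧ ξ ▷ j = ψ)
    (faithful : ∀ {T : C} {h h' : T ⟶ X} (ξ ξ' : h ⟶ h'), ξ ▷ q = ξ' ▷ q → ξ ▷ j = ξ' ▷ j →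
      ξ = ξ') : IsTwoCartesian α where
  mem_top := trivial
  mem_left := trivial
  mem_right := trivial
  mem_bot := trivial
  essSurj _ _ θ := by
    obtain ⟨h, γ, δ, e⟩ := lift θ
    exact ⟨h, γ, δ, trivial, e⟩
  fullyFaithful _ _ φ ψ e := by
    obtain ⟨ξ, h₁, h₂⟩ := full φ ψ e
    exact ⟨ξ, ⟨h₁, h₂⟩, fun ξ' h' => faithful _ _ (h'.1.trans h₁.symm) (h'.2.trans h₂.symm)⟩

namespace IsTwoCartesianIn

section

variable {X Y Z W : C} {j : X ⟶ Y} {q : X ⟶ Z} {p : Y ⟶ W} {i : Z ⟶ W} {α : q ≫ i ⟶ j ≫ p}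
  (hα : IsTwoCartesian α)
include hα

lemma lift {T : C} {u : T ⟶ Y} {v : T ⟶ Z} (θ : v ≫ i ⟶ u ≫ p) :
    ∃ (h : T ⟶ X) (γ : h ≫ q ⟶ v) (δ : h ≫ j ⟶ u), precompSquare h α ≫ δ ▷ p = γ ▷ i ≫ θ := by
  obtain ⟨h, γ, δ, -, e⟩ := hα.essSurj (u := u) (v := v) trivial trivial θ
  exact ⟨h, γ, δ, e⟩

lemma full {T : C} {h h' : T ⟶ X} (φ : h ≫ q ⟶ h' ≫ q) (ψ : h ≫ j ⟶ h' ≫ j)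
    (e : φ ▷ i ≫ precompSquare h' α = precompSquare h α ≫ ψ ▷ p) :
    ∃ ξ : h ⟶ h', ξ ▷ q = φ ∧ ξ ▷ j = ψ :=
  (hα.fullyFaithful trivial trivial φ ψ e).exists

lemma faithful {T : C} {h h' : T ⟶ X} (ξ ξ' : h ⟶ h') (e : ξ ▷ q = ξ' ▷ q)
    (e' : ξ ▷ j = ξ' ▷ j) : ξ = ξ' :=
  (hα.fullyFaithful trivial trivial _ _ (whiskerRight_precompSquare ξ α)).unique ⟨rfl, rfl⟩
    ⟨e.symm, e'.symm⟩

lemma flip [IsLocallyGroupoid C] : IsTwoCartesian (inv α) := by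
  refine .mk' (fun {T u v} θ => ?_) (fun {T h h'} φ ψ e => ?_)
    (fun ξ ξ' e e' => hα.faithful _ _ e' e)
  · obtain ⟨h, γ, δ, e⟩ := hα.lift (inv θ)
    refine ⟨h, δ, γ, ?_⟩
    rw [precompSquare_inv, IsIso.inv_comp_eq, ← Category.assoc, e]
    simp
  · obtain ⟨ξ, h₁, h₂⟩ := hα.full ψ φ (by
      rw [precompSquare_inv, precompSquare_inv, IsIso.eq_inv_comp] at e
      rw [← cancel_mono (inv (precompSquare h' α)), Category.assoc, Category.assoc, e]
      simp)
    exact ⟨ξ, h₂, h₁⟩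

lemma adjust_horizontal [IsLocallyGroupoid C] {j' : X ⟶ Y} {i' : Z ⟶ W} (ι : i' ⟶ i)
    (ζ : j ⟶ j') : IsTwoCartesian (q ◁ ι ≫ α ≫ ζ ▷ p) := by
  have key : ∀ {T : C} (h : T ⟶ X), precompSquare h (q ◁ ι ≫ α ≫ ζ ▷ p) =
      (h ≫ q) ◁ ι ≫ precompSquare h α ≫ (h ◁ ζ) ▷ p := by
    intro T h
    dsimp only [precompSquare]
    bicategory
  refine .mk' (fun {T u v} θ => ?_) (fun {T h h'} φ ψ e => ?_) (fun ω ω' e e' => ?_)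
  · obtain ⟨h, γ, δ, e⟩ := hα.lift (v ◁ inv ι ≫ θ)
    refine ⟨h, γ, h ◁ inv ζ ≫ δ, ?_⟩
    rw [key, comp_whiskerRight, Category.assoc, Category.assoc, ← comp_whiskerRight_assoc,
      ← whiskerLeft_comp, IsIso.hom_inv_id, whiskerLeft_id, id_whiskerRight, Category.id_comp, e,
      whisker_exchange_assoc, ← whiskerLeft_comp_assoc, IsIso.hom_inv_id, whiskerLeft_id,
      Category.id_comp]
  · obtain ⟨ω, h₁, h₂⟩ := hα.full φ (h ◁ ζ ≫ ψ ≫ h' ◁ inv ζ) (by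
      rw [key, key, ← whisker_exchange_assoc, Category.assoc, cancel_epi] at e
      rw [← cancel_mono ((h' ◁ ζ) ▷ p), Category.assoc, e, Category.assoc, Category.assoc,
        ← comp_whiskerRight, ← comp_whiskerRight]
      congr 2
      simp)
    refine ⟨ω, h₁, ?_⟩
    rw [← cancel_epi (h ◁ ζ), whisker_exchange, h₂]
    simp
  · refine hα.faithful _ _ e ?_
    rw [← cancel_mono (_ ◁ ζ), ← whisker_exchange, ← whisker_exchange, e']

lemma adjust [IsLocallyGroupoid C] {j' : X ⟶ Y} {q' : X ⟶ Z} {p' : Y ⟶ W} {i' : Z ⟶ W}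
    (κ : q' ⟶ q) (ι : i' ⟶ i) (ζ : j ⟶ j') (ξ : p ⟶ p') :
    IsTwoCartesian (κ ▷ i' ≫ q ◁ ι ≫ α ≫ ζ ▷ p ≫ j' ◁ ξ) := by
  have h := ((hα.adjust_horizontal ι ζ).flip.adjust_horizontal (inv ξ) (inv κ)).flip
  have e : κ ▷ i' ≫ q ◁ ι ≫ α ≫ ζ ▷ p ≫ j' ◁ ξ =
      inv (j' ◁ inv ξ ≫ inv (q ◁ ι ≫ α ≫ ζ ▷ p) ≫ inv κ ▷ i') := by simp
  rwa [e]

end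

section Paste

variable {X₁ X₂ X₃ Y₁ Y₂ Y₃ : C} {p₁ : X₁ ⟶ Y₁} {p₂ : X₂ ⟶ Y₂}
    {p₃ : X₃ ⟶ Y₃} {j : X₁ ⟶ X₂} {i : Y₁ ⟶ Y₂} {j' : X₂ ⟶ X₃} {i' : Y₂ ⟶ Y₃}
    {α : p₁ ≫ i ⟶ j ≫ p₂} {α' : p₂ ≫ i' ⟶ j' ≫ p₃} [IsLocallyGroupoid C]

lemma hpaste (hα : IsTwoCartesian α) (hα' : IsTwoCartesian α') :
    IsTwoCartesian (hpaste α α') := by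
  refine .mk' (fun {T u v} θ => ?_) (fun {T h h'} φ ψ e => ?_) (fun ω ω' e e' => ?_)
  · obtain ⟨h₂, γ₂, δ₂, e₂⟩ := hα'.lift (u := u) (v := v ≫ i) ((α_ v i i').hom ≫ θ)
    obtain ⟨h, γ, δ, e⟩ := hα.lift (inv γ₂)
    refine ⟨h, γ, (α_ h j j').inv ≫ δ ▷ j' ≫ δ₂, ?_⟩
    rw [precompSquare_hpaste]
    simp only [comp_whiskerRight, Category.assoc, hom_inv_whiskerRight_assoc]
    rw [← reassoc_of% whiskerRight_precompSquare δ α', e₂, ← comp_whiskerRight_assoc, e]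
    simp
  · rw [precompSquare_hpaste, precompSquare_hpaste] at e
    obtain ⟨ψ₂, h₁, h₂⟩ := hα'.full (h := h ≫ j) (h' := h' ≫ j)
      (inv (precompSquare h α) ≫ φ ▷ i ≫ precompSquare h' α)
      ((α_ h j j').hom ≫ ψ ≫ (α_ h' j j').inv) (by
        rw [← cancel_epi (precompSquare h α ▷ i')]
        rw [← cancel_epi (α_ (h ≫ p₁) i i').inv]
        rw [← cancel_mono ((α_ h' j j').hom ▷ p₃)]
        simp only [comp_whiskerRight, Category.assoc, inv_hom_whiskerRight, Category.comp_id] at e ⊢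
        rw [← e]
        simp)
    obtain ⟨ξ, h₃, h₄⟩ := hα.full φ ψ₂ (by rw [h₁]; simp)
    refine ⟨ξ, h₃, ?_⟩
    rw [whiskerRight_comp, h₄, h₂]
    simp
  · refine hα.faithful _ _ e (hα'.faithful _ _ ?_ ?_)
    · rw [← cancel_epi (precompSquare _ α), ← whiskerRight_precompSquare, e,
        whiskerRight_precompSquare]
    · rw [← cancel_epi (α_ _ j j').inv, ← cancel_mono (α_ _ j j').hom]
      simpa using e'

lemma of_hpaste (hα : IsTwoCartesian (TwoGlue.hpaste α α')) (hα' : IsTwoCartesian α') :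
    IsTwoCartesian α := by
  refine .mk' (fun {T u v} θ => ?_) (fun {T h h'} φ ψ e => ?_) (fun ω ω' e e' => ?_)
  · obtain ⟨h, γ, δ', e⟩ := hα.lift (u := u ≫ j') (v := v)
      ((α_ v i i').inv ≫ θ ▷ i' ≫ precompSquare u α')
    rw [precompSquare_hpaste] at e
    obtain ⟨δ, h₁, h₂⟩ := hα'.full (h := h ≫ j) (h' := u)
      (inv (precompSquare h α) ≫ γ ▷ i ≫ θ) ((α_ h j j').hom ≫ δ') (by
        rw [← cancel_epi (precompSquare h α ▷ i'), ← cancel_epi (α_ (h ≫ p₁) i i').inv]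
        simp only [comp_whiskerRight, Category.assoc] at e ⊢
        rw [e]
        simp)
    exact ⟨h, γ, δ, by rw [h₁]; simp⟩
  · obtain ⟨ξ, h₁, h₂⟩ := hα.full φ ((α_ h j j').inv ≫ ψ ▷ j' ≫ (α_ h' j j').hom) (by
      rw [precompSquare_hpaste, precompSquare_hpaste]
      simp only [comp_whiskerRight, Category.assoc, hom_inv_whiskerRight_assoc]
      rw [← reassoc_of% whiskerRight_precompSquare ψ α', ← comp_whiskerRight_assoc, ← e]
      simp)
    refine ⟨ξ, h₁, hα'.faithful _ _ ?_ ?_⟩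
    · rw [← cancel_epi (precompSquare _ α), ← whiskerRight_precompSquare, h₁, e]
    · rw [← cancel_epi (α_ _ j j').inv, ← cancel_mono (α_ _ j j').hom]
      simpa using h₂
  · refine hα.faithful _ _ e ?_
    rw [whiskerRight_comp, whiskerRight_comp, e']

end Paste

section VPaste

variable {X₁ X₂ X₃ Y₁ Y₂ Y₃ : C} {i₁ : X₁ ⟶ Y₁} {i₂ : X₂ ⟶ Y₂} {i₃ : X₃ ⟶ Y₃}
    {q : X₁ ⟶ X₂} {p : Y₁ ⟶ Y₂} {q' : X₂ ⟶ X₃} {p' : Y₂ ⟶ Y₃}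
    {α : q ≫ i₂ ⟶ i₁ ≫ p} {α' : q' ≫ i₃ ⟶ i₂ ≫ p'} [IsLocallyGroupoid C]

lemma vpaste (hα : IsTwoCartesian α) (hα' : IsTwoCartesian α') :
    IsTwoCartesian (vpaste α α') := by
  have h := (hα.flip.hpaste hα'.flip).flip
  rw [inv_hpaste] at h
  simpa using h

lemma of_vpaste (hα : IsTwoCartesian (TwoGlue.vpaste α α')) (hα' : IsTwoCartesian α') :
    IsTwoCartesian α := by
  have h := hα.flip
  rw [inv_vpaste] at h
  simpa using (h.of_hpaste hα'.flip).flip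

end VPaste

lemma exists_left_factor [IsLocallyGroupoid C] {X Y₁ Y₂ Y₃ X₂ X₃ : C} {p₂ : X₂ ⟶ Y₂}
    {p₃ : X₃ ⟶ Y₃} {j' : X₂ ⟶ X₃} {i' : Y₂ ⟶ Y₃} {α' : p₂ ≫ i' ⟶ j' ≫ p₃}
    (hα' : IsTwoCartesian α') {p₁ : X ⟶ Y₁} {i : Y₁ ⟶ Y₂} {t : X ⟶ X₃}
    (τ : p₁ ≫ i ≫ i' ⟶ t ≫ p₃) :
    ∃ (j : X ⟶ X₂) (α : p₁ ≫ i ⟶ j ≫ p₂) (δ : j ≫ j' ⟶ t),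
      TwoGlue.hpaste α α' ≫ δ ▷ p₃ = τ := by
  obtain ⟨h, γ, δ, e⟩ := hα'.lift ((α_ p₁ i i').hom ≫ τ)
  refine ⟨h, inv γ, δ, ?_⟩
  rw [hpaste_eq_precompSquare]
  simp only [Category.assoc, e]
  simp [← comp_whiskerRight_assoc]

/-- A Cartesian square factors through any Cartesian square on a factor of its bottom edge. -/
lemma exists_factor_bottom [IsLocallyGroupoid C] {X Y Z W U V : C} {t : X ⟶ Y} {q : X ⟶ Z}
    {p : Y ⟶ W} {i : Z ⟶ W} {τ : q ≫ i ⟶ t ≫ p} (hτ : IsTwoCartesian τ) {a : Z ⟶ V} {b : V ⟶ W}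
    (ι : i ⟶ a ≫ b) {b' : U ⟶ Y} {p' : U ⟶ V} {β : p' ≫ b ⟶ b' ≫ p} (hβ : IsTwoCartesian β) :
    ∃ (a' : X ⟶ U) (α : q ≫ a ⟶ a' ≫ p') (δ : a' ≫ b' ⟶ t), IsTwoCartesian α ∧
      q ◁ ι ≫ TwoGlue.hpaste α β ≫ δ ▷ p = τ := by
  obtain ⟨a', α, δ, e⟩ := hβ.exists_left_factor (q ◁ inv ι ≫ τ)
  have h := hτ.adjust_horizontal (inv ι) (inv δ)
  have e' : q ◁ inv ι ≫ τ ≫ inv δ ▷ p = TwoGlue.hpaste α β := by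
    rw [← Category.assoc, ← e]; simp
  rw [e'] at h
  exact ⟨a', α, δ, h.of_hpaste hβ, by rw [e]; simp⟩

/-- A Cartesian square factors through any Cartesian square on a factor of its right edge. -/
lemma exists_factor_right [IsLocallyGroupoid C] {X Y Z W U V : C} {j : X ⟶ Y} {t : X ⟶ Z}
    {p : Y ⟶ W} {i : Z ⟶ W} {τ : t ≫ i ⟶ j ≫ p} (hτ : IsTwoCartesian τ) {a : Y ⟶ V} {b : V ⟶ W}
    (ι : a ≫ b ⟶ p) {b' : U ⟶ Z} {i' : U ⟶ V} {β : b' ≫ i ⟶ i' ≫ b} (hβ : IsTwoCartesian β) :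
    ∃ (a' : X ⟶ U) (α : a' ≫ i' ⟶ j ≫ a) (δ : t ⟶ a' ≫ b'), IsTwoCartesian α ∧
      δ ▷ i ≫ TwoGlue.vpaste α β ≫ j ◁ ι = τ := by
  obtain ⟨a', α, δ, hα, e⟩ := hτ.flip.exists_factor_bottom (inv ι) hβ.flip
  have k : TwoGlue.hpaste α (inv β) ≫ TwoGlue.vpaste (inv α) β = 𝟙 _ := by
    rw [← IsIso.hom_inv_id (TwoGlue.hpaste α (inv β)), inv_hpaste, IsIso.inv_inv]
  refine ⟨a', inv α, inv δ, hα.flip, ?_⟩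
  rw [← cancel_epi (inv τ), IsIso.inv_hom_id, ← e]
  simp [reassoc_of% k]

variable [IsLocallyGroupoid C]

/-- The square with vertical identities attached to a 2-cell. -/
lemma vertical_id {X Y : C} {i j : X ⟶ Y} (η : i ⟶ j) :
    IsTwoCartesian ((λ_ i).hom ≫ η ≫ (ρ_ j).inv) := by
  have h : IsTwoCartesian ((λ_ j).hom ≫ (ρ_ j).inv) := by
    have key : ∀ {T : C} (h : T ⟶ X), precompSquare h ((λ_ j).hom ≫ (ρ_ j).inv) =
        (ρ_ h).hom ▷ j ≫ (ρ_ (h ≫ j)).inv := by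
      intro T h
      simp [precompSquare]
    refine .mk' (fun {T u v} θ => ?_) (fun {T h h'} φ ψ e => ?_) (fun ω ω' e e' => ?_)
    · exact ⟨v, (ρ_ v).hom, θ ≫ (ρ_ u).hom, by rw [key]; simp⟩
    · refine ⟨(ρ_ h).inv ≫ φ ≫ (ρ_ h').hom, by simp, ?_⟩
      rw [key, key] at e
      rw [← cancel_epi ((ρ_ h).hom ▷ j)]
      simp only [← Category.assoc, whiskerRight_id] at e
      rw [cancel_mono] at e
      simpa using e
    · simpa using e
  have := h.adjust_horizontal η (𝟙 j)
  simpa using this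

lemma horizontal_id {X Y : C} {q p : X ⟶ Y} (η : q ⟶ p) :
    IsTwoCartesian ((ρ_ q).hom ≫ η ≫ (λ_ p).inv) := by
  have h := (vertical_id (inv η)).flip
  simpa using h

end IsTwoCartesianIn

/-- The square with vertical identities on the edge `k`. -/
abbrev idSquare {X Y : C} (k : X ⟶ Y) : 𝟙 X ≫ k ⟶ k ≫ 𝟙 Y := (λ_ k).hom ≫ 𝟙 k ≫ (ρ_ k).inv

/-- The square whose top and left edges are `f` and whose other edges are identities. -/
abbrev swap {X Y : C} (f : X ⟶ Y) : f ≫ 𝟙 Y ⟶ f ≫ 𝟙 Y := 𝟙 (f ≫ 𝟙 Y)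

lemma pasteTriangles_eq_vpaste {X X' Y Z W : C} {k : X' ⟶ Y} {r : X' ⟶ Z} {p : Y ⟶ W} {i : Z ⟶ W}
    {f : X ⟶ X'} {q : X ⟶ Z} {j : X ⟶ Y} (γ : q ⟶ f ≫ r) (β : r ≫ i ⟶ k ≫ p) (δ : f ≫ k ⟶ j) :
    pasteTriangles γ β δ = γ ▷ i ≫ (f ≫ r) ◁ 𝟙 i ≫
      vpaste (𝟙 f ▷ k ≫ f ◁ (λ_ k).inv ≫ hpaste (swap f) (idSquare k) ≫ 𝟙 (f ≫ k) ▷ 𝟙 Y ≫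
        (f ≫ k) ◁ 𝟙 (𝟙 Y)) β ≫ δ ▷ (𝟙 Y ≫ p) ≫ j ◁ (λ_ p).hom := by
  dsimp only [pasteTriangles, precompSquare, vpaste, hpaste]
  simp only [whiskerLeft_id, id_whiskerRight, Category.id_comp, Category.comp_id]
  bicategory

lemma swap_comp {X Y Z : C} (f : X ⟶ Y) (g : Y ⟶ Z) :
    swap (f ≫ g) = pasteTriangles (𝟙 (f ≫ g)) (swap g) (𝟙 (f ≫ g)) := by
  simp [pasteTriangles, precompSquare]

lemma IsTwoCartesianIn.swap_of_pasteTriangles [IsLocallyGroupoid C] {X X' Y Z W : C} {k : X' ⟶ Y}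
    {r : X' ⟶ Z} {p : Y ⟶ W} {i : Z ⟶ W} {f : X ⟶ X'} {q : X ⟶ Z} {j : X ⟶ Y} {γ : q ⟶ f ≫ r}
    {β : r ≫ i ⟶ k ≫ p} {δ : f ≫ k ⟶ j} (h : IsTwoCartesian (pasteTriangles γ β δ))
    (hβ : IsTwoCartesian β) : IsTwoCartesian (swap f) := by
  have h₁ := h.adjust (inv γ) (𝟙 i) (inv δ) (λ_ p).inv
  have e : inv γ ▷ i ≫ q ◁ 𝟙 i ≫ pasteTriangles γ β δ ≫ inv δ ▷ p ≫ (f ≫ k) ◁ (λ_ p).inv =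
      TwoGlue.vpaste (f ◁ (λ_ k).inv ≫ TwoGlue.hpaste (swap f) (idSquare k)) β := by
    rw [pasteTriangles_eq_vpaste]
    simp only [whiskerLeft_id, id_whiskerRight, Category.id_comp, Category.comp_id, Category.assoc]
    rw [← whisker_exchange, ← comp_whiskerRight_assoc (inv γ)]
    simp
  rw [e] at h₁
  have h₂ := (h₁.of_vpaste hβ).adjust_horizontal (λ_ k).hom (𝟙 (f ≫ k))
  have e₂ : f ◁ (λ_ k).hom ≫ (f ◁ (λ_ k).inv ≫ TwoGlue.hpaste (swap f) (idSquare k)) ≫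
      𝟙 (f ≫ k) ▷ 𝟙 Y = TwoGlue.hpaste (swap f) (idSquare k) := by
    simp
  rw [e₂] at h₂
  exact h₂.of_hpaste (.vertical_id _)

end Cartesian

lemma WideSub.inf_le_inf_right {C : Type u} [Bicategory.{w, v} C] {A B : WideSub C}
    (J : WideSub C) (h : A ≤ B) : A ⊓ J ≤ B ⊓ J :=
  fun _ _ _ hf => ⟨h _ hf.1, hf.2⟩

section PastingClosed

variable {C : Type u} [Bicategory.{w, v} C]

/-- A property of squares with horizontal edges in `P` and vertical edges in `Q` that is stable
under pasting of such squares, under changes of the edges, and holds for squares with a pair of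
opposite identity edges. -/
structure PastingClosed (P Q : WideSub C) (R : ∀ {X Y Z W : C} {j : X ⟶ Y} {q : X ⟶ Z}
    {p : Y ⟶ W} {i : Z ⟶ W}, (q ≫ i ⟶ j ≫ p) → Prop) : Prop where
  hpaste : ∀ {X₁ X₂ X₃ Y₁ Y₂ Y₃ : C} {p₁ : X₁ ⟶ Y₁} {p₂ : X₂ ⟶ Y₂} {p₃ : X₃ ⟶ Y₃}
    {j : X₁ ⟶ X₂} {i : Y₁ ⟶ Y₂} {j' : X₂ ⟶ X₃} {i' : Y₂ ⟶ Y₃} {α : p₁ ≫ i ⟶ j ≫ p₂}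
    {α' : p₂ ≫ i' ⟶ j' ≫ p₃}, Q.mem p₁ → Q.mem p₂ → Q.mem p₃ → P.mem j → P.mem i → P.mem j' →
    P.mem i' → R α → R α' → R (hpaste α α')
  vpaste : ∀ {X₁ X₂ X₃ Y₁ Y₂ Y₃ : C} {i₁ : X₁ ⟶ Y₁} {i₂ : X₂ ⟶ Y₂} {i₃ : X₃ ⟶ Y₃}
    {q : X₁ ⟶ X₂} {p : Y₁ ⟶ Y₂} {q' : X₂ ⟶ X₃} {p' : Y₂ ⟶ Y₃} {α : q ≫ i₂ ⟶ i₁ ≫ p}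
    {α' : q' ≫ i₃ ⟶ i₂ ≫ p'}, P.mem i₁ → P.mem i₂ → P.mem i₃ → Q.mem q → Q.mem p → Q.mem q' →
    Q.mem p' → R α → R α' → R (vpaste α α')
  adjust : ∀ {X Y Z W : C} {j j' : X ⟶ Y} {q q' : X ⟶ Z} {p p' : Y ⟶ W} {i i' : Z ⟶ W}
    {α : q ≫ i ⟶ j ≫ p} (κ : q' ⟶ q) (ι : i' ⟶ i) (ζ : j ⟶ j') (ξ : p ⟶ p'),
    P.mem j → P.mem j' → Q.mem q → Q.mem q' → Q.mem p → Q.mem p' → P.mem i → P.mem i' → R α →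
    R (κ ▷ i' ≫ q ◁ ι ≫ α ≫ ζ ▷ p ≫ j' ◁ ξ)
  vertical_id : ∀ {X Y : C} {i j : X ⟶ Y} (η : i ⟶ j), P.mem i → P.mem j →
    R ((λ_ i).hom ≫ η ≫ (ρ_ j).inv)
  horizontal_id : ∀ {X Y : C} {q p : X ⟶ Y} (η : q ⟶ p), Q.mem q → Q.mem p →
    R ((ρ_ q).hom ≫ η ≫ (λ_ p).inv)

namespace PastingClosed

variable {P Q : WideSub C} {R : ∀ {X Y Z W : C} {j : X ⟶ Y} {q : X ⟶ Z}
    {p : Y ⟶ W} {i : Z ⟶ W}, (q ≫ i ⟶ j ≫ p) → Prop} (hR : PastingClosed P Q R)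
include hR

lemma pasteTriangles {X X' Y Z W : C} {k : X' ⟶ Y} {r : X' ⟶ Z} {p : Y ⟶ W} {i : Z ⟶ W}
    {f : X ⟶ X'} {q : X ⟶ Z} {j : X ⟶ Y} {γ : q ⟶ f ≫ r} {β : r ≫ i ⟶ k ≫ p} {δ : f ≫ k ⟶ j}
    (hi : P.mem i) (hj : P.mem j) (hp : Q.mem p) (hq : Q.mem q) (hk : P.mem k) (hr : Q.mem r)
    (hf : (P ⊓ Q).mem f) (hβ : R β) (h : R (swap f)) : R (pasteTriangles γ β δ) := by
  rw [pasteTriangles_eq_vpaste]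
  have hfk := P.comp_mem hf.1 hk
  have hfk' := P.comp_mem hf.1 (P.comp_mem (P.id_mem _) hk)
  have hfr := Q.comp_mem hf.2 hr
  have hp' := Q.comp_mem (Q.id_mem _) hp
  refine hR.adjust γ (𝟙 i) δ (λ_ p).hom hfk hj hfr hq hp' hp hi hi (hR.vpaste hfk hk hi hf.2
    (Q.id_mem _) hr hp (hR.adjust (𝟙 f) (λ_ k).inv (𝟙 (f ≫ k)) (𝟙 (𝟙 Y)) hfk hfk hf.2 hf.2
      (Q.id_mem _) (Q.id_mem _) (P.comp_mem (P.id_mem _) hk) hk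
      (hR.hpaste hf.2 (Q.id_mem _) (Q.id_mem _) hf.1 (P.id_mem _) hk hk h
        (hR.vertical_id _ hk hk))) hβ)

lemma swap_of_iso [IsLocallyGroupoid C] {X Y : C} {f g : X ⟶ Y} (η : f ≅ g) (hf : (P ⊓ Q).mem f)
    (hg : (P ⊓ Q).mem g) (h : R (swap f)) : R (swap g) := by
  have := hR.adjust η.inv (𝟙 _) η.hom (𝟙 _) hf.1 hg.1 hf.2 hg.2 (Q.id_mem Y) (Q.id_mem Y)
    (P.id_mem Y) (P.id_mem Y) h
  simpa [swap] using this

lemma swap_id (X : C) : R (swap (𝟙 X)) := by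
  have h := hR.horizontal_id (𝟙 (𝟙 X)) (Q.id_mem X) (Q.id_mem X)
  rwa [Category.id_comp, ← unitors_equal, Iso.hom_inv_id] at h

lemma swap_comp {X Y Z : C} {f : X ⟶ Y} {g : Y ⟶ Z} (hf : (P ⊓ Q).mem f) (hg : (P ⊓ Q).mem g)
    (h : R (swap f)) (h' : R (swap g)) : R (swap (f ≫ g)) := by
  rw [TwoGlue.swap_comp]
  exact hR.pasteTriangles (P.id_mem _) (P.comp_mem hf.1 hg.1) (Q.id_mem _) (Q.comp_mem hf.2 hg.2)
    hg.1 hg.2 hf h' h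

lemma mem_of_isComposite {A₁ A₂ B : WideSub C} (h₁ : A₁ ≤ B) (h₂ : A₂ ≤ B) {X Y : C} {f : X ⟶ Y}
    (hf : IsComposite A₁ A₂ f) : B.mem f := by
  induction hf with
  | nil X => exact B.id_mem X
  | cons ha hp _ ih => exact B.comp_mem (B.comp_mem (h₁ _ ha) (h₂ _ hp)) ih

/-- Swaps of 1-cells that are generated by two subcategories. -/
lemma swap_of_generates [IsLocallyGroupoid C] {A₁ A₂ B : WideSub C} (hB : B ≤ P ⊓ Q)
    (h₁ : A₁ ≤ B) (h₂ : A₂ ≤ B) (gen : Generates A₁ A₂ B)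
    (base₁ : ∀ {X Y : C} (f : X ⟶ Y), A₁.mem f → R (swap f))
    (base₂ : ∀ {X Y : C} (f : X ⟶ Y), A₂.mem f → R (swap f)) {X Y : C} (f : X ⟶ Y)
    (hf : B.mem f) : R (swap f) := by
  obtain ⟨g, hg, ⟨e⟩⟩ := gen f hf
  have hgB := hR.mem_of_isComposite h₁ h₂ hg
  refine hR.swap_of_iso e.symm (hB _ hgB) (hB _ hf) ?_
  clear e hf hgB f
  induction hg with
  | nil X => exact hR.swap_id X
  | cons ha hp hf ih =>
    exact hR.swap_comp ((P ⊓ Q).comp_mem (hB _ (h₁ _ ha)) (hB _ (h₂ _ hp)))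
      (hB _ (hR.mem_of_isComposite h₁ h₂ hf))
      (hR.swap_comp (hB _ (h₁ _ ha)) (hB _ (h₂ _ hp)) (base₁ _ ha) (base₂ _ hp)) ih

/-- Cartesian squares, when the horizontal edges factor. -/
lemma cartesian [IsLocallyGroupoid C] {A₁ A₂ : WideSub C} (h₁ : A₁ ≤ P) (h₂ : A₂ ≤ P)
    (hfac : Factors A₁ A₂ P) (hbc : HasBaseChanges Q A₂) (hst : StableUnderBaseChange Q A₂)
    (hst₁ : StableUnderBaseChange A₁ Q) (hst₂ : StableUnderBaseChange A₂ Q)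
    (base₁ : ∀ {X Y Z W : C} {j : X ⟶ Y} {q : X ⟶ Z} {p : Y ⟶ W} {i : Z ⟶ W}
      (α : q ≫ i ⟶ j ≫ p), A₁.mem j → Q.mem q → Q.mem p → A₁.mem i → IsTwoCartesian α → R α)
    (base₂ : ∀ {X Y Z W : C} {j : X ⟶ Y} {q : X ⟶ Z} {p : Y ⟶ W} {i : Z ⟶ W}
      (α : q ≫ i ⟶ j ≫ p), A₂.mem j → Q.mem q → Q.mem p → A₂.mem i → IsTwoCartesian α → R α)
    {X Y Z W : C} {j : X ⟶ Y} {q : X ⟶ Z} {p : Y ⟶ W} {i : Z ⟶ W}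
    (α : q ≫ i ⟶ j ≫ p) (hj : P.mem j) (hq : Q.mem q) (hp : Q.mem p) (hi : P.mem i)
    (hα : IsTwoCartesian α) : R α := by
  obtain ⟨V, a, b, ha, hb, ⟨ι⟩⟩ := hfac i hi
  obtain ⟨U, p', b', β, hβ⟩ := hbc b p hb hp
  have hp' := hst β hβ hp hb
  have hb' := hst₂ (inv β) hβ.flip hb hp
  obtain ⟨a', α', δ, hα', e⟩ := hα.exists_factor_bottom ι.hom hβ.flip
  have ha' := hst₁ α' hα' ha hp'
  have := hR.adjust (𝟙 q) ι.hom δ (𝟙 p) (P.comp_mem (h₁ _ ha') (h₂ _ hb')) hj hq hq hp hp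
    (P.comp_mem (h₁ _ ha) (h₂ _ hb)) hi (hR.hpaste hq hp' hp (h₁ _ ha') (h₁ _ ha) (h₂ _ hb')
      (h₂ _ hb) (base₁ α' ha' hq hp' ha hα') (base₂ (inv β) hb' hp' hp hb hβ.flip))
  simpa [e] using this

end PastingClosed

end PastingClosed

section Compat

variable {C : Type u} [Bicategory.{w, v} C] {D : Type u'} [Bicategory.{w', v'} D]
  {P Q : WideSub C} {F₀ F₀' : C → D} {F : PsFun P F₀} {F' : PsFun P F₀'} {H : PsFun Q F₀}
  {H' : PsFun Q F₀'} {α : ∀ X, F₀ X ⟶ F₀' X}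

/-- Compatibility of two pseudonatural transformations with the 2-cells that two gluing data attach
to a square. -/
def Compat (t : PsTrans F F' α) (u : PsTrans H H' α) (G : Gluing F H) (G' : Gluing F' H')
    {X Y Z W : C} {j : X ⟶ Y} {q : X ⟶ Z} {p : Y ⟶ W} {i : Z ⟶ W} (β : q ≫ i ⟶ j ≫ p) : Prop :=
  ∀ (hj : P.mem j) (hq : Q.mem q) (hp : Q.mem p) (hi : P.mem i),
    Cyl (hpaste (u.sq q hq) (t.sq i hi)) (hpaste (t.sq j hj) (u.sq p hp))
      (G'.iso hj hq hp hi β).hom (G.iso hj hq hp hi β).hom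

lemma Compat.pastingClosed [IsLocallyGroupoid C] (t : PsTrans F F' α) (u : PsTrans H H' α)
    (G : Gluing F H) (G' : Gluing F' H') : PastingClosed P Q (Compat t u G G') where
  hpaste {X₁ X₂ X₃ Y₁ Y₂ Y₃ p₁ p₂ p₃ j i j' i' β β'} h₁ h₂ h₃ hj hi hj' hi' hβ hβ' := by
    intro hjj _ _ hii
    rw [G.ax_b' h₁ h₂ h₃ hj hi hj' hi', G'.ax_b' h₁ h₂ h₃ hj hi hj' hi']
    exact Cyl.hCell t u (hβ hj h₁ h₂ hi) (hβ' hj' h₂ h₃ hi')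
  vpaste {X₁ X₂ X₃ Y₁ Y₂ Y₃ i₁ i₂ i₃ q p q' p' β β'} h₁ h₂ h₃ hq hp hq' hp' hβ hβ' := by
    intro _ hqq hpp _
    rw [G.ax_b h₁ h₂ h₃ hq hp hq' hp', G'.ax_b h₁ h₂ h₃ hq hp hq' hp']
    exact Cyl.vCell t u (hβ h₁ hq hp h₂) (hβ' h₂ hq' hp' h₃)
  adjust κ ι ζ ξ hj hj' hq hq' hp hp' hi hi' hβ := by
    intro _ _ _ _
    rw [G.iso_adCell hj hq hp hi, G'.iso_adCell hj hq hp hi]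
    exact Cyl.adCell t u _ _ _ _ κ ι ζ ξ (hβ hj hq hp hi)
  vertical_id η hi hj _ _ _ _ := Cyl.ax_a t u G G' hi hj η
  horizontal_id η hq hp _ _ _ _ := Cyl.ax_a' t u G G' hq hp η

lemma PsTrans.ext_of_factors [IsLocallyGroupoid C] {A₁ A₂ : WideSub C} (h₁ : A₁ ≤ P)
    (h₂ : A₂ ≤ P) (hfac : Factors A₁ A₂ P) {t t' : PsTrans F F' α}
    (e₁ : t.restrict h₁ = t'.restrict h₁) (e₂ : t.restrict h₂ = t'.restrict h₂) : t = t' := by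
  refine PsTrans.ext' fun {X Y} f hf => congrArg Iso.hom (Iso.ext_inv ?_)
  obtain ⟨Z, a, p, ha, hp, ⟨ν⟩⟩ := hfac f hf
  have k₁ : t.sq a (h₁ _ ha) = t'.sq a (h₁ _ ha) :=
    congrArg (fun s : PsTrans (F.restrict h₁) (F'.restrict h₁) α => s.sq a ha) e₁
  have k₂ : t.sq p (h₂ _ hp) = t'.sq p (h₂ _ hp) :=
    congrArg (fun s : PsTrans (F.restrict h₂) (F'.restrict h₂) α => s.sq p hp) e₂
  have hap := P.comp_mem (h₁ _ ha) (h₂ _ hp)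
  have c := (t.cyl_map₂ hf hap ν.hom).comp (t.cyl_mapComp a p (h₁ _ ha) (h₂ _ hp))
  have c' := (t'.cyl_map₂ hf hap ν.hom).comp (t'.cyl_mapComp a p (h₁ _ ha) (h₂ _ hp))
  rw [k₁, k₂] at c
  have : IsIso (F.map₂ hf hap ν.hom ≫ (F.mapComp a p (h₁ _ ha) (h₂ _ hp)).hom) :=
    (F.map₂Iso hf hap ν.hom ≪≫ F.mapComp a p (h₁ _ ha) (h₂ _ hp)).isIso_hom
  exact c.eq_left c'

/-- Modifications between the restrictions to two subcategories extend. -/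
lemma PsTrans.modification_of_factors {A₁ A₂ : WideSub C} (h₁ : A₁ ≤ P) (h₂ : A₂ ≤ P)
    (hfac : Factors A₁ A₂ P) {α' : ∀ X, F₀ X ⟶ F₀' X} {s : PsTrans F F' α} {t : PsTrans F F' α'}
    (Ξ : ∀ X, α X ⟶ α' X)
    (n₁ : ∀ {X Y : C} (f : X ⟶ Y) (hf : A₁.mem f), F.map f (h₁ _ hf) ◁ Ξ Y ≫
      (t.nat f (h₁ _ hf)).hom = (s.nat f (h₁ _ hf)).hom ≫ Ξ X ▷ F'.map f (h₁ _ hf))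
    (n₂ : ∀ {X Y : C} (f : X ⟶ Y) (hf : A₂.mem f), F.map f (h₂ _ hf) ◁ Ξ Y ≫
      (t.nat f (h₂ _ hf)).hom = (s.nat f (h₂ _ hf)).hom ≫ Ξ X ▷ F'.map f (h₂ _ hf))
    {X Y : C} (f : X ⟶ Y) (hf : P.mem f) :
    F.map f hf ◁ Ξ Y ≫ (t.nat f hf).hom = (s.nat f hf).hom ≫ Ξ X ▷ F'.map f hf := by
  obtain ⟨Z, a, p, ha, hp, ⟨ν⟩⟩ := hfac f hf
  have ha' := h₁ _ ha
  have hp' := h₂ _ hp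
  have hap := P.comp_mem ha' hp'
  have key : F.map (a ≫ p) hap ◁ Ξ Y ≫ (t.nat (a ≫ p) hap).hom =
      (s.nat (a ≫ p) hap).hom ≫ Ξ X ▷ F'.map (a ≫ p) hap := by
    rw [← cancel_mono (α' X ◁ (F'.mapComp a p ha' hp').hom), Category.assoc, Category.assoc,
      t.nat_comp a p ha' hp', whisker_exchange_assoc, ← whisker_exchange,
      reassoc_of% s.nat_comp a p ha' hp', cancel_epi]
    dsimp only [vpaste]
    have e₁ := n₁ a ha
    have e₂ := n₂ p hp
    calc _ = 𝟙 _ ⊗≫ F.map a ha' ◁ (F.map p hp' ◁ Ξ Y ≫ (t.nat p hp').hom) ⊗≫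
          (t.nat a ha').hom ▷ F'.map p hp' ⊗≫ 𝟙 _ := by bicategory
      _ = 𝟙 _ ⊗≫ F.map a ha' ◁ (s.nat p hp').hom ⊗≫ (F.map a ha' ◁ Ξ Z ≫
          (t.nat a ha').hom) ▷ F'.map p hp' ⊗≫ 𝟙 _ := by rw [e₂]; bicategory
      _ = _ := by rw [e₁]; bicategory
  have hs := s.nat_naturality hf hap ν.hom
  have ht := t.nat_naturality hf hap ν.hom
  have hν : F'.map₂ hf hap ν.hom ≫ F'.map₂ hap hf ν.inv = 𝟙 _ := F'.map₂_hom_inv hf hap ν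
  rw [← Category.comp_id ((t.nat f hf).hom), ← whiskerLeft_id, ← hν, whiskerLeft_comp,
    ← reassoc_of% ht, whisker_exchange_assoc, reassoc_of% key, ← whisker_exchange, reassoc_of% hs,
    ← whiskerLeft_comp_assoc, hν]
  simp

end Compat

section FullyFaithful

variable {C : Type u} [Bicategory.{w, v} C] [IsLocallyGroupoid C] {D : Type u'}
  [Bicategory.{w', v'} D] {m : ℕ} {A : Fin (m + 2) → WideSub C} {B : WideSub C}

lemma GD.Hom.ext' {n : ℕ} {A : Fin n → WideSub C} {E E' : GD D A} {s t : Hom E E'}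
    (h : s.app = t.app) (h' : ∀ i, HEq (s.tr i) (t.tr i)) : s = t := by
  obtain ⟨sa, st, sc⟩ := s
  obtain ⟨ta, tt, tc⟩ := t
  obtain rfl : sa = ta := h
  obtain rfl : st = tt := funext fun i => eq_of_heq (h' i)
  rfl

lemma comparisonMap_injective (hA₁ : A 0 ≤ B) (hA₂ : A 1 ≤ B) (h_i : Factors (A 0) (A 1) B)
    {E E' : GD D (coarsen B A)} :
    Function.Injective (comparisonMap B A hA₁ hA₂ : GD.Hom E E' → _) := by
  intro s t e
  obtain ⟨sa, st, sc⟩ := s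
  obtain ⟨ta, tt, tc⟩ := t
  obtain rfl : sa = ta := congrArg GD.Hom.app e
  have h : ∀ i, (st (merge i)).restrict (le_coarsen hA₁ hA₂ i) =
      (tt (merge i)).restrict (le_coarsen hA₁ hA₂ i) := by
    injection e with _ e
    exact fun i => congrFun e i
  obtain rfl : st = tt := by
    funext i
    induction i using Fin.cases with
    | zero => exact PsTrans.ext_of_factors hA₁ hA₂ h_i (h 0) (h 1)
    | succ i => exact h i.succ.succ
  rfl

lemma comparisonMap_surjective (hA₁ : A 0 ≤ B) (hA₂ : A 1 ≤ B) (h_i : Factors (A 0) (A 1) B)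
    (h_ii : HasFiberProductsAgreeing (A 1) B)
    (h_iii : ∀ i : Fin m, HasBaseChanges (A i.succ.succ) (A 1) ∧
      StableUnderBaseChange (A i.succ.succ) (A 1))
    (h_iv : ∀ j : Fin m, StableUnderBaseChange (A 0) (A j.succ.succ) ∧
      StableUnderBaseChange (A 1) (A j.succ.succ))
    (h_v : ∀ i : Fin m, Squaring B (A i.succ.succ))
    (h_vi : ∀ i : Fin m, Generates (A 0 ⊓ A i.succ.succ) (A 1 ⊓ A i.succ.succ)
      (B ⊓ A i.succ.succ)) {E E' : GD D (coarsen B A)} :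
    Function.Surjective (comparisonMap B A hA₁ hA₂ : GD.Hom E E' → _) := by
  intro s
  obtain ⟨t, ht₁, ht₂⟩ := PsTrans.exists_extension (hP := hA₁) (hQ := hA₂) (F := E.ps 0)
    (F' := E'.ps 0) (s.tr 0) (s.tr 1) (fun {X Y Z W j q p i} hj hq hp hi β => by
      have h := (compat_iff_cyl _ _ _ _ _ _).1 (s.compat (i := 0) (j := 1) (by simp) hj hq hp hi β)
      have e : ∀ E : GD D (coarsen B A), E.full (merge_mono (i := (0 : Fin (m + 2))) (j := 1)
        (by simp)) = (E.ps 0).selfGluing := fun E => E.full_self 0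
      dsimp only [comparisonObj] at h
      rw [e, e] at h
      exact h) (Roofed.of_factors hA₁ h_i h_ii) h_i
  have key : ∀ (k : Fin m) {X Y Z W : C} {j : X ⟶ Y} {q : X ⟶ Z} {p : Y ⟶ W} {i : Z ⟶ W}
      (β : q ≫ i ⟶ j ≫ p), B.mem j → (A k.succ.succ).mem q → (A k.succ.succ).mem p → B.mem i →
      Compat t (s.tr k.succ.succ) (E.G (Fin.succ_pos k)) (E'.G (Fin.succ_pos k)) β := by
    intro k X Y Z W j q p i β hj hq hp hi
    have cl := Compat.pastingClosed t (s.tr k.succ.succ) (E.G (Fin.succ_pos k))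
      (E'.G (Fin.succ_pos k))
    have base₁ : ∀ {X Y Z W : C} {j : X ⟶ Y} {q : X ⟶ Z} {p : Y ⟶ W} {i : Z ⟶ W}
      (α : q ≫ i ⟶ j ≫ p), (A 0).mem j → (A k.succ.succ).mem q → (A k.succ.succ).mem p →
        (A 0).mem i →
        Compat t (s.tr k.succ.succ) (E.G (Fin.succ_pos k)) (E'.G (Fin.succ_pos k)) α := by
      intro X Y Z W j q p i α hj hq hp hi _ _ _ _
      have h := (compat_iff_cyl _ _ _ _ _ _).1 (s.compat (i := 0) (j := k.succ.succ)
        (Fin.succ_pos _) hj hq hp hi α)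
      have e : ∀ E : GD D (coarsen B A), E.full (merge_mono (i := (0 : Fin (m + 2)))
        (j := k.succ.succ) (Fin.succ_pos _).le) = E.G (Fin.succ_pos k) :=
          fun E => E.full_of_lt (Fin.succ_pos k)
      dsimp only [comparisonObj] at h
      rw [e, e, ← ht₁] at h
      exact h
    have base₂ : ∀ {X Y Z W : C} {j : X ⟶ Y} {q : X ⟶ Z} {p : Y ⟶ W} {i : Z ⟶ W}
      (α : q ≫ i ⟶ j ≫ p), (A 1).mem j → (A k.succ.succ).mem q → (A k.succ.succ).mem p →
        (A 1).mem i →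
        Compat t (s.tr k.succ.succ) (E.G (Fin.succ_pos k)) (E'.G (Fin.succ_pos k)) α := by
      intro X Y Z W j q p i α hj hq hp hi _ _ _ _
      have h := (compat_iff_cyl _ _ _ _ _ _).1 (s.compat (i := 1) (j := k.succ.succ)
        (by simp [Fin.lt_def]) hj hq hp hi α)
      have e : ∀ E : GD D (coarsen B A), E.full (merge_mono (i := (1 : Fin (m + 2)))
        (j := k.succ.succ) (by simp [Fin.le_def])) = E.G (Fin.succ_pos k) :=
          fun E => E.full_of_lt (Fin.succ_pos k)
      dsimp only [comparisonObj] at h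
      rw [e, e, ← ht₂] at h
      exact h
    obtain ⟨X', f, k', r, β', γ, δ, hk, hr, hf, hβ', rfl⟩ := h_v k β hi hj hp hq
    refine cl.pasteTriangles hi hj hp hq hk hr hf
      (cl.cartesian hA₁ hA₂ h_i (h_iii k).1 (h_iii k).2 (h_iv k).1 (h_iv k).2
        (fun α h₁ h₂ h₃ h₄ _ => base₁ α h₁ h₂ h₃ h₄) (fun α h₁ h₂ h₃ h₄ _ => base₂ α h₁ h₂ h₃ h₄)
        β' hk hr hp hi hβ')
      (cl.swap_of_generates (fun _ _ _ h => h) (WideSub.inf_le_inf_right _ hA₁)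
        (WideSub.inf_le_inf_right _ hA₂) (h_vi k)
        (fun f hf => base₁ _ hf.1 hf.2 ((A _).id_mem _) ((A _).id_mem _))
        (fun f hf => base₂ _ hf.1 hf.2 ((A _).id_mem _) ((A _).id_mem _)) f hf)
  let tr : ∀ i, PsTrans (E.ps i) (E'.ps i) s.app :=
    Fin.cases t (fun k => s.tr k.succ.succ)
  refine ⟨⟨s.app, tr, fun {i j} hij {X Y Z W b q p a} hb hq hp ha α => ?_⟩, ?_⟩
  · induction j using Fin.cases with
    | zero => exact absurd hij (Fin.not_lt_zero i)
    | succ j =>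
      induction i using Fin.cases with
      | zero => exact (compat_iff_cyl _ _ _ _ _ _).2 (key j α hb hq hp ha hb hq hp ha)
      | succ i =>
        have h := s.compat (i := i.succ.succ) (j := j.succ.succ) (Fin.succ_lt_succ_iff.2 hij)
          hb hq hp ha α
        have e : ∀ E : GD D (coarsen B A), E.full (merge_mono (i := i.succ.succ)
          (j := j.succ.succ) (Fin.succ_lt_succ_iff.2 hij).le) = E.G hij :=
            fun E => E.full_of_lt hij
        dsimp only [comparisonObj] at h
        rw [e, e] at h
        exact h
  · refine GD.Hom.ext' rfl fun i => heq_of_eq ?_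
    induction i using Fin.cases with
    | zero => exact ht₁
    | succ i =>
      induction i using Fin.cases with
      | zero => exact ht₂
      | succ i => rfl

/-- The comparison 2-functor is 2-fully faithful. -/
theorem comparison_isTwoFullyFaithful [Strict D] (hA₁ : A 0 ≤ B) (hA₂ : A 1 ≤ B)
    (h_i : Factors (A 0) (A 1) B)
    (h_ii : HasFiberProductsAgreeing (A 1) B)
    (h_iii : ∀ i : Fin m, HasBaseChanges (A i.succ.succ) (A 1) ∧
      StableUnderBaseChange (A i.succ.succ) (A 1))
    (h_iv : ∀ j : Fin m, StableUnderBaseChange (A 0) (A j.succ.succ) ∧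
      StableUnderBaseChange (A 1) (A j.succ.succ))
    (h_v : ∀ i : Fin m, Squaring B (A i.succ.succ))
    (h_vi : ∀ i : Fin m, Generates (A 0 ⊓ A i.succ.succ) (A 1 ⊓ A i.succ.succ)
      (B ⊓ A i.succ.succ)) :
    IsTwoFullyFaithful (comparison (D := D) B A hA₁ hA₂) where
  bijective _ _ := ⟨comparisonMap_injective hA₁ hA₂ h_i,
    comparisonMap_surjective hA₁ hA₂ h_i h_ii h_iii h_iv h_v h_vi⟩
  full _ _ := by
    refine ⟨fun {s t} (Ξ : GD.Hom₂ (comparisonMap B A hA₁ hA₂ s) (comparisonMap B A hA₁ hA₂ t)) =>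
      ⟨GD.Hom₂.mk (s := s) (t := t) (fun X => Ξ.app X) (fun i X Y f hf => ?_), rfl⟩⟩
    induction i using Fin.cases with
    | zero =>
      exact PsTrans.modification_of_factors hA₁ hA₂ h_i (fun X => Ξ.app X)
        (fun f hf => Ξ.nat 0 f hf) (fun f hf => Ξ.nat 1 f hf) f hf
    | succ i => exact Ξ.nat i.succ.succ f hf
  faithful _ _ := ⟨fun {_ _ _ _} e => GD.hom₂_ext fun X =>
    congrFun (congrArg GD.Hom₂.app e) X⟩

end FullyFaithful

section Tri

variable {C : Type u} [Bicategory.{w, v} C] [IsLocallyGroupoid C] {D : Type u'}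
  [Bicategory.{w', v'} D] {P Q : WideSub C} {F₀ : C → D} {F₁ : PsFun P F₀} {F₂ : PsFun Q F₀}
  (G : Gluing F₁ F₂)

namespace Gluing

/-- The 2-cell that a gluing datum attaches to a triangle. -/
noncomputable def tri {X Y Z : C} {a : X ⟶ Z} {b : X ⟶ Y} {s : Y ⟶ Z} (ha : P.mem a)
    (hb : P.mem b) (hs : Q.mem s) (σ : a ⟶ b ≫ s) :
    F₁.map a ha ≅ F₁.map b hb ≫ F₂.map s hs :=
  (λ_ _).symm ≪≫ whiskerRightIso (F₂.mapId X).symm _ ≪≫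
    G.iso hb (Q.id_mem X) hs ha ((λ_ a).hom ≫ σ)

lemma tri_comp {X Y Z : C} {a' a : X ⟶ Z} {b : X ⟶ Y} {s : Y ⟶ Z} (ha' : P.mem a')
    (ha : P.mem a) (hb : P.mem b) (hs : Q.mem s) (η : a' ⟶ a) (σ : a ⟶ b ≫ s) :
    (G.tri ha' hb hs (η ≫ σ)).hom = F₁.map₂ ha' ha η ≫ (G.tri ha hb hs σ).hom := by
  have e : (λ_ a').hom ≫ η ≫ σ = 𝟙 X ◁ η ≫ (λ_ a).hom ≫ σ := by simp
  simp only [tri, Iso.trans_hom, e, G.iso_whiskerLeft hb (Q.id_mem X) hs ha ha']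
  simp [← whisker_exchange_assoc]

lemma tri_whiskerLeft {X Y Z : C} {a : X ⟶ Z} {b : X ⟶ Y} {s s' : Y ⟶ Z}
    (ha : P.mem a) (hb : P.mem b) (hs : Q.mem s) (hs' : Q.mem s') (σ : a ⟶ b ≫ s) (ξ : s ⟶ s') :
    (G.tri ha hb hs' (σ ≫ b ◁ ξ)).hom =
      (G.tri ha hb hs σ).hom ≫ F₁.map b hb ◁ F₂.map₂ hs hs' ξ := by
  simp only [tri, Iso.trans_hom, ← Category.assoc (λ_ a).hom,
    G.iso_vertical_right hb (Q.id_mem X) hs hs' ha]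
  simp

lemma tri_whiskerRight {X Y Z : C} {a : X ⟶ Z} {b b' : X ⟶ Y} {s : Y ⟶ Z}
    (ha : P.mem a) (hb : P.mem b) (hb' : P.mem b') (hs : Q.mem s) (σ : a ⟶ b ≫ s) (ζ : b ⟶ b') :
    (G.tri ha hb' hs (σ ≫ ζ ▷ s)).hom =
      (G.tri ha hb hs σ).hom ≫ F₁.map₂ hb hb' ζ ▷ F₂.map s hs := by
  simp only [tri, Iso.trans_hom, ← Category.assoc (λ_ a).hom,
    G.iso_whiskerRight hb hb' (Q.id_mem X) hs ha]
  simp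

lemma tri_rightUnitor_inv {X Y : C} {a : X ⟶ Y} (ha : P.mem a) :
    (G.tri ha ha (Q.id_mem Y) (ρ_ a).inv).hom =
      (ρ_ _).inv ≫ F₁.map a ha ◁ (F₂.mapId Y).inv := by
  have h := G.ax_a ha ha (𝟙 a)
  rw [F₁.map₂_id, Category.id_comp, Category.id_comp] at h
  simp only [tri, Iso.trans_hom, h]
  simp

/-- Pasting a triangle on the top edge of a square. -/
lemma iso_tri_top {X Y Z W V : C} {c : X ⟶ Y} {q : X ⟶ Z} {r : Y ⟶ W} {i : Z ⟶ W} {c' : X ⟶ V}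
    {s : V ⟶ Y} (hc : P.mem c) (hq : Q.mem q) (hr : Q.mem r) (hi : P.mem i) (hc' : P.mem c')
    (hs : Q.mem s) (κ : q ≫ i ⟶ c ≫ r) (σ : c ⟶ c' ≫ s) :
    (G.iso hc' hq (Q.comp_mem hs hr) hi (κ ≫ σ ▷ r ≫ (α_ c' s r).hom)).hom =
      (G.iso hc hq hr hi κ).hom ≫ (G.tri hc hc' hs σ).hom ▷ F₂.map r hr ≫ (α_ _ _ _).hom ≫
        F₁.map c' hc' ◁ (F₂.mapComp s r hs hr).inv := by
  have e : vpaste ((λ_ c).hom ≫ σ) κ = (λ_ q).hom ▷ i ≫ κ ≫ σ ▷ r ≫ (α_ c' s r).hom := by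
    dsimp only [vpaste]
    calc _ = 𝟙 _ ⊗≫ (𝟙 X ◁ κ) ⊗≫ σ ▷ r ⊗≫ 𝟙 _ := by bicategory
      _ = _ := by rw [id_whiskerLeft]; bicategory
  have h := G.ax_b hc' hc hi (Q.id_mem X) hs hq hr ((λ_ c).hom ≫ σ) κ
  rw [e, G.iso_vertical_left hc' hq (Q.comp_mem (Q.id_mem X) hq) (Q.comp_mem hs hr) hi,
    F₂.map₂_leftUnitor] at h
  simp only [comp_whiskerRight, Category.assoc] at h
  rw [cancel_epi] at h
  rw [← cancel_epi ((λ_ (F₂.map q hq)).hom ▷ F₁.map i hi),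
    ← cancel_epi ((F₂.mapId X).hom ▷ F₂.map q hq ▷ F₁.map i hi), h]
  simp only [tri, Iso.trans_hom, vpaste]
  calc _ = 𝟙 _ ⊗≫ F₂.map (𝟙 X) _ ◁ (G.iso hc hq hr hi κ).hom ⊗≫
        ((F₂.mapId X).hom ≫ (F₂.mapId X).inv) ▷ (F₁.map c hc ≫ F₂.map r hr) ⊗≫
        (G.iso hc' (Q.id_mem X) hs hc ((λ_ c).hom ≫ σ)).hom ▷ F₂.map r hr ⊗≫
        F₁.map c' hc' ◁ (F₂.mapComp s r hs hr).inv ⊗≫ 𝟙 _ := by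
          rw [Iso.hom_inv_id]; bicategory
    _ = 𝟙 _ ⊗≫ (F₂.map (𝟙 X) (Q.id_mem X) ◁ (G.iso hc hq hr hi κ).hom ≫
        (F₂.mapId X).hom ▷ (F₁.map c hc ≫ F₂.map r hr)) ⊗≫ ((F₂.mapId X).inv ▷ F₁.map c hc ≫
        (G.iso hc' (Q.id_mem X) hs hc ((λ_ c).hom ≫ σ)).hom) ▷ F₂.map r hr ⊗≫
        F₁.map c' hc' ◁ (F₂.mapComp s r hs hr).inv ⊗≫ 𝟙 _ := by bicategory
    _ = _ := by
          rw [whisker_exchange, id_whiskerLeft]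
          simp only [Iso.symm_hom, whiskerRightIso_hom]
          bicategory

/-- Pasting a triangle on the bottom edge of a square. -/
lemma iso_tri_bot {X Y Z W V : C} {j : X ⟶ Y} {q : X ⟶ Z} {p : Y ⟶ W} {i' : Z ⟶ W} {i : Z ⟶ V}
    {s : W ⟶ V} (hj : P.mem j) (hq : Q.mem q) (hp : Q.mem p) (hi' : P.mem i') (hi : P.mem i)
    (hs : Q.mem s) (κ : q ≫ i' ⟶ j ≫ p) (σ : i ⟶ i' ≫ s) :
    (G.iso hj hq (Q.comp_mem hp hs) hi
      (q ◁ σ ≫ (α_ q i' s).inv ≫ κ ▷ s ≫ (α_ j p s).hom)).hom =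
      F₂.map q hq ◁ (G.tri hi hi' hs σ).hom ≫ (α_ _ _ _).inv ≫
        (G.iso hj hq hp hi' κ).hom ▷ F₂.map s hs ≫ (α_ _ _ _).hom ≫
        F₁.map j hj ◁ (F₂.mapComp p s hp hs).inv := by
  have e : vpaste κ ((λ_ i).hom ≫ σ) = (ρ_ q).hom ▷ i ≫ q ◁ σ ≫ (α_ q i' s).inv ≫ κ ▷ s ≫
      (α_ j p s).hom := by
    dsimp only [vpaste]
    bicategory
  have h := G.ax_b hj hi' hi hq hp (Q.id_mem Z) hs κ ((λ_ i).hom ≫ σ)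
  rw [e, G.iso_vertical_left hj hq (Q.comp_mem hq (Q.id_mem Z)) (Q.comp_mem hp hs) hi,
    F₂.map₂_rightUnitor] at h
  simp only [comp_whiskerRight, Category.assoc] at h
  rw [cancel_epi] at h
  rw [← cancel_epi ((ρ_ (F₂.map q hq)).hom ▷ F₁.map i hi),
    ← cancel_epi ((F₂.map q hq ◁ (F₂.mapId Z).hom) ▷ F₁.map i hi), h]
  simp only [tri, Iso.trans_hom, vpaste]
  calc _ = 𝟙 _ ⊗≫ F₂.map q hq ◁ (G.iso hi' (Q.id_mem Z) hs hi ((λ_ i).hom ≫ σ)).hom ⊗≫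
          (G.iso hj hq hp hi' κ).hom ▷ F₂.map s hs ⊗≫
          F₁.map j hj ◁ (F₂.mapComp p s hp hs).inv ⊗≫ 𝟙 _ := by bicategory
    _ = 𝟙 _ ⊗≫ F₂.map q hq ◁ ((F₂.mapId Z).hom ≫ (F₂.mapId Z).inv) ▷ F₁.map i hi ⊗≫
          F₂.map q hq ◁ (G.iso hi' (Q.id_mem Z) hs hi ((λ_ i).hom ≫ σ)).hom ⊗≫
          (G.iso hj hq hp hi' κ).hom ▷ F₂.map s hs ⊗≫
          F₁.map j hj ◁ (F₂.mapComp p s hp hs).inv ⊗≫ 𝟙 _ := by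
            rw [Iso.hom_inv_id]; bicategory
    _ = _ := by simp only [Iso.symm_hom, whiskerRightIso_hom]; bicategory

lemma tri_trans {X Z V W : C} {a : X ⟶ Z} {b : X ⟶ V} {s : V ⟶ Z} {c : X ⟶ W} {t : W ⟶ V}
    (ha : P.mem a) (hb : P.mem b) (hs : Q.mem s) (hc : P.mem c) (ht : Q.mem t) (σ : a ⟶ b ≫ s)
    (ω : b ⟶ c ≫ t) :
    (G.tri ha hc (Q.comp_mem ht hs) (σ ≫ ω ▷ s ≫ (α_ c t s).hom)).hom =
      (G.tri ha hb hs σ).hom ≫ (G.tri hb hc ht ω).hom ▷ F₂.map s hs ≫ (α_ _ _ _).hom ≫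
        F₁.map c hc ◁ (F₂.mapComp t s ht hs).inv := by
  have h := G.iso_tri_top hb (Q.id_mem X) hs ha hc ht ((λ_ a).hom ≫ σ) ω
  simp only [Category.assoc] at h
  simp only [tri, Iso.trans_hom, h, Category.assoc]

/-- Horizontal pasting of a triangle and a square. -/
lemma tri_hpaste {X Y Z V U : C} {a : X ⟶ Z} {a' : X ⟶ V} {s : V ⟶ Z} {d : Z ⟶ Y} {e : V ⟶ U}
    {u : U ⟶ Y} (ha : P.mem a) (ha' : P.mem a') (hs : Q.mem s) (hd : P.mem d) (he : P.mem e)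
    (hu : Q.mem u) (σ : a ⟶ a' ≫ s) (κ : s ≫ d ⟶ e ≫ u) :
    (G.tri (P.comp_mem ha hd) (P.comp_mem ha' he) hu
      (σ ▷ d ≫ (α_ a' s d).hom ≫ a' ◁ κ ≫ (α_ a' e u).inv)).hom =
      (F₁.mapComp a d ha hd).hom ≫ (G.tri ha ha' hs σ).hom ▷ F₁.map d hd ≫ (α_ _ _ _).hom ≫
        F₁.map a' ha' ◁ (G.iso he hs hu hd κ).hom ≫ (α_ _ _ _).inv ≫
        (F₁.mapComp a' e ha' he).inv ▷ F₂.map u hu := by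
  have h := G.ax_b' (Q.id_mem X) hs hu ha' ha he hd ((λ_ a).hom ≫ σ) κ
  have e : hpaste ((λ_ a).hom ≫ σ) κ =
      (λ_ (a ≫ d)).hom ≫ σ ▷ d ≫ (α_ a' s d).hom ≫ a' ◁ κ ≫ (α_ a' e u).inv := by
    dsimp only [hpaste]
    bicategory
  rw [e] at h
  simp only [tri, Iso.trans_hom, h, hpaste]
  simp [← whisker_exchange_assoc]

lemma tri_comp_whiskerLeft {X Y Z U : C} {a : X ⟶ Z} {d : Z ⟶ Y} {e : Z ⟶ U}
    {u : U ⟶ Y} (ha : P.mem a) (hd : P.mem d) (he : P.mem e)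
    (hu : Q.mem u) (ω : d ⟶ e ≫ u) :
    (G.tri (P.comp_mem ha hd) (P.comp_mem ha he) hu (a ◁ ω ≫ (α_ a e u).inv)).hom =
      (F₁.mapComp a d ha hd).hom ≫ F₁.map a ha ◁ (G.tri hd he hu ω).hom ≫ (α_ _ _ _).inv ≫
        (F₁.mapComp a e ha he).inv ▷ F₂.map u hu := by
  have h := G.tri_hpaste ha ha (Q.id_mem Z) hd he hu (ρ_ a).inv ((λ_ d).hom ≫ ω)
  have e' : (ρ_ a).inv ▷ d ≫ (α_ a (𝟙 Z) d).hom ≫ a ◁ ((λ_ d).hom ≫ ω) ≫ (α_ a e u).inv =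
    a ◁ ω ≫ (α_ a e u).inv := by simp
  rw [e', tri_rightUnitor_inv] at h
  rw [h]
  simp [tri]

end Gluing

end Tri

section NF

variable {C : Type u} [Bicategory.{w, v} C] {D : Type u'}
  [Bicategory.{w', v'} D] {P Q : WideSub C} {F₀ : C → D} {F₁ : PsFun P F₀} {F₂ : PsFun Q F₀}

/-- Composites of a 1-cell of `P` and a 1-cell of `Q`. -/
structure NF (P Q : WideSub C) (X Y : C) where
  {V : C}
  {a : X ⟶ V}
  {p : V ⟶ Y}
  ha : P.mem a
  hp : Q.mem p

namespace NF

variable {X Y : C}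

/-- The composite. -/
abbrev hom (K : NF P Q X Y) : X ⟶ Y := K.a ≫ K.p

/-- The composite of the images. -/
abbrev map (F₁ : PsFun P F₀) (F₂ : PsFun Q F₀) (K : NF P Q X Y) : F₀ X ⟶ F₀ Y :=
  F₁.map K.a K.ha ≫ F₂.map K.p K.hp

/-- A 2-cell between composites that is given by a 1-cell of `Q` between the middle objects. -/
structure Ref (K M : NF P Q X Y) where
  {s : M.V ⟶ K.V}
  hs : Q.mem s
  σ : K.a ⟶ M.a ≫ s
  τ : s ≫ K.p ⟶ M.p

namespace Ref

/-- The underlying 2-cell. -/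
def cell {K M : NF P Q X Y} (e : Ref K M) : K.hom ⟶ M.hom :=
  e.σ ▷ K.p ≫ (α_ M.a e.s K.p).hom ≫ M.a ◁ e.τ

/-- Composition. -/
abbrev comp {K M N : NF P Q X Y} (e : Ref K M) (e' : Ref M N) : Ref K N where
  s := e'.s ≫ e.s
  hs := Q.comp_mem e'.hs e.hs
  σ := e.σ ≫ e'.σ ▷ e.s ≫ (α_ _ _ _).hom
  τ := (α_ _ _ _).hom ≫ e'.s ◁ e.τ ≫ e'.τ

lemma cell_comp {K M N : NF P Q X Y} (e : Ref K M) (e' : Ref M N) :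
    (e.comp e').cell = e.cell ≫ e'.cell := by
  dsimp only [cell, comp]
  calc _ = 𝟙 _ ⊗≫ e.σ ▷ K.p ⊗≫ (e'.σ ▷ (e.s ≫ K.p) ≫ (N.a ≫ e'.s) ◁ e.τ) ⊗≫
        N.a ◁ e'.τ ⊗≫ 𝟙 _ := by bicategory
    _ = _ := by rw [← whisker_exchange]; bicategory

variable [IsLocallyGroupoid C] (G : Gluing F₁ F₂)

/-- The image of a 2-cell. -/
noncomputable abbrev iso {K M : NF P Q X Y} (e : Ref K M) : K.map F₁ F₂ ≅ M.map F₁ F₂ :=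
  whiskerRightIso (G.tri K.ha M.ha e.hs e.σ) _ ≪≫ α_ _ _ _ ≪≫
    whiskerLeftIso _ ((F₂.mapComp e.s K.p e.hs K.hp).symm ≪≫
      F₂.map₂Iso (Q.comp_mem e.hs K.hp) M.hp e.τ)

lemma iso_comp {K M N : NF P Q X Y} (e : Ref K M) (e' : Ref M N) :
    ((e.comp e').iso G).hom = (e.iso G).hom ≫ (e'.iso G).hom := by
  simp only [iso, comp, Iso.trans_hom, whiskerRightIso_hom, whiskerLeftIso_hom, Iso.symm_hom,
    G.tri_trans K.ha M.ha e.hs N.ha e'.hs, PsFun.map₂Iso]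
  rw [F₂.map₂_comp _ (Q.comp_mem e'.hs (Q.comp_mem e.hs K.hp)), F₂.map₂_comp _
    (Q.comp_mem e'.hs M.hp) N.hp, F₂.map₂_associator _ _ _ e'.hs e.hs K.hp,
    F₂.map₂_whiskerLeft e'.s e'.hs (Q.comp_mem e.hs K.hp) M.hp]
  have h := whisker_exchange (G.tri M.ha N.ha e'.hs e'.σ).hom
    ((F₂.mapComp e.s K.p e.hs K.hp).inv ≫ F₂.map₂ (Q.comp_mem e.hs K.hp) M.hp e.τ)
  simp only [whiskerLeft_comp, Category.assoc] at h
  simp only [whiskerLeft_comp, comp_whiskerRight, Category.assoc, reassoc_of% h]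
  simp

lemma iso_congr {K M : NF P Q X Y} {s s' : M.V ⟶ K.V} (hs : Q.mem s) (hs' : Q.mem s')
    (σ : K.a ⟶ M.a ≫ s) (ξ : s ⟶ s') (τ : s' ≫ K.p ⟶ M.p) :
    (iso G (Ref.mk hs' (σ ≫ M.a ◁ ξ) τ)).hom = (iso G (Ref.mk hs σ (ξ ▷ K.p ≫ τ))).hom := by
  simp only [iso, Iso.trans_hom, whiskerRightIso_hom, whiskerLeftIso_hom, Iso.symm_hom,
    G.tri_whiskerLeft K.ha M.ha hs hs', PsFun.map₂Iso]
  rw [F₂.map₂_comp _ (Q.comp_mem hs' K.hp), F₂.map₂_whiskerRight hs hs' ξ K.p K.hp]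
  simp

end Ref

end NF

end NF

section NF

variable {C : Type u} [Bicategory.{w, v} C] [IsLocallyGroupoid C] {D : Type u'}
  [Bicategory.{w', v'} D] {P Q B : WideSub C} {F₀ : C → D} {F₁ : PsFun P F₀} {F₂ : PsFun Q F₀}

lemma Roofed.exists_ref (h : Roofed P Q) {X Y : C} {K L : NF P Q X Y} (θ : K.hom ⟶ L.hom) :
    ∃ (M : NF P Q X Y) (e : NF.Ref K M) (e' : NF.Ref L M), e.cell = θ ≫ e'.cell := by
  obtain ⟨V, b, s, s', σ, σ', τ, hb, hs, hs', e⟩ := h K.a K.p L.a L.p K.ha K.hp L.ha L.hp θ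
  exact ⟨⟨hb, Q.comp_mem hs' L.hp⟩, ⟨hs, σ, τ⟩, ⟨hs', σ', 𝟙 _⟩, by simpa [NF.Ref.cell] using e⟩

lemma whiskered_roof {X Z E V U Z' : C} {a : X ⟶ Z} {d : Z ⟶ E} {b : X ⟶ V} {m : V ⟶ E} {c : X ⟶ U}
    {t' : U ⟶ Z} {t : U ⟶ V} {q : E ⟶ Z'} {i : Z ⟶ Z'} {s : V ⟶ Z'} (γ₀ : d ≫ q ⟶ i) (γ : m ≫ q ⟶ s)
    (σ : a ≫ i ⟶ b ≫ s) {χ : a ≫ d ⟶ b ≫ m} {ω' : a ⟶ c ≫ t'} {ω : b ⟶ c ≫ t} {υ : t' ≫ d ⟶ t ≫ m}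
    (hχ : χ ▷ q = (α_ a d q).hom ≫ a ◁ γ₀ ≫ σ ≫ b ◁ inv γ ≫ (α_ b m q).inv)
    (e : ω' ▷ d ≫ (α_ c t' d).hom ≫ c ◁ υ = χ ≫ ω ▷ m ≫ (α_ c t m).hom) :
    ω' ▷ i ≫ (α_ c t' i).hom ≫
      c ◁ (t' ◁ inv γ₀ ≫ (α_ t' d q).inv ≫ υ ▷ q ≫ (α_ t m q).hom ≫ t ◁ γ) =
      σ ≫ ω ▷ s ≫ (α_ c t s).hom := by
  calc _ = 𝟙 _ ⊗≫ (ω' ▷ i ≫ (c ≫ t') ◁ inv γ₀) ⊗≫ c ◁ υ ▷ q ⊗≫ c ◁ t ◁ γ ⊗≫ 𝟙 _ := by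
        bicategory
    _ = 𝟙 _ ⊗≫ a ◁ inv γ₀ ⊗≫ (ω' ▷ d ≫ (α_ c t' d).hom ≫ c ◁ υ) ▷ q ⊗≫ c ◁ t ◁ γ ⊗≫ 𝟙 _ := by
        rw [← whisker_exchange]; bicategory
    _ = 𝟙 _ ⊗≫ a ◁ inv γ₀ ⊗≫ χ ▷ q ⊗≫ (ω ▷ (m ≫ q) ≫ (c ≫ t) ◁ γ) ⊗≫ 𝟙 _ := by
        rw [e]; bicategory
    _ = 𝟙 _ ⊗≫ a ◁ (inv γ₀ ≫ γ₀) ⊗≫ σ ⊗≫ b ◁ (inv γ ≫ γ) ⊗≫ ω ▷ s ⊗≫ 𝟙 _ := by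
        rw [hχ, ← whisker_exchange]; bicategory
    _ = _ := by
        rw [IsIso.inv_hom_id, IsIso.inv_hom_id]; bicategory

lemma NF.Ref.iso_congr' (G : Gluing F₁ F₂) {X Y : C} {K M : NF P Q X Y} (e : K.Ref M)
    {s : M.V ⟶ K.V} (hs : Q.mem s) (ξ : s ⟶ e.s) {σ : K.a ⟶ M.a ≫ s} (h : σ ≫ M.a ◁ ξ = e.σ) :
    (e.iso G).hom = ((NF.Ref.mk hs σ (ξ ▷ K.p ≫ e.τ)).iso G).hom := by
  have := NF.Ref.iso_congr G hs e.hs σ ξ e.τ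
  simp only [h] at this
  exact this

/-- The image of a 2-cell does not depend on the 1-cell between the middle objects. -/
lemma NF.Ref.iso_unique (hP : P ≤ B) (hQ : Q ≤ B) (hroof : Roofed P Q)
    (hfib : HasFiberProductsAgreeing Q B) (G : Gluing F₁ F₂) {X Y : C} {K M : NF P Q X Y}
    (e e' : K.Ref M) (h : e.cell = e'.cell) : (e.iso G).hom = (e'.iso G).hom := by
  obtain ⟨E, j, q, κ, hκ⟩ := hfib.1 K.p K.p K.hp K.hp
  obtain ⟨m, γ, δ, hm, hmκ⟩ := hκ.essSurj (u := e'.s) (v := e.s) e'.hs e.hs (e.τ ≫ inv e'.τ)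
  obtain ⟨d, γ₀, δ₀, hd, hdκ⟩ := hκ.essSurj (u := 𝟙 K.V) (v := 𝟙 K.V) (Q.id_mem _) (Q.id_mem _)
    (𝟙 (𝟙 K.V ≫ K.p))
  have hm' : γ ▷ K.p ≫ e.τ = precompSquare m κ ≫ δ ▷ K.p ≫ e'.τ := by
    rw [reassoc_of% hmκ]; simp
  have hd' : inv γ₀ ▷ K.p ≫ precompSquare d κ = inv δ₀ ▷ K.p := by
    rw [← cancel_mono (δ₀ ▷ K.p), Category.assoc, hdκ]
    simp [← comp_whiskerRight]
  have hd'' : precompSquare d κ = γ₀ ▷ K.p ≫ inv δ₀ ▷ K.p := by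
    rw [← hd', ← comp_whiskerRight_assoc]; simp
  have hm'' : inv γ ▷ K.p ≫ precompSquare m κ = e.τ ≫ inv e'.τ ≫ inv δ ▷ K.p := by
    rw [← cancel_mono (δ ▷ K.p), Category.assoc, hmκ]
    simp [← comp_whiskerRight, ← comp_whiskerRight_assoc]
  have h' : e.σ ▷ K.p ≫ (α_ M.a e.s K.p).hom ≫ M.a ◁ e.τ ≫ M.a ◁ inv e'.τ =
      e'.σ ▷ K.p ≫ (α_ M.a e'.s K.p).hom := by
    have h₀ := h
    simp only [NF.Ref.cell] at h₀
    rw [reassoc_of% h₀, ← whiskerLeft_comp]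
    simp
  obtain ⟨χ, ⟨hχ₁, hχ₂⟩, -⟩ := (hfib.2 κ hκ).fullyFaithful
    (B.comp_mem (hP _ K.ha) (hQ _ hd)) (B.comp_mem (hP _ M.ha) (hQ _ hm))
    ((α_ K.a d q).hom ≫ K.a ◁ γ₀ ≫ ((ρ_ K.a).hom ≫ e.σ) ≫ M.a ◁ inv γ ≫ (α_ M.a m q).inv)
    ((α_ K.a d j).hom ≫ K.a ◁ δ₀ ≫ ((ρ_ K.a).hom ≫ e'.σ) ≫ M.a ◁ inv δ ≫ (α_ M.a m j).inv) (by
      calc _ = 𝟙 _ ⊗≫ K.a ◁ γ₀ ▷ K.p ⊗≫ e.σ ▷ K.p ⊗≫ M.a ◁ (inv γ ▷ K.p ≫ precompSquare m κ) ⊗≫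
            𝟙 _ := by dsimp only [precompSquare]; bicategory
        _ = 𝟙 _ ⊗≫ K.a ◁ γ₀ ▷ K.p ⊗≫ (e.σ ▷ K.p ≫ (α_ M.a e.s K.p).hom ≫ M.a ◁ e.τ ≫
            M.a ◁ inv e'.τ) ⊗≫ M.a ◁ inv δ ▷ K.p ⊗≫ 𝟙 _ := by
          rw [hm'']; bicategory
        _ = 𝟙 _ ⊗≫ K.a ◁ (γ₀ ▷ K.p ≫ (inv δ₀ ≫ δ₀) ▷ K.p) ⊗≫ e'.σ ▷ K.p ⊗≫ M.a ◁ inv δ ▷ K.p ⊗≫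
            𝟙 _ := by rw [h', IsIso.inv_hom_id]; bicategory
        _ = 𝟙 _ ⊗≫ K.a ◁ precompSquare d κ ⊗≫ K.a ◁ δ₀ ▷ K.p ⊗≫ e'.σ ▷ K.p ⊗≫
            M.a ◁ inv δ ▷ K.p ⊗≫ 𝟙 _ := by rw [hd'']; bicategory
        _ = _ := by dsimp only [precompSquare]; bicategory)
  obtain ⟨U, c, t', t, ω', ω, υ, hc, ht', ht, hr⟩ := hroof K.a d M.a m K.ha hd M.ha hm χ
  have k₁ := whiskered_roof γ₀ γ ((ρ_ K.a).hom ≫ e.σ) hχ₁ hr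
  have k₂ := whiskered_roof δ₀ δ ((ρ_ K.a).hom ≫ e'.σ) hχ₂ hr
  set N : NF P Q X Y := ⟨hc, Q.comp_mem ht M.hp⟩
  let f : M.Ref N := ⟨ht, ω, 𝟙 _⟩
  rw [← cancel_mono (f.iso G).hom, ← NF.Ref.iso_comp, ← NF.Ref.iso_comp,
    NF.Ref.iso_congr' G (e.comp f) ht' ((ρ_ t').inv ≫ t' ◁ inv γ₀ ≫ (α_ t' d q).inv ≫ υ ▷ q ≫
      (α_ t m q).hom ≫ t ◁ γ) (σ := ω') (by
        rw [← cancel_epi (ρ_ K.a).hom]; simpa [f] using k₁),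
    NF.Ref.iso_congr' G (e'.comp f) ht' ((ρ_ t').inv ≫ t' ◁ inv δ₀ ≫ (α_ t' d j).inv ≫ υ ▷ j ≫
      (α_ t m j).hom ≫ t ◁ δ) (σ := ω') (by
        rw [← cancel_epi (ρ_ K.a).hom]; simpa [f] using k₂)]
  have key : ((ρ_ t').inv ≫ t' ◁ inv γ₀ ≫ (α_ t' d q).inv ≫ υ ▷ q ≫ (α_ t m q).hom ≫ t ◁ γ) ▷ K.p ≫
      (e.comp f).τ = ((ρ_ t').inv ≫ t' ◁ inv δ₀ ≫ (α_ t' d j).inv ≫ υ ▷ j ≫ (α_ t m j).hom ≫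
        t ◁ δ) ▷ K.p ≫ (e'.comp f).τ := by
    dsimp only [f, NF.Ref.comp]
    calc _ = 𝟙 _ ⊗≫ t' ◁ inv γ₀ ▷ K.p ⊗≫ υ ▷ (q ≫ K.p) ⊗≫ t ◁ (γ ▷ K.p ≫ e.τ) ⊗≫ 𝟙 _ := by
          bicategory
      _ = 𝟙 _ ⊗≫ t' ◁ inv γ₀ ▷ K.p ⊗≫ (υ ▷ (q ≫ K.p) ≫ (t ≫ m) ◁ κ) ⊗≫
          t ◁ (δ ▷ K.p ≫ e'.τ) ⊗≫ 𝟙 _ := by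
        rw [hm']; dsimp only [precompSquare]; bicategory
      _ = 𝟙 _ ⊗≫ t' ◁ (inv γ₀ ▷ K.p ≫ precompSquare d κ) ⊗≫ υ ▷ (j ≫ K.p) ⊗≫
          t ◁ (δ ▷ K.p ≫ e'.τ) ⊗≫ 𝟙 _ := by
        rw [← whisker_exchange]; dsimp only [precompSquare]; bicategory
      _ = _ := by rw [hd']; bicategory
  rw [key]

/-- The image of a 2-cell between composites of 1-cells of `P` and of `Q`. -/
lemma NF.exists_iso (hP : P ≤ B) (hQ : Q ≤ B) (hroof : Roofed P Q)
    (hfib : HasFiberProductsAgreeing Q B) (G : Gluing F₁ F₂) {X Y : C} {K L : NF P Q X Y}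
    (θ : K.hom ⟶ L.hom) : ∃ φ : K.map F₁ F₂ ≅ L.map F₁ F₂, ∀ {M : NF P Q X Y} (e : K.Ref M)
      (e' : L.Ref M), e.cell = θ ≫ e'.cell → φ.hom ≫ (e'.iso G).hom = (e.iso G).hom := by
  obtain ⟨M, e, e', h⟩ := hroof.exists_ref θ
  refine ⟨e.iso G ≪≫ (e'.iso G).symm, fun {N} f f' hf => ?_⟩
  obtain ⟨R, g, g', hg⟩ := hroof.exists_ref (inv e'.cell ≫ f'.cell)
  have h₁ := Ref.iso_unique hP hQ hroof hfib G (e.comp g) (f.comp g') (by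
    rw [Ref.cell_comp, Ref.cell_comp, hg, h, hf]; simp)
  have h₂ := Ref.iso_unique hP hQ hroof hfib G (e'.comp g) (f'.comp g') (by
    rw [Ref.cell_comp, Ref.cell_comp, hg]; simp)
  rw [Ref.iso_comp, Ref.iso_comp] at h₁ h₂
  rw [← cancel_mono (g'.iso G).hom, ← h₁, Category.assoc, ← h₂]
  simp

end NF

section Transport

variable {C : Type u} [Bicategory.{w, v} C] [IsLocallyGroupoid C] {D : Type u'}
  [Bicategory.{w', v'} D] {P Q B : WideSub C} {F₀ : C → D} {F₁ : PsFun P F₀} {F₂ : PsFun Q F₀}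

/-- Images of the 2-cells between composites of 1-cells of `P` and of `Q`. -/
structure Transport (G : Gluing F₁ F₂) where
  roof : Roofed P Q
  iso : ∀ {X Y : C} {K L : NF P Q X Y} (_ : K.hom ⟶ L.hom), K.map F₁ F₂ ≅ L.map F₁ F₂
  iso_ref : ∀ {X Y : C} {K L M : NF P Q X Y} (θ : K.hom ⟶ L.hom) (e : K.Ref M) (e' : L.Ref M),
    e.cell = θ ≫ e'.cell → (iso θ).hom ≫ (e'.iso G).hom = (e.iso G).hom

/-- The images of 2-cells, constructed from common refinements. -/
noncomputable def Transport.mk' (hP : P ≤ B) (hQ : Q ≤ B) (hroof : Roofed P Q)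
    (hfib : HasFiberProductsAgreeing Q B) (G : Gluing F₁ F₂) : Transport G where
  roof := hroof
  iso θ := (NF.exists_iso hP hQ hroof hfib G θ).choose
  iso_ref θ e e' h := (NF.exists_iso hP hQ hroof hfib G θ).choose_spec e e' h

namespace Transport

variable {G : Gluing F₁ F₂} (T : Transport G) {X Y : C} {K L M : NF P Q X Y}

lemma iso_comp (θ : K.hom ⟶ L.hom) (θ' : L.hom ⟶ M.hom) :
    (T.iso (θ ≫ θ')).hom = (T.iso θ).hom ≫ (T.iso θ').hom := by
  obtain ⟨N, e, f, h⟩ := Roofed.exists_ref T.roof θ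
  obtain ⟨N', f', e', h'⟩ := Roofed.exists_ref T.roof θ'
  obtain ⟨R, g, g', k⟩ := Roofed.exists_ref T.roof (inv f.cell ≫ f'.cell)
  have k' : f.cell ≫ g.cell = f'.cell ≫ g'.cell := by rw [k]; simp
  rw [← cancel_mono ((e'.comp g').iso G).hom,
    T.iso_ref (θ ≫ θ') (e.comp g) (e'.comp g') (by
      simp only [NF.Ref.cell_comp, h, Category.assoc, k', reassoc_of% h']),
    Category.assoc, T.iso_ref θ' (f.comp g) (e'.comp g') (by
      rw [NF.Ref.cell_comp, NF.Ref.cell_comp, k', h', Category.assoc]),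
    T.iso_ref θ (e.comp g) (f.comp g) (by simp only [NF.Ref.cell_comp, h, Category.assoc])]

lemma iso_id : (T.iso (𝟙 K.hom)).hom = 𝟙 _ := by
  have h := T.iso_comp (𝟙 K.hom) (𝟙 K.hom)
  rw [Category.id_comp, ← cancel_epi (T.iso (𝟙 K.hom)).inv] at h
  simpa using h.symm

lemma iso_cell (e : K.Ref L) : (T.iso e.cell).hom = (e.iso G).hom := by
  obtain ⟨N, f, f', h⟩ := Roofed.exists_ref T.roof (𝟙 L.hom)
  rw [Category.id_comp] at h
  rw [← cancel_mono (f.iso G).hom, ← NF.Ref.iso_comp]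
  exact T.iso_ref e.cell (e.comp f) f (NF.Ref.cell_comp _ _)

lemma iso_eq_of_ref {e : K.Ref L} {θ : K.hom ⟶ L.hom} (h : θ = e.cell) :
    (T.iso θ).hom = (e.iso G).hom := by
  rw [h, T.iso_cell]

end Transport

end Transport

section Prod

variable {C : Type u} [Bicategory.{w, v} C] {D : Type u'}
  [Bicategory.{w', v'} D] {P Q B : WideSub C} {F₀ : C → D} {F₁ : PsFun P F₀} {F₂ : PsFun Q F₀}
  {X Y Z : C}

namespace NF

/-- A factorization of the middle part of the composite of two composites. -/
structure Prod (K : NF P Q X Y) (L : NF P Q Y Z) where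
  {W : C}
  {d : K.V ⟶ W}
  {t : W ⟶ L.V}
  hd : P.mem d
  ht : Q.mem t
  κ : K.p ≫ L.a ⟶ d ≫ t

namespace Prod

variable {K : NF P Q X Y} {L : NF P Q Y Z}

/-- The resulting composite. -/
abbrev nf (N : Prod K L) : NF P Q X Z := ⟨P.comp_mem K.ha N.hd, Q.comp_mem N.ht L.hp⟩

/-- The middle associativity 2-cell. -/
abbrev mid {B : Type*} [Bicategory B] {X U Y V Z W : B} {a : X ⟶ U} {p : U ⟶ Y} {b : Y ⟶ V}
    {q : V ⟶ Z} {d : U ⟶ W} {t : W ⟶ V} (κ : p ≫ b ⟶ d ≫ t) :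
    (a ≫ p) ≫ (b ≫ q) ⟶ (a ≫ d) ≫ (t ≫ q) :=
  (α_ a p (b ≫ q)).hom ≫ a ◁ ((α_ p b q).inv ≫ κ ▷ q ≫ (α_ d t q).hom) ≫ (α_ a d (t ≫ q)).inv

/-- The underlying 2-cell. -/
def cell (N : Prod K L) : K.hom ≫ L.hom ⟶ N.nf.hom := mid N.κ

variable [IsLocallyGroupoid C] (G : Gluing F₁ F₂)

/-- The image of the underlying 2-cell. -/
noncomputable abbrev iso (N : Prod K L) :
    K.map F₁ F₂ ≫ L.map F₁ F₂ ≅ N.nf.map F₁ F₂ :=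
  α_ _ _ _ ≪≫ whiskerLeftIso _ ((α_ _ _ _).symm ≪≫
    whiskerRightIso (G.iso N.hd K.hp N.ht L.ha N.κ) _ ≪≫ α_ _ _ _) ≪≫ (α_ _ _ _).symm ≪≫
    whiskerRightIso (F₁.mapComp K.a N.d K.ha N.hd).symm _ ≪≫
    whiskerLeftIso _ (F₂.mapComp N.t L.p N.ht L.hp).symm

lemma iso_hom (N : Prod K L) : (N.iso G).hom = mid (G.iso N.hd K.hp N.ht L.ha N.κ).hom ≫
    (F₁.mapComp K.a N.d K.ha N.hd).inv ▷ _ ≫ _ ◁ (F₂.mapComp N.t L.p N.ht L.hp).inv := by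
  simp

end Prod

end NF

end Prod

section Exchange

variable {E : Type u} [Bicategory.{w, v} E] {X U Y V Z W W' W₂ : E}

lemma mid_refine {a : X ⟶ U} {p : U ⟶ Y} {b : Y ⟶ V} {q : V ⟶ Z} {d : U ⟶ W} {t : W ⟶ V}
    {d' : U ⟶ W'} {u : W' ⟶ W} {t' : W' ⟶ V} {ad : X ⟶ W} {ad' : X ⟶ W'} {tq : W ⟶ Z}
    {ut : W' ⟶ V} {tq' : W' ⟶ Z} (κ : p ≫ b ⟶ d ≫ t) (σ : d ⟶ d' ≫ u) (m : ad ≅ a ≫ d)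
    (m' : ad' ≅ a ≫ d') (n : tq ≅ t ≫ q) (k : ut ≅ u ≫ t) (n' : tq' ≅ t' ≫ q) (τ : ut ⟶ t') :
    NF.Prod.mid (κ ≫ σ ▷ t ≫ (α_ _ _ _).hom ≫ d' ◁ (k.inv ≫ τ)) ≫ m'.inv ▷ (t' ≫ q) ≫
        ad' ◁ n'.inv =
      (NF.Prod.mid κ ≫ m.inv ▷ (t ≫ q) ≫ ad ◁ n.inv) ≫
        (m.hom ≫ a ◁ σ ≫ (α_ _ _ _).inv ≫ m'.inv ▷ u) ▷ tq ≫ (α_ _ _ _).hom ≫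
        ad' ◁ (u ◁ n.hom ≫ (α_ _ _ _).inv ≫ k.inv ▷ q ≫ τ ▷ q ≫ n'.inv) := by
  symm
  dsimp only [NF.Prod.mid]
  calc _ = 𝟙 _ ⊗≫ a ◁ κ ▷ q ⊗≫ m.inv ▷ (t ≫ q) ⊗≫ (ad ◁ n.inv ≫
        (m.hom ≫ a ◁ σ ≫ (α_ _ _ _).inv ≫ m'.inv ▷ u) ▷ tq) ⊗≫ ad' ◁ u ◁ n.hom ⊗≫
          ad' ◁ (k.inv ≫ τ) ▷ q ⊗≫ ad' ◁ n'.inv := by bicategory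
    _ = 𝟙 _ ⊗≫ a ◁ κ ▷ q ⊗≫ (m.inv ≫ m.hom) ▷ (t ≫ q) ⊗≫ a ◁ σ ▷ (t ≫ q) ⊗≫
          m'.inv ▷ (u ≫ t ≫ q) ⊗≫ ad' ◁ u ◁ (n.inv ≫ n.hom) ⊗≫
          ad' ◁ (k.inv ≫ τ) ▷ q ⊗≫ ad' ◁ n'.inv := by rw [whisker_exchange]; bicategory
    _ = 𝟙 _ ⊗≫ a ◁ κ ▷ q ⊗≫ a ◁ σ ▷ (t ≫ q) ⊗≫
          (m'.inv ▷ ((u ≫ t) ≫ q) ≫ ad' ◁ (k.inv ≫ τ) ▷ q) ⊗≫ ad' ◁ n'.inv := by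
        rw [Iso.inv_hom_id, Iso.inv_hom_id]; bicategory
    _ = _ := by rw [← whisker_exchange]; bicategory

lemma mid_left {a : X ⟶ U} {p : U ⟶ Y} {b : Y ⟶ V} {q : V ⟶ Z} {d : U ⟶ W} {t : W ⟶ V}
    {U' : E} {a' : X ⟶ U'} {s : U' ⟶ U} {sp : U' ⟶ Y} {d' : U' ⟶ W'} {u : W' ⟶ W} {ad : X ⟶ W}
    {ad' : X ⟶ W'} {tq : W ⟶ Z} {ut : W' ⟶ V} {utq : W' ⟶ Z} {r : U' ⟶ Y} (σ : a ⟶ a' ≫ s)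
    (h : sp ≅ s ≫ p) (τ : sp ≅ r) (κ : p ≫ b ⟶ d ≫ t) (κ' : s ≫ d ⟶ d' ≫ u) (m : ad ≅ a ≫ d)
    (m' : ad' ≅ a' ≫ d') (n : tq ≅ t ≫ q) (k : ut ≅ u ≫ t) (n' : utq ≅ ut ≫ q) :
    (σ ▷ p ≫ (α_ _ _ _).hom ≫ a' ◁ (h.inv ≫ τ.hom)) ▷ (b ≫ q) ≫
        NF.Prod.mid (τ.inv ▷ b ≫ h.hom ▷ b ≫ vpaste κ' κ ≫ d' ◁ k.inv) ≫ m'.inv ▷ (ut ≫ q) ≫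
        ad' ◁ n'.inv =
      (NF.Prod.mid κ ≫ m.inv ▷ (t ≫ q) ≫ ad ◁ n.inv) ≫
        (m.hom ≫ σ ▷ d ≫ (α_ _ _ _).hom ≫ a' ◁ κ' ≫ (α_ _ _ _).inv ≫ m'.inv ▷ u) ▷ tq ≫
        (α_ _ _ _).hom ≫ ad' ◁ (u ◁ n.hom ≫ (α_ _ _ _).inv ≫ k.inv ▷ q ≫ n'.inv) := by
  dsimp only [NF.Prod.mid, vpaste]
  calc _ = 𝟙 _ ⊗≫ σ ▷ p ▷ (b ≫ q) ⊗≫ a' ◁ h.inv ▷ (b ≫ q) ⊗≫ a' ◁ (τ.hom ≫ τ.inv) ▷ (b ≫ q) ⊗≫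
        a' ◁ h.hom ▷ b ▷ q ⊗≫ (a' ≫ s) ◁ κ ▷ q ⊗≫ a' ◁ κ' ▷ (t ≫ q) ⊗≫
        ((a' ≫ d') ◁ k.inv ▷ q ≫ m'.inv ▷ (ut ≫ q)) ⊗≫ ad' ◁ n'.inv := by bicategory
    _ = 𝟙 _ ⊗≫ σ ▷ p ▷ (b ≫ q) ⊗≫ a' ◁ (h.inv ≫ h.hom) ▷ (b ≫ q) ⊗≫ (a' ≫ s) ◁ κ ▷ q ⊗≫
        a' ◁ κ' ▷ (t ≫ q) ⊗≫ m'.inv ▷ ((u ≫ t) ≫ q) ⊗≫ ad' ◁ k.inv ▷ q ⊗≫ ad' ◁ n'.inv := by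
      rw [whisker_exchange, Iso.hom_inv_id]; bicategory
    _ = 𝟙 _ ⊗≫ (σ ▷ (p ≫ b) ≫ (a' ≫ s) ◁ κ) ▷ q ⊗≫
        a' ◁ κ' ▷ (t ≫ q) ⊗≫ m'.inv ▷ ((u ≫ t) ≫ q) ⊗≫ ad' ◁ k.inv ▷ q ⊗≫ ad' ◁ n'.inv := by
      rw [Iso.inv_hom_id]; bicategory
    _ = 𝟙 _ ⊗≫ a ◁ κ ▷ q ⊗≫ (𝟙 (a ≫ d) ⊗≫ σ ▷ d ⊗≫
        a' ◁ κ' ⊗≫ m'.inv ▷ u) ▷ (t ≫ q) ⊗≫ ad' ◁ k.inv ▷ q ⊗≫ ad' ◁ n'.inv := by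
      rw [← whisker_exchange]; bicategory
    _ = 𝟙 _ ⊗≫ a ◁ κ ▷ q ⊗≫ (m.inv ≫ m.hom) ▷ (t ≫ q) ⊗≫ (𝟙 (a ≫ d) ⊗≫ σ ▷ d ⊗≫
        a' ◁ κ' ⊗≫ m'.inv ▷ u) ▷ (t ≫ q) ⊗≫ ad' ◁ u ◁ (n.inv ≫ n.hom) ⊗≫ ad' ◁ k.inv ▷ q ⊗≫
        ad' ◁ n'.inv := by
      rw [Iso.inv_hom_id, Iso.inv_hom_id]; bicategory
    _ = 𝟙 _ ⊗≫ a ◁ κ ▷ q ⊗≫ m.inv ▷ (t ≫ q) ⊗≫ ((m.hom ≫ σ ▷ d ≫ (α_ _ _ _).hom ≫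
        a' ◁ κ' ≫ (α_ _ _ _).inv ≫ m'.inv ▷ u) ▷ (t ≫ q) ≫ (ad' ≫ u) ◁ n.inv) ⊗≫
        ad' ◁ u ◁ n.hom ⊗≫ ad' ◁ k.inv ▷ q ⊗≫ ad' ◁ n'.inv := by bicategory
    _ = _ := by rw [← whisker_exchange]; bicategory

lemma mid_right {a : X ⟶ U} {p : U ⟶ Y} {b : Y ⟶ V} {q : V ⟶ Z} {V' : E} {b' : Y ⟶ V'}
    {s : V' ⟶ V} {q' : V' ⟶ Z} {d : U ⟶ W} {t : W ⟶ V'} {ad : X ⟶ W} {sq : V' ⟶ Z} {tq' : W ⟶ Z}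
    {ts : W ⟶ V} {tsq : W ⟶ Z} (σ : b ⟶ b' ≫ s) (h : sq ≅ s ≫ q) (τ : sq ⟶ q')
    (κ : p ≫ b' ⟶ d ≫ t) (m : ad ≅ a ≫ d) (n : tq' ≅ t ≫ q') (k : ts ≅ t ≫ s)
    (l : tsq ≅ ts ≫ q) :
    (a ≫ p) ◁ (σ ▷ q ≫ (α_ _ _ _).hom ≫ b' ◁ (h.inv ≫ τ)) ≫ NF.Prod.mid κ ≫ m.inv ▷ (t ≫ q') ≫
        ad ◁ n.inv =
      (NF.Prod.mid (p ◁ σ ≫ (α_ _ _ _).inv ≫ κ ▷ s ≫ (α_ _ _ _).hom ≫ d ◁ k.inv) ≫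
        m.inv ▷ (ts ≫ q) ≫ ad ◁ l.inv) ≫ ad ◁ (l.hom ≫ k.hom ▷ q ≫ (α_ _ _ _).hom ≫
          t ◁ h.inv ≫ t ◁ τ ≫ n.inv) := by
  dsimp only [NF.Prod.mid]
  calc _ = 𝟙 _ ⊗≫ a ◁ p ◁ σ ▷ q ⊗≫ a ◁ ((p ≫ b') ◁ (h.inv ≫ τ) ≫ κ ▷ q') ⊗≫
        m.inv ▷ (t ≫ q') ⊗≫ ad ◁ n.inv := by bicategory
    _ = 𝟙 _ ⊗≫ a ◁ p ◁ σ ▷ q ⊗≫ a ◁ κ ▷ (s ≫ q) ⊗≫ ((a ≫ d) ◁ t ◁ (h.inv ≫ τ) ≫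
        m.inv ▷ (t ≫ q')) ⊗≫ ad ◁ n.inv := by rw [whisker_exchange]; bicategory
    _ = 𝟙 _ ⊗≫ a ◁ p ◁ σ ▷ q ⊗≫ a ◁ κ ▷ (s ≫ q) ⊗≫ m.inv ▷ ((t ≫ s) ≫ q) ⊗≫ ad ◁ (t ◁ (h.inv ≫ τ) ≫
        n.inv) := by rw [whisker_exchange]; bicategory
    _ = 𝟙 _ ⊗≫ a ◁ p ◁ σ ▷ q ⊗≫ a ◁ κ ▷ (s ≫ q) ⊗≫ (m.inv ▷ ((t ≫ s) ≫ q) ≫ ad ◁ k.inv ▷ q) ⊗≫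
        ad ◁ (l.inv ≫ l.hom) ⊗≫ ad ◁ k.hom ▷ q ⊗≫ ad ◁ (t ◁ (h.inv ≫ τ) ≫ n.inv) := by
      rw [Iso.inv_hom_id]
      have e : k.inv ▷ q ≫ k.hom ▷ q = 𝟙 _ := by rw [← comp_whiskerRight]; simp
      calc _ = 𝟙 _ ⊗≫ a ◁ p ◁ σ ▷ q ⊗≫ a ◁ κ ▷ (s ≫ q) ⊗≫ m.inv ▷ ((t ≫ s) ≫ q) ⊗≫
          ad ◁ (k.inv ▷ q ≫ k.hom ▷ q) ⊗≫ ad ◁ (t ◁ (h.inv ≫ τ) ≫ n.inv) := by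
            rw [e]; bicategory
        _ = _ := by bicategory
    _ = _ := by rw [← whisker_exchange]; bicategory

lemma mid_assoc {a : X ⟶ U} {p : U ⟶ Y} {b : Y ⟶ V} {q : V ⟶ Z} {d : U ⟶ W} {t : W ⟶ V}
    {V₂ Z₂ : E} {c : Z ⟶ V₂} {r : V₂ ⟶ Z₂} {e : V ⟶ W₂} {g : W₂ ⟶ V₂} {f : W ⟶ W'} {h : W' ⟶ W₂}
    {ad : X ⟶ W} {tq : W ⟶ Z} {adf : X ⟶ W'} {hg : W' ⟶ V₂} {hgr : W' ⟶ Z₂} {df : U ⟶ W'}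
    {adf' : X ⟶ W'} {gr : W₂ ⟶ Z₂} {hgr' : W' ⟶ Z₂} {be : Y ⟶ W₂}
    (κ₁ : p ≫ b ⟶ d ≫ t) (κ₂ : q ≫ c ⟶ e ≫ g) (κ : t ≫ e ⟶ f ≫ h) (m₁ : ad ≅ a ≫ d)
    (n₁ : tq ≅ t ≫ q) (m₂ : adf ≅ ad ≫ f) (k : hg ≅ h ≫ g) (n₂ : hgr ≅ hg ≫ r)
    (m₃ : adf' ≅ a ≫ df) (l : df ≅ d ≫ f) (n₃ : gr ≅ g ≫ r) (n₄ : hgr' ≅ h ≫ gr)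
    (b₁ : be ≅ b ≫ e) :
    (NF.Prod.mid κ₁ ≫ m₁.inv ▷ (t ≫ q) ≫ ad ◁ n₁.inv) ▷ (c ≫ r) ≫
      (NF.Prod.mid (n₁.hom ▷ c ≫ vpaste κ κ₂ ≫ f ◁ k.inv) ≫ m₂.inv ▷ (hg ≫ r) ≫ adf ◁ n₂.inv) ≫
      (m₂.hom ≫ m₁.hom ▷ f ≫ (α_ _ _ _).hom ≫ a ◁ l.inv ≫ m₃.inv) ▷ hgr ≫
      adf' ◁ (n₂.hom ≫ k.hom ▷ r ≫ (α_ _ _ _).hom ≫ h ◁ n₃.inv ≫ n₄.inv) =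
    (α_ _ _ _).hom ≫ (a ≫ p) ◁ (NF.Prod.mid κ₂ ≫ b₁.inv ▷ (g ≫ r) ≫ be ◁ n₃.inv) ≫
      NF.Prod.mid (p ◁ b₁.hom ≫ hpaste κ₁ κ ≫ l.inv ▷ h) ≫ m₃.inv ▷ (h ≫ gr) ≫ adf' ◁ n₄.inv := by
  have e₁ : ad ◁ n₁.inv ▷ (c ≫ r) ≫ ad ◁ n₁.hom ▷ (c ≫ r) = 𝟙 _ := by
    rw [← whiskerLeft_comp, ← comp_whiskerRight]; simp
  have e₂ : m₂.inv ▷ (hg ≫ r) ≫ m₂.hom ▷ (hg ≫ r) = 𝟙 _ := by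
    rw [← comp_whiskerRight]; simp
  have e₃ : adf' ◁ k.inv ▷ r ≫ adf' ◁ k.hom ▷ r = 𝟙 _ := by
    rw [← whiskerLeft_comp, ← comp_whiskerRight]; simp
  have e₅ : p ◁ b₁.inv ▷ (g ≫ r) ≫ p ◁ b₁.hom ▷ (g ≫ r) = 𝟙 _ := by
    rw [← whiskerLeft_comp, ← comp_whiskerRight]; simp
  let ζ : ad ≫ f ⟶ adf' := m₁.hom ▷ f ≫ (α_ _ _ _).hom ≫ a ◁ l.inv ≫ m₃.inv
  dsimp only [NF.Prod.mid, vpaste, hpaste]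
  calc _ = 𝟙 _ ⊗≫ a ◁ κ₁ ▷ q ▷ (c ≫ r) ⊗≫ m₁.inv ▷ ((t ≫ q) ≫ (c ≫ r)) ⊗≫
        (ad ◁ n₁.inv ▷ (c ≫ r) ≫ ad ◁ n₁.hom ▷ (c ≫ r)) ⊗≫ ad ◁ t ◁ κ₂ ▷ r ⊗≫ ad ◁ κ ▷ (g ≫ r) ⊗≫
        (ad ≫ f) ◁ k.inv ▷ r ⊗≫ m₂.inv ▷ (hg ≫ r) ⊗≫ (adf ◁ n₂.inv ≫ (m₂.hom ≫ ζ) ▷ hgr) ⊗≫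
        adf' ◁ (n₂.hom ≫ k.hom ▷ r ≫ (α_ _ _ _).hom ≫ h ◁ n₃.inv ≫ n₄.inv) := by
          dsimp only [ζ]; bicategory
    _ = 𝟙 _ ⊗≫ a ◁ κ₁ ▷ q ▷ (c ≫ r) ⊗≫ m₁.inv ▷ ((t ≫ q) ≫ (c ≫ r)) ⊗≫
        ad ◁ t ◁ κ₂ ▷ r ⊗≫ ad ◁ κ ▷ (g ≫ r) ⊗≫
        (ad ≫ f) ◁ k.inv ▷ r ⊗≫ (m₂.inv ▷ (hg ≫ r) ≫ m₂.hom ▷ (hg ≫ r)) ⊗≫ ζ ▷ (hg ≫ r) ⊗≫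
        adf' ◁ (n₂.inv ≫ n₂.hom) ⊗≫ adf' ◁ (k.hom ▷ r ≫ (α_ _ _ _).hom ≫ h ◁ n₃.inv ≫ n₄.inv) := by
          rw [e₁, whisker_exchange]; bicategory
    _ = 𝟙 _ ⊗≫ a ◁ κ₁ ▷ q ▷ (c ≫ r) ⊗≫ m₁.inv ▷ ((t ≫ q) ≫ (c ≫ r)) ⊗≫
        ad ◁ t ◁ κ₂ ▷ r ⊗≫ ad ◁ κ ▷ (g ≫ r) ⊗≫
        ((ad ≫ f) ◁ k.inv ▷ r ≫ ζ ▷ (hg ≫ r)) ⊗≫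
        adf' ◁ (k.hom ▷ r ≫ (α_ _ _ _).hom ≫ h ◁ n₃.inv ≫ n₄.inv) := by
          rw [e₂, Iso.inv_hom_id]; bicategory
    _ = 𝟙 _ ⊗≫ a ◁ κ₁ ▷ q ▷ (c ≫ r) ⊗≫ m₁.inv ▷ ((t ≫ q) ≫ (c ≫ r)) ⊗≫
        ad ◁ t ◁ κ₂ ▷ r ⊗≫ ad ◁ κ ▷ (g ≫ r) ⊗≫ ζ ▷ ((h ≫ g) ≫ r) ⊗≫
        (adf' ◁ k.inv ▷ r ≫ adf' ◁ k.hom ▷ r) ⊗≫ adf' ◁ (h ◁ n₃.inv ≫ n₄.inv) := by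
          rw [whisker_exchange]; bicategory
    _ = 𝟙 _ ⊗≫ a ◁ κ₁ ▷ q ▷ (c ≫ r) ⊗≫ (m₁.inv ▷ (t ≫ ((q ≫ c) ≫ r)) ≫
        ad ◁ t ◁ κ₂ ▷ r) ⊗≫ ad ◁ κ ▷ (g ≫ r) ⊗≫ ζ ▷ ((h ≫ g) ≫ r) ⊗≫
        adf' ◁ (h ◁ n₃.inv ≫ n₄.inv) := by
          rw [e₃]; bicategory
    _ = 𝟙 _ ⊗≫ a ◁ (κ₁ ▷ ((q ≫ c) ≫ r) ≫ (d ≫ t) ◁ κ₂ ▷ r) ⊗≫ (m₁.inv ▷ ((t ≫ e) ≫ (g ≫ r)) ≫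
        ad ◁ κ ▷ (g ≫ r)) ⊗≫ ζ ▷ ((h ≫ g) ≫ r) ⊗≫
        adf' ◁ (h ◁ n₃.inv ≫ n₄.inv) := by
          rw [← whisker_exchange]; bicategory
    _ = 𝟙 _ ⊗≫ a ◁ p ◁ b ◁ κ₂ ▷ r ⊗≫ a ◁ κ₁ ▷ (e ≫ g ≫ r) ⊗≫ a ◁ d ◁ κ ▷ (g ≫ r) ⊗≫
        (m₁.inv ▷ f ≫ m₁.hom ▷ f) ▷ (h ≫ g ≫ r) ⊗≫ (a ◁ l.inv ≫ m₃.inv) ▷ (h ≫ g ≫ r) ⊗≫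
        adf' ◁ (h ◁ n₃.inv ≫ n₄.inv) := by
          rw [← whisker_exchange, ← whisker_exchange]; dsimp only [ζ]; bicategory
    _ = 𝟙 _ ⊗≫ a ◁ p ◁ b ◁ κ₂ ▷ r ⊗≫ a ◁ (𝟙 (p ≫ b ≫ e) ⊗≫ κ₁ ▷ e ⊗≫ d ◁ κ ⊗≫ l.inv ▷ h) ▷ (g ≫ r) ⊗≫
        (m₃.inv ▷ ((h ≫ g) ≫ r) ≫ adf' ◁ ((α_ _ _ _).hom ≫ h ◁ n₃.inv)) ⊗≫ adf' ◁ n₄.inv := by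
          rw [← comp_whiskerRight m₁.inv, Iso.inv_hom_id]; bicategory
    _ = 𝟙 _ ⊗≫ a ◁ p ◁ b ◁ κ₂ ▷ r ⊗≫ a ◁ ((𝟙 (p ≫ b ≫ e) ⊗≫ κ₁ ▷ e ⊗≫ d ◁ κ ⊗≫ l.inv ▷ h) ▷ (g ≫ r) ≫
        (df ≫ h) ◁ n₃.inv) ⊗≫ m₃.inv ▷ (h ≫ gr) ⊗≫ adf' ◁ n₄.inv := by
          rw [← whisker_exchange]; bicategory
    _ = 𝟙 _ ⊗≫ a ◁ p ◁ b ◁ κ₂ ▷ r ⊗≫ a ◁ (p ◁ b₁.inv ▷ (g ≫ r) ≫ p ◁ b₁.hom ▷ (g ≫ r)) ⊗≫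
        a ◁ p ◁ (b ≫ e) ◁ n₃.inv ⊗≫ a ◁ ((𝟙 (p ≫ b ≫ e) ⊗≫ κ₁ ▷ e ⊗≫ d ◁ κ ⊗≫ l.inv ▷ h) ▷ gr) ⊗≫
        m₃.inv ▷ (h ≫ gr) ⊗≫ adf' ◁ n₄.inv := by
          rw [← whisker_exchange, e₅]; bicategory
    _ = 𝟙 _ ⊗≫ a ◁ p ◁ b ◁ κ₂ ▷ r ⊗≫ a ◁ p ◁ b₁.inv ▷ (g ≫ r) ⊗≫ a ◁ p ◁ (b₁.hom ▷ (g ≫ r) ≫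
        (b ≫ e) ◁ n₃.inv) ⊗≫ a ◁ ((𝟙 (p ≫ b ≫ e) ⊗≫ κ₁ ▷ e ⊗≫ d ◁ κ ⊗≫ l.inv ▷ h) ▷ gr) ⊗≫
        m₃.inv ▷ (h ≫ gr) ⊗≫ adf' ◁ n₄.inv := by bicategory
    _ = _ := by rw [← whisker_exchange]; bicategory

end Exchange

section Laws

variable {C : Type u} [Bicategory.{w, v} C] [IsLocallyGroupoid C] {D : Type u'}
  [Bicategory.{w', v'} D] {P Q B : WideSub C} {F₀ : C → D} {F₁ : PsFun P F₀} {F₂ : PsFun Q F₀}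
  {X Y Z : C} (G : Gluing F₁ F₂)

namespace NF

lemma Ref.iso_of_id {X V Y : C} {a a' : X ⟶ V} {p p' : V ⟶ Y} (ha : P.mem a) (ha' : P.mem a')
    (hp : Q.mem p) (hp' : Q.mem p') (η : a ⟶ a') (ξ : p ⟶ p') :
    ((Ref.mk (K := ⟨ha, hp⟩) (M := ⟨ha', hp'⟩) (Q.id_mem V) (η ≫ (ρ_ a').inv)
      ((λ_ p).hom ≫ ξ)).iso G).hom =
      F₁.map₂ ha ha' η ▷ F₂.map p hp ≫ F₁.map a' ha' ◁ F₂.map₂ hp hp' ξ := by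
  simp only [Ref.iso, Iso.trans_hom, whiskerRightIso_hom, whiskerLeftIso_hom, Iso.symm_hom,
    G.tri_comp ha ha' ha' (Q.id_mem V), G.tri_rightUnitor_inv ha', PsFun.map₂Iso]
  rw [F₂.map₂_comp _ hp, F₂.map₂_leftUnitor]
  simp

/-- Refinement of the target. -/
lemma Prod.iso_refine {K : NF P Q X Y} {L : NF P Q Y Z} (N : Prod K L) {W' : C} {d' : K.V ⟶ W'}
    {u : W' ⟶ N.W} {t' : W' ⟶ L.V} (hd' : P.mem d') (hu : Q.mem u) (ht' : Q.mem t')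
    (σ : N.d ⟶ d' ≫ u) (τ : u ≫ N.t ⟶ t') :
    ((Prod.mk hd' ht' (N.κ ≫ σ ▷ N.t ≫ (α_ _ _ _).hom ≫ d' ◁ τ)).iso G).hom =
      (N.iso G).hom ≫ ((Ref.mk (K := N.nf) (M := ⟨P.comp_mem K.ha hd', Q.comp_mem ht' L.hp⟩) hu
        (K.a ◁ σ ≫ (α_ _ _ _).inv) ((α_ _ _ _).inv ≫ τ ▷ L.p)).iso G).hom := by
  have e : N.κ ≫ σ ▷ N.t ≫ (α_ _ _ _).hom ≫ d' ◁ τ =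
    (N.κ ≫ σ ▷ N.t ≫ (α_ _ _ _).hom) ≫ d' ◁ τ := by simp
  simp only [Ref.iso, Iso.trans_hom, whiskerRightIso_hom, whiskerLeftIso_hom, Iso.symm_hom,
    G.tri_comp_whiskerLeft K.ha N.hd hd' hu, PsFun.map₂Iso, Prod.iso, e,
    G.iso_vertical_right hd' K.hp (Q.comp_mem hu N.ht) ht' L.ha,
    G.iso_tri_top N.hd K.hp N.ht L.ha hd' hu]
  rw [F₂.map₂_comp _ (Q.comp_mem (Q.comp_mem hu N.ht) L.hp), F₂.map₂_associator_inv _ _ _ hu N.ht L.hp,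
    F₂.map₂_whiskerRight (Q.comp_mem hu N.ht) ht' τ L.p L.hp]
  have h := mid_refine (G.iso N.hd K.hp N.ht L.ha N.κ).hom (G.tri N.hd hd' hu σ).hom
    (F₁.mapComp K.a N.d K.ha N.hd) (F₁.mapComp K.a d' K.ha hd') (F₂.mapComp N.t L.p N.ht L.hp)
    (F₂.mapComp u N.t hu N.ht) (F₂.mapComp t' L.p ht' L.hp) (F₂.map₂ (Q.comp_mem hu N.ht) ht' τ)
  simpa using h

lemma Prod.cell_refine {K : NF P Q X Y} {L : NF P Q Y Z} (N : Prod K L) {W' : C} {d' : K.V ⟶ W'}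
    {u : W' ⟶ N.W} {t' : W' ⟶ L.V} (hd' : P.mem d') (hu : Q.mem u) (ht' : Q.mem t')
    (σ : N.d ⟶ d' ≫ u) (τ : u ≫ N.t ⟶ t') :
    (Prod.mk hd' ht' (N.κ ≫ σ ▷ N.t ≫ (α_ _ _ _).hom ≫ d' ◁ τ)).cell =
      N.cell ≫ (Ref.mk (K := N.nf) (M := ⟨P.comp_mem K.ha hd', Q.comp_mem ht' L.hp⟩) hu
        (K.a ◁ σ ≫ (α_ _ _ _).inv) ((α_ _ _ _).inv ≫ τ ▷ L.p)).cell := by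
  dsimp only [Prod.cell, Prod.mid, Ref.cell]
  bicategory

/-- Refinement of the first factor. -/
lemma Prod.iso_left {K K' : NF P Q X Y} {L : NF P Q Y Z} (e : K.Ref K') (N : Prod K L) {W' : C}
    {d' : K'.V ⟶ W'} {u : W' ⟶ N.W} (hd' : P.mem d') (hu : Q.mem u) (κ : e.s ≫ N.d ⟶ d' ≫ u) :
    (e.iso G).hom ▷ L.map F₁ F₂ ≫ ((Prod.mk (K := K') (L := L) hd' (Q.comp_mem hu N.ht)
      (inv e.τ ▷ L.a ≫ vpaste κ N.κ)).iso G).hom =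
      (N.iso G).hom ≫ ((Ref.mk (K := N.nf)
        (M := ⟨P.comp_mem K'.ha hd', Q.comp_mem (Q.comp_mem hu N.ht) L.hp⟩) hu
        (e.σ ▷ N.d ≫ (α_ _ _ _).hom ≫ K'.a ◁ κ ≫ (α_ _ _ _).inv) (α_ _ _ _).inv).iso G).hom := by
  simp only [Ref.iso, Iso.trans_hom, whiskerRightIso_hom, whiskerLeftIso_hom, Iso.symm_hom,
    G.tri_hpaste K.ha K'.ha e.hs N.hd hd' hu, PsFun.map₂Iso, Prod.iso,
    G.iso_vertical_left hd' (Q.comp_mem e.hs K.hp) K'.hp (Q.comp_mem hu N.ht) L.ha,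
    G.ax_b hd' N.hd L.ha e.hs hu K.hp N.ht]
  rw [F₂.map₂_associator_inv _ _ _ hu N.ht L.hp]
  have e₁ : F₂.map₂ (Q.comp_mem e.hs K.hp) K'.hp e.τ =
    (F₂.map₂Iso (Q.comp_mem e.hs K.hp) K'.hp e.τ).hom := rfl
  have e₂ : F₂.map₂ K'.hp (Q.comp_mem e.hs K.hp) (inv e.τ) =
    (F₂.map₂Iso (Q.comp_mem e.hs K.hp) K'.hp e.τ).inv := rfl
  rw [e₁, e₂]
  have h := mid_left (G.tri K.ha K'.ha e.hs e.σ).hom (F₂.mapComp e.s K.p e.hs K.hp)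
    (F₂.map₂Iso (Q.comp_mem e.hs K.hp) K'.hp e.τ) (G.iso N.hd K.hp N.ht L.ha N.κ).hom
    (G.iso hd' e.hs hu N.hd κ).hom (F₁.mapComp K.a N.d K.ha N.hd) (F₁.mapComp K'.a d' K'.ha hd')
    (F₂.mapComp N.t L.p N.ht L.hp) (F₂.mapComp u N.t hu N.ht)
    (F₂.mapComp (u ≫ N.t) L.p (Q.comp_mem hu N.ht) L.hp)
  simpa [vpaste] using h

lemma Prod.cell_left {K K' : NF P Q X Y} {L : NF P Q Y Z} (e : K.Ref K') (N : Prod K L) {W' : C}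
    {d' : K'.V ⟶ W'} {u : W' ⟶ N.W} (hd' : P.mem d') (hu : Q.mem u) (κ : e.s ≫ N.d ⟶ d' ≫ u) :
    e.cell ▷ L.hom ≫ (Prod.mk (K := K') (L := L) hd' (Q.comp_mem hu N.ht)
      (inv e.τ ▷ L.a ≫ vpaste κ N.κ)).cell =
      N.cell ≫ (Ref.mk (K := N.nf)
        (M := ⟨P.comp_mem K'.ha hd', Q.comp_mem (Q.comp_mem hu N.ht) L.hp⟩) hu
        (e.σ ▷ N.d ≫ (α_ _ _ _).hom ≫ K'.a ◁ κ ≫ (α_ _ _ _).inv) (α_ _ _ _).inv).cell := by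
  dsimp only [Prod.cell, Prod.mid, Ref.cell, vpaste]
  calc _ = 𝟙 _ ⊗≫ e.σ ▷ K.p ▷ (L.a ≫ L.p) ⊗≫ K'.a ◁ (e.τ ≫ inv e.τ) ▷ (L.a ≫ L.p) ⊗≫
        (K'.a ≫ e.s) ◁ N.κ ▷ L.p ⊗≫ K'.a ◁ κ ▷ (N.t ≫ L.p) ⊗≫ 𝟙 _ := by bicategory
    _ = 𝟙 _ ⊗≫ (e.σ ▷ (K.p ≫ L.a) ≫ (K'.a ≫ e.s) ◁ N.κ) ▷ L.p ⊗≫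
        K'.a ◁ κ ▷ (N.t ≫ L.p) ⊗≫ 𝟙 _ := by rw [IsIso.hom_inv_id]; bicategory
    _ = _ := by rw [← whisker_exchange]; bicategory

/-- Refinement of the second factor. -/
lemma Prod.iso_right {K : NF P Q X Y} {L L' : NF P Q Y Z} (e : L.Ref L') (N : Prod K L') :
    K.map F₁ F₂ ◁ (e.iso G).hom ≫ (N.iso G).hom =
      ((Prod.mk (K := K) (L := L) N.hd (Q.comp_mem N.ht e.hs)
        (K.p ◁ e.σ ≫ (α_ _ _ _).inv ≫ N.κ ▷ e.s ≫ (α_ _ _ _).hom)).iso G).hom ≫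
      _ ◁ F₂.map₂ (Q.comp_mem (Q.comp_mem N.ht e.hs) L.hp) (Q.comp_mem N.ht L'.hp)
        ((α_ _ _ _).hom ≫ N.t ◁ e.τ) := by
  simp only [Ref.iso, Iso.trans_hom, whiskerRightIso_hom, whiskerLeftIso_hom, Iso.symm_hom,
    PsFun.map₂Iso, Prod.iso, G.iso_tri_bot N.hd K.hp N.ht L'.ha L.ha e.hs]
  rw [F₂.map₂_comp _ (Q.comp_mem N.ht (Q.comp_mem e.hs L.hp)),
    F₂.map₂_associator _ _ _ N.ht e.hs L.hp,
    F₂.map₂_whiskerLeft _ N.ht (Q.comp_mem e.hs L.hp) L'.hp e.τ]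
  have h := mid_right (a := F₁.map K.a K.ha) (G.tri L.ha L'.ha e.hs e.σ).hom
    (F₂.mapComp e.s L.p e.hs L.hp) (F₂.map₂ (Q.comp_mem e.hs L.hp) L'.hp e.τ)
    (G.iso N.hd K.hp N.ht L'.ha N.κ).hom (F₁.mapComp K.a N.d K.ha N.hd)
    (F₂.mapComp N.t L'.p N.ht L'.hp) (F₂.mapComp N.t e.s N.ht e.hs)
    (F₂.mapComp (N.t ≫ e.s) L.p (Q.comp_mem N.ht e.hs) L.hp)
  simpa using h

lemma Prod.cell_right {K : NF P Q X Y} {L L' : NF P Q Y Z} (e : L.Ref L') (N : Prod K L') :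
    K.hom ◁ e.cell ≫ N.cell =
      (Prod.mk (K := K) (L := L) N.hd (Q.comp_mem N.ht e.hs)
        (K.p ◁ e.σ ≫ (α_ _ _ _).inv ≫ N.κ ▷ e.s ≫ (α_ _ _ _).hom)).cell ≫
      _ ◁ ((α_ _ _ _).hom ≫ N.t ◁ e.τ) := by
  dsimp only [Prod.cell, Prod.mid, Ref.cell]
  calc _ = 𝟙 _ ⊗≫ K.a ◁ K.p ◁ e.σ ▷ L.p ⊗≫ K.a ◁ ((K.p ≫ L'.a) ◁ e.τ ≫ N.κ ▷ L'.p) ⊗≫ 𝟙 _ := by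
        bicategory
    _ = _ := by rw [whisker_exchange]; bicategory

/-- Associativity. -/
lemma Prod.iso_assoc {W : C} {K : NF P Q X Y} {L : NF P Q Y Z} {M : NF P Q Z W} (N₁ : Prod K L)
    (N₂ : Prod L M) {V : C} {f : N₁.W ⟶ V} {v : V ⟶ N₂.W} (hf : P.mem f) (hv : Q.mem v)
    (κ : N₁.t ≫ N₂.d ⟶ f ≫ v) :
    (N₁.iso G).hom ▷ _ ≫ ((Prod.mk (K := N₁.nf) (L := M) hf (Q.comp_mem hv N₂.ht)
      (vpaste κ N₂.κ)).iso G).hom ≫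
      F₁.map₂ (P.comp_mem (P.comp_mem K.ha N₁.hd) hf) (P.comp_mem K.ha (P.comp_mem N₁.hd hf))
        (α_ _ _ _).hom ▷ _ ≫ _ ◁ F₂.map₂ (Q.comp_mem (Q.comp_mem hv N₂.ht) M.hp)
          (Q.comp_mem hv (Q.comp_mem N₂.ht M.hp)) (α_ _ _ _).hom =
      (α_ _ _ _).hom ≫ _ ◁ (N₂.iso G).hom ≫ ((Prod.mk (K := K) (L := N₂.nf)
        (P.comp_mem N₁.hd hf) hv (hpaste N₁.κ κ)).iso G).hom := by
  simp only [Iso.trans_hom, whiskerRightIso_hom, whiskerLeftIso_hom, Iso.symm_hom,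
    Prod.iso, G.ax_b hf N₂.hd M.ha N₁.ht hv L.hp N₂.ht,
    G.ax_b' K.hp N₁.ht hv N₁.hd L.ha hf N₂.hd]
  rw [F₂.map₂_associator _ _ _ hv N₂.ht M.hp, F₁.map₂_associator _ _ _ K.ha N₁.hd hf]
  have h := mid_assoc (G.iso N₁.hd K.hp N₁.ht L.ha N₁.κ).hom (G.iso N₂.hd L.hp N₂.ht M.ha N₂.κ).hom
    (G.iso hf N₁.ht hv N₂.hd κ).hom (F₁.mapComp K.a N₁.d K.ha N₁.hd)
    (F₂.mapComp N₁.t L.p N₁.ht L.hp) (F₁.mapComp (K.a ≫ N₁.d) f (P.comp_mem K.ha N₁.hd) hf)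
    (F₂.mapComp v N₂.t hv N₂.ht) (F₂.mapComp (v ≫ N₂.t) M.p (Q.comp_mem hv N₂.ht) M.hp)
    (F₁.mapComp K.a (N₁.d ≫ f) K.ha (P.comp_mem N₁.hd hf)) (F₁.mapComp N₁.d f N₁.hd hf)
    (F₂.mapComp N₂.t M.p N₂.ht M.hp)
    (F₂.mapComp v (N₂.t ≫ M.p) hv (Q.comp_mem N₂.ht M.hp)) (F₁.mapComp L.a N₂.d L.ha N₂.hd)
  simpa [vpaste, hpaste] using h

lemma Prod.cell_assoc {W : C} {K : NF P Q X Y} {L : NF P Q Y Z} {M : NF P Q Z W} (N₁ : Prod K L)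
    (N₂ : Prod L M) {V : C} {f : N₁.W ⟶ V} {v : V ⟶ N₂.W} (hf : P.mem f) (hv : Q.mem v)
    (κ : N₁.t ≫ N₂.d ⟶ f ≫ v) :
    N₁.cell ▷ M.hom ≫ (Prod.mk (K := N₁.nf) (L := M) hf (Q.comp_mem hv N₂.ht)
      (vpaste κ N₂.κ)).cell ≫ (α_ _ _ _).hom ▷ _ ≫ _ ◁ (α_ _ _ _).hom =
      (α_ _ _ _).hom ≫ K.hom ◁ N₂.cell ≫ (Prod.mk (K := K) (L := N₂.nf)
        (P.comp_mem N₁.hd hf) hv (hpaste N₁.κ κ)).cell := by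
  dsimp only [Prod.cell, Prod.mid, hpaste, vpaste]
  calc _ = 𝟙 _ ⊗≫ K.a ◁ (N₁.κ ▷ (L.p ≫ M.a) ≫ (N₁.d ≫ N₁.t) ◁ N₂.κ) ▷ M.p ⊗≫ (K.a ≫ N₁.d) ◁ κ ▷ N₂.t ▷ M.p ⊗≫ 𝟙 _ := by
        bicategory
    _ = _ := by rw [← whisker_exchange]; bicategory

end NF

end Laws

section Mul

variable {C : Type u} [Bicategory.{w, v} C] [IsLocallyGroupoid C] {D : Type u'}
  [Bicategory.{w', v'} D] {P Q B : WideSub C} {F₀ : C → D} {F₁ : PsFun P F₀} {F₂ : PsFun Q F₀}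

lemma NF.Prod.nonempty (hP : P ≤ B) (hQ : Q ≤ B) (hfac : Factors P Q B) {X Y Z : C}
    (K : NF P Q X Y) (L : NF P Q Y Z) : Nonempty (NF.Prod K L) := by
  obtain ⟨W, d, t, hd, ht, ⟨κ⟩⟩ := hfac (K.p ≫ L.a) (B.comp_mem (hQ _ K.hp) (hP _ L.ha))
  exact ⟨⟨hd, ht, κ.hom⟩⟩

namespace Transport

variable {G : Gluing F₁ F₂} (T : Transport G) {X Y Z W : C}

lemma prod_eq {K : NF P Q X Y} {L : NF P Q Y Z} {M : NF P Q X Z} (N N' : NF.Prod K L)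
    (θ : K.hom ≫ L.hom ⟶ M.hom) :
    (N.iso G).hom ≫ (T.iso (inv N.cell ≫ θ)).hom =
      (N'.iso G).hom ≫ (T.iso (inv N'.cell ≫ θ)).hom := by
  obtain ⟨R, e, e', h⟩ := Roofed.exists_ref T.roof (K := ⟨N.hd, N.ht⟩) (L := ⟨N'.hd, N'.ht⟩)
    (inv N.κ ≫ N'.κ)
  have h' : N.κ ≫ e.cell = N'.κ ≫ e'.cell := by rw [h]; simp
  have k₁ : ((NF.Prod.mk R.ha R.hp (N.κ ≫ e.cell)).iso G).hom = _ :=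
    N.iso_refine G R.ha e.hs R.hp e.σ e.τ
  have k₂ : ((NF.Prod.mk R.ha R.hp (N'.κ ≫ e'.cell)).iso G).hom = _ :=
    N'.iso_refine G R.ha e'.hs R.hp e'.σ e'.τ
  have c₁ : (NF.Prod.mk R.ha R.hp (N.κ ≫ e.cell)).cell = _ :=
    N.cell_refine R.ha e.hs R.hp e.σ e.τ
  have c₂ : (NF.Prod.mk R.ha R.hp (N'.κ ≫ e'.cell)).cell = _ :=
    N'.cell_refine R.ha e'.hs R.hp e'.σ e'.τ
  set f : N.nf.Ref ⟨P.comp_mem K.ha R.ha, Q.comp_mem R.hp L.hp⟩ :=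
    ⟨e.hs, K.a ◁ e.σ ≫ (α_ _ _ _).inv, (α_ _ _ _).inv ≫ e.τ ▷ L.p⟩
  set f' : N'.nf.Ref ⟨P.comp_mem K.ha R.ha, Q.comp_mem R.hp L.hp⟩ :=
    ⟨e'.hs, K.a ◁ e'.σ ≫ (α_ _ _ _).inv, (α_ _ _ _).inv ≫ e'.τ ▷ L.p⟩
  rw [h'] at k₁ c₁
  have k := k₁.symm.trans k₂
  have c := c₁.symm.trans c₂
  rw [← T.iso_cell f, ← T.iso_cell f'] at k
  have e₁ : inv N.cell ≫ θ = f.cell ≫ inv f.cell ≫ inv N.cell ≫ θ := by simp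
  have e₂ : inv N'.cell ≫ θ = f'.cell ≫ inv f.cell ≫ inv N.cell ≫ θ := by
    rw [← cancel_epi N'.cell, ← reassoc_of% c]; simp
  rw [e₁, e₂, T.iso_comp f.cell, T.iso_comp f'.cell, reassoc_of% k]

variable (hprod : ∀ {X Y Z : C} (K : NF P Q X Y) (L : NF P Q Y Z), Nonempty (NF.Prod K L))

/-- The composition of images of 2-cells. -/
noncomputable def mul {K : NF P Q X Y} {L : NF P Q Y Z} {M : NF P Q X Z}
    (θ : K.hom ≫ L.hom ⟶ M.hom) : K.map F₁ F₂ ≫ L.map F₁ F₂ ≅ M.map F₁ F₂ :=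
  (hprod K L).some.iso G ≪≫ T.iso (inv (hprod K L).some.cell ≫ θ)

lemma mul_eq {K : NF P Q X Y} {L : NF P Q Y Z} {M : NF P Q X Z} (N : NF.Prod K L)
    (θ : K.hom ≫ L.hom ⟶ M.hom) :
    (T.mul hprod θ).hom = (N.iso G).hom ≫ (T.iso (inv N.cell ≫ θ)).hom :=
  T.prod_eq _ _ _

lemma mul_cell {K : NF P Q X Y} {L : NF P Q Y Z} (N : NF.Prod K L) :
    (T.mul hprod N.cell).hom = (N.iso G).hom := by
  rw [T.mul_eq hprod N, IsIso.inv_hom_id, T.iso_id, Category.comp_id]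

lemma mul_comp {K : NF P Q X Y} {L : NF P Q Y Z} {M M' : NF P Q X Z}
    (θ : K.hom ≫ L.hom ⟶ M.hom) (φ : M.hom ⟶ M'.hom) :
    (T.mul hprod (θ ≫ φ)).hom = (T.mul hprod θ).hom ≫ (T.iso φ).hom := by
  simp only [mul, Iso.trans_hom, Category.assoc, ← T.iso_comp]

lemma iso_inv_eq {K L : NF P Q X Y} (θ : K.hom ⟶ L.hom) :
    (T.iso (inv θ)).hom = (T.iso θ).inv := by
  rw [← cancel_epi (T.iso θ).hom, ← T.iso_comp]
  simp [T.iso_id]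

/-- The image of a 2-cell between the second factors. -/
lemma iso_whiskerLeft {V : C} {a : X ⟶ V} {p p' : V ⟶ Y} (ha : P.mem a) (hp : Q.mem p)
    (hp' : Q.mem p') (ξ : p ⟶ p') :
    (T.iso (K := ⟨ha, hp⟩) (L := ⟨ha, hp'⟩) (a ◁ ξ)).hom = F₁.map a ha ◁ F₂.map₂ hp hp' ξ := by
  rw [T.iso_eq_of_ref (e := ⟨Q.id_mem V, 𝟙 a ≫ (ρ_ a).inv, (λ_ p).hom ≫ ξ⟩),
    NF.Ref.iso_of_id G ha ha hp hp', F₁.map₂_id]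
  · simp
  · dsimp [NF.Ref.cell]; simp

/-- The image of a pair of 2-cells between the factors. -/
lemma iso_pair {V : C} {a a' : X ⟶ V} {p p' : V ⟶ Y} (ha : P.mem a) (ha' : P.mem a')
    (hp : Q.mem p) (hp' : Q.mem p') (η : a ⟶ a') (ξ : p ⟶ p') :
    (T.iso (K := ⟨ha, hp⟩) (L := ⟨ha', hp'⟩) (η ▷ p ≫ a' ◁ ξ)).hom =
      F₁.map₂ ha ha' η ▷ F₂.map p hp ≫ F₁.map a' ha' ◁ F₂.map₂ hp hp' ξ := by
  rw [T.iso_eq_of_ref (e := ⟨Q.id_mem V, η ≫ (ρ_ a').inv, (λ_ p).hom ≫ ξ⟩),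
    NF.Ref.iso_of_id G ha ha' hp hp']
  dsimp [NF.Ref.cell]; simp

lemma mul_ref_left (hfac : ∀ {X Y Z : C} (q : X ⟶ Y) (i : Y ⟶ Z), Q.mem q → P.mem i →
      ∃ (W : C) (j : X ⟶ W) (p : W ⟶ Z) (_ : q ≫ i ⟶ j ≫ p), P.mem j ∧ Q.mem p)
    {K K' : NF P Q X Y} {L : NF P Q Y Z} {M : NF P Q X Z} (e : K.Ref K')
    (θ : K'.hom ≫ L.hom ⟶ M.hom) :
    (T.iso e.cell).hom ▷ L.map F₁ F₂ ≫ (T.mul hprod θ).hom =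
      (T.mul hprod (e.cell ▷ L.hom ≫ θ)).hom := by
  have N := (hprod K L).some
  obtain ⟨V, d, u, κ, hd, hu⟩ := hfac e.s N.d e.hs N.hd
  have k := N.iso_left G e hd hu κ
  have c := N.cell_left e hd hu κ
  rw [T.iso_cell, T.mul_eq hprod (NF.Prod.mk hd (Q.comp_mem hu N.ht) _), T.mul_eq hprod N,
    reassoc_of% k, ← T.iso_cell, ← T.iso_comp]
  congr 3
  rw [← cancel_epi N.cell, ← reassoc_of% c]
  simp

lemma mul_left (hfac : ∀ {X Y Z : C} (q : X ⟶ Y) (i : Y ⟶ Z), Q.mem q → P.mem i →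
      ∃ (W : C) (j : X ⟶ W) (p : W ⟶ Z) (_ : q ≫ i ⟶ j ≫ p), P.mem j ∧ Q.mem p)
    {K K' : NF P Q X Y} {L : NF P Q Y Z} {M : NF P Q X Z} (φ : K.hom ⟶ K'.hom)
    (θ : K'.hom ≫ L.hom ⟶ M.hom) :
    (T.iso φ).hom ▷ L.map F₁ F₂ ≫ (T.mul hprod θ).hom =
      (T.mul hprod (φ ▷ L.hom ≫ θ)).hom := by
  obtain ⟨R, e, e', h⟩ := Roofed.exists_ref T.roof φ
  have k : φ = e.cell ≫ inv e'.cell := by rw [h]; simp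
  have k' := T.mul_ref_left hprod hfac e' (inv e'.cell ▷ L.hom ≫ θ)
  rw [← comp_whiskerRight_assoc, IsIso.hom_inv_id, id_whiskerRight, Category.id_comp] at k'
  rw [k, T.iso_comp, comp_whiskerRight, Category.assoc, comp_whiskerRight, Category.assoc,
    ← T.mul_ref_left hprod hfac e, ← k', T.iso_inv_eq, inv_hom_whiskerRight_assoc]

lemma mul_ref_right {K : NF P Q X Y} {L L' : NF P Q Y Z} {M : NF P Q X Z} (e : L.Ref L')
    (θ : K.hom ≫ L'.hom ⟶ M.hom) :
    K.map F₁ F₂ ◁ (T.iso e.cell).hom ≫ (T.mul hprod θ).hom =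
      (T.mul hprod (K.hom ◁ e.cell ≫ θ)).hom := by
  have N := (hprod K L').some
  have k := N.iso_right G e
  have c := N.cell_right e
  set N' : NF.Prod K L := NF.Prod.mk N.hd (Q.comp_mem N.ht e.hs)
    (K.p ◁ e.σ ≫ (α_ _ _ _).inv ≫ N.κ ▷ e.s ≫ (α_ _ _ _).hom)
  rw [T.iso_cell, T.mul_eq hprod N, T.mul_eq hprod N', reassoc_of% k, ← T.iso_whiskerLeft,
    ← T.iso_comp]
  congr 3
  rw [← cancel_epi N'.cell, ← reassoc_of% c]
  simp

lemma mul_right {K : NF P Q X Y} {L L' : NF P Q Y Z} {M : NF P Q X Z} (φ : L.hom ⟶ L'.hom)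
    (θ : K.hom ≫ L'.hom ⟶ M.hom) :
    K.map F₁ F₂ ◁ (T.iso φ).hom ≫ (T.mul hprod θ).hom =
      (T.mul hprod (K.hom ◁ φ ≫ θ)).hom := by
  obtain ⟨R, e, e', h⟩ := Roofed.exists_ref T.roof φ
  have k : φ = e.cell ≫ inv e'.cell := by rw [h]; simp
  have k' := T.mul_ref_right hprod (K := K) e' (K.hom ◁ inv e'.cell ≫ θ)
  rw [← whiskerLeft_comp_assoc, IsIso.hom_inv_id, Bicategory.whiskerLeft_id,
    Category.id_comp] at k'
  rw [k, T.iso_comp, whiskerLeft_comp, Category.assoc, whiskerLeft_comp, Category.assoc,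
    ← T.mul_ref_right hprod e, ← k', T.iso_inv_eq, whiskerLeft_inv_hom_assoc]

lemma mul_assoc (hfac : ∀ {X Y Z : C} (q : X ⟶ Y) (i : Y ⟶ Z), Q.mem q → P.mem i →
      ∃ (W : C) (j : X ⟶ W) (p : W ⟶ Z) (_ : q ≫ i ⟶ j ≫ p), P.mem j ∧ Q.mem p)
    {K : NF P Q X Y} {L : NF P Q Y Z} {M : NF P Q Z W} {K' : NF P Q X Z} {L' : NF P Q Y W}
    {R : NF P Q X W} (θ₁ : K.hom ≫ L.hom ⟶ K'.hom) (θ₂ : K'.hom ≫ M.hom ⟶ R.hom)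
    (θ₃ : L.hom ≫ M.hom ⟶ L'.hom) (θ₄ : K.hom ≫ L'.hom ⟶ R.hom)
    (h : θ₁ ▷ M.hom ≫ θ₂ = (α_ _ _ _).hom ≫ K.hom ◁ θ₃ ≫ θ₄) :
    (T.mul hprod θ₁).hom ▷ M.map F₁ F₂ ≫ (T.mul hprod θ₂).hom =
      (α_ _ _ _).hom ≫ K.map F₁ F₂ ◁ (T.mul hprod θ₃).hom ≫ (T.mul hprod θ₄).hom := by
  have N₁ := (hprod K L).some
  have N₂ := (hprod L M).some
  obtain ⟨V, f, v, κ, hf, hv⟩ := hfac N₁.t N₂.d N₁.ht N₂.hd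
  have k := N₁.iso_assoc G N₂ hf hv κ
  have c := N₁.cell_assoc N₂ hf hv κ
  rw [← T.iso_pair (P.comp_mem (P.comp_mem K.ha N₁.hd) hf) _
    (Q.comp_mem (Q.comp_mem hv N₂.ht) M.hp)] at k
  rw [T.mul_eq hprod N₁ θ₁, T.mul_eq hprod N₂ θ₃, comp_whiskerRight, Category.assoc,
    T.mul_left hprod hfac, whiskerLeft_comp, Category.assoc, T.mul_right hprod,
    T.mul_eq hprod (NF.Prod.mk (K := N₁.nf) (L := M) hf (Q.comp_mem hv N₂.ht) (vpaste κ N₂.κ)), T.mul_eq hprod (NF.Prod.mk (K := K) (L := N₂.nf) (P.comp_mem N₁.hd hf) hv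
      (hpaste N₁.κ κ)), ← reassoc_of% k,
    ← T.iso_comp]
  congr 4
  rw [← cancel_epi (NF.Prod.mk (K := N₁.nf) (L := M) hf (Q.comp_mem hv N₂.ht) (vpaste κ N₂.κ)).cell, ← cancel_epi (N₁.cell ▷ M.hom)]
  simp only [Category.assoc]
  rw [reassoc_of% c]
  simp only [IsIso.hom_inv_id_assoc]
  rw [← comp_whiskerRight_assoc, ← whiskerLeft_comp_assoc]
  simpa using h

end Transport

end Mul

section Exchange

variable {E : Type u} [Bicategory.{w, v} E] {X U V W Z : E}

lemma mid_ι₁ {a : X ⟶ U} {d : U ⟶ U} {b : U ⟶ V} {d' : V ⟶ V} {p : V ⟶ Z} {ab : X ⟶ V}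
    {dp : V ⟶ Z} (e : d ≅ 𝟙 U) (e' : d' ≅ 𝟙 V) (m : ab ≅ a ≫ b) (n : dp ≅ d' ≫ p) :
    ((ρ_ a).inv ≫ a ◁ e.inv) ▷ (b ≫ p) ≫
      (NF.Prod.mid (e.hom ▷ b ≫ (λ_ b).hom ≫ 𝟙 b ≫ (ρ_ b).inv ≫ b ◁ e'.inv) ≫ m.inv ▷ (d' ≫ p) ≫
      ab ◁ n.inv) ≫ ab ◁ (n.hom ≫ e'.hom ▷ p ≫ (λ_ p).hom) = (α_ a b p).inv ≫ m.inv ▷ p := by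
  dsimp only [NF.Prod.mid]
  calc _ = 𝟙 _ ⊗≫ a ◁ (e.inv ≫ e.hom) ▷ (b ≫ p) ⊗≫ ((a ≫ b) ◁ e'.inv ▷ p ≫
        m.inv ▷ (d' ≫ p)) ⊗≫ ab ◁ (n.inv ≫ n.hom) ⊗≫ ab ◁ e'.hom ▷ p ⊗≫ 𝟙 _ := by bicategory
    _ = 𝟙 _ ⊗≫ m.inv ▷ (𝟙 V ≫ p) ⊗≫ ab ◁ (e'.inv ≫ e'.hom) ▷ p ⊗≫ 𝟙 _ := by
      rw [whisker_exchange, Iso.inv_hom_id, Iso.inv_hom_id]; bicategory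
    _ = _ := by rw [Iso.inv_hom_id]; bicategory

lemma mid_ι₂ {a : X ⟶ U} {d : V ⟶ V} {p : U ⟶ V} {d' : U ⟶ U} {q : V ⟶ Z} {ad : X ⟶ U}
    {pq : U ⟶ Z} (e : d ≅ 𝟙 V) (e' : d' ≅ 𝟙 U) (m : ad ≅ a ≫ d') (n : pq ≅ p ≫ q) :
    (a ≫ p) ◁ ((λ_ q).inv ≫ e.inv ▷ q) ≫
      (NF.Prod.mid (p ◁ e.hom ≫ (ρ_ p).hom ≫ 𝟙 p ≫ (λ_ p).inv ≫ e'.inv ▷ p) ≫ m.inv ▷ (p ≫ q) ≫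
      ad ◁ n.inv) ≫ (m.hom ≫ a ◁ e'.hom ≫ (ρ_ a).hom) ▷ pq = (α_ a p q).hom ≫ a ◁ n.inv := by
  dsimp only [NF.Prod.mid]
  calc _ = 𝟙 _ ⊗≫ (a ≫ p) ◁ (e.inv ≫ e.hom) ▷ q ⊗≫ a ◁ e'.inv ▷ (p ≫ q) ⊗≫
        m.inv ▷ (p ≫ q) ⊗≫ (ad ◁ n.inv ≫ (m.hom ≫ a ◁ e'.hom ≫ (ρ_ a).hom) ▷ pq) := by bicategory
    _ = 𝟙 _ ⊗≫ a ◁ e'.inv ▷ (p ≫ q) ⊗≫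
        (m.inv ≫ m.hom) ▷ (p ≫ q) ⊗≫ a ◁ e'.hom ▷ (p ≫ q) ⊗≫ a ◁ n.inv := by
      rw [whisker_exchange, Iso.inv_hom_id]; bicategory
    _ = 𝟙 _ ⊗≫ a ◁ (e'.inv ≫ e'.hom) ▷ (p ≫ q) ⊗≫ a ◁ n.inv := by
      rw [Iso.inv_hom_id]; bicategory
    _ = _ := by rw [Iso.inv_hom_id]; bicategory

lemma mid_square {d : X ⟶ X} {q : X ⟶ U} {i : U ⟶ Z} {d' : Z ⟶ Z} {j : X ⟶ W} {p : W ⟶ Z}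
    {dj : X ⟶ W} {pd : W ⟶ Z} (e : d ≅ 𝟙 X) (e' : d' ≅ 𝟙 Z) (m : dj ≅ d ≫ j) (n : pd ≅ p ≫ d')
    (β : q ≫ i ⟶ j ≫ p) :
    ((λ_ q).inv ≫ e.inv ▷ q) ▷ i ≫ (d ≫ q) ◁ ((ρ_ i).inv ≫ i ◁ e'.inv) ≫
      (NF.Prod.mid β ≫ m.inv ▷ (p ≫ d') ≫ dj ◁ n.inv) ≫
      (m.hom ≫ e.hom ▷ j ≫ (λ_ j).hom) ▷ pd ≫ j ◁ (n.hom ≫ p ◁ e'.hom ≫ (ρ_ p).hom) = β := by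
  dsimp only [NF.Prod.mid]
  calc _ = 𝟙 _ ⊗≫ (e.inv ▷ (q ≫ i) ≫ d ◁ ((ρ_ (q ≫ i)).inv ≫ (q ≫ i) ◁ e'.inv ≫ β ▷ d')) ⊗≫
        m.inv ▷ (p ≫ d') ⊗≫ (dj ◁ n.inv ≫ (m.hom ≫ e.hom ▷ j ≫ (λ_ j).hom) ▷ pd) ⊗≫
        j ◁ n.hom ⊗≫ j ◁ p ◁ e'.hom ⊗≫ 𝟙 _ := by bicategory
    _ = 𝟙 _ ⊗≫ (𝟙 X ◁ ((ρ_ (q ≫ i)).inv ≫ (q ≫ i) ◁ e'.inv ≫ β ▷ d') ≫ e.inv ▷ ((j ≫ p) ≫ d')) ⊗≫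
        (m.inv ≫ m.hom) ▷ (p ≫ d') ⊗≫ e.hom ▷ (j ≫ p ≫ d') ⊗≫ j ◁ (n.inv ≫ n.hom) ⊗≫
        j ◁ p ◁ e'.hom ⊗≫ 𝟙 _ := by
          rw [← whisker_exchange e.inv, whisker_exchange _ n.inv]; bicategory
    _ = 𝟙 _ ⊗≫ 𝟙 X ◁ ((q ≫ i) ◁ e'.inv ≫ β ▷ d') ⊗≫ (e.inv ≫ e.hom) ▷ (j ≫ p ≫ d') ⊗≫
        j ◁ p ◁ e'.hom ⊗≫ 𝟙 _ := by rw [Iso.inv_hom_id, Iso.inv_hom_id]; bicategory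
    _ = 𝟙 _ ⊗≫ 𝟙 X ◁ (β ▷ 𝟙 Z) ⊗≫ j ◁ p ◁ (e'.inv ≫ e'.hom) ⊗≫ 𝟙 _ := by
        rw [whisker_exchange, Iso.inv_hom_id]; bicategory
    _ = 𝟙 _ ⊗≫ 𝟙 X ◁ (β ▷ 𝟙 Z) ⊗≫ 𝟙 _ := by rw [Iso.inv_hom_id]; bicategory
    _ = _ := by bicategory

end Exchange

section Units

variable {C : Type u} [Bicategory.{w, v} C] [IsLocallyGroupoid C] {D : Type u'}
  [Bicategory.{w', v'} D] {P Q B : WideSub C} {F₀ : C → D} {F₁ : PsFun P F₀} {F₂ : PsFun Q F₀}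

namespace NF

variable {X Y : C}

/-- A 1-cell of `P` as a composite. -/
abbrev left {a : X ⟶ Y} (ha : P.mem a) : NF P Q X Y := ⟨ha, Q.id_mem Y⟩

/-- A 1-cell of `Q` as a composite. -/
abbrev right {p : X ⟶ Y} (hp : Q.mem p) : NF P Q X Y := ⟨P.id_mem X, hp⟩

/-- The image of a 1-cell of `P`, viewed as a composite. -/
abbrev leftIso (F₁ : PsFun P F₀) (F₂ : PsFun Q F₀) {a : X ⟶ Y} (ha : P.mem a) :
    F₁.map a ha ≅ (left (Q := Q) ha).map F₁ F₂ :=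
  (ρ_ _).symm ≪≫ whiskerLeftIso _ (F₂.mapId Y).symm

/-- The image of a 1-cell of `Q`, viewed as a composite. -/
abbrev rightIso (F₁ : PsFun P F₀) (F₂ : PsFun Q F₀) {p : X ⟶ Y} (hp : Q.mem p) :
    F₂.map p hp ≅ (right (P := P) hp).map F₁ F₂ :=
  (λ_ _).symm ≪≫ whiskerRightIso (F₁.mapId X).symm _

end NF

namespace Transport

variable {G : Gluing F₁ F₂} (T : Transport G) {X Y Z W : C}
  (hprod : ∀ {X Y Z : C} (K : NF P Q X Y) (L : NF P Q Y Z), Nonempty (NF.Prod K L))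

lemma mul_leftIso {a : X ⟶ Y} {b : Y ⟶ Z} {p : Z ⟶ W} (ha : P.mem a) (hb : P.mem b)
    (hp : Q.mem p) :
    (NF.leftIso F₁ F₂ ha).hom ▷ _ ≫
      (T.mul hprod (K := NF.left ha) (L := ⟨hb, hp⟩) (M := ⟨P.comp_mem ha hb, hp⟩)
        ((ρ_ a).hom ▷ (b ≫ p) ≫ (α_ a b p).inv)).hom =
      (α_ _ _ _).inv ≫ (F₁.mapComp a b ha hb).inv ▷ F₂.map p hp := by
  let N : NF.Prod (NF.left (Q := Q) ha) (NF.mk hb hp) :=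
    ⟨hb, Q.id_mem Z, (λ_ b).hom ≫ 𝟙 b ≫ (ρ_ b).inv⟩
  have e : (ρ_ a).hom ▷ (b ≫ p) ≫ (α_ a b p).inv = N.cell ≫ (a ≫ b) ◁ (λ_ p).hom := by
    simp [N, NF.Prod.cell]
  have h := T.mul_comp hprod (K := NF.left ha) (L := ⟨hb, hp⟩) (M' := ⟨P.comp_mem ha hb, hp⟩)
    N.cell ((a ≫ b) ◁ (λ_ p).hom)
  rw [T.iso_whiskerLeft, F₂.map₂_leftUnitor, T.mul_cell, NF.Prod.iso_hom] at h
  dsimp only [N] at h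
  rw [G.ax_a hb hb (𝟙 b), F₁.map₂_id] at h
  rw [e, h]
  have := mid_ι₁ (F₂.mapId Y) (F₂.mapId Z) (F₁.mapComp a b ha hb)
    (F₂.mapComp (𝟙 Z) p (Q.id_mem Z) hp)
  simpa using this

lemma mul_rightIso {a : X ⟶ Y} {p : Y ⟶ Z} {q : Z ⟶ W} (ha : P.mem a) (hp : Q.mem p)
    (hq : Q.mem q) :
    _ ◁ (NF.rightIso F₁ F₂ hq).hom ≫
      (T.mul hprod (K := ⟨ha, hp⟩) (L := NF.right hq) (M := ⟨ha, Q.comp_mem hp hq⟩)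
        ((a ≫ p) ◁ (λ_ q).hom ≫ (α_ a p q).hom)).hom =
      (α_ _ _ _).hom ≫ F₁.map a ha ◁ (F₂.mapComp p q hp hq).inv := by
  let N : NF.Prod (NF.mk ha hp) (NF.right (P := P) hq) :=
    ⟨P.id_mem Y, hp, (ρ_ p).hom ≫ 𝟙 p ≫ (λ_ p).inv⟩
  have e : (a ≫ p) ◁ (λ_ q).hom ≫ (α_ a p q).hom = N.cell ≫ (ρ_ a).hom ▷ (p ≫ q) ≫
      a ◁ 𝟙 (p ≫ q) := by
    simp [N, NF.Prod.cell]
  have h := T.mul_comp hprod (K := ⟨ha, hp⟩) (L := NF.right hq) (M' := ⟨ha, Q.comp_mem hp hq⟩)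
    N.cell ((ρ_ a).hom ▷ (p ≫ q) ≫ a ◁ 𝟙 (p ≫ q))
  rw [T.iso_pair, F₁.map₂_rightUnitor, F₂.map₂_id, T.mul_cell, NF.Prod.iso_hom] at h
  dsimp only [N] at h
  rw [G.ax_a' hp hp (𝟙 p), F₂.map₂_id] at h
  rw [e, h]
  have := mid_ι₂ (F₁.mapId Z) (F₁.mapId Y) (F₁.mapComp a (𝟙 Y) ha (P.id_mem Y))
    (F₂.mapComp p q hp hq)
  simpa using this

lemma mul_square {j : X ⟶ Y} {q : X ⟶ Z} {p : Y ⟶ W} {i : Z ⟶ W} (hj : P.mem j) (hq : Q.mem q)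
    (hp : Q.mem p) (hi : P.mem i) (β : q ≫ i ⟶ j ≫ p) :
    (NF.rightIso F₁ F₂ hq).hom ▷ _ ≫ _ ◁ (NF.leftIso F₁ F₂ hi).hom ≫
      (T.mul hprod (K := NF.right hq) (L := NF.left hi) (M := ⟨hj, hp⟩)
        ((λ_ q).hom ▷ _ ≫ q ◁ (ρ_ i).hom ≫ β)).hom = (G.iso hj hq hp hi β).hom := by
  let N : NF.Prod (NF.right (P := P) hq) (NF.left (Q := Q) hi) := ⟨hj, hp, β⟩
  have e : (λ_ q).hom ▷ (i ≫ 𝟙 W) ≫ q ◁ (ρ_ i).hom ≫ β = N.cell ≫ (λ_ j).hom ▷ (p ≫ 𝟙 W) ≫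
      j ◁ (ρ_ p).hom := by
    dsimp [N, NF.Prod.cell]
    bicategory
  have h := T.mul_comp hprod (K := NF.right hq) (L := NF.left hi) (M' := ⟨hj, hp⟩)
    N.cell ((λ_ j).hom ▷ (p ≫ 𝟙 W) ≫ j ◁ (ρ_ p).hom)
  rw [T.iso_pair, F₁.map₂_leftUnitor, F₂.map₂_rightUnitor, T.mul_cell, NF.Prod.iso_hom] at h
  rw [e, h]
  have := mid_square (F₁.mapId X) (F₂.mapId W) (F₁.mapComp (𝟙 X) j (P.id_mem X) hj)
    (F₂.mapComp p (𝟙 W) hp (Q.id_mem W)) (G.iso hj hq hp hi β).hom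
  simpa using this

end Transport

end Units

section OfMul

variable {C : Type u} [Bicategory.{w, v} C] {D : Type u'} [Bicategory.{w', v'} D] {A : WideSub C}
  {F₀ : C → D}

/-- Construction of a pseudofunctor from the inverses of its coherence 2-cells. -/
def PsFun.ofMul (map : ∀ {X Y : C} (f : X ⟶ Y), A.mem f → (F₀ X ⟶ F₀ Y))
    (map₂ : ∀ {X Y : C} {f g : X ⟶ Y} (hf : A.mem f) (hg : A.mem g), (f ⟶ g) →
      (map f hf ⟶ map g hg))
    (one : ∀ X : C, map (𝟙 X) (A.id_mem X) ≅ 𝟙 (F₀ X))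
    (mul : ∀ {X Y Z : C} (f : X ⟶ Y) (g : Y ⟶ Z) (hf : A.mem f) (hg : A.mem g),
      map f hf ≫ map g hg ≅ map (f ≫ g) (A.comp_mem hf hg))
    (map₂_id : ∀ {X Y : C} (f : X ⟶ Y) (hf : A.mem f), map₂ hf hf (𝟙 f) = 𝟙 (map f hf))
    (map₂_comp : ∀ {X Y : C} {f g h : X ⟶ Y} (hf : A.mem f) (hg : A.mem g) (hh : A.mem h)
      (η : f ⟶ g) (θ : g ⟶ h), map₂ hf hh (η ≫ θ) = map₂ hf hg η ≫ map₂ hg hh θ)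
    (mul_left : ∀ {X Y Z : C} {f g : X ⟶ Y} (hf : A.mem f) (hg : A.mem g) (η : f ⟶ g)
      (h : Y ⟶ Z) (hh : A.mem h), map₂ hf hg η ▷ map h hh ≫ (mul g h hg hh).hom =
        (mul f h hf hh).hom ≫ map₂ (A.comp_mem hf hh) (A.comp_mem hg hh) (η ▷ h))
    (mul_right : ∀ {X Y Z : C} (f : X ⟶ Y) {g h : Y ⟶ Z} (hf : A.mem f) (hg : A.mem g)
      (hh : A.mem h) (η : g ⟶ h), map f hf ◁ map₂ hg hh η ≫ (mul f h hf hh).hom =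
        (mul f g hf hg).hom ≫ map₂ (A.comp_mem hf hg) (A.comp_mem hf hh) (f ◁ η))
    (mul_assoc : ∀ {W X Y Z : C} (f : W ⟶ X) (g : X ⟶ Y) (h : Y ⟶ Z) (hf : A.mem f)
      (hg : A.mem g) (hh : A.mem h), (mul f g hf hg).hom ▷ map h hh ≫
        (mul (f ≫ g) h (A.comp_mem hf hg) hh).hom ≫ map₂ (A.comp_mem (A.comp_mem hf hg) hh)
          (A.comp_mem hf (A.comp_mem hg hh)) (α_ f g h).hom =
        (α_ _ _ _).hom ≫ map f hf ◁ (mul g h hg hh).hom ≫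
          (mul f (g ≫ h) hf (A.comp_mem hg hh)).hom)
    (one_mul : ∀ {X Y : C} (f : X ⟶ Y) (hf : A.mem f), (mul (𝟙 X) f (A.id_mem X) hf).hom ≫
      map₂ (A.comp_mem (A.id_mem X) hf) hf (λ_ f).hom = (one X).hom ▷ map f hf ≫ (λ_ _).hom)
    (mul_one : ∀ {X Y : C} (f : X ⟶ Y) (hf : A.mem f), (mul f (𝟙 Y) hf (A.id_mem Y)).hom ≫
      map₂ (A.comp_mem hf (A.id_mem Y)) hf (ρ_ f).hom = map f hf ◁ (one Y).hom ≫ (ρ_ _).hom) :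
    PsFun A F₀ where
  map f hf := map f hf
  map₂ hf hg η := map₂ hf hg η
  mapId X := one X
  mapComp f g hf hg := (mul f g hf hg).symm
  map₂_id f hf := map₂_id f hf
  map₂_comp hf hg hh η θ := map₂_comp hf hg hh η θ
  map₂_whiskerLeft f _ _ hf hg hh η := by
    simp only [Iso.symm_hom, Iso.symm_inv, mul_right, Iso.inv_hom_id_assoc]
  map₂_whiskerRight hf hg η h hh := by
    simp only [Iso.symm_hom, Iso.symm_inv, mul_left, Iso.inv_hom_id_assoc]
  map₂_associator f g h hf hg hh := by
    rw [← cancel_epi (mul (f ≫ g) h (A.comp_mem hf hg) hh).hom,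
      ← cancel_epi ((mul f g hf hg).hom ▷ map h hh), mul_assoc]
    simp [← comp_whiskerRight_assoc]
  map₂_leftUnitor f hf := by
    simp only [Iso.symm_hom, ← one_mul, Iso.inv_hom_id_assoc]
  map₂_rightUnitor f hf := by
    simp only [Iso.symm_hom, ← mul_one, Iso.inv_hom_id_assoc]

/-- Isomorphisms of pseudofunctors that have the same action on objects. -/
structure PsIso (F F' : PsFun A F₀) where
  iso : ∀ {X Y : C} (f : X ⟶ Y) (hf : A.mem f), F.map f hf ≅ F'.map f hf
  map₂ : ∀ {X Y : C} {f g : X ⟶ Y} (hf : A.mem f) (hg : A.mem g) (η : f ⟶ g),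
    F.map₂ hf hg η ≫ (iso g hg).hom = (iso f hf).hom ≫ F'.map₂ hf hg η
  mapId : ∀ X : C, (iso (𝟙 X) (A.id_mem X)).hom ≫ (F'.mapId X).hom = (F.mapId X).hom
  mapComp : ∀ {X Y Z : C} (f : X ⟶ Y) (g : Y ⟶ Z) (hf : A.mem f) (hg : A.mem g),
    (iso (f ≫ g) (A.comp_mem hf hg)).hom ≫ (F'.mapComp f g hf hg).hom =
      (F.mapComp f g hf hg).hom ≫ (iso f hf).hom ▷ F.map g hg ≫ F'.map f hf ◁ (iso g hg).hom

end OfMul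

section

variable {E : Type u} [Bicategory.{w, v} E] {X Y Z W : E}

lemma conj_mul_left {f f' g g' : X ⟶ Y} {h h' : Y ⟶ Z} {k l : X ⟶ Z} (a : f ≅ f') (b : g ≅ g')
    (c : h ≅ h') (d : f ≫ h ≅ k) (e : g ≫ h ≅ l) (η : f ⟶ g) :
    (a.inv ≫ η ≫ b.hom) ▷ h' ≫ b.inv ▷ h' ≫ g ◁ c.inv ≫ e.hom =
      (a.inv ▷ h' ≫ f ◁ c.inv ≫ d.hom) ≫ d.inv ≫ η ▷ h ≫ e.hom := by
  simp [← whisker_exchange_assoc]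

lemma conj_mul_right {f f' : X ⟶ Y} {g g' h h' : Y ⟶ Z} {k l : X ⟶ Z} (a : f ≅ f') (b : g ≅ g')
    (c : h ≅ h') (d : f ≫ g ≅ k) (e : f ≫ h ≅ l) (η : g ⟶ h) :
    f' ◁ (b.inv ≫ η ≫ c.hom) ≫ a.inv ▷ h' ≫ f ◁ c.inv ≫ e.hom =
      (a.inv ▷ g' ≫ f ◁ b.inv ≫ d.hom) ≫ d.inv ≫ f ◁ η ≫ e.hom := by
  simp [whisker_exchange_assoc]

lemma conj_mul_one {f f' : X ⟶ Y} {g : Y ⟶ Y} {k : X ⟶ Y} (a : f ≅ f') (b : 𝟙 Y ≅ g)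
    (d : f ≫ 𝟙 Y ≅ k) : (a.inv ▷ g ≫ f ◁ b.inv ≫ d.hom) ≫ d.inv ≫ (ρ_ f).hom ≫ a.hom =
      f' ◁ (b.inv ≫ (ρ_ (𝟙 Y)).inv) ≫ f' ◁ (λ_ (𝟙 Y)).hom ≫ (ρ_ f').hom := by
  rw [← whiskerLeft_comp_assoc, unitors_equal]
  simp only [Category.assoc, Iso.hom_inv_id_assoc, Iso.inv_hom_id, Category.comp_id]
  rw [← rightUnitor_naturality, ← whisker_exchange_assoc, ← comp_whiskerRight_assoc]
  simp

lemma conj_mul_assoc {f f' : X ⟶ Y} {g g' : Y ⟶ Z} {h h' : Z ⟶ W} {k : X ⟶ Z} {l n : X ⟶ W}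
    {m : Y ⟶ W} (a : f ≅ f') (b : g ≅ g') (c : h ≅ h') (d : f ≫ g ≅ k) (d' : g ≫ h ≅ m)
    (e : (f ≫ g) ≫ h ≅ l) (e' : f ≫ g ≫ h ≅ n) :
    (a.inv ▷ g' ≫ f ◁ b.inv ≫ d.hom) ▷ h' ≫ (d.inv ▷ h' ≫ (f ≫ g) ◁ c.inv ≫ e.hom) ≫
      e.inv ≫ (α_ f g h).hom ≫ e'.hom = (α_ f' g' h').hom ≫
        f' ◁ (b.inv ▷ h' ≫ g ◁ c.inv ≫ d'.hom) ≫ a.inv ▷ m ≫ f ◁ d'.inv ≫ e'.hom := by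
  symm
  calc _ = (α_ f' g' h').hom ≫ f' ◁ (b.inv ▷ h' ≫ g ◁ c.inv) ≫ (f' ◁ d'.hom ≫ a.inv ▷ m) ≫
        f ◁ d'.inv ≫ e'.hom := by simp
    _ = 𝟙 _ ⊗≫ (f' ◁ (b.inv ▷ h' ≫ g ◁ c.inv) ≫ a.inv ▷ (g ≫ h)) ⊗≫ e'.hom := by
      rw [whisker_exchange]; simp [bicategoricalComp]
    _ = _ := by rw [whisker_exchange]; simp [bicategoricalComp]

end

section Glued

variable {C : Type u} [Bicategory.{w, v} C] [IsLocallyGroupoid C] {D : Type u'}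
  [Bicategory.{w', v'} D] {P Q B : WideSub C} {F₀ : C → D} {F₁ : PsFun P F₀} {F₂ : PsFun Q F₀}

omit [IsLocallyGroupoid C] in
lemma NF.leftIso_inv_mapId (F₁ : PsFun P F₀) (F₂ : PsFun Q F₀) (X : C) :
    (NF.leftIso F₁ F₂ (P.id_mem X)).inv ≫ (F₁.mapId X).hom =
      (NF.rightIso F₁ F₂ (Q.id_mem X)).inv ≫ (F₂.mapId X).hom := by
  simp only [Iso.trans_inv, whiskerLeftIso_inv, whiskerRightIso_inv, Iso.symm_inv, Category.assoc]
  rw [← rightUnitor_naturality, ← leftUnitor_naturality, whisker_exchange_assoc]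
  simp

namespace Transport

variable {G : Gluing F₁ F₂} (T : Transport G)
  (hprod : ∀ {X Y Z : C} (K : NF P Q X Y) (L : NF P Q Y Z), Nonempty (NF.Prod K L))
  (hfac : ∀ {X Y Z : C} (q : X ⟶ Y) (i : Y ⟶ Z), Q.mem q → P.mem i →
      ∃ (W : C) (j : X ⟶ W) (p : W ⟶ Z) (_ : q ≫ i ⟶ j ≫ p), P.mem j ∧ Q.mem p)
  (nf : ∀ {X Y : C} (f : X ⟶ Y), B.mem f → NF P Q X Y)
  (ν : ∀ {X Y : C} (f : X ⟶ Y) (hf : B.mem f), f ≅ (nf f hf).hom)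


lemma one_mul {X Y : C} (K : NF P Q X Y) :
    (T.mul hprod (K := NF.left (P.id_mem X)) (L := K) (M := K)
      ((ρ_ (𝟙 X)).hom ▷ K.hom ≫ (λ_ K.hom).hom)).hom =
      (NF.leftIso F₁ F₂ (P.id_mem X)).inv ▷ _ ≫ (F₁.mapId X).hom ▷ _ ≫ (λ_ _).hom := by
  rw [← cancel_epi ((NF.leftIso F₁ F₂ (P.id_mem X)).hom ▷ _)]
  have e : (ρ_ (𝟙 X)).hom ▷ K.hom ≫ (λ_ K.hom).hom =
    ((ρ_ (𝟙 X)).hom ▷ (K.a ≫ K.p) ≫ (α_ (𝟙 X) K.a K.p).inv) ≫ (λ_ K.a).hom ▷ K.p ≫ K.a ◁ 𝟙 K.p := by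
    simp
  rw [e, T.mul_comp hprod (M := ⟨P.comp_mem (P.id_mem X) K.ha, K.hp⟩), T.iso_pair,
    reassoc_of% T.mul_leftIso hprod (P.id_mem X) K.ha K.hp, F₁.map₂_leftUnitor, F₂.map₂_id]
  simp

lemma mul_one {X Y : C} (K : NF P Q X Y) :
    (T.mul hprod (K := K) (L := NF.right (Q.id_mem Y)) (M := K)
      (K.hom ◁ (λ_ (𝟙 Y)).hom ≫ (ρ_ K.hom).hom)).hom =
      _ ◁ (NF.rightIso F₁ F₂ (Q.id_mem Y)).inv ≫ _ ◁ (F₂.mapId Y).hom ≫ (ρ_ _).hom := by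
  rw [← cancel_epi (_ ◁ (NF.rightIso F₁ F₂ (Q.id_mem Y)).hom)]
  have e : K.hom ◁ (λ_ (𝟙 Y)).hom ≫ (ρ_ K.hom).hom =
    ((K.a ≫ K.p) ◁ (λ_ (𝟙 Y)).hom ≫ (α_ K.a K.p (𝟙 Y)).hom) ≫ K.a ◁ (ρ_ K.p).hom := by
    simp
  rw [e, T.mul_comp hprod (M := ⟨K.ha, Q.comp_mem K.hp (Q.id_mem Y)⟩), T.iso_whiskerLeft,
    reassoc_of% T.mul_rightIso hprod K.ha K.hp (Q.id_mem Y), F₂.map₂_rightUnitor]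
  simp

/-- The pseudofunctor deduced from a gluing datum. -/
noncomputable def psFun : PsFun B F₀ :=
  PsFun.ofMul (fun f hf => (nf f hf).map F₁ F₂)
    (fun {_ _ f g} hf hg η => (T.iso ((ν f hf).inv ≫ η ≫ (ν g hg).hom)).hom)
    (fun X => T.iso (K := nf (𝟙 X) _) (L := NF.left (P.id_mem X))
      ((ν (𝟙 X) (B.id_mem X)).inv ≫ (ρ_ _).inv) ≪≫ (NF.leftIso F₁ F₂ _).symm ≪≫ F₁.mapId X)
    (fun f g hf hg => T.mul hprod ((ν f hf).inv ▷ _ ≫ f ◁ (ν g hg).inv ≫ (ν (f ≫ g) _).hom))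
    (fun f hf => by rw [Category.id_comp, Iso.inv_hom_id, T.iso_id])
    (fun hf hg hh η θ => by rw [← T.iso_comp]; simp)
    (fun {_ _ _ f g} hf hg η h hh => by
      rw [T.mul_left hprod hfac, ← T.mul_comp]
      exact congrArg (fun θ => (T.mul hprod θ).hom) (conj_mul_left _ _ _ _ _ η))
    (fun {_ _ _ f g h} hf hg hh η => by
      rw [T.mul_right hprod, ← T.mul_comp]
      exact congrArg (fun θ => (T.mul hprod θ).hom) (conj_mul_right _ _ _ _ _ η))
    (fun f g h hf hg hh => by
      rw [← T.mul_comp]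
      exact T.mul_assoc hprod hfac _ _ _ _ (conj_mul_assoc _ _ _ _ _ _ _))
    (fun {X Y} f hf => by
      have e : ((ν (𝟙 X) (B.id_mem X)).inv ▷ _ ≫ 𝟙 X ◁ (ν f hf).inv ≫ (ν (𝟙 X ≫ f) _).hom) ≫
        (ν (𝟙 X ≫ f) (B.comp_mem (B.id_mem X) hf)).inv ≫ (λ_ f).hom ≫ (ν f hf).hom =
          ((ν (𝟙 X) (B.id_mem X)).inv ≫ (ρ_ _).inv) ▷ _ ≫ (ρ_ (𝟙 X)).hom ▷ (nf f hf).hom ≫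
            (λ_ (nf f hf).hom).hom := by
        rw [← comp_whiskerRight_assoc]; simp
      have h := T.mul_left hprod hfac (K' := NF.left (P.id_mem X)) (L := nf f hf)
        ((ν (𝟙 X) (B.id_mem X)).inv ≫ (ρ_ _).inv)
        ((ρ_ (𝟙 X)).hom ▷ (nf f hf).hom ≫ (λ_ (nf f hf).hom).hom)
      rw [← T.mul_comp, e, ← h, T.one_mul]
      simp)
    (fun {X Y} f hf => by
      have e : ((ν f hf).inv ▷ _ ≫ f ◁ (ν (𝟙 Y) (B.id_mem Y)).inv ≫ (ν (f ≫ 𝟙 Y) _).hom) ≫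
        (ν (f ≫ 𝟙 Y) (B.comp_mem hf (B.id_mem Y))).inv ≫ (ρ_ f).hom ≫ (ν f hf).hom =
          _ ◁ ((ν (𝟙 Y) (B.id_mem Y)).inv ≫ (ρ_ _).inv) ≫ (nf f hf).hom ◁ (λ_ (𝟙 Y)).hom ≫
            (ρ_ (nf f hf).hom).hom := by
        exact conj_mul_one _ _ _
      have h := T.mul_right hprod (K := nf f hf) (L' := NF.right (Q.id_mem Y))
        ((ν (𝟙 Y) (B.id_mem Y)).inv ≫ (ρ_ _).inv)
        ((nf f hf).hom ◁ (λ_ (𝟙 Y)).hom ≫ (ρ_ (nf f hf).hom).hom)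
      rw [← T.mul_comp, e, ← h, T.mul_one]
      simp only [Iso.trans_hom, Iso.symm_hom, whiskerLeft_comp, Category.assoc]
      rw [← whiskerLeft_comp_assoc _ (NF.leftIso F₁ F₂ _).inv, NF.leftIso_inv_mapId]
      simp)

end Transport

end Glued

section

variable {E : Type u} [Bicategory.{w, v} E] {X Y Z : E}

lemma conj_mul {f f' u : X ⟶ Y} {g g' t : Y ⟶ Z} {k : X ⟶ Z} (a : f ≅ f') (b : g ≅ g')
    (d : f ≫ g ⟶ k) (φ : u ⟶ f) (ψ : t ⟶ g) :
    (φ ≫ a.hom) ▷ t ≫ f' ◁ (ψ ≫ b.hom) ≫ a.inv ▷ g' ≫ f ◁ b.inv ≫ d =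
      φ ▷ t ≫ f ◁ ψ ≫ d := by
  simp only [whiskerLeft_comp, comp_whiskerRight, Category.assoc]
  rw [whisker_exchange_assoc, whisker_exchange_assoc]
  simp

lemma mapComp_rightUnitor {f : X ⟶ Y} {g : Y ⟶ Z} {d : Z ⟶ Z} {k : X ⟶ Z} (m : k ≅ f ≫ g)
    (n : 𝟙 Z ⟶ d) : m.hom ≫ (ρ_ (f ≫ g)).inv ≫ (α_ f g (𝟙 Z)).hom ≫ f ◁ g ◁ n ≫
      (α_ f g d).inv ≫ m.inv ▷ d = (ρ_ k).inv ≫ k ◁ n := by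
  rw [associator_inv_naturality_right_assoc, Iso.hom_inv_id_assoc, whisker_exchange]
  simp

lemma mapComp_leftUnitor {f : X ⟶ Y} {g : Y ⟶ Z} {d : X ⟶ X} {k : X ⟶ Z} (m : k ≅ f ≫ g)
    (n : 𝟙 X ⟶ d) : m.hom ≫ (λ_ (f ≫ g)).inv ≫ (α_ (𝟙 X) f g).inv ≫ n ▷ f ▷ g ≫
      (α_ d f g).hom ≫ d ◁ m.inv = (λ_ k).inv ≫ n ▷ k := by
  rw [associator_naturality_left_assoc, Iso.inv_hom_id_assoc, ← whisker_exchange]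
  simp

lemma conj_map₂ {k f f' g g' : X ⟶ Y} (φ : k ⟶ f) (a : f ≅ f') (η : f ⟶ g) (b : g ⟶ g') :
    (φ ≫ a.hom) ≫ a.inv ≫ η ≫ b = (φ ≫ η) ≫ b := by
  simp

end

section Glued

variable {C : Type u} [Bicategory.{w, v} C] [IsLocallyGroupoid C] {D : Type u'}
  [Bicategory.{w', v'} D] {P Q B : WideSub C} {F₀ : C → D} {F₁ : PsFun P F₀} {F₂ : PsFun Q F₀}

namespace Transport

variable {G : Gluing F₁ F₂} (T : Transport G)
  (hprod : ∀ {X Y Z : C} (K : NF P Q X Y) (L : NF P Q Y Z), Nonempty (NF.Prod K L))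
  (hfac : ∀ {X Y Z : C} (q : X ⟶ Y) (i : Y ⟶ Z), Q.mem q → P.mem i →
      ∃ (W : C) (j : X ⟶ W) (p : W ⟶ Z) (_ : q ≫ i ⟶ j ≫ p), P.mem j ∧ Q.mem p)
  (nf : ∀ {X Y : C} (f : X ⟶ Y), B.mem f → NF P Q X Y)
  (ν : ∀ {X Y : C} (f : X ⟶ Y) (hf : B.mem f), f ≅ (nf f hf).hom)

lemma mul_mixed {X Y Z : C} {a : X ⟶ Y} {p : Y ⟶ Z} (ha : P.mem a) (hp : Q.mem p) :
    (NF.leftIso F₁ F₂ ha).hom ▷ _ ≫ _ ◁ (NF.rightIso F₁ F₂ hp).hom ≫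
      (T.mul hprod (K := NF.left ha) (L := NF.right hp) (M := ⟨ha, hp⟩)
        ((ρ_ a).hom ▷ (𝟙 Y ≫ p) ≫ a ◁ (λ_ p).hom)).hom = 𝟙 _ := by
  have e : (ρ_ a).hom ▷ (𝟙 Y ≫ p) ≫ a ◁ (λ_ p).hom =
    ((ρ_ a).hom ▷ (𝟙 Y ≫ p) ≫ (α_ a (𝟙 Y) p).inv) ≫ (ρ_ a).hom ▷ p ≫ a ◁ 𝟙 p := by bicategory
  rw [← whisker_exchange_assoc, e, T.mul_comp hprod (M := ⟨P.comp_mem ha (P.id_mem Y), hp⟩),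
    T.iso_pair, reassoc_of% T.mul_leftIso hprod ha (P.id_mem Y) hp, F₁.map₂_rightUnitor,
    F₂.map₂_id]
  simp

include hfac in
lemma mul_conj {X Y Z : C} {K K' : NF P Q X Y} {L L' : NF P Q Y Z} {M : NF P Q X Z}
    {s : F₀ X ⟶ F₀ Y} {t : F₀ Y ⟶ F₀ Z} (x : s ⟶ K.map F₁ F₂) (y : t ⟶ L.map F₁ F₂)
    (φ : K.hom ⟶ K'.hom) (ψ : L.hom ⟶ L'.hom) (θ : K'.hom ≫ L'.hom ⟶ M.hom) :
    (x ≫ (T.iso φ).hom) ▷ t ≫ _ ◁ (y ≫ (T.iso ψ).hom) ≫ (T.mul hprod θ).hom =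
      x ▷ t ≫ _ ◁ y ≫ (T.mul hprod (φ ▷ L.hom ≫ K'.hom ◁ ψ ≫ θ)).hom := by
  rw [whiskerLeft_comp, Category.assoc, T.mul_right hprod, comp_whiskerRight, Category.assoc,
    ← whisker_exchange_assoc, T.mul_left hprod hfac]

/-- The image of a 1-cell given by a composite. -/
abbrev psFun_iso {X Y : C} (K : NF P Q X Y) (f : X ⟶ Y) (hf : B.mem f) (φ : K.hom ⟶ f) :
    K.map F₁ F₂ ≅ (T.psFun hprod hfac nf ν).map f hf :=
  T.iso (φ ≫ (ν f hf).hom)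

lemma psFun_mapComp {X Y Z : C} {K : NF P Q X Y} {L : NF P Q Y Z}
    {s : F₀ X ⟶ F₀ Y} {t : F₀ Y ⟶ F₀ Z} (x : s ⟶ K.map F₁ F₂) (y : t ⟶ L.map F₁ F₂) {f : X ⟶ Y}
    {g : Y ⟶ Z} (hf : B.mem f) (hg : B.mem g) (φ : K.hom ⟶ f) (ψ : L.hom ⟶ g) :
    (x ≫ (T.psFun_iso hprod hfac nf ν K f hf φ).hom) ▷ t ≫
        _ ◁ (y ≫ (T.psFun_iso hprod hfac nf ν L g hg ψ).hom) ≫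
        ((T.psFun hprod hfac nf ν).mapComp f g hf hg).inv =
      x ▷ t ≫ _ ◁ y ≫ (T.mul hprod (φ ▷ L.hom ≫ f ◁ ψ ≫ (ν (f ≫ g) (B.comp_mem hf hg)).hom)).hom :=
  (T.mul_conj hprod hfac x y (φ ≫ (ν f hf).hom) (ψ ≫ (ν g hg).hom) _).trans
    (congrArg (fun θ => x ▷ t ≫ _ ◁ y ≫ (T.mul hprod θ).hom) (conj_mul _ _ _ _ _))

lemma iso_psFun_map₂ {X Y : C} {K : NF P Q X Y} {f g : X ⟶ Y} (hf : B.mem f) (hg : B.mem g)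
    (φ : K.hom ⟶ f) (η : f ⟶ g) : (T.psFun_iso hprod hfac nf ν K f hf φ).hom ≫
      (T.psFun hprod hfac nf ν).map₂ hf hg η =
        (T.psFun_iso hprod hfac nf ν K g hg (φ ≫ η)).hom :=
  (T.iso_comp _ _).symm.trans
    (congrArg (fun θ => (T.iso θ).hom) (conj_map₂ φ _ η _))

lemma iso_psFun_iso {X Y : C} {K L : NF P Q X Y} {f : X ⟶ Y} (hf : B.mem f)
    (ψ : K.hom ⟶ L.hom) (φ : L.hom ⟶ f) : (T.iso ψ).hom ≫
      (T.psFun_iso hprod hfac nf ν L f hf φ).hom =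
        (T.psFun_iso hprod hfac nf ν K f hf (ψ ≫ φ)).hom :=
  (T.iso_comp _ _).symm.trans
    (congrArg (fun θ => (T.iso θ).hom) (Category.assoc _ _ _).symm)

/-- The first pseudofunctor is the restriction of the pseudofunctor deduced from the gluing
datum. -/
noncomputable def leftPsIso (hP : P ≤ B) :
    PsIso F₁ ((T.psFun hprod hfac nf ν).restrict hP) where
  iso f hf := NF.leftIso F₁ F₂ hf ≪≫ T.psFun_iso hprod hfac nf ν (NF.left hf) f (hP _ hf) (ρ_ f).hom
  map₂ {X Y f g} hf hg η := by
    have h := T.iso_psFun_iso hprod hfac nf ν (K := NF.left hf) (L := NF.left hg) (hP _ hg)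
      (η ▷ 𝟙 Y ≫ g ◁ 𝟙 (𝟙 Y)) (ρ_ g).hom
    rw [T.iso_pair, F₂.map₂_id] at h
    simp only [Iso.trans_hom, Category.assoc, T.iso_psFun_map₂]
    simp only [Bicategory.whiskerLeft_id, Category.comp_id, rightUnitor_naturality] at h
    rw [← h]
    simp [whisker_exchange_assoc]
  mapId X := by
    simp only [Iso.trans_hom, Category.assoc]
    have h : (T.psFun_iso hprod hfac nf ν (NF.left (P.id_mem X)) (𝟙 X) (hP _ (P.id_mem X))
        (ρ_ (𝟙 X)).hom).hom ≫ ((T.psFun hprod hfac nf ν).mapId X).hom =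
        (T.iso _).hom ≫ (T.iso _).hom ≫ _ := rfl
    rw [h, ← Category.assoc (T.iso _).hom, ← T.iso_comp]
    simp [T.iso_id]
  mapComp {X Y Z} f g hf hg := by
    change _ ≫ ((T.psFun hprod hfac nf ν).mapComp f g (hP _ hf) (hP _ hg)).hom = _
    rw [← Iso.eq_comp_inv]
    simp only [Category.assoc]
    have h := T.psFun_mapComp hprod hfac nf ν (K := NF.left hf) (L := NF.left hg)
      (NF.leftIso F₁ F₂ hf).hom (NF.leftIso F₁ F₂ hg).hom (hP _ hf) (hP _ hg) (ρ_ f).hom (ρ_ g).hom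
    have e : (ρ_ f).hom ▷ (g ≫ 𝟙 Z) ≫ f ◁ (ρ_ g).hom ≫ (ν (f ≫ g) (B.comp_mem (hP _ hf) (hP _ hg))).hom =
      ((ρ_ f).hom ▷ (g ≫ 𝟙 Z) ≫ (α_ f g (𝟙 Z)).inv) ≫ (ρ_ (f ≫ g)).hom ≫ (ν (f ≫ g) _).hom := by
      simp
    have k := T.mul_leftIso hprod hf hg (Q.id_mem Z)
    simp only [Iso.trans_hom] at h k ⊢
    rw [h, e, T.mul_comp hprod (M := NF.left (P.comp_mem hf hg)), ← whisker_exchange_assoc,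
      reassoc_of% k]
    simp only [Iso.symm_hom, whiskerLeftIso_hom, whiskerLeft_comp, Category.assoc,
      whiskerLeft_rightUnitor_inv]
    have l := mapComp_rightUnitor (F₁.mapComp f g hf hg) (F₂.mapId Z).inv
    exact ((reassoc_of% l) _).symm

/-- The second pseudofunctor is the restriction of the pseudofunctor deduced from the gluing
datum. -/
noncomputable def rightPsIso (hQ : Q ≤ B) :
    PsIso F₂ ((T.psFun hprod hfac nf ν).restrict hQ) where
  iso f hf := NF.rightIso F₁ F₂ hf ≪≫
    T.psFun_iso hprod hfac nf ν (NF.right hf) f (hQ _ hf) (λ_ f).hom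
  map₂ {X Y f g} hf hg η := by
    have h := T.iso_psFun_iso hprod hfac nf ν (K := NF.right hf) (L := NF.right hg) (hQ _ hg)
      (𝟙 X ◁ η) (λ_ g).hom
    rw [T.iso_whiskerLeft] at h
    simp only [Iso.trans_hom, Category.assoc, T.iso_psFun_map₂]
    simp only [leftUnitor_naturality] at h
    rw [← h]
    simp [← whisker_exchange_assoc]
  mapId X := by
    simp only [Iso.trans_hom, Category.assoc]
    have h : (T.psFun_iso hprod hfac nf ν (NF.right (Q.id_mem X)) (𝟙 X) (hQ _ (Q.id_mem X))
        (λ_ (𝟙 X)).hom).hom ≫ ((T.psFun hprod hfac nf ν).mapId X).hom =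
        (T.iso _).hom ≫ (T.iso _).hom ≫
          ((NF.leftIso F₁ F₂ (P.id_mem X)).inv ≫ (F₁.mapId X).hom) := rfl
    rw [h, ← Category.assoc (T.iso _).hom, ← T.iso_comp, NF.leftIso_inv_mapId]
    simp [T.iso_id, unitors_equal]
  mapComp {X Y Z} f g hf hg := by
    change _ ≫ ((T.psFun hprod hfac nf ν).mapComp f g (hQ _ hf) (hQ _ hg)).hom = _
    rw [← Iso.eq_comp_inv]
    simp only [Category.assoc]
    have h := T.psFun_mapComp hprod hfac nf ν (K := NF.right hf) (L := NF.right hg)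
      (NF.rightIso F₁ F₂ hf).hom (NF.rightIso F₁ F₂ hg).hom (hQ _ hf) (hQ _ hg) (λ_ f).hom (λ_ g).hom
    have e : (λ_ f).hom ▷ (𝟙 Y ≫ g) ≫ f ◁ (λ_ g).hom ≫ (ν (f ≫ g) (B.comp_mem (hQ _ hf) (hQ _ hg))).hom =
      ((𝟙 X ≫ f) ◁ (λ_ g).hom ≫ (α_ (𝟙 X) f g).hom) ≫ (λ_ (f ≫ g)).hom ≫ (ν (f ≫ g) _).hom := by
      simp [← whisker_exchange_assoc]
    have k := T.mul_rightIso hprod (P.id_mem X) hf hg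
    simp only [Iso.trans_hom] at h k ⊢
    rw [h, e, T.mul_comp hprod (M := NF.right (Q.comp_mem hf hg)), reassoc_of% k]
    simp only [Iso.symm_hom, whiskerRightIso_hom, comp_whiskerRight, Category.assoc,
      leftUnitor_inv_whiskerRight]
    have l := mapComp_leftUnitor (F₂.mapComp f g hf hg) (F₁.mapId X).inv
    exact ((reassoc_of% l) _).symm

lemma psFun_mapSq (hP : P ≤ B) (hQ : Q ≤ B) {X Y Z W : C} {j : X ⟶ Y} {q : X ⟶ Z} {p : Y ⟶ W}
    {i : Z ⟶ W} (hj : P.mem j) (hq : Q.mem q) (hp : Q.mem p) (hi : P.mem i) (β : q ≫ i ⟶ j ≫ p) :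
    ((T.rightPsIso hprod hfac nf ν hQ).iso q hq).hom ▷ F₁.map i hi ≫
      _ ◁ ((T.leftPsIso hprod hfac nf ν hP).iso i hi).hom ≫
        (T.psFun hprod hfac nf ν).mapSq (hP _ hj) (hQ _ hq) (hQ _ hp) (hP _ hi) β =
      (G.iso hj hq hp hi β).hom ≫ ((T.leftPsIso hprod hfac nf ν hP).iso j hj).hom ▷ F₂.map p hp ≫
      _ ◁ ((T.rightPsIso hprod hfac nf ν hQ).iso p hp).hom := by
  have h₁ := T.psFun_mapComp hprod hfac nf ν (K := NF.right hq) (L := NF.left hi)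
    (NF.rightIso F₁ F₂ hq).hom (NF.leftIso F₁ F₂ hi).hom (hQ _ hq) (hP _ hi) (λ_ q).hom (ρ_ i).hom
  have h₂ := T.psFun_mapComp hprod hfac nf ν (K := NF.left hj) (L := NF.right hp)
    (NF.leftIso F₁ F₂ hj).hom (NF.rightIso F₁ F₂ hp).hom (hP _ hj) (hQ _ hp) (ρ_ j).hom (λ_ p).hom
  have k₂ := T.mul_comp hprod (K := NF.left hj) (L := NF.right hp) (M := ⟨hj, hp⟩)
    ((ρ_ j).hom ▷ (𝟙 Y ≫ p) ≫ j ◁ (λ_ p).hom) (ν (j ≫ p) (B.comp_mem (hP _ hj) (hQ _ hp))).hom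
  have k₁ := T.mul_comp hprod (K := NF.right hq) (L := NF.left hi) (M := nf (q ≫ i)
    (B.comp_mem (hQ _ hq) (hP _ hi))) ((λ_ q).hom ▷ _ ≫ q ◁ (ρ_ i).hom ≫ (ν (q ≫ i)
      (B.comp_mem (hQ _ hq) (hP _ hi))).hom) ((ν _ _).inv ≫ β ≫ (ν (j ≫ p)
        (B.comp_mem (hP _ hj) (hQ _ hp))).hom)
  have k₃ := T.mul_comp hprod (K := NF.right hq) (L := NF.left hi) (M := ⟨hj, hp⟩)
    ((λ_ q).hom ▷ _ ≫ q ◁ (ρ_ i).hom ≫ β) (ν (j ≫ p) (B.comp_mem (hP _ hj) (hQ _ hp))).hom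
  have e₁ : (T.iso ((ν (q ≫ i) (B.comp_mem (hQ _ hq) (hP _ hi))).inv ≫ β ≫ (ν (j ≫ p)
        (B.comp_mem (hP _ hj) (hQ _ hp))).hom)).hom = (T.psFun hprod hfac nf ν).map₂ _ _ β := rfl
  simp only [Category.assoc, Iso.hom_inv_id_assoc] at k₁ k₂ k₃
  rw [k₃] at k₁
  rw [← cancel_mono ((T.psFun hprod hfac nf ν).mapComp j p (hP _ hj) (hQ _ hp)).inv]
  simp only [PsFun.mapSq, Category.assoc, Iso.hom_inv_id, Category.comp_id]
  have l₁ := T.mul_mixed hprod hj hp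
  have l₂ := T.mul_square hprod hj hq hp hi β
  simp only [rightPsIso, leftPsIso, Iso.trans_hom, Category.assoc] at h₁ h₂ l₁ l₂ ⊢
  rw [h₂, k₂, reassoc_of% l₁, reassoc_of% h₁, ← e₁]
  exact (Category.assoc _ _ _).trans ((congrArg (_ ≫ ·) ((Category.assoc _ _ _).trans
    (congrArg (_ ≫ ·) k₁.symm))).trans ((reassoc_of% l₂) _))

end Transport

/-- A gluing datum on `P` and `Q` comes from a pseudofunctor on `B`. -/
theorem Gluing.exists_psFun (G : Gluing F₁ F₂) (hP : P ≤ B) (hQ : Q ≤ B) (hfac : Factors P Q B)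
    (hfib : HasFiberProductsAgreeing Q B) :
    ∃ (F : PsFun B F₀) (e₁ : PsIso F₁ (F.restrict hP)) (e₂ : PsIso F₂ (F.restrict hQ)),
      ∀ {X Y Z W : C} {j : X ⟶ Y} {q : X ⟶ Z} {p : Y ⟶ W} {i : Z ⟶ W} (hj : P.mem j)
        (hq : Q.mem q) (hp : Q.mem p) (hi : P.mem i) (β : q ≫ i ⟶ j ≫ p),
        (e₂.iso q hq).hom ▷ F₁.map i hi ≫ _ ◁ (e₁.iso i hi).hom ≫
          F.mapSq (hP _ hj) (hQ _ hq) (hQ _ hp) (hP _ hi) β =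
        (G.iso hj hq hp hi β).hom ≫ (e₁.iso j hj).hom ▷ F₂.map p hp ≫
          _ ◁ (e₂.iso p hp).hom := by
  have T := Transport.mk' hP hQ (Roofed.of_factors hP hfac hfib) hfib G
  have hnf : ∀ {X Y : C} (f : X ⟶ Y), B.mem f → ∃ K : NF P Q X Y, Nonempty (f ≅ K.hom) := by
    intro X Y f hf
    obtain ⟨Z, a, p, ha, hp, h⟩ := hfac f hf
    exact ⟨⟨ha, hp⟩, h⟩
  have hsq : ∀ {X Y Z : C} (q : X ⟶ Y) (i : Y ⟶ Z), Q.mem q → P.mem i →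
      ∃ (W : C) (j : X ⟶ W) (p : W ⟶ Z) (_ : q ≫ i ⟶ j ≫ p), P.mem j ∧ Q.mem p := by
    intro X Y Z q i hq hi
    obtain ⟨W, a, p, ha, hp, ⟨h⟩⟩ := hfac (q ≫ i) (B.comp_mem (hQ _ hq) (hP _ hi))
    exact ⟨W, a, p, h.hom, ha, hp⟩
  exact ⟨T.psFun (NF.Prod.nonempty hP hQ hfac) hsq (fun f hf => (hnf f hf).choose)
    (fun f hf => (hnf f hf).choose_spec.some), T.leftPsIso _ _ _ _ hP, T.rightPsIso _ _ _ _ hQ,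
    T.psFun_mapSq _ _ _ _ hP hQ⟩

end Glued

section

variable {E : Type u} [Bicategory.{w, v} E]

lemma conj_vpaste {X₁ X₂ X₃ Y₁ Y₂ Y₃ : E} {i₁ j₁ : X₁ ⟶ Y₁} {i₂ j₂ : X₂ ⟶ Y₂} {i₃ j₃ : X₃ ⟶ Y₃}
    {q r : X₁ ⟶ X₂} {p s : Y₁ ⟶ Y₂} {q' r' : X₂ ⟶ X₃} {p' s' : Y₂ ⟶ Y₃} {a₁ : i₁ ⟶ j₁}
    {a₂ : i₂ ⟶ j₂} {a₃ : i₃ ⟶ j₃} {b : q ⟶ r} {c : p ⟶ s} {b' : q' ⟶ r'} {c' : p' ⟶ s'}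
    {φ : q ≫ i₂ ⟶ i₁ ≫ p} {φ' : q' ≫ i₃ ⟶ i₂ ≫ p'} {ψ : r ≫ j₂ ⟶ j₁ ≫ s}
    {ψ' : r' ≫ j₃ ⟶ j₂ ≫ s'} (h : b ▷ i₂ ≫ r ◁ a₂ ≫ ψ = φ ≫ a₁ ▷ p ≫ j₁ ◁ c)
    (h' : b' ▷ i₃ ≫ r' ◁ a₃ ≫ ψ' = φ' ≫ a₂ ▷ p' ≫ j₂ ◁ c') :
    (b ▷ q' ≫ r ◁ b') ▷ i₃ ≫ (r ≫ r') ◁ a₃ ≫ vpaste ψ ψ' =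
      vpaste φ φ' ≫ a₁ ▷ (p ≫ p') ≫ j₁ ◁ (c ▷ p' ≫ s ◁ c') := by
  dsimp only [vpaste]
  calc _ = 𝟙 _ ⊗≫ b ▷ (q' ≫ i₃) ⊗≫ r ◁ (b' ▷ i₃ ≫ r' ◁ a₃ ≫ ψ') ⊗≫ ψ ▷ s' ⊗≫ 𝟙 _ := by
        bicategory
    _ = 𝟙 _ ⊗≫ (b ▷ (q' ≫ i₃) ≫ r ◁ φ') ⊗≫ r ◁ a₂ ▷ p' ⊗≫ ((r ≫ j₂) ◁ c' ≫ ψ ▷ s') ⊗≫ 𝟙 _ := by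
        rw [h']; bicategory
    _ = 𝟙 _ ⊗≫ q ◁ φ' ⊗≫ (b ▷ i₂ ≫ r ◁ a₂ ≫ ψ) ▷ p' ⊗≫ j₁ ◁ s ◁ c' ⊗≫ 𝟙 _ := by
        rw [← whisker_exchange, whisker_exchange ψ]; bicategory
    _ = _ := by rw [h]; bicategory

lemma conj_hpaste {X₁ X₂ X₃ Y₁ Y₂ Y₃ : E} {p₁ r₁ : X₁ ⟶ Y₁} {p₂ r₂ : X₂ ⟶ Y₂} {p₃ r₃ : X₃ ⟶ Y₃}
    {j k : X₁ ⟶ X₂} {i l : Y₁ ⟶ Y₂} {j' k' : X₂ ⟶ X₃} {i' l' : Y₂ ⟶ Y₃} {a₁ : p₁ ⟶ r₁}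
    {a₂ : p₂ ⟶ r₂} {a₃ : p₃ ⟶ r₃} {b : j ⟶ k} {c : i ⟶ l} {b' : j' ⟶ k'} {c' : i' ⟶ l'}
    {φ : p₁ ≫ i ⟶ j ≫ p₂} {φ' : p₂ ≫ i' ⟶ j' ≫ p₃} {ψ : r₁ ≫ l ⟶ k ≫ r₂}
    {ψ' : r₂ ≫ l' ⟶ k' ≫ r₃} (h : a₁ ▷ i ≫ r₁ ◁ c ≫ ψ = φ ≫ b ▷ p₂ ≫ k ◁ a₂)
    (h' : a₂ ▷ i' ≫ r₂ ◁ c' ≫ ψ' = φ' ≫ b' ▷ p₃ ≫ k' ◁ a₃) :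
    a₁ ▷ (i ≫ i') ≫ r₁ ◁ (c ▷ i' ≫ l ◁ c') ≫ hpaste ψ ψ' =
      hpaste φ φ' ≫ (b ▷ j' ≫ k ◁ b') ▷ p₃ ≫ (k ≫ k') ◁ a₃ := by
  dsimp only [hpaste]
  calc _ = 𝟙 _ ⊗≫ a₁ ▷ (i ≫ i') ⊗≫ r₁ ◁ c ▷ i' ⊗≫ ((r₁ ≫ l) ◁ c' ≫ ψ ▷ l') ⊗≫ k ◁ ψ' ⊗≫ 𝟙 _ := by
        bicategory
    _ = 𝟙 _ ⊗≫ (a₁ ▷ i ≫ r₁ ◁ c ≫ ψ) ▷ i' ⊗≫ k ◁ r₂ ◁ c' ⊗≫ k ◁ ψ' ⊗≫ 𝟙 _ := by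
        rw [whisker_exchange]; bicategory
    _ = 𝟙 _ ⊗≫ φ ▷ i' ⊗≫ b ▷ (p₂ ≫ i') ⊗≫ k ◁ (a₂ ▷ i' ≫ r₂ ◁ c' ≫ ψ') ⊗≫ 𝟙 _ := by
        rw [h]; bicategory
    _ = 𝟙 _ ⊗≫ φ ▷ i' ⊗≫ (b ▷ (p₂ ≫ i') ≫ k ◁ φ') ⊗≫ k ◁ b' ▷ p₃ ⊗≫ k ◁ k' ◁ a₃ ⊗≫ 𝟙 _ := by
        rw [h']; bicategory
    _ = _ := by rw [← whisker_exchange]; bicategory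

lemma conj_hcomp {X Y Z W : E} {i i' : Z ⟶ W} {j j' : X ⟶ Y} {Q Q' q q' : X ⟶ Z}
    {P P' p p' : Y ⟶ W} {a : i ⟶ i'} {a₁ : j ⟶ j'} {b₀ : Q ⟶ Q'} {b : q ⟶ q'} {m : Q ⟶ q}
    {m' : Q' ⟶ q'} {c₀ : P ⟶ P'} {c : p ⟶ p'} {n : P ≅ p} {n' : P' ≅ p'} {V : q ≫ i ⟶ j ≫ p}
    {V' : q' ≫ i' ⟶ j' ≫ p'} (hb : b₀ ≫ m' = m ≫ b) (hc : c₀ ≫ n'.hom = n.hom ≫ c)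
    (hV : b ▷ i ≫ q' ◁ a ≫ V' = V ≫ a₁ ▷ p ≫ j' ◁ c) :
    b₀ ▷ i ≫ Q' ◁ a ≫ (m' ▷ i' ≫ V' ≫ j' ◁ n'.inv) =
      (m ▷ i ≫ V ≫ j ◁ n.inv) ≫ a₁ ▷ P ≫ j' ◁ c₀ := by
  have hc' : n.inv ≫ c₀ = c ≫ n'.inv := by rw [Iso.inv_comp_eq, ← reassoc_of% hc]; simp
  rw [whisker_exchange_assoc, ← comp_whiskerRight_assoc, hb]
  simp only [comp_whiskerRight, Category.assoc]
  rw [reassoc_of% hV, whisker_exchange_assoc, ← whiskerLeft_comp, ← whiskerLeft_comp, hc']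

lemma conj_vcomp {X Y Z W : E} {q q' : X ⟶ Z} {p p' : Y ⟶ W} {I I' i i' : Z ⟶ W}
    {J J' j j' : X ⟶ Y} {a : q ⟶ q'} {a₁ : p ⟶ p'} {b₀ : I ⟶ I'} {b : i ⟶ i'} {m : I ⟶ i}
    {m' : I' ⟶ i'} {c₀ : J ⟶ J'} {c : j ⟶ j'} {n : J ≅ j} {n' : J' ≅ j'} {V : q ≫ i ⟶ j ≫ p}
    {V' : q' ≫ i' ⟶ j' ≫ p'} (hb : b₀ ≫ m' = m ≫ b) (hc : c₀ ≫ n'.hom = n.hom ≫ c)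
    (hV : a ▷ i ≫ q' ◁ b ≫ V' = V ≫ c ▷ p ≫ j' ◁ a₁) :
    a ▷ I ≫ q' ◁ b₀ ≫ (q' ◁ m' ≫ V' ≫ n'.inv ▷ p') =
      (q ◁ m ≫ V ≫ n.inv ▷ p) ≫ c₀ ▷ p ≫ J' ◁ a₁ := by
  have hc' : n.inv ≫ c₀ = c ≫ n'.inv := by rw [Iso.inv_comp_eq, ← reassoc_of% hc]; simp
  rw [← whiskerLeft_comp_assoc, hb]
  simp only [whiskerLeft_comp, Category.assoc]
  rw [← whisker_exchange_assoc, reassoc_of% hV, ← comp_whiskerRight_assoc n.inv, hc',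
    whisker_exchange]
  simp

lemma vpaste_unit_conj {X Y Z : E} {f f' : X ⟶ Y} {g g' : Y ⟶ Z} (a : f ≫ 𝟙 Y ⟶ 𝟙 X ≫ f')
    (b : g ≫ 𝟙 Z ⟶ 𝟙 Y ≫ g') :
    (ρ_ (f ≫ g)).inv ≫ vpaste a b ≫ (λ_ (f' ≫ g')).hom =
      ((ρ_ f).inv ≫ a ≫ (λ_ f').hom) ▷ g ≫ f' ◁ ((ρ_ g).inv ≫ b ≫ (λ_ g').hom) := by
  rw [← whisker_exchange]
  dsimp only [vpaste]
  bicategory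

lemma conj_ax {X Y : E} {f f' g g' : X ⟶ Y} {h h' : X ⟶ X} {k k' : Y ⟶ Y} {a : f ⟶ f'}
    {b : g ⟶ g'} {η : f ⟶ g} {η' : f' ⟶ g'} {e : h ⟶ h'} {e' : k ≅ k'} {u : h ⟶ 𝟙 X}
    {u' : h' ⟶ 𝟙 X} {v : k ≅ 𝟙 Y} {v' : k' ≅ 𝟙 Y} (h₁ : η ≫ b = a ≫ η') (h₂ : e ≫ u' = u)
    (h₃ : e'.hom ≫ v'.hom = v.hom) :
    e ▷ f ≫ h' ◁ a ≫ (u' ▷ f' ≫ (λ_ f').hom ≫ η' ≫ (ρ_ g').inv ≫ g' ◁ v'.inv) =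
      (u ▷ f ≫ (λ_ f).hom ≫ η ≫ (ρ_ g).inv ≫ g ◁ v.inv) ≫ b ▷ k ≫ g' ◁ e'.hom := by
  have h₄ : v.inv ≫ e'.hom = v'.inv := by rw [Iso.inv_comp_eq, ← h₃]; simp
  subst h₂
  rw [whisker_exchange_assoc]
  simp only [comp_whiskerRight, Category.assoc]
  rw [whisker_exchange_assoc, ← whiskerLeft_comp, h₄, id_whiskerLeft]
  simp [reassoc_of% h₁]

lemma conj_ax' {X Y : E} {f f' g g' : X ⟶ Y} {h h' : Y ⟶ Y} {k k' : X ⟶ X} {a : f ⟶ f'}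
    {b : g ⟶ g'} {η : f ⟶ g} {η' : f' ⟶ g'} {e : h ⟶ h'} {e' : k ≅ k'} {u : h ⟶ 𝟙 Y}
    {u' : h' ⟶ 𝟙 Y} {v : k ≅ 𝟙 X} {v' : k' ≅ 𝟙 X} (h₁ : η ≫ b = a ≫ η') (h₂ : e ≫ u' = u)
    (h₃ : e'.hom ≫ v'.hom = v.hom) :
    a ▷ h ≫ f' ◁ e ≫ (f' ◁ u' ≫ (ρ_ f').hom ≫ η' ≫ (λ_ g').inv ≫ v'.inv ▷ g') =
      (f ◁ u ≫ (ρ_ f).hom ≫ η ≫ (λ_ g).inv ≫ v.inv ▷ g) ≫ e'.hom ▷ g ≫ k' ◁ b := by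
  have h₄ : v.inv ≫ e'.hom = v'.inv := by rw [Iso.inv_comp_eq, ← h₃]; simp
  subst h₂
  simp only [Category.assoc]
  rw [← comp_whiskerRight_assoc v.inv, h₄, ← whisker_exchange, id_whiskerLeft]
  rw [← whiskerLeft_comp_assoc, ← whisker_exchange_assoc]
  simp [reassoc_of% h₁]

end

section PsIso

variable {C : Type u} [Bicategory.{w, v} C] {D : Type u'} [Bicategory.{w', v'} D] {A J : WideSub C}
  {F₀ : C → D} {F F' : PsFun A F₀} {H H' : PsFun J F₀}

namespace PsIso

/-- The inverse isomorphism. -/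
@[simps]
def symm (e : PsIso F F') : PsIso F' F where
  iso f hf := (e.iso f hf).symm
  map₂ hf hg η := by simp [Iso.comp_inv_eq, e.map₂]
  mapId X := by simp [Iso.inv_comp_eq, e.mapId]
  mapComp f g hf hg := by
    simp [Iso.inv_comp_eq, reassoc_of% e.mapComp f g hf hg, ← whisker_exchange_assoc]

/-- The identity isomorphism. -/
@[simps]
def refl (F : PsFun A F₀) : PsIso F F where
  iso f hf := Iso.refl _
  map₂ hf hg η := by simp
  mapId X := by simp
  mapComp f g hf hg := by simp

/-- The pseudonatural transformation with identity components given by an isomorphism. -/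
@[simps]
def toTrans (e : PsIso F F') : PsTrans F F' (fun X => 𝟙 (F₀ X)) where
  nat f hf := ρ_ (F.map f hf) ≪≫ e.iso f hf ≪≫ (λ_ (F'.map f hf)).symm
  nat_naturality hf hg η := by simp [reassoc_of% e.map₂]
  nat_id X := by simp [reassoc_of% e.mapId]
  nat_comp f g hf hg := by
    simp [reassoc_of% e.mapComp f g hf hg, vpaste, ← whisker_exchange_assoc]

/-- The isomorphism given by a pseudonatural transformation with identity components. -/
@[simps]
def ofTrans (t : PsTrans F F' (fun X => 𝟙 (F₀ X))) : PsIso F F' where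
  iso f hf := (ρ_ (F.map f hf)).symm ≪≫ t.nat f hf ≪≫ λ_ (F'.map f hf)
  map₂ hf hg η := by
    have h := t.nat_naturality hf hg η
    simp only [Iso.trans_hom, Iso.symm_hom, Category.assoc]
    rw [← leftUnitor_naturality, ← reassoc_of% h]
    simp
  mapId X := by
    have h := t.nat_id X
    simp only [Iso.trans_hom, Iso.symm_hom, Category.assoc]
    rw [← leftUnitor_naturality, reassoc_of% h]
    simp [unitors_equal]
  mapComp f g hf hg := by
    have h := t.nat_comp f g hf hg
    simp only [Iso.trans_hom, Iso.symm_hom, Category.assoc]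
    rw [← leftUnitor_naturality, reassoc_of% h, ← vpaste_unit_conj]
    simp

end PsIso

/-- Transport of a gluing datum along isomorphisms of pseudofunctors. -/
@[simps]
def Gluing.conj (G : Gluing F H) (e : PsIso F F') (d : PsIso H H') : Gluing F' H' where
  iso {X Y Z W j q p i} hj hq hp hi α :=
    (whiskerRightIso (d.iso q hq) _ ≪≫ whiskerLeftIso _ (e.iso i hi)).symm ≪≫
      G.iso hj hq hp hi α ≪≫ whiskerRightIso (e.iso j hj) _ ≪≫ whiskerLeftIso _ (d.iso p hp)
  ax_a {X Y i j} hi hj α := by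
    rw [Iso.trans_hom, Iso.symm_hom, Iso.inv_comp_eq, Iso.trans_hom, G.ax_a]
    simpa using (conj_ax (e.map₂ hi hj α) (d.mapId X) (d.mapId Y)).symm
  ax_a' {X Y i j} hi hj α := by
    rw [Iso.trans_hom, Iso.symm_hom, Iso.inv_comp_eq, Iso.trans_hom, G.ax_a']
    simpa using (conj_ax' (d.map₂ hi hj α) (e.mapId Y) (e.mapId X)).symm
  ax_b {X₁ X₂ X₃ Y₁ Y₂ Y₃ i₁ i₂ i₃ q p q' p'} h₁ h₂ h₃ hq hp hq' hp' α α' := by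
    have h := conj_vpaste (b := (d.iso q hq).hom) (c := (d.iso p hp).hom) (a₁ := (e.iso i₁ h₁).hom)
      (a₂ := (e.iso i₂ h₂).hom) (φ := (G.iso h₁ hq hp h₂ α).hom) (b' := (d.iso q' hq').hom)
      (c' := (d.iso p' hp').hom) (a₃ := (e.iso i₃ h₃).hom) (φ' := (G.iso h₂ hq' hp' h₃ α').hom)
      (ψ := ((whiskerRightIso (d.iso q hq) _ ≪≫ whiskerLeftIso _ (e.iso i₂ h₂)).symm ≪≫
      G.iso h₁ hq hp h₂ α ≪≫ whiskerRightIso (e.iso i₁ h₁) _ ≪≫ whiskerLeftIso _ (d.iso p hp)).hom)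
      (ψ' := ((whiskerRightIso (d.iso q' hq') _ ≪≫ whiskerLeftIso _ (e.iso i₃ h₃)).symm ≪≫
      G.iso h₂ hq' hp' h₃ α' ≪≫ whiskerRightIso (e.iso i₂ h₂) _ ≪≫
        whiskerLeftIso _ (d.iso p' hp')).hom) (by simp) (by simp)
    rw [Iso.trans_hom, Iso.symm_hom, Iso.inv_comp_eq, Iso.trans_hom, G.ax_b h₁ h₂ h₃ hq hp hq' hp']
    simpa using (conj_hcomp (d.mapComp q q' hq hq') (d.mapComp p p' hp hp') h).symm
  ax_b' {X₁ X₂ X₃ Y₁ Y₂ Y₃ p₁ p₂ p₃ j i j' i'} h₁ h₂ h₃ hj hi hj' hi' α α' := by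
    have h := conj_hpaste (a₁ := (d.iso p₁ h₁).hom) (a₂ := (d.iso p₂ h₂).hom)
      (b := (e.iso j hj).hom)
      (c := (e.iso i hi).hom) (φ := (G.iso hj h₁ h₂ hi α).hom) (a₃ := (d.iso p₃ h₃).hom)
      (b' := (e.iso j' hj').hom) (c' := (e.iso i' hi').hom) (φ' := (G.iso hj' h₂ h₃ hi' α').hom)
      (ψ := ((whiskerRightIso (d.iso p₁ h₁) _ ≪≫ whiskerLeftIso _ (e.iso i hi)).symm ≪≫
      G.iso hj h₁ h₂ hi α ≪≫ whiskerRightIso (e.iso j hj) _ ≪≫ whiskerLeftIso _ (d.iso p₂ h₂)).hom)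
      (ψ' := ((whiskerRightIso (d.iso p₂ h₂) _ ≪≫ whiskerLeftIso _ (e.iso i' hi')).symm ≪≫
      G.iso hj' h₂ h₃ hi' α' ≪≫ whiskerRightIso (e.iso j' hj') _ ≪≫
        whiskerLeftIso _ (d.iso p₃ h₃)).hom) (by simp) (by simp)
    rw [Iso.trans_hom, Iso.symm_hom, Iso.inv_comp_eq, Iso.trans_hom, G.ax_b' h₁ h₂ h₃ hj hi hj' hi']
    simpa using (conj_vcomp (e.mapComp i i' hi hi') (e.mapComp j j' hj hj') h).symm

end PsIso

lemma unit_exchange {E : Type u} [Bicategory.{w, v} E] {X Y : E} {g h k : X ⟶ Y} {e : X ⟶ X}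
    (u : 𝟙 X ⟶ e) (φ : g ⟶ h) (n : h ≅ k) :
    (λ_ g).inv ≫ u ▷ g ≫ e ◁ φ = φ ≫ n.hom ≫ (λ_ k).inv ≫ u ▷ k ≫ e ◁ n.inv := by
  simp [← whisker_exchange]

lemma unit_cancel {E : Type u} [Bicategory.{w, v} E] {X Y Z : E} {e : X ⟶ X} (u : 𝟙 X ≅ e)
    {f f' : X ⟶ Y} {g g' : Y ⟶ Z} {x k : X ⟶ Z} {a : x ⟶ k} {m : x ⟶ f ≫ g} {b : f ⟶ f'}
    {c : g ⟶ g'} {n : k ≅ f' ≫ g'}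
    (h : a ≫ (λ_ k).inv ≫ u.hom ▷ k ≫ ((λ_ e).inv ≫ u.hom ▷ e) ▷ k =
      m ≫ (b ≫ (λ_ f').inv ≫ u.hom ▷ f') ▷ g ≫ (α_ e f' g).hom ≫
        e ◁ (f' ◁ c ≫ n.inv ≫ (λ_ k).inv ≫ u.hom ▷ k) ≫ (α_ e e k).inv) :
    a ≫ n.hom = m ≫ b ▷ g ≫ f' ◁ c := by
  have h₁ : m ≫ (b ≫ (λ_ f').inv ≫ u.hom ▷ f') ▷ g ≫ (α_ e f' g).hom ≫
      e ◁ (f' ◁ c ≫ n.inv ≫ (λ_ k).inv ≫ u.hom ▷ k) ≫ (α_ e e k).inv =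
      (m ≫ b ▷ g ≫ f' ◁ c ≫ n.inv) ≫ (λ_ k).inv ≫ u.hom ▷ k ≫
        ((λ_ e).inv ≫ u.hom ▷ e) ▷ k := by
    calc _ = m ≫ b ▷ g ⊗≫ (u.hom ▷ (f' ≫ g) ≫ e ◁ (f' ◁ c ≫ n.inv)) ⊗≫ e ◁ u.hom ▷ k ⊗≫ 𝟙 _ := by
          bicategory
      _ = m ≫ b ▷ g ⊗≫ f' ◁ c ⊗≫ n.inv ⊗≫ u.hom ▷ k ⊗≫ (e ◁ u.hom) ▷ k ⊗≫ 𝟙 _ := by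
          rw [← whisker_exchange]; bicategory
      _ = m ≫ b ▷ g ⊗≫ f' ◁ c ⊗≫ n.inv ⊗≫ (𝟙 X ◁ u.hom ≫ u.hom ▷ e) ▷ k ⊗≫ 𝟙 _ := by
          rw [whisker_exchange]; bicategory
      _ = _ := by
          bicategory
  rw [h₁, cancel_mono] at h
  simp [h]

section SelfIso

variable {C : Type u} [Bicategory.{w, v} C] [IsLocallyGroupoid C] {D : Type u'}
  [Bicategory.{w', v'} D] {K J : WideSub C} {F₀ : C → D} {F : PsFun K F₀} {H : PsFun J F₀}

namespace Gluing

variable (G : Gluing F H) (hK : K ≤ J)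

/-- The isomorphism between the two images of a 1-cell that is both horizontal and vertical. -/
noncomputable def diag {X Y : C} (a : X ⟶ Y) (ha : K.mem a) :
    F.map a ha ≅ H.map a (hK _ ha) :=
  G.tri ha (K.id_mem X) (hK _ ha) (λ_ a).inv ≪≫ whiskerRightIso (F.mapId X) _ ≪≫ λ_ _

lemma tri_leftUnitor_inv {X Y : C} (a : X ⟶ Y) (ha : K.mem a) :
    (G.tri ha (K.id_mem X) (hK _ ha) (λ_ a).inv).hom =
      (G.diag hK a ha).hom ≫ (λ_ _).inv ≫ (F.mapId X).inv ▷ _ := by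
  simp [diag]

lemma iso_diag {X Y Z W : C} {j : X ⟶ Y} {q : X ⟶ Z} {p : Y ⟶ W} {i : Z ⟶ W}
    (hj : K.mem j) (hq : J.mem q) (hp : J.mem p) (hi : K.mem i) (κ : q ≫ i ⟶ j ≫ p) :
    (G.iso hj hq hp hi κ).hom ≫ (G.diag hK j hj).hom ▷ H.map p hp =
      H.map q hq ◁ (G.diag hK i hi).hom ≫ H.mapSq (hK _ hj) hq hp (hK _ hi) κ := by
  have h₁ := G.iso_tri_top hj hq hp hi (K.id_mem X) (hK _ hj) κ (λ_ j).inv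
  have h₂ := G.iso_tri_bot (K.id_mem X) hq hq (K.id_mem Z) hi (hK _ hi)
    ((ρ_ q).hom ≫ 𝟙 q ≫ (λ_ q).inv) (λ_ i).inv
  have h₃ := G.iso_vertical_right (K.id_mem X) hq (J.comp_mem hq (hK _ hi))
    (J.comp_mem (hK _ hj) hp) hi (q ◁ (λ_ i).inv ≫ (α_ q (𝟙 Z) i).inv ≫
      ((ρ_ q).hom ≫ 𝟙 q ≫ (λ_ q).inv) ▷ i ≫ (α_ (𝟙 X) q i).hom) κ
  have e : (q ◁ (λ_ i).inv ≫ (α_ q (𝟙 Z) i).inv ≫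
      ((ρ_ q).hom ≫ 𝟙 q ≫ (λ_ q).inv) ▷ i ≫ (α_ (𝟙 X) q i).hom) ≫ 𝟙 X ◁ κ =
      κ ≫ (λ_ j).inv ▷ p ≫ (α_ (𝟙 X) j p).hom := by simp
  rw [e, h₁, h₂, G.ax_a', G.tri_leftUnitor_inv hK j, G.tri_leftUnitor_inv hK i, H.map₂_id] at h₃
  rw [← cancel_mono ((λ_ _).inv ≫ (F.mapId X).inv ▷ _ ≫ _ ◁ (H.mapComp j p (hK _ hj) hp).inv)]
  simp only [PsFun.mapSq, comp_whiskerRight, whiskerLeft_comp, Category.assoc, whisker_assoc,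
    leftUnitor_inv_whiskerRight, Iso.inv_hom_id_assoc, Category.id_comp] at h₃ ⊢
  refine Eq.trans ?_ (h₃.trans ?_)
  · simp
  · have h₄ := unit_exchange (F.mapId X).inv ((H.mapComp q i hq (hK _ hi)).inv ≫
      H.map₂ (J.comp_mem hq (hK _ hi)) (J.comp_mem (hK _ hj) hp) κ)
      (H.mapComp j p (hK _ hj) hp)
    simp only [whiskerRight_comp, whiskerLeft_comp, Category.assoc] at h₄
    simp [h₄]

lemma diag_id (X : C) : (G.diag hK (𝟙 X) (K.id_mem X)).hom ≫ (H.mapId X).hom =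
    (F.mapId X).hom := by
  have h := G.tri_rightUnitor_inv (K.id_mem X)
  simp only [diag, Iso.trans_hom]
  have e : G.tri (K.id_mem X) (K.id_mem X) (hK _ (K.id_mem X)) (λ_ (𝟙 X)).inv =
    G.tri (K.id_mem X) (K.id_mem X) (J.id_mem X) (ρ_ (𝟙 X)).inv := by rw [unitors_inv_equal]
  rw [e, h]
  simp [whisker_exchange_assoc, unitors_equal]

/-- The isomorphism between the restrictions of the two pseudofunctors. -/
@[simps]
noncomputable def diagIso : PsIso F (H.restrict hK) where
  iso := G.diag hK
  map₂ {X Y f g} hf hg η := by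
    have h := G.tri_comp hf hg (K.id_mem X) (hK _ hg) η (λ_ g).inv
    rw [leftUnitor_inv_naturality, G.tri_whiskerLeft hf (K.id_mem X) (hK _ hf) (hK _ hg)] at h
    simp only [diag, Iso.trans_hom, ← reassoc_of% h]
    simp [whisker_exchange_assoc]
  mapId X := G.diag_id hK X
  mapComp {X Y Z} f g hf hg := by
    have h := G.tri_hpaste hf (K.id_mem X) (hK _ hf) hg (K.id_mem X)
      (J.comp_mem (hK _ hf) (hK _ hg)) (λ_ f).inv (λ_ (f ≫ g)).inv
    have e : (λ_ f).inv ▷ g ≫ (α_ (𝟙 X) f g).hom ≫ 𝟙 X ◁ (λ_ (f ≫ g)).inv ≫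
        (α_ (𝟙 X) (𝟙 X) (f ≫ g)).inv = (λ_ (f ≫ g)).inv ≫ (λ_ (𝟙 X)).inv ▷ (f ≫ g) := by
      bicategory
    have h' := G.iso_diag hK (K.id_mem X) (hK _ hf) (J.comp_mem (hK _ hf) (hK _ hg)) hg
      (λ_ (f ≫ g)).inv
    have h₁ : (G.diag hK (𝟙 X) (K.id_mem X)).hom ≫ (H.mapId X).hom = (F.mapId X).hom :=
      G.diag_id hK X
    have h₂ : (G.iso (K.id_mem X) (hK _ hf) (J.comp_mem (hK _ hf) (hK _ hg)) hg
        (λ_ (f ≫ g)).inv).hom = H.map f _ ◁ (G.diag hK g hg).hom ≫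
          (H.mapComp f g (hK _ hf) (hK _ hg)).inv ≫ (λ_ _).inv ≫ (F.mapId X).inv ▷ _ := by
      rw [← cancel_mono ((G.diag hK (𝟙 X) (K.id_mem X)).hom ▷ _), h',
        ← cancel_mono ((H.mapId X).hom ▷ _)]
      simp only [Category.assoc, ← comp_whiskerRight, h₁, PsFun.mapSq]
      rw [H.map₂_leftUnitor_inv]
      simp
    rw [e, G.tri_whiskerRight (K.comp_mem hf hg) (K.id_mem X)
      (K.comp_mem (K.id_mem X) (K.id_mem X)), G.tri_leftUnitor_inv hK f hf,
      G.tri_leftUnitor_inv hK (f ≫ g) (K.comp_mem hf hg), h₂,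
      F.map₂_leftUnitor_inv, ← cancel_mono ((F.mapComp (𝟙 X) (𝟙 X) _ _).hom ▷ _)] at h
    exact unit_cancel (F.mapId X).symm (n := H.mapComp f g (hK _ hf) (hK _ hg)) (by
      simp only [Category.assoc, comp_whiskerRight, whiskerLeft_comp] at h ⊢
      simpa using h)


end Gluing

end SelfIso

section

variable {E : Type u} [Bicategory.{w, v} E]

lemma CubeCommutes.transpose {X' Y' Z' W' X Y Z W : E} {a : Z ⟶ W} {b : X ⟶ Y} {a' : Z' ⟶ W'}
    {b' : X' ⟶ Y'} {p : Y ⟶ W} {q : X ⟶ Z} {p' : Y' ⟶ W'} {q' : X' ⟶ Z'} {x : X' ⟶ X} {y : Y' ⟶ Y}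
    {z : Z' ⟶ Z} {w : W' ⟶ W} {I' : x ≫ q ⟶ q' ≫ z} {J : z ≫ a ⟶ a' ≫ w} {J' : x ≫ b ⟶ b' ≫ y}
    {I : y ≫ p ⟶ p' ≫ w} {K' : q' ≫ a' ⟶ b' ≫ p'} {K : q ≫ a ⟶ b ≫ p} {L : b ≫ p ⟶ q ≫ a}
    {L' : b' ≫ p' ⟶ q' ≫ a'} (h : CubeCommutes I' J K' K J' I) (e : L ≫ K = 𝟙 _)
    (e' : K' ≫ L' = 𝟙 _) : CubeCommutes J' I L' L I' J := by
  have h' : hpaste J' I = x ◁ L ≫ hpaste I' J ≫ K' ▷ w := by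
    rw [show hpaste I' J ≫ K' ▷ w = _ from h, ← whiskerLeft_comp_assoc, e]
    simp
  rw [CubeCommutes, h']
  simp [← comp_whiskerRight, e']

lemma cyl_unit_iff {X Y Z W : E} {i i' : Z ⟶ W} {j j' : X ⟶ Y} {q q' : X ⟶ Z} {p p' : Y ⟶ W}
    (ei : i ≅ i') (ej : j ≅ j') (eq : q ≅ q') (ep : p ≅ p') (φ : q ≫ i ⟶ j ≫ p)
    (φ' : q' ≫ i' ⟶ j' ≫ p') :
    Cyl (hpaste (ρ_ q ≪≫ eq ≪≫ (λ_ q').symm).inv (ρ_ i ≪≫ ei ≪≫ (λ_ i').symm).inv)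
      (hpaste (ρ_ j ≪≫ ej ≪≫ (λ_ j').symm).inv (ρ_ p ≪≫ ep ≪≫ (λ_ p').symm).inv) φ' φ ↔
    eq.hom ▷ i ≫ q' ◁ ei.hom ≫ φ' = φ ≫ ej.hom ▷ p ≫ j' ◁ ep.hom := by
  have e : ∀ {X Y Z : E} {f f' : X ⟶ Y} {g g' : Y ⟶ Z} (a : f ≅ f') (b : g ≅ g'),
      hpaste (ρ_ f ≪≫ a ≪≫ (λ_ f').symm).inv (ρ_ g ≪≫ b ≪≫ (λ_ g').symm).inv =
        (λ_ (f' ≫ g')).hom ≫ (f' ◁ b.inv ≫ a.inv ▷ g) ≫ (ρ_ (f ≫ g)).inv := by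
    intros
    rw [whisker_exchange]
    dsimp only [hpaste, Iso.trans_inv, Iso.symm_inv]
    bicategory
  rw [e, e, Cyl, ← cancel_epi (λ_ (q' ≫ i')).inv, ← cancel_mono (ρ_ (j ≫ p)).hom]
  rw [← cancel_epi (eq.hom ▷ i ≫ q' ◁ ei.hom), ← cancel_mono (ej.hom ▷ p ≫ j' ◁ ep.hom)]
  simp [← whiskerLeft_comp_assoc, ← comp_whiskerRight_assoc, ← whiskerLeft_comp, eq_comm]

lemma unit_cube_cancel {X Y Z W : E} {h e : X ⟶ X} {h' e' : Y ⟶ Y} (m : h ≅ 𝟙 X) (u : e ≅ 𝟙 X)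
    (m' : h' ≅ 𝟙 Y) (u' : e' ≅ 𝟙 Y) {i : Z ⟶ W} {j : X ⟶ Y} {q q' : X ⟶ Z} {p p' : Y ⟶ W}
    (r : q ≅ q') (s : p ≅ p') {φ : q ≫ i ⟶ j ≫ p} {ψ : q' ≫ i ⟶ j ≫ p'}
    {I' : h ≫ q ⟶ e ≫ q'} {K' : e ≫ j ⟶ j ≫ e'} {J' : h ≫ j ⟶ j ≫ h'} {I : h' ≫ p ⟶ e' ≫ p'}
    (hc : CubeCommutes I' ψ K' φ J' I)
    (h₁ : I' = m.hom ▷ q ≫ (λ_ q).hom ≫ r.hom ≫ (λ_ q').inv ≫ u.inv ▷ q')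
    (h₂ : K' = u.hom ▷ j ≫ (λ_ j).hom ≫ 𝟙 j ≫ (ρ_ j).inv ≫ j ◁ u'.inv)
    (h₃ : J' = m.hom ▷ j ≫ (λ_ j).hom ≫ 𝟙 j ≫ (ρ_ j).inv ≫ j ◁ m'.inv)
    (h₄ : I = m'.hom ▷ p ≫ (λ_ p).hom ≫ s.hom ≫ (λ_ p').inv ≫ u'.inv ▷ p') :
    r.hom ▷ i ≫ ψ = φ ≫ j ◁ s.hom := by
  subst h₁ h₂ h₃ h₄
  dsimp only [CubeCommutes, hpaste] at hc
  have h₁ := calc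
    m.hom ▷ (q ≫ i) ⊗≫ (r.hom ▷ i ≫ ψ) ⊗≫ j ◁ u'.inv ▷ p' = 𝟙 _ ⊗≫ m.hom ▷ (q ≫ i) ⊗≫
          r.hom ▷ i ⊗≫ 𝟙 X ◁ ψ ⊗≫ (u.inv ≫ u.hom) ▷ (j ≫ p') ⊗≫ j ◁ u'.inv ▷ p' := by
        rw [Iso.inv_hom_id]; bicategory
    _ = 𝟙 _ ⊗≫ m.hom ▷ (q ≫ i) ⊗≫ r.hom ▷ i ⊗≫ (𝟙 X ◁ ψ ≫ u.inv ▷ (j ≫ p')) ⊗≫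
          u.hom ▷ (j ≫ p') ⊗≫ j ◁ u'.inv ▷ p' := by bicategory
    _ = _ := by rw [whisker_exchange]; bicategory
    _ = _ := congrArg (fun t => 𝟙 _ ⊗≫ t ⊗≫ 𝟙 _) hc
    _ = 𝟙 _ ⊗≫ (h ◁ φ ≫ m.hom ▷ (j ≫ p)) ⊗≫ j ◁ (m'.inv ≫ m'.hom) ▷ p ⊗≫ j ◁ s.hom ⊗≫
          j ◁ u'.inv ▷ p' := by bicategory
    _ = m.hom ▷ (q ≫ i) ⊗≫ (φ ≫ j ◁ s.hom) ⊗≫ j ◁ u'.inv ▷ p' := by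
        rw [whisker_exchange, Iso.inv_hom_id]; bicategory
  simp only [bicategoricalComp] at h₁
  rw [cancel_epi, cancel_epi, Category.assoc] at h₁
  exact (cancel_mono _).1 ((Category.assoc _ _ _).trans h₁)

end

/-- Conditions under which gluing data on `P`, `Q` and `J` extend to gluing data on `B` and `J`. -/
structure ExtensionConditions {C : Type u} [Bicategory.{w, v} C] (P Q B J : WideSub C) : Prop where
  hP : P ≤ B
  hQ : Q ≤ B
  fac : Factors P Q B
  fib : HasFiberProductsAgreeing Q B
  bc : HasBaseChanges J Q
  st : StableUnderBaseChange J Q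
  stP : StableUnderBaseChange P J
  stQ : StableUnderBaseChange Q J
  sq : Squaring B J
  sqP : Squaring P J
  sqQ : Squaring Q J
  sqJ : Squaring J (J ⊓ B)
  facJ : Factors (P ⊓ J) (Q ⊓ J) (B ⊓ J)
  fibJ : HasFiberProductsAgreeing (Q ⊓ J) (B ⊓ J)
  bcQ : HasBaseChanges (Q ⊓ J) P
  stPB : StableUnderBaseChange (P ⊓ J) B
  stQB : StableUnderBaseChange (Q ⊓ J) B
  stPJ : StableUnderBaseChange (P ⊓ J) J
  stQJ : StableUnderBaseChange (Q ⊓ J) J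

section

variable {C : Type u} [Bicategory.{w, v} C] [IsLocallyGroupoid C] {D : Type u'}
  [Bicategory.{w', v'} D] {F₀ : C → D}

lemma compat_toTrans_iff {P Q : WideSub C} {F F' : PsFun P F₀} {H H' : PsFun Q F₀}
    (e : PsIso F F') (d : PsIso H H') (G : Gluing F H) (G' : Gluing F' H') {X Y Z W : C}
    {j : X ⟶ Y} {q : X ⟶ Z} {p : Y ⟶ W} {i : Z ⟶ W} (β : q ≫ i ⟶ j ≫ p) :
    Compat e.toTrans d.toTrans G G' β ↔
      ∀ (hj : P.mem j) (hq : Q.mem q) (hp : Q.mem p) (hi : P.mem i),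
        (d.iso q hq).hom ▷ F.map i hi ≫ H'.map q hq ◁ (e.iso i hi).hom ≫
          (G'.iso hj hq hp hi β).hom =
        (G.iso hj hq hp hi β).hom ≫ (e.iso j hj).hom ▷ H.map p hp ≫
          F'.map j hj ◁ (d.iso p hp).hom :=
  forall₄_congr fun _ _ _ _ => cyl_unit_iff _ _ _ _ _ _

variable {P Q B J : WideSub C} {F : PsFun B F₀} {H : PsFun J F₀}

/-- The cubes of type `(P, Q, J)` commute. -/
def CubesCommute (F : PsFun B F₀) {hP : P ≤ B} {hQ : Q ≤ B} (GP : Gluing (F.restrict hP) H)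
    (GQ : Gluing (F.restrict hQ) H) : Prop :=
  ∀ c : Cube P Q J, CubeCommutes (GQ.iso c.hq' c.hx c.hz c.hq c.I').hom
    (GP.iso c.ha' c.hz c.hw c.ha c.J).hom
    (F.mapSq (hP _ c.hb') (hQ _ c.hq') (hQ _ c.hp') (hP _ c.ha') c.K')
    (F.mapSq (hP _ c.hb) (hQ _ c.hq) (hQ _ c.hp) (hP _ c.ha) c.K)
    (GP.iso c.hb' c.hx c.hy c.hb c.J').hom (GQ.iso c.hp' c.hy c.hw c.hp c.I).hom

lemma PsFun.mapSq_hom_inv {X Y Z W : C} {j : X ⟶ Y} {q : X ⟶ Z} {p : Y ⟶ W} {i : Z ⟶ W}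
    (hj : B.mem j) (hq : B.mem q) (hp : B.mem p) (hi : B.mem i) {β : q ≫ i ⟶ j ≫ p}
    {γ : j ≫ p ⟶ q ≫ i} (h : β ≫ γ = 𝟙 _) :
    F.mapSq hj hq hp hi β ≫ F.mapSq hq hj hi hp γ = 𝟙 _ := by
  simp [PsFun.mapSq, F.map₂_map₂_assoc, h, F.map₂_id]

lemma WideSub.inf_le_left (P Q : WideSub C) : P ⊓ Q ≤ P := fun _ _ _ h => h.1

lemma WideSub.inf_le_right (P Q : WideSub C) : P ⊓ Q ≤ Q := fun _ _ _ h => h.2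

/-- The isomorphism between the restrictions of the two pseudofunctors to the 1-cells that are both
horizontal and vertical. -/
noncomputable def Gluing.diagInf {F : PsFun P F₀} (G : Gluing F H) :
    PsIso (F.restrict (P.inf_le_left J)) (H.restrict (P.inf_le_right J)) :=
  (G.restrict (P.inf_le_left J) (fun _ _ _ h => h)).diagIso (P.inf_le_right J)

lemma Gluing.iso_id_left {F : PsFun P F₀} (G : Gluing F H) {X Z : C} (q : X ⟶ Z)
    (hq : (P ⊓ J).mem q) :
    (G.iso (P.id_mem X) (J.id_mem X) hq.2 hq.1 (𝟙 (𝟙 X ≫ q))).hom =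
      (H.mapId X).hom ▷ F.map q hq.1 ≫ (λ_ _).hom ≫ (G.diagInf.iso q hq).hom ≫ (λ_ _).inv ≫
        (F.mapId X).inv ▷ _ := by
  simp [diagInf, diag, tri]

lemma Gluing.iso_diagInf {F : PsFun P F₀} (G : Gluing F H) {X Y Z W : C} {j : X ⟶ Y} {q : X ⟶ Z}
    {p : Y ⟶ W} {i : Z ⟶ W} (hj : (P ⊓ J).mem j) (hq : J.mem q) (hp : J.mem p)
    (hi : (P ⊓ J).mem i) (κ : q ≫ i ⟶ j ≫ p) :
    (G.iso hj.1 hq hp hi.1 κ).hom ≫ (G.diagInf.iso j hj).hom ▷ H.map p hp =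
      H.map q hq ◁ (G.diagInf.iso i hi).hom ≫ H.mapSq hj.2 hq hp hi.2 κ :=
  (G.restrict (P.inf_le_left J) (fun _ _ _ h => h)).iso_diag (P.inf_le_right J) hj hq hp hi κ

variable {hP : P ≤ B} {hQ : Q ≤ B} {GP : Gluing (F.restrict hP) H} {GQ : Gluing (F.restrict hQ) H}

lemma CubesCommute.transpose (hc : CubesCommute F GP GQ) : CubesCommute F GQ GP := fun c =>
  CubeCommutes.transpose (hc
    { ha := c.hp, hb := c.hq, ha' := c.hp', hb' := c.hq', hp := c.ha, hq := c.hb, hp' := c.ha'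
      hq' := c.hb', hx := c.hx, hy := c.hz, hz := c.hy, hw := c.hw, I' := c.J', J := c.I
      K' := inv c.K', K := inv c.K, J' := c.I', I := c.J
      comm := c.comm.transpose (by simp) (by simp) }) (F.mapSq_hom_inv _ _ _ _ (by simp))
      (F.mapSq_hom_inv _ _ _ _ (by simp))

lemma CubesCommute.self : CubesCommute F GP GP := fun c => GP.cube_self c

/-- Over a square whose vertical edges are also horizontal, a gluing datum is determined by the
pseudofunctors. -/
lemma CubesCommute.iso_eq (hc : CubesCommute F GP GQ) {X Y Z W : C} {j : X ⟶ Y} {q : X ⟶ Z}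
    {p : Y ⟶ W} {i : Z ⟶ W} (hj : P.mem j) (hq : (Q ⊓ J).mem q) (hp : (Q ⊓ J).mem p) (hi : P.mem i)
    (α : q ≫ i ⟶ j ≫ p) :
    (GQ.diagInf.iso q hq).hom ▷ F.map i (hP _ hi) ≫ (GP.iso hj hq.2 hp.2 hi α).hom =
      F.mapSq (hP _ hj) (hQ _ hq.1) (hQ _ hp.1) (hP _ hi) α ≫ F.map j (hP _ hj) ◁
        (GQ.diagInf.iso p hp).hom := by
  have h := hc
    { ha := hi, hb := hj, ha' := hj, hb' := hj, hp := hp.1, hq := hq.1, hp' := Q.id_mem Y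
      hq' := Q.id_mem X, hx := J.id_mem X, hy := J.id_mem Y, hz := hq.2, hw := hp.2
      I' := 𝟙 _, J := α, K' := idSquare j, K := α, J' := idSquare j, I := 𝟙 _
      comm := by simp [CubeCommutes, hpaste] }
  have h₁ := F.selfGluing.ax_a (hP _ hj) (hP _ hj) (𝟙 j)
  have h₂ := GP.ax_a hj hj (𝟙 j)
  rw [PsFun.map₂_id] at h₁ h₂
  exact unit_cube_cancel (H.mapId X) (F.mapId X) (H.mapId Y) (F.mapId Y) (GQ.diagInf.iso q hq)
    (GQ.diagInf.iso p hp) h (GQ.iso_id_left q hq) h₁ h₂ (GQ.iso_id_left p hp)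

end

section

variable {C : Type u} [Bicategory.{w, v} C] [IsLocallyGroupoid C] {D : Type u'}
  [Bicategory.{w', v'} D] {F₀ : C → D} {P Q B J : WideSub C} {F : PsFun B F₀} {H : PsFun J F₀}
  {hP : P ≤ B} {hQ : Q ≤ B} {GP : Gluing (F.restrict hP) H} {GQ : Gluing (F.restrict hQ) H}

/-- The two pseudofunctors are isomorphic on the 1-cells that are both horizontal and vertical. -/
lemma CubesCommute.exists_diag (hc : CubesCommute F GP GQ) (E : ExtensionConditions P Q B J) :
    ∃ r : PsIso (F.restrict (B.inf_le_left J)) (H.restrict (B.inf_le_right J)),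
      (∀ {X Y : C} (a : X ⟶ Y) (ha : (P ⊓ J).mem a),
        r.iso a ⟨hP _ ha.1, ha.2⟩ = GP.diagInf.iso a ha) ∧
      ∀ {X Y : C} (a : X ⟶ Y) (ha : (Q ⊓ J).mem a),
        r.iso a ⟨hQ _ ha.1, ha.2⟩ = GQ.diagInf.iso a ha := by
  obtain ⟨t, h₁, h₂⟩ := PsTrans.exists_extension (F := F.restrict (B.inf_le_left J))
    (F' := H.restrict (B.inf_le_right J)) (hP := WideSub.inf_le_inf_right J hP)
    (hQ := WideSub.inf_le_inf_right J hQ) GP.diagInf.toTrans GQ.diagInf.toTrans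
    (fun {X Y Z W j q p i} hj hq hp hi β => (cyl_unit_iff _ _ _ _ _ _).2 (by
      rw [← GP.iso_diagInf hj hq.2 hp.2 hi β]
      have h := hc.iso_eq hj.1 hq hp hi.1 β
      refine (Category.assoc _ _ _).symm.trans ((congrArg (· ≫ _) h).trans ?_)
      exact (Category.assoc _ _ _).trans (congrArg _ (whisker_exchange _ _))))
    (Roofed.of_factors (WideSub.inf_le_inf_right J hP) E.facJ E.fibJ) E.facJ
  refine ⟨.ofTrans t, fun a ha => ?_, fun a ha => ?_⟩
  · have h := congrArg (fun s => PsTrans.nat s a ha) h₁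
    exact (congrArg (fun n => (ρ_ _).symm ≪≫ n ≪≫ λ_ _) h).trans (by ext; simp)
  · have h := congrArg (fun s => PsTrans.nat s a ha) h₂
    exact (congrArg (fun n => (ρ_ _).symm ≪≫ n ≪≫ λ_ _) h).trans (by ext; simp)

lemma compat_of_isTwoCartesian {A : WideSub C} {hA : A ≤ B} {GA : Gluing (F.restrict hA) H}
    (hcP : CubesCommute F GA GP) (hcQ : CubesCommute F GA GQ) (E : ExtensionConditions P Q B J)
    {r : PsIso (F.restrict (B.inf_le_left J)) (H.restrict (B.inf_le_right J))}
    (hrP : ∀ {X Y : C} (a : X ⟶ Y) (ha : (P ⊓ J).mem a),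
      r.iso a ⟨hP _ ha.1, ha.2⟩ = GP.diagInf.iso a ha)
    (hrQ : ∀ {X Y : C} (a : X ⟶ Y) (ha : (Q ⊓ J).mem a),
      r.iso a ⟨hQ _ ha.1, ha.2⟩ = GQ.diagInf.iso a ha)
    (hbc : ∀ {Y Z W : C} (p : Y ⟶ W) (i : Z ⟶ W), (Q ⊓ J).mem p → A.mem i →
      ∃ (X : C) (j : X ⟶ Y) (q : X ⟶ Z) (α : q ≫ i ⟶ j ≫ p), IsTwoCartesian α)
    (hst : StableUnderBaseChange A J) {X Y Z W : C} {j : X ⟶ Y} {q : X ⟶ Z} {p : Y ⟶ W} {i : Z ⟶ W}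
    {α : q ≫ i ⟶ j ≫ p} (hj : A.mem j) (hq : (B ⊓ J).mem q) (hp : (B ⊓ J).mem p) (hi : A.mem i)
    (hα : IsTwoCartesian α) :
    (r.iso q hq).hom ▷ F.map i (hA _ hi) ≫ (GA.iso hj hq.2 hp.2 hi α).hom =
      F.mapSq (hA _ hj) hq.1 hp.1 (hA _ hi) α ≫ F.map j (hA _ hj) ◁ (r.iso p hp).hom := by
  have hR := Compat.pastingClosed (PsIso.refl (F.restrict hA)).toTrans r.toTrans
    (F.selfGluing.restrict hA (B.inf_le_left J))
    (GA.restrict (fun _ _ _ h => h) (B.inf_le_right J))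
  have key : ∀ {X Y Z W : C} {j : X ⟶ Y} {q : X ⟶ Z} {p : Y ⟶ W} {i : Z ⟶ W}
      (α : q ≫ i ⟶ j ≫ p), ((P ⊓ J).mem q ∧ (P ⊓ J).mem p ∨ (Q ⊓ J).mem q ∧ (Q ⊓ J).mem p) →
      Compat (PsIso.refl (F.restrict hA)).toTrans r.toTrans
        (F.selfGluing.restrict hA (B.inf_le_left J))
        (GA.restrict (fun _ _ _ h => h) (B.inf_le_right J)) α := by
    intro X Y Z W j q p i α hqp
    refine (compat_toTrans_iff _ _ _ _ _).2 fun hj hq hp hi => ?_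
    simp only [PsIso.refl_iso, Iso.refl_hom, whiskerLeft_id, Category.id_comp, id_whiskerRight]
    obtain ⟨hq', hp'⟩ | ⟨hq', hp'⟩ := hqp
    · rw [hrP q hq', hrP p hp']
      exact hcP.iso_eq hj hq' hp' hi α
    · rw [hrQ q hq', hrQ p hp']
      exact hcQ.iso_eq hj hq' hp' hi α
  suffices h : Compat (PsIso.refl (F.restrict hA)).toTrans r.toTrans
      (F.selfGluing.restrict hA (B.inf_le_left J))
      (GA.restrict (fun _ _ _ h => h) (B.inf_le_right J)) α by
    have h' := (compat_toTrans_iff _ _ _ _ _).1 h hj hq hp hi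
    simp only [PsIso.refl_iso, Iso.refl_hom, whiskerLeft_id, Category.id_comp,
      id_whiskerRight] at h'
    exact h'
  obtain ⟨V, a, b, ha, hb, ⟨ν⟩⟩ := E.facJ p hp
  obtain ⟨U, i', b', β, hβ⟩ := hbc b i hb hi
  obtain ⟨a', α', δ, hα', rfl⟩ := hα.exists_factor_right ν.inv hβ
  have hb' : (Q ⊓ J).mem b' := E.stQB _ hβ.flip hb (hA _ hi)
  have hi' : A.mem i' := hst _ hβ hi hb.2
  have ha' : (P ⊓ J).mem a' := E.stPB _ hα'.flip ha (hA _ hi')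
  have ha'' : (B ⊓ J).mem a' := ⟨hP _ ha'.1, ha'.2⟩
  have hb'' : (B ⊓ J).mem b' := ⟨hQ _ hb'.1, hb'.2⟩
  have hab := WideSub.comp_mem (B ⊓ J) (f := a) (g := b) ⟨hP _ ha.1, ha.2⟩ ⟨hQ _ hb.1, hb.2⟩
  have h := hR.adjust δ (𝟙 i) (𝟙 j) ν.inv hj hj ((B ⊓ J).comp_mem ha'' hb'') hq hab hp hi hi
    (hR.vpaste hj hi' hi ha'' ⟨hP _ ha.1, ha.2⟩ hb'' ⟨hQ _ hb.1, hb.2⟩ (key α' (.inl ⟨ha', ha⟩))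
      (key β (.inr ⟨hb', hb⟩)))
  simpa using h

end

lemma comp_whiskerRight_eq {E : Type u} [Bicategory.{w, v} E] {X Y Z : E} {f g : X ⟶ Y}
    {k : Y ⟶ Z} {l : X ⟶ Z} {x : l ⟶ f ≫ k} {y : l ⟶ g ≫ k} (e : f ≅ g) (h : x = y ≫ e.inv ▷ k) :
    x ≫ e.hom ▷ k = y := by
  simp [h, ← comp_whiskerRight]

section Arr

variable {C : Type u} [Bicategory.{w, v} C]

/-- The 1-cells of `J`, viewed as the objects of a bicategory whose 1-cells are squares. -/
structure Arr (J : WideSub C) where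
  {src tgt : C}
  hom : src ⟶ tgt
  mem : J.mem hom

namespace Arr

variable {J : WideSub C}

/-- A square with vertical edges in `J`. -/
structure Hom (p q : Arr J) where
  {top : p.src ⟶ q.src}
  {bot : p.tgt ⟶ q.tgt}
  sq : p.hom ≫ bot ⟶ top ≫ q.hom

/-- A pair of 2-cells between the horizontal edges of two squares. -/
@[ext]
structure Hom₂ {p q : Arr J} (f g : Hom p q) where
  top : f.top ⟶ g.top
  bot : f.bot ⟶ g.bot
  cyl : Cyl f.sq g.sq bot top

instance (p q : Arr J) : Category (Hom p q) where
  Hom := Hom₂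
  id f := ⟨𝟙 _, 𝟙 _, .refl _⟩
  comp η θ := ⟨η.top ≫ θ.top, η.bot ≫ θ.bot, η.cyl.comp θ.cyl⟩
  id_comp _ := Hom₂.ext (Category.id_comp _) (Category.id_comp _)
  comp_id _ := Hom₂.ext (Category.comp_id _) (Category.comp_id _)
  assoc _ _ _ := Hom₂.ext (Category.assoc _ _ _) (Category.assoc _ _ _)

/-- An invertible 2-cell. -/
@[simps]
def isoMk {p q : Arr J} {f g : Hom p q} (η : f.top ≅ g.top) (θ : f.bot ≅ g.bot)
    (h : Cyl f.sq g.sq θ.hom η.hom) : f ≅ g where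
  hom := ⟨η.hom, θ.hom, h⟩
  inv := ⟨η.inv, θ.inv, h.symm⟩
  hom_inv_id := Hom₂.ext η.hom_inv_id θ.hom_inv_id
  inv_hom_id := Hom₂.ext η.inv_hom_id θ.inv_hom_id

instance : Bicategory (Arr J) where
  Hom p q := Hom p q
  id p := ⟨Cyl.one p.hom⟩
  comp f g := ⟨hpaste f.sq g.sq⟩
  homCategory p q := inferInstanceAs (Category (Hom p q))
  whiskerLeft f _ _ η := Hom₂.mk (f.top ◁ η.top) (f.bot ◁ η.bot) (.whiskerLeft f.sq η.cyl)
  whiskerRight η h := Hom₂.mk (η.top ▷ h.top) (η.bot ▷ h.bot) (.whiskerRight η.cyl h.sq)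
  associator f g h := isoMk (α_ _ _ _) (α_ _ _ _) (.associator f.sq g.sq h.sq)
  leftUnitor f := isoMk (λ_ _) (λ_ _) (.leftUnitor f.sq)
  rightUnitor f := isoMk (ρ_ _) (ρ_ _) (.rightUnitor f.sq)
  whiskerLeft_id _ _ := Hom₂.ext (whiskerLeft_id _ _) (whiskerLeft_id _ _)
  whiskerLeft_comp _ _ _ _ _ _ := Hom₂.ext (whiskerLeft_comp _ _ _) (whiskerLeft_comp _ _ _)
  id_whiskerLeft _ := Hom₂.ext (id_whiskerLeft _) (id_whiskerLeft _)
  comp_whiskerLeft _ _ _ _ _ := Hom₂.ext (comp_whiskerLeft _ _ _) (comp_whiskerLeft _ _ _)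
  id_whiskerRight _ _ := Hom₂.ext (id_whiskerRight _ _) (id_whiskerRight _ _)
  comp_whiskerRight _ _ _ := Hom₂.ext (comp_whiskerRight _ _ _) (comp_whiskerRight _ _ _)
  whiskerRight_id _ := Hom₂.ext (whiskerRight_id _) (whiskerRight_id _)
  whiskerRight_comp _ _ _ := Hom₂.ext (whiskerRight_comp _ _ _) (whiskerRight_comp _ _ _)
  whisker_assoc _ _ _ _ _ := Hom₂.ext (whisker_assoc _ _ _) (whisker_assoc _ _ _)
  whisker_exchange _ _ := Hom₂.ext (whisker_exchange _ _) (whisker_exchange _ _)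
  pentagon _ _ _ _ := Hom₂.ext (pentagon _ _ _ _) (pentagon _ _ _ _)
  triangle _ _ := Hom₂.ext (triangle _ _) (triangle _ _)

@[simp] lemma comp_top' {p q : Arr J} {f g h : p ⟶ q} (η : f ⟶ g) (θ : g ⟶ h) :
    (η ≫ θ).top = η.top ≫ θ.top := rfl

@[simp] lemma comp_bot' {p q : Arr J} {f g h : p ⟶ q} (η : f ⟶ g) (θ : g ⟶ h) :
    (η ≫ θ).bot = η.bot ≫ θ.bot := rfl

@[simp] lemma id_top' {p q : Arr J} (f : p ⟶ q) : (𝟙 f : f ⟶ f).top = 𝟙 f.top := rfl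

@[simp] lemma id_bot' {p q : Arr J} (f : p ⟶ q) : (𝟙 f : f ⟶ f).bot = 𝟙 f.bot := rfl

instance [IsLocallyGroupoid C] : IsLocallyGroupoid (Arr J) := fun p q => ⟨fun {f g} η =>
    (isoMk (f := f) (g := g) (asIso η.top) (asIso η.bot) η.cyl).isIso_hom⟩

@[simp] lemma inv_top [IsLocallyGroupoid C] {p q : Arr J} {f g : p ⟶ q} (η : f ⟶ g) :
    (inv η).top = inv η.top :=
  IsIso.eq_inv_of_hom_inv_id (by rw [← comp_top', IsIso.hom_inv_id, id_top'])

@[simp] lemma inv_bot [IsLocallyGroupoid C] {p q : Arr J} {f g : p ⟶ q} (η : f ⟶ g) :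
    (inv η).bot = inv η.bot :=
  IsIso.eq_inv_of_hom_inv_id (by rw [← comp_bot', IsIso.hom_inv_id, id_bot'])

variable (J)

/-- The squares whose horizontal edges are in `A`. -/
def square (A : WideSub C) : WideSub (Arr J) where
  mem f := A.mem f.top ∧ A.mem f.bot
  id_mem p := ⟨A.id_mem _, A.id_mem _⟩
  comp_mem h h' := ⟨A.comp_mem h.1 h'.1, A.comp_mem h.2 h'.2⟩

/-- The 2-Cartesian squares whose horizontal edges are in `A`. -/
def cart [IsLocallyGroupoid C] (A : WideSub C) : WideSub (Arr J) where
  mem f := (square J A).mem f ∧ IsTwoCartesian f.sq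
  id_mem p := ⟨(square J A).id_mem p, by
    have h := IsTwoCartesianIn.horizontal_id (𝟙 p.hom)
    rwa [Category.id_comp] at h⟩
  comp_mem h h' := ⟨(square J A).comp_mem h.1 h'.1, h.2.hpaste h'.2⟩

variable {J}

lemma square_mono {A B : WideSub C} (h : A ≤ B) : square J A ≤ square J B :=
  fun _ _ _ hf => ⟨h _ hf.1, h _ hf.2⟩

lemma cart_mono [IsLocallyGroupoid C] {A B : WideSub C} (h : A ≤ B) : cart J A ≤ cart J B :=
  fun _ _ _ hf => ⟨square_mono h _ hf.1, hf.2⟩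

lemma cart_le_square [IsLocallyGroupoid C] (A : WideSub C) : cart J A ≤ square J A :=
  fun _ _ _ hf => hf.1

section PsFun

variable {D : Type u'} [Bicategory.{w', v'} D] {A : WideSub C} {F₀ : C → D}

variable (J) in
/-- The pseudofunctor on squares given by the upper edges. -/
@[simps]
def topPs (F : PsFun A F₀) : PsFun (square J A) (fun p => F₀ p.src) where
  map f hf := F.map f.top hf.1
  map₂ hf hg η := F.map₂ hf.1 hg.1 η.top
  mapId p := F.mapId p.src
  mapComp f g hf hg := F.mapComp f.top g.top hf.1 hg.1
  map₂_id f hf := F.map₂_id f.top hf.1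
  map₂_comp hf hg hh η θ := F.map₂_comp hf.1 hg.1 hh.1 η.top θ.top
  map₂_whiskerLeft f _ _ hf hg hh η := F.map₂_whiskerLeft f.top hf.1 hg.1 hh.1 η.top
  map₂_whiskerRight hf hg η k hk := F.map₂_whiskerRight hf.1 hg.1 η.top k.top hk.1
  map₂_associator f g k hf hg hk := F.map₂_associator f.top g.top k.top hf.1 hg.1 hk.1
  map₂_leftUnitor f hf := F.map₂_leftUnitor f.top hf.1
  map₂_rightUnitor f hf := F.map₂_rightUnitor f.top hf.1

variable (J) in
/-- The pseudofunctor on squares given by the lower edges. -/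
@[simps]
def botPs (F : PsFun A F₀) : PsFun (square J A) (fun p => F₀ p.tgt) where
  map f hf := F.map f.bot hf.2
  map₂ hf hg η := F.map₂ hf.2 hg.2 η.bot
  mapId p := F.mapId p.tgt
  mapComp f g hf hg := F.mapComp f.bot g.bot hf.2 hg.2
  map₂_id f hf := F.map₂_id f.bot hf.2
  map₂_comp hf hg hh η θ := F.map₂_comp hf.2 hg.2 hh.2 η.bot θ.bot
  map₂_whiskerLeft f _ _ hf hg hh η := F.map₂_whiskerLeft f.bot hf.2 hg.2 hh.2 η.bot
  map₂_whiskerRight hf hg η k hk := F.map₂_whiskerRight hf.2 hg.2 η.bot k.bot hk.2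
  map₂_associator f g k hf hg hk := F.map₂_associator f.bot g.bot k.bot hf.2 hg.2 hk.2
  map₂_leftUnitor f hf := F.map₂_leftUnitor f.bot hf.2
  map₂_rightUnitor f hf := F.map₂_rightUnitor f.bot hf.2

variable {F : PsFun A F₀} {H : PsFun J F₀}

lemma cyl_iso [IsLocallyGroupoid C] (G : Gluing F H) {p q : Arr J} {f g : p ⟶ q}
    (hf : (square J A).mem f) (hg : (square J A).mem g) (η : f ⟶ g) :
    Cyl (G.iso hf.1 p.mem q.mem hf.2 f.sq).hom (G.iso hg.1 p.mem q.mem hg.2 g.sq).hom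
      (F.map₂ hf.2 hg.2 η.bot) (F.map₂ hf.1 hg.1 η.top) := by
  have h := congrArg (fun α => (G.iso hg.1 p.mem q.mem hf.2 α).hom) η.cyl
  simp only [G.iso_whiskerRight hf.1 hg.1 p.mem q.mem hf.2,
    G.iso_whiskerLeft hg.1 p.mem q.mem hg.2 hf.2] at h
  exact h

/-- A gluing datum, as a pseudonatural transformation on squares. -/
def glueTrans [IsLocallyGroupoid C] (G : Gluing F H) :
    PsTrans (topPs J F) (botPs J F) (fun p => H.map p.hom p.mem) :=
  .ofSq (fun {p q} f hf => G.iso hf.1 p.mem q.mem hf.2 f.sq)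
    (fun hf hg η => cyl_iso G hf hg η)
    (fun p => by
      have h := G.ax_a' p.mem p.mem (𝟙 p.hom)
      rw [H.map₂_id, Category.id_comp, Category.id_comp] at h
      have h' : (G.iso (A.id_mem _) p.mem p.mem (A.id_mem _) (Cyl.one p.hom)).hom = _ := h
      exact comp_whiskerRight_eq (F.mapId p.src) (h'.trans (by simp only [Category.assoc]; rfl)))
    (fun {p q r} f g hf hg => by
      have h := G.ax_b' p.mem q.mem r.mem hf.1 hf.2 hg.1 hg.2 f.sq g.sq
      exact comp_whiskerRight_eq (F.mapComp f.top g.top hf.1 hg.1)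
        (h.trans (Category.assoc _ _ _).symm))

end PsFun

end Arr

end Arr

namespace Arr

variable {C : Type u} [Bicategory.{w, v} C] [IsLocallyGroupoid C] {J : WideSub C}

@[simp] lemma comp_top {p q r : Arr J} (f : p ⟶ q) (g : q ⟶ r) : (f ≫ g).top = f.top ≫ g.top := rfl

@[simp] lemma comp_bot {p q r : Arr J} (f : p ⟶ q) (g : q ⟶ r) : (f ≫ g).bot = f.bot ≫ g.bot := rfl

@[simp] lemma comp_sq {p q r : Arr J} (f : p ⟶ q) (g : q ⟶ r) : (f ≫ g).sq = hpaste f.sq g.sq := rfl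

@[simp] lemma whiskerLeft_bot {p q r : Arr J} (f : p ⟶ q) {g h : q ⟶ r} (η : g ⟶ h) :
    (f ◁ η).bot = f.bot ◁ η.bot := rfl

@[simp] lemma whiskerRight_bot {p q r : Arr J} {f g : p ⟶ q} (η : f ⟶ g) (h : q ⟶ r) :
    (η ▷ h).bot = η.bot ▷ h.bot := rfl

@[simp] lemma associator_hom_bot {p q r s : Arr J} (f : p ⟶ q) (g : q ⟶ r) (h : r ⟶ s) :
    (α_ f g h).hom.bot = (α_ f.bot g.bot h.bot).hom := rfl

@[simp] lemma associator_inv_bot {p q r s : Arr J} (f : p ⟶ q) (g : q ⟶ r) (h : r ⟶ s) :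
    (α_ f g h).inv.bot = (α_ f.bot g.bot h.bot).inv := rfl

lemma isTwoCartesian_of_hom₂ {p q : Arr J} {f g : p ⟶ q} (Θ : f ⟶ g) (hf : IsTwoCartesian f.sq) :
    IsTwoCartesian g.sq := by
  have h := hf.adjust_horizontal (inv Θ.bot) Θ.top
  rwa [show f.sq ≫ Θ.top ▷ q.hom = _ from Θ.cyl, ← whiskerLeft_comp_assoc, IsIso.inv_hom_id,
    whiskerLeft_id, Category.id_comp] at h

lemma exists_lift {p q r : Arr J} {f : p ⟶ q} (hf : IsTwoCartesian f.sq) (h : r ⟶ q)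
    (b : r.tgt ⟶ p.tgt) (η : b ≫ f.bot ⟶ h.bot) :
    ∃ (t : r.src ⟶ p.src) (σ : r.hom ≫ b ⟶ t ≫ p.hom) (Θ : (Hom.mk σ : r ⟶ p) ≫ f ⟶ h),
      Θ.bot = η := by
  obtain ⟨j, α, δ, e⟩ := hf.exists_left_factor (r.hom ◁ η ≫ h.sq)
  exact ⟨j, α, Hom₂.mk δ η e, rfl⟩

lemma exists_hom₂ {p q r : Arr J} {f : p ⟶ q} (hf : IsTwoCartesian f.sq) {g g' : r ⟶ p}
    (Θ : g ≫ f ⟶ g' ≫ f) (β : g.bot ⟶ g'.bot) (e : Θ.bot = β ▷ f.bot) :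
    ∃ Ξ : g ⟶ g', Ξ.bot = β ∧ Ξ ▷ f = Θ := by
  have h := Θ.cyl
  rw [Cyl, e, comp_sq, comp_sq, hpaste_eq_precompSquare, hpaste_eq_precompSquare] at h
  obtain ⟨ξ, h₁, h₂⟩ := hf.full (inv g.sq ≫ r.hom ◁ β ≫ g'.sq) Θ.top (by
    rw [← cancel_epi (g.sq ▷ f.bot), ← cancel_epi (α_ r.hom g.bot f.bot).inv]
    simpa [← comp_whiskerRight_assoc] using h.symm)
  exact ⟨Hom₂.mk ξ β (by rw [Cyl, h₁]; simp), rfl, Hom₂.ext h₂ e.symm⟩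

lemma factors_cart {P Q B : WideSub C} (hfac : Factors P Q B)
    (hbc : ∀ {Y Z W : C} (p : Y ⟶ W) (i : Z ⟶ W), J.mem p → Q.mem i →
      ∃ (X : C) (j : X ⟶ Y) (q : X ⟶ Z) (α : q ≫ i ⟶ j ≫ p), IsTwoCartesian α ∧ J.mem q)
    (stP : StableUnderBaseChange P J) (stQ : StableUnderBaseChange Q J) :
    Factors (cart J P) (cart J Q) (cart J B) := by
  rintro p q f ⟨⟨-, hf⟩, hf'⟩
  obtain ⟨Z, a, b, ha, hb, ⟨ν⟩⟩ := hfac _ hf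
  obtain ⟨X, j, r, β, hβ, hr⟩ := hbc q.hom b q.mem hb
  obtain ⟨a', α, δ, hα, e⟩ := hf'.exists_factor_bottom ν.hom hβ
  refine ⟨⟨r, hr⟩, ⟨α⟩, ⟨β⟩, ⟨⟨stP _ hα ha hr, ha⟩, hα⟩, ⟨⟨stQ _ hβ hb q.mem, hb⟩, hβ⟩,
    ⟨isoMk (asIso δ).symm ν ?_⟩⟩
  rw [Cyl, ← e]
  simp [← comp_whiskerRight]

lemma exists_roof_lift {x y z z' t : Arr J} {a : x ⟶ z} {p : z ⟶ y} {a' : x ⟶ z'} {p' : z' ⟶ y}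
    {b : x ⟶ t} {s : t ⟶ z} (hp : IsTwoCartesian p.sq) (hp' : IsTwoCartesian p'.sq)
    (hs : IsTwoCartesian s.sq) (θ : a ≫ p ⟶ a' ≫ p') (σ : a ⟶ b ≫ s) {s₀ : t.tgt ⟶ z'.tgt}
    (σ₀ : a'.bot ⟶ b.bot ≫ s₀) (τ₀ : s.bot ≫ p.bot ⟶ s₀ ≫ p'.bot)
    (e : σ.bot ▷ p.bot ≫ (α_ _ _ _).hom ≫ b.bot ◁ τ₀ =
      θ.bot ≫ σ₀ ▷ p'.bot ≫ (α_ _ _ _).hom) :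
    ∃ (s' : t ⟶ z') (σ' : a' ⟶ b ≫ s') (τ : s ≫ p ⟶ s' ≫ p'), s'.bot = s₀ ∧
      IsTwoCartesian s'.sq ∧
      σ ▷ p ≫ (α_ b s p).hom ≫ b ◁ τ = θ ≫ σ' ▷ p' ≫ (α_ b s' p').hom := by
  obtain ⟨u, ω, Θ, hΘ⟩ := exists_lift hp' (s ≫ p) s₀ (inv τ₀)
  have hc : IsTwoCartesian (hpaste ω p'.sq) := isTwoCartesian_of_hom₂ (inv Θ) (hs.hpaste hp)
  obtain ⟨Ξ, -, h⟩ := exists_hom₂ hp' (g := a') (g' := b ≫ (Hom.mk ω : t ⟶ z'))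
    (inv θ ≫ σ ▷ p ≫ (α_ b s p).hom ≫ b ◁ inv Θ ≫ (α_ _ _ _).inv) σ₀ (by
      simp [hΘ, reassoc_of% e])
  exact ⟨⟨ω⟩, Ξ, inv Θ, rfl, hc.of_hpaste hp', by simp [h]⟩

lemma roofed_cart {P Q : WideSub C} (hroof : Roofed P Q)
    (hbc : ∀ {Y Z W : C} (p : Y ⟶ W) (i : Z ⟶ W), J.mem p → Q.mem i →
      ∃ (X : C) (j : X ⟶ Y) (q : X ⟶ Z) (α : q ≫ i ⟶ j ≫ p), IsTwoCartesian α ∧ J.mem q)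
    (stP : StableUnderBaseChange P J) (stQ : StableUnderBaseChange Q J) :
    Roofed (cart J P) (cart J Q) := by
  rintro x y z z' a p a' p' ⟨⟨-, ha⟩, ha₁⟩ ⟨⟨-, hp⟩, hp₁⟩ ⟨⟨-, ha'⟩, ha₁'⟩ ⟨⟨-, hp'⟩, hp₁'⟩ θ
  obtain ⟨V, b₀, s₀, s₀', σ₀, σ₀', τ₀, hb, hs, hs', e⟩ := hroof a.bot p.bot a'.bot p'.bot ha hp ha' hp' θ.bot
  obtain ⟨X, j, r, β, hβ, hr⟩ := hbc z.hom s₀ z.mem hs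
  obtain ⟨u, ω, Θ, hΘ⟩ := exists_lift (p := ⟨r, hr⟩) (f := ⟨β⟩) hβ a b₀ (inv σ₀)
  have hω : IsTwoCartesian ω := by
    have h : IsTwoCartesian (hpaste ω β) := isTwoCartesian_of_hom₂ (inv Θ) ha₁
    exact h.of_hpaste hβ
  obtain ⟨s', σ', τ, rfl, hs₁, e'⟩ := exists_roof_lift (t := ⟨r, hr⟩) (s := ⟨β⟩) hp₁ hp₁' hβ θ
    (inv Θ) σ₀' τ₀ (by simpa [hΘ] using e)
  exact ⟨_, _, ⟨β⟩, s', _, σ', τ, ⟨⟨stP _ hω hb hr, hb⟩, hω⟩, ⟨⟨stQ _ hβ hs z.mem, hs⟩, hβ⟩,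
    ⟨⟨stQ _ hs₁ hs' z'.mem, hs'⟩, hs₁⟩, e'⟩

end Arr

section

variable {C : Type u} [Bicategory.{w, v} C] [IsLocallyGroupoid C] {P Q B J : WideSub C}

lemma StableUnderBaseChange.mono {A J K : WideSub C} (h : StableUnderBaseChange A J) (hK : K ≤ J) :
    StableUnderBaseChange A K := fun α hα hi hp => h α hα hi (hK _ hp)

namespace ExtensionConditions

variable (E : ExtensionConditions P Q B J)
include E

lemma exists_baseChange {Y Z W : C} (p : Y ⟶ W) (i : Z ⟶ W) (hp : J.mem p) (hi : Q.mem i) :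
    ∃ (X : C) (j : X ⟶ Y) (q : X ⟶ Z) (α : q ≫ i ⟶ j ≫ p), IsTwoCartesian α ∧ J.mem q := by
  obtain ⟨X, j, q, α, hα⟩ := E.bc i p hi hp
  exact ⟨X, q, j, inv α, hα.flip, E.st α hα hp hi⟩

lemma exists_baseChange_inf {Y Z W : C} (p : Y ⟶ W) (i : Z ⟶ W) (hp : (B ⊓ J).mem p)
    (hi : Q.mem i) :
    ∃ (X : C) (j : X ⟶ Y) (q : X ⟶ Z) (α : q ≫ i ⟶ j ≫ p), IsTwoCartesian α ∧ (B ⊓ J).mem q := by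
  obtain ⟨V, a, b, ha, hb, ⟨ν⟩⟩ := E.facJ p hp
  obtain ⟨X, i', b', β, hβ, -⟩ := E.exists_baseChange b i hb.2 hi
  have hi' : Q.mem i' := E.stQ _ hβ hi hb.2
  obtain ⟨X', j, a', α, hα, -⟩ := E.exists_baseChange a i' ha.2 hi'
  have ha' := E.stPB _ hα.flip ha (E.hQ _ hi')
  have hb' := E.stQB _ hβ.flip hb (E.hQ _ hi)
  exact ⟨X', j, a' ≫ b', _, (hα.vpaste hβ).adjust (𝟙 _) (𝟙 _) (𝟙 _) ν.inv,
    (B ⊓ J).comp_mem ⟨E.hP _ ha'.1, ha'.2⟩ ⟨E.hQ _ hb'.1, hb'.2⟩⟩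

lemma factors_cart : Factors (Arr.cart J P) (Arr.cart J Q) (Arr.cart J B) :=
  Arr.factors_cart E.fac E.exists_baseChange E.stP E.stQ

lemma factors_cart_inf :
    Factors (Arr.cart (B ⊓ J) P) (Arr.cart (B ⊓ J) Q) (Arr.cart (B ⊓ J) B) :=
  Arr.factors_cart E.fac E.exists_baseChange_inf (StableUnderBaseChange.mono E.stP (B.inf_le_right J))
    (StableUnderBaseChange.mono E.stQ (B.inf_le_right J))

lemma roofed_cart : Roofed (Arr.cart J P) (Arr.cart J Q) :=
  Arr.roofed_cart (Roofed.of_factors E.hP E.fac E.fib) E.exists_baseChange E.stP E.stQ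

end ExtensionConditions

lemma PsTrans.ext_nat {D : Type u'} [Bicategory.{w', v'} D] {F₀ F₀' : C → D} {F : PsFun B F₀}
    {F' : PsFun B F₀'} {α : ∀ X, F₀ X ⟶ F₀' X} {t t' : PsTrans F F' α}
    (h : ∀ {X Y : C} (f : X ⟶ Y) (hf : B.mem f), t.sq f hf = t'.sq f hf) : t = t' := by
  obtain ⟨n, _, _, _⟩ := t
  obtain ⟨n', _, _, _⟩ := t'
  have e : @n = @n' := by
    funext X Y f hf
    exact Iso.ext_inv (h f hf)
  subst e
  rfl

variable {D : Type u'} [Bicategory.{w', v'} D] {F₀ : C → D} {F : PsFun B F₀} {H : PsFun J F₀}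
  {hP : P ≤ B} {hQ : Q ≤ B} {GP : Gluing (F.restrict hP) H} {GQ : Gluing (F.restrict hQ) H}

lemma Gluing.conj_refl_iff {F : PsFun P F₀} (G : Gluing F H) {H' : PsFun J F₀} (d : PsIso H H')
    {X Y Z W : C} {j : X ⟶ Y} {q : X ⟶ Z} {p : Y ⟶ W} {i : Z ⟶ W} (hj : P.mem j) (hq : J.mem q)
    (hp : J.mem p) (hi : P.mem i) (α : q ≫ i ⟶ j ≫ p)
    (φ : H'.map q hq ≫ F.map i hi ⟶ F.map j hj ≫ H'.map p hp) :
    (d.iso q hq).hom ▷ F.map i hi ≫ φ = (G.iso hj hq hp hi α).hom ≫ F.map j hj ◁ (d.iso p hp).hom ↔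
      φ = ((G.conj (.refl F) d).iso hj hq hp hi α).hom := by
  constructor
  · intro h
    rw [← cancel_epi ((d.iso q hq).hom ▷ F.map i hi), h]
    simp [conj]
  · rintro rfl
    simp [conj]

namespace Arr

variable (F H) in
/-- Pseudonatural transformations that attach 2-cells to the squares in `S`. -/
abbrev SqTrans {S : WideSub (Arr J)} (hS : S ≤ square J B) :=
  PsTrans ((topPs J F).restrict hS) ((botPs J F).restrict hS) (fun p => H.map p.hom p.mem)

lemma exists_cartTrans (hc : CubesCommute F GP GQ) (E : ExtensionConditions P Q B J) :
    ∃ T : SqTrans F H (cart_le_square B),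
      (∀ {p q : Arr J} (f : p ⟶ q) (hf : (cart J P).mem f),
        T.sq f (cart_mono hP _ hf) = (GP.iso hf.1.1 p.mem q.mem hf.1.2 f.sq).hom) ∧
      ∀ {p q : Arr J} (f : p ⟶ q) (hf : (cart J Q).mem f),
        T.sq f (cart_mono hQ _ hf) = (GQ.iso hf.1.1 p.mem q.mem hf.1.2 f.sq).hom := by
  obtain ⟨T, h₁, h₂⟩ := PsTrans.exists_extension
    (F := (topPs J F).restrict (cart_le_square B)) (F' := (botPs J F).restrict (cart_le_square B))
    (hP := cart_mono hP) (hQ := cart_mono hQ)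
    ((glueTrans GP).restrict (cart_le_square P)) ((glueTrans GQ).restrict (cart_le_square Q))
    (fun {X Y Z W j q p i} hj hq hp hi β => hc
      { ha := hi.1.2, hb := hj.1.2, ha' := hi.1.1, hb' := hj.1.1, hp := hp.1.2, hq := hq.1.2
        hp' := hp.1.1, hq' := hq.1.1, hx := X.mem, hy := Y.mem, hz := Z.mem, hw := W.mem
        I' := q.sq, J := i.sq, K' := β.top, K := β.bot, J' := j.sq, I := p.sq, comm := β.cyl })
    E.roofed_cart E.factors_cart
  exact ⟨T, fun f hf => congrArg (fun t => PsTrans.sq t f hf) h₁,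
    fun f hf => congrArg (fun t => PsTrans.sq t f hf) h₂⟩

/-- Restriction to the squares whose vertical edges are in a smaller subcategory. -/
def pullTrans (T : SqTrans F H (cart_le_square B)) {K : WideSub C} (h : K ≤ J) :
    SqTrans F (H.restrict h) (J := K) (cart_le_square B) where
  nat {p q} f hf := T.nat (X := ⟨p.hom, h _ p.mem⟩) (Y := ⟨q.hom, h _ q.mem⟩) ⟨f.sq⟩ hf
  nat_naturality {p q f g} hf hg η := T.nat_naturality (X := ⟨p.hom, h _ p.mem⟩)
    (Y := ⟨q.hom, h _ q.mem⟩) (f := ⟨f.sq⟩) (g := ⟨g.sq⟩) hf hg (Hom₂.mk η.top η.bot η.cyl)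
  nat_id p := T.nat_id ⟨p.hom, h _ p.mem⟩
  nat_comp {p q r} f g hf hg := T.nat_comp (X := ⟨p.hom, h _ p.mem⟩) (Y := ⟨q.hom, h _ q.mem⟩)
    (Z := ⟨r.hom, h _ r.mem⟩) ⟨f.sq⟩ ⟨g.sq⟩ hf hg

/-- On 2-Cartesian squares whose vertical edges are in `B`, the 2-cells are those of the
pseudofunctor on `B`. -/
lemma cartTrans_eq (hc : CubesCommute F GP GQ) (E : ExtensionConditions P Q B J)
    {T : SqTrans F H (cart_le_square B)}
    (hTP : ∀ {p q : Arr J} (f : p ⟶ q) (hf : (cart J P).mem f),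
        T.sq f (cart_mono hP _ hf) = (GP.iso hf.1.1 p.mem q.mem hf.1.2 f.sq).hom)
    (hTQ : ∀ {p q : Arr J} (f : p ⟶ q) (hf : (cart J Q).mem f),
        T.sq f (cart_mono hQ _ hf) = (GQ.iso hf.1.1 p.mem q.mem hf.1.2 f.sq).hom)
    {r : PsIso (F.restrict (B.inf_le_left J)) (H.restrict (B.inf_le_right J))}
    (hrP : ∀ {X Y : C} (a : X ⟶ Y) (ha : (P ⊓ J).mem a),
      r.iso a ⟨hP _ ha.1, ha.2⟩ = GP.diagInf.iso a ha)
    (hrQ : ∀ {X Y : C} (a : X ⟶ Y) (ha : (Q ⊓ J).mem a),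
      r.iso a ⟨hQ _ ha.1, ha.2⟩ = GQ.diagInf.iso a ha)
    {p q : Arr J} (f : p ⟶ q) (hf : (cart J B).mem f) (hp : B.mem p.hom) (hq : B.mem q.hom) :
    (r.iso p.hom ⟨hp, p.mem⟩).hom ▷ F.map f.bot hf.1.2 ≫ T.sq f hf =
      F.mapSq hf.1.1 hp hq hf.1.2 f.sq ≫ F.map f.top hf.1.1 ◁ (r.iso q.hom ⟨hq, q.mem⟩).hom := by
  let G : Gluing F (F.restrict (B.inf_le_left J)) :=
    F.selfGluing.restrict (fun _ _ _ h => h) (B.inf_le_left J)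
  have h : pullTrans T (B.inf_le_right J) =
      (glueTrans (G.conj (.refl F) r)).restrict (cart_le_square B) := by
    refine PsTrans.ext_of_factors (cart_mono hP) (cart_mono hQ) E.factors_cart_inf
      (PsTrans.ext_nat fun {p q} f hf => ?_) (PsTrans.ext_nat fun {p q} f hf => ?_)
    · exact (hTP (p := ⟨p.hom, p.mem.2⟩) (q := ⟨q.hom, q.mem.2⟩) (Hom.mk f.sq) hf).trans
        ((G.conj_refl_iff r (hP _ hf.1.1) p.mem q.mem (hP _ hf.1.2) f.sq _).1
          (compat_of_isTwoCartesian .self hc E hrP hrQ (fun p i hp hi => by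
            obtain ⟨X, j, q, α, hα⟩ := E.bcQ i p hi hp
            exact ⟨X, q, j, inv α, hα.flip⟩) E.stP hf.1.1 p.mem q.mem hf.1.2 hf.2))
    · exact (hTQ (p := ⟨p.hom, p.mem.2⟩) (q := ⟨q.hom, q.mem.2⟩) (Hom.mk f.sq) hf).trans
        ((G.conj_refl_iff r (hQ _ hf.1.1) p.mem q.mem (hQ _ hf.1.2) f.sq _).1
          (compat_of_isTwoCartesian hc.transpose .self E hrP hrQ (fun p i hp hi => by
            obtain ⟨X, j, q, α, hα, -⟩ := E.exists_baseChange p i hp.2 hi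
            exact ⟨X, j, q, α, hα⟩) E.stQ hf.1.1 p.mem q.mem hf.1.2 hf.2))
  have h' : T.sq f hf = ((G.conj (.refl F) r).iso hf.1.1 (q := p.hom) ⟨hp, p.mem⟩
      (p := q.hom) ⟨hq, q.mem⟩ hf.1.2 f.sq).hom :=
    congrArg (fun t : SqTrans F (H.restrict (B.inf_le_right J)) (cart_le_square B) =>
      t.sq (X := ⟨p.hom, hp, p.mem⟩) (Y := ⟨q.hom, hq, q.mem⟩) (Hom.mk f.sq) hf) h
  exact (G.conj_refl_iff r hf.1.1 _ _ hf.1.2 f.sq _).2 h'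

end Arr

end

section

variable {C : Type u} [Bicategory.{w, v} C]

lemma Cyl.vpaste {X Y X' Y' X'' Y'' : C} {x : X ⟶ X'} {y : Y ⟶ Y'} {x' : X' ⟶ X''} {y' : Y' ⟶ Y''}
    {f g : X ⟶ Y} {f' g' : X' ⟶ Y'} {f'' g'' : X'' ⟶ Y''} {α : x ≫ f' ⟶ f ≫ y}
    {β : x ≫ g' ⟶ g ≫ y} {α' : x' ≫ f'' ⟶ f' ≫ y'} {β' : x' ≫ g'' ⟶ g' ≫ y'} {η : f ⟶ g}
    {η' : f' ⟶ g'} {η'' : f'' ⟶ g''} (h : Cyl α β η' η) (h' : Cyl α' β' η'' η') :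
    Cyl (vpaste α α') (vpaste β β') η'' η := by
  dsimp only [Cyl, TwoGlue.vpaste] at *
  calc _ = 𝟙 _ ⊗≫ x ◁ α' ⊗≫ (α ≫ η ▷ y) ▷ y' ⊗≫ 𝟙 _ := by bicategory
    _ = 𝟙 _ ⊗≫ x ◁ (α' ≫ η' ▷ y') ⊗≫ β ▷ y' ⊗≫ 𝟙 _ := by rw [h]; bicategory
    _ = _ := by rw [h']; bicategory

lemma Cyl.conj {X Y X' Y' : C} {x z : X ⟶ X'} {y t : Y ⟶ Y'} {f g : X' ⟶ Y'} {f' g' : X ⟶ Y}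
    {α : x ≫ f ⟶ f' ≫ y} {β : x ≫ g ⟶ g' ≫ y} {η : f ⟶ g} {η' : f' ⟶ g'} (h : Cyl α β η η')
    (e : z ⟶ x) (e' : y ⟶ t) :
    Cyl (e ▷ f ≫ α ≫ f' ◁ e') (e ▷ g ≫ β ≫ g' ◁ e') η η' := by
  dsimp only [Cyl] at *
  rw [whisker_exchange_assoc, ← reassoc_of% h]
  simp [whisker_exchange]

lemma hpaste_conj {X₁ X₂ X₃ Y₁ Y₂ Y₃ : C} {p₁ q₁ : X₁ ⟶ Y₁} {p₂ q₂ : X₂ ⟶ Y₂} {p₃ q₃ : X₃ ⟶ Y₃}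
    {j : X₁ ⟶ X₂} {i : Y₁ ⟶ Y₂} {j' : X₂ ⟶ X₃} {i' : Y₂ ⟶ Y₃} (α : p₁ ≫ i ⟶ j ≫ p₂)
    (α' : p₂ ≫ i' ⟶ j' ≫ p₃) (e₁ : q₁ ⟶ p₁) (e₂ : q₂ ≅ p₂) (e₃ : p₃ ⟶ q₃) :
    hpaste (e₁ ▷ i ≫ α ≫ j ◁ e₂.inv) (e₂.hom ▷ i' ≫ α' ≫ j' ◁ e₃) =
      e₁ ▷ (i ≫ i') ≫ hpaste α α' ≫ (j ≫ j') ◁ e₃ := by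
  dsimp only [hpaste]
  calc _ = 𝟙 _ ⊗≫ e₁ ▷ (i ≫ i') ⊗≫ α ▷ i' ⊗≫ j ◁ (e₂.inv ≫ e₂.hom) ▷ i' ⊗≫ j ◁ α' ⊗≫
        (j ≫ j') ◁ e₃ ⊗≫ 𝟙 _ := by bicategory
    _ = _ := by rw [Iso.inv_hom_id]; bicategory

end

namespace Arr

variable {C : Type u} [Bicategory.{w, v} C] [IsLocallyGroupoid C] {B J : WideSub C}
  {D : Type u'} [Bicategory.{w', v'} D] {F₀ : C → D} {F : PsFun B F₀} {H : PsFun J F₀}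
  {S : WideSub (Arr J)} {hS : S ≤ square J B}

/-- The membership of a square in `S`. -/
abbrev MemSq (S : WideSub (Arr J)) {X Y Z W : C} {j : X ⟶ Y} {q : X ⟶ Z} {p : Y ⟶ W} {i : Z ⟶ W}
    (hq : J.mem q) (hp : J.mem p) (α : q ≫ i ⟶ j ≫ p) : Prop :=
  S.mem (X := ⟨q, hq⟩) (Y := ⟨p, hp⟩) (Hom.mk α)

namespace SqTrans

/-- The 2-cell attached to a square. -/
abbrev cell (T : SqTrans F H hS) {X Y Z W : C} {j : X ⟶ Y} {q : X ⟶ Z} {p : Y ⟶ W} {i : Z ⟶ W}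
    {hq : J.mem q} {hp : J.mem p} {α : q ≫ i ⟶ j ≫ p} (hα : MemSq S hq hp α) :
    H.map q hq ≫ F.map i (hS _ hα).2 ⟶ F.map j (hS _ hα).1 ≫ H.map p hp :=
  T.sq (X := ⟨q, hq⟩) (Y := ⟨p, hp⟩) (Hom.mk α) hα

variable (T : SqTrans F H hS)

lemma cyl_cell {X Y Z X' Y' Z' : C} {j : X ⟶ Z} {q : X ⟶ X'} {p : Z ⟶ Z'} {i : X' ⟶ Z'}
    {j₁ : X ⟶ Y} {t : Y ⟶ Y'} {i₁ : X' ⟶ Y'} {j₂ : Y ⟶ Z} {i₂ : Y' ⟶ Z'} {hq : J.mem q}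
    {hp : J.mem p} {ht : J.mem t} {α : q ≫ i ⟶ j ≫ p} {α₁ : q ≫ i₁ ⟶ j₁ ≫ t}
    {α₂ : t ≫ i₂ ⟶ j₂ ≫ p} {η : j ⟶ j₁ ≫ j₂} {θ : i ⟶ i₁ ≫ i₂} (h : Cyl α (hpaste α₁ α₂) θ η)
    (hα : MemSq S hq hp α) (hα₁ : MemSq S hq ht α₁) (hα₂ : MemSq S ht hp α₂) :
    Cyl (T.cell hα) (hpaste (T.cell hα₁) (T.cell hα₂))
      (F.map₂ (hS _ hα).2 (B.comp_mem (hS _ hα₁).2 (hS _ hα₂).2) θ ≫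
        (F.mapComp i₁ i₂ (hS _ hα₁).2 (hS _ hα₂).2).hom)
      (F.map₂ (hS _ hα).1 (B.comp_mem (hS _ hα₁).1 (hS _ hα₂).1) η ≫
        (F.mapComp j₁ j₂ (hS _ hα₁).1 (hS _ hα₂).1).hom) :=
  (T.cyl_map₂ (X := ⟨q, hq⟩) (Y := ⟨p, hp⟩) (f := Hom.mk α)
    (g := (Hom.mk α₁ : (⟨q, hq⟩ : Arr J) ⟶ ⟨t, ht⟩) ≫ Hom.mk α₂) hα (S.comp_mem hα₁ hα₂)
    (Hom₂.mk η θ h)).comp (T.cyl_mapComp (X := ⟨q, hq⟩) (Y := ⟨t, ht⟩) (Z := ⟨p, hp⟩) (Hom.mk α₁)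
      (Hom.mk α₂) hα₁ hα₂)

/-- Compatibility with vertical pasting. -/
def VComp {X Y X' Y' X'' Y'' : C} {x : X ⟶ X'} {y : Y ⟶ Y'} {x' : X' ⟶ X''} {y' : Y' ⟶ Y''}
    {f : X ⟶ Y} {f' : X' ⟶ Y'} {f'' : X'' ⟶ Y''} (α : x ≫ f' ⟶ f ≫ y)
    (α' : x' ≫ f'' ⟶ f' ≫ y') : Prop :=
  ∀ (hx : J.mem x) (hy : J.mem y) (hx' : J.mem x') (hy' : J.mem y') (hα : MemSq S hx hy α)
    (hα' : MemSq S hx' hy' α')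
    (hv : MemSq S (J.comp_mem hx hx') (J.comp_mem hy hy') (vpaste α α')),
    T.cell hv = vCell F H (T.cell hα) (T.cell hα')

lemma VComp.of_cyl {X Y Z X' Y' Z' X'' Y'' Z'' : C} {x : X ⟶ X'} {y : Y ⟶ Y'} {z : Z ⟶ Z'}
    {x' : X' ⟶ X''} {y' : Y' ⟶ Y''} {z' : Z' ⟶ Z''} {f : X ⟶ Z} {f' : X' ⟶ Z'} {f'' : X'' ⟶ Z''}
    {f₁ : X ⟶ Y} {f₁' : X' ⟶ Y'} {f₁'' : X'' ⟶ Y''} {f₂ : Y ⟶ Z} {f₂' : Y' ⟶ Z'}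
    {f₂'' : Y'' ⟶ Z''} {α : x ≫ f' ⟶ f ≫ z} {α' : x' ≫ f'' ⟶ f' ≫ z'}
    {α₁ : x ≫ f₁' ⟶ f₁ ≫ y} {α₁' : x' ≫ f₁'' ⟶ f₁' ≫ y'} {α₂ : y ≫ f₂' ⟶ f₂ ≫ z}
    {α₂' : y' ≫ f₂'' ⟶ f₂' ≫ z'} {η : f ⟶ f₁ ≫ f₂} {η' : f' ⟶ f₁' ≫ f₂'}
    {η'' : f'' ⟶ f₁'' ≫ f₂''} (h : Cyl α (hpaste α₁ α₂) η' η)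
    (h' : Cyl α' (hpaste α₁' α₂') η'' η') (h₁ : T.VComp α₁ α₁') (h₂ : T.VComp α₂ α₂')
    {hy : J.mem y} {hy' : J.mem y'} {hx : J.mem x} {hx' : J.mem x'} {hz : J.mem z} {hz' : J.mem z'}
    (hα₁ : MemSq S hx hy α₁) (hα₁' : MemSq S hx' hy' α₁')
    (hv₁ : MemSq S (J.comp_mem hx hx') (J.comp_mem hy hy') (vpaste α₁ α₁'))
    (hα₂ : MemSq S hy hz α₂) (hα₂' : MemSq S hy' hz' α₂')
    (hv₂ : MemSq S (J.comp_mem hy hy') (J.comp_mem hz hz') (vpaste α₂ α₂')) :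
    T.VComp α α' := by
  intro hx hz hx' hz' hα hα' hv
  have e := h.vpaste h'
  rw [← hpaste_vpaste] at e
  have e₁ := T.cyl_cell e hv hv₁ hv₂
  rw [h₁ hx hy hx' hy' hα₁ hα₁' hv₁, h₂ hy hz hy' hz' hα₂ hα₂' hv₂] at e₁
  have e₂ := ((T.cyl_cell h hα hα₁ hα₂).vpaste (T.cyl_cell h' hα' hα₁' hα₂')).conj
    (H.mapComp x x' hx hx').hom (H.mapComp z z' hz hz').inv
  rw [← hpaste_vpaste, ← hpaste_conj _ _ _ (H.mapComp y y' hy hy')] at e₂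
  have : IsIso (F.map₂ (hS _ hα).1 (B.comp_mem (hS _ hα₁).1 (hS _ hα₂).1) η) :=
    (F.map₂Iso _ _ η).isIso_hom
  exact e₁.eq_left e₂

end SqTrans

end Arr

section

variable {C : Type u} [Bicategory.{w, v} C]

lemma eq_of_cyl_left {X Y Z W : C} {q q' : X ⟶ Z} {i : Z ⟶ W} {j : X ⟶ Y} {p : Y ⟶ W} {e : Z ⟶ Z}
    {e' : X ⟶ X} (m : e ≅ 𝟙 Z) (n : e' ≅ 𝟙 X) {κ : q' ⟶ q} {x : q' ≫ i ⟶ j ≫ p}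
    {y : q ≫ i ⟶ j ≫ p} (h : Cyl x (hpaste (q' ◁ m.hom ≫ (ρ_ q').hom ≫ κ ≫ (λ_ q).inv ≫ n.inv ▷ q) y)
      ((λ_ i).inv ≫ m.inv ▷ i) ((λ_ j).inv ≫ n.inv ▷ j)) : x = κ ▷ i ≫ y := by
  have e : q' ◁ ((λ_ i).inv ≫ m.inv ▷ i) ≫
      hpaste (q' ◁ m.hom ≫ (ρ_ q').hom ≫ κ ≫ (λ_ q).inv ≫ n.inv ▷ q) y =
      (κ ▷ i ≫ y) ≫ ((λ_ j).inv ≫ n.inv ▷ j) ▷ p := by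
    dsimp only [hpaste]
    calc _ = 𝟙 _ ⊗≫ q' ◁ (m.inv ≫ m.hom) ▷ i ⊗≫ κ ▷ i ⊗≫ (n.inv ▷ (q ≫ i) ≫ e' ◁ y) ⊗≫ 𝟙 _ := by
          bicategory
      _ = _ := by rw [Iso.inv_hom_id, ← whisker_exchange]; bicategory
  rw [Cyl, e, cancel_mono] at h
  exact h

lemma eq_of_cyl_right {X Y Z W : C} {q : X ⟶ Z} {i : Z ⟶ W} {j : X ⟶ Y} {p p' : Y ⟶ W} {e : W ⟶ W}
    {e' : Y ⟶ Y} (m : e ≅ 𝟙 W) (n : e' ≅ 𝟙 Y) {ξ : p ⟶ p'} {x : q ≫ i ⟶ j ≫ p'}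
    {y : q ≫ i ⟶ j ≫ p} (h : Cyl x (hpaste y (p ◁ m.hom ≫ (ρ_ p).hom ≫ ξ ≫ (λ_ p').inv ≫ n.inv ▷ p'))
      ((ρ_ i).inv ≫ i ◁ m.inv) ((ρ_ j).inv ≫ j ◁ n.inv)) : x = y ≫ j ◁ ξ := by
  have e : q ◁ ((ρ_ i).inv ≫ i ◁ m.inv) ≫
      hpaste y (p ◁ m.hom ≫ (ρ_ p).hom ≫ ξ ≫ (λ_ p').inv ≫ n.inv ▷ p') =
      (y ≫ j ◁ ξ) ≫ ((ρ_ j).inv ≫ j ◁ n.inv) ▷ p' := by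
    dsimp only [hpaste]
    calc _ = 𝟙 _ ⊗≫ ((q ≫ i) ◁ m.inv ≫ y ▷ e) ⊗≫ j ◁ p ◁ m.hom ⊗≫ j ◁ ξ ⊗≫ j ◁ n.inv ▷ p' ⊗≫ 𝟙 _ := by
          bicategory
      _ = 𝟙 _ ⊗≫ y ⊗≫ j ◁ p ◁ (m.inv ≫ m.hom) ⊗≫ j ◁ ξ ⊗≫ j ◁ n.inv ▷ p' ⊗≫ 𝟙 _ := by
          rw [whisker_exchange]; bicategory
      _ = _ := by rw [Iso.inv_hom_id]; bicategory
  rw [Cyl, e, cancel_mono] at h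
  exact h

end

namespace Arr

variable {C : Type u} [Bicategory.{w, v} C] [IsLocallyGroupoid C] {P Q B J : WideSub C}
  {D : Type u'} [Bicategory.{w', v'} D] {F₀ : C → D} {F : PsFun B F₀} {H : PsFun J F₀}
  {S : WideSub (Arr J)} {hS : S ≤ square J B}

namespace SqTrans

variable (T : SqTrans F H hS)

/-- The 2-cells attached to squares with horizontal identities are the images of 2-cells. -/
def IdComp : Prop :=
  ∀ {X Y : C} {q p : X ⟶ Y} (hq : J.mem q) (hp : J.mem p) (κ : q ⟶ p)
    (hκ : MemSq S hq hp ((ρ_ q).hom ≫ κ ≫ (λ_ p).inv)),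
    T.cell hκ = H.map q hq ◁ (F.mapId Y).hom ≫ (ρ_ (H.map q hq)).hom ≫ H.map₂ hq hp κ ≫
        (λ_ (H.map p hp)).inv ≫ (F.mapId X).inv ▷ H.map p hp

variable {T}

lemma IdComp.cell_left (hT : T.IdComp) {X Y Z W : C} {j : X ⟶ Y} {q q' : X ⟶ Z} {p : Y ⟶ W}
    {i : Z ⟶ W} {hq : J.mem q} {hq' : J.mem q'} {hp : J.mem p} (κ : q' ⟶ q)
    {α : q ≫ i ⟶ j ≫ p} (hα : MemSq S hq hp α) (hκ : MemSq S hq' hq ((ρ_ q').hom ≫ κ ≫ (λ_ q).inv))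
    (h : MemSq S hq' hp (κ ▷ i ≫ α)) :
    T.cell h = H.map₂ hq' hq κ ▷ F.map i (hS _ hα).2 ≫ T.cell hα := by
  have e := T.cyl_cell (η := (λ_ j).inv) (θ := (λ_ i).inv) (by
    dsimp only [Cyl, hpaste]
    simp [← whisker_exchange_assoc]) h hκ hα
  rw [F.map₂_leftUnitor_inv, F.map₂_leftUnitor_inv, hT hq' hq κ hκ] at e
  exact eq_of_cyl_left (F.mapId Z) (F.mapId X) (e.of_eq (by simp) (by simp))

lemma IdComp.cell_right (hT : T.IdComp) {X Y Z W : C} {j : X ⟶ Y} {q : X ⟶ Z} {p p' : Y ⟶ W}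
    {i : Z ⟶ W} {hq : J.mem q} {hp : J.mem p} {hp' : J.mem p'} (ξ : p ⟶ p')
    {α : q ≫ i ⟶ j ≫ p} (hα : MemSq S hq hp α) (hξ : MemSq S hp hp' ((ρ_ p).hom ≫ ξ ≫ (λ_ p').inv))
    (h : MemSq S hq hp' (α ≫ j ◁ ξ)) :
    T.cell h = T.cell hα ≫ F.map j (hS _ hα).1 ◁ H.map₂ hp hp' ξ := by
  have e := T.cyl_cell (η := (ρ_ j).inv) (θ := (ρ_ i).inv) (by
    dsimp only [Cyl, hpaste]
    simp [whisker_exchange_assoc]) h hα hξ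
  rw [F.map₂_rightUnitor_inv, F.map₂_rightUnitor_inv, hT hp hp' ξ hξ] at e
  exact eq_of_cyl_right (F.mapId W) (F.mapId Y) (e.of_eq (by simp) (by simp))

end SqTrans

variable {hP : P ≤ B} {hQ : Q ≤ B} {GP : Gluing (F.restrict hP) H} {GQ : Gluing (F.restrict hQ) H}

lemma cartTrans_vComp (E : ExtensionConditions P Q B J)
    {T : SqTrans F H (cart_le_square B)}
    (hTP : ∀ {p q : Arr J} (f : p ⟶ q) (hf : (cart J P).mem f),
        T.sq f (cart_mono hP _ hf) = (GP.iso hf.1.1 p.mem q.mem hf.1.2 f.sq).hom)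
    (hTQ : ∀ {p q : Arr J} (f : p ⟶ q) (hf : (cart J Q).mem f),
        T.sq f (cart_mono hQ _ hf) = (GQ.iso hf.1.1 p.mem q.mem hf.1.2 f.sq).hom)
    {X Y X' Y' X'' Y'' : C} {x : X ⟶ X'} {y : Y ⟶ Y'} {x' : X' ⟶ X''} {y' : Y' ⟶ Y''}
    {f : X ⟶ Y} {f' : X' ⟶ Y'} {f'' : X'' ⟶ Y''} (α : x ≫ f' ⟶ f ≫ y)
    (α' : x' ≫ f'' ⟶ f' ≫ y') : SqTrans.VComp T α α' := by
  intro hx hy hx' hy' hα hα' hv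
  obtain ⟨V, a, b, ha, hb, ⟨ν⟩⟩ := E.fac f'' hα'.1.2
  obtain ⟨U, b', z', β', hβ', hz'⟩ := E.exists_baseChange y' b hy' hb
  have hb' : Q.mem b' := E.stQ _ hβ' hb hy'
  obtain ⟨a', α₁', δ', hα₁', e'⟩ := hα'.2.exists_factor_bottom ν.hom hβ'
  have ha' : P.mem a' := E.stP _ hα₁' ha hz'
  obtain ⟨R, b₁, z, β, hβ, hz⟩ := E.exists_baseChange y b' hy hb'
  have hb₁ : Q.mem b₁ := E.stQ _ hβ hb' hy
  obtain ⟨a₁, α₁, δ, hα₁, e⟩ := hα.2.exists_factor_bottom (inv δ') hβ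
  have ha₁ : P.mem a₁ := E.stP _ hα₁ ha' hz
  have c : Cyl α (hpaste α₁ β) (inv δ') (inv δ) := by
    replace e : x ◁ inv δ' ≫ hpaste α₁ β ≫ δ ▷ y = α := e
    rw [Cyl, ← e]
    simp [← comp_whiskerRight]
  have c' : Cyl α' (hpaste α₁' β') ν.hom (inv δ') := by
    replace e' : x' ◁ ν.hom ≫ hpaste α₁' β' ≫ δ' ▷ y' = α' := e'
    rw [Cyl, ← e']
    simp [← comp_whiskerRight]
  refine SqTrans.VComp.of_cyl T c c' (fun hx hz hx' hz' _ _ _ => ?_)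
    (fun hz hy hz' hy' _ _ _ => ?_) (hx := hx) (hx' := hx') (hy := hz) (hy' := hz') (hz := hy)
    (hz' := hy') ⟨⟨hP _ ha₁, hP _ ha'⟩, hα₁⟩ ⟨⟨hP _ ha', hP _ ha⟩, hα₁'⟩
    ⟨⟨hP _ ha₁, hP _ ha⟩, hα₁.vpaste hα₁'⟩ ⟨⟨hQ _ hb₁, hQ _ hb'⟩, hβ⟩ ⟨⟨hQ _ hb', hQ _ hb⟩, hβ'⟩
    ⟨⟨hQ _ hb₁, hQ _ hb⟩, hβ.vpaste hβ'⟩ hx hy hx' hy' hα hα' hv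
  · refine (hTP _ ⟨⟨ha₁, ha⟩, hα₁.vpaste hα₁'⟩).trans
      ((GP.ax_b ha₁ ha' ha hx hz hx' hz' α₁ α₁').trans ?_)
    exact congrArg₂ (vCell F H) (hTP (p := ⟨x, hx⟩) (q := ⟨z, hz⟩) (Hom.mk α₁)
      ⟨⟨ha₁, ha'⟩, hα₁⟩).symm (hTP (p := ⟨x', hx'⟩) (q := ⟨z', hz'⟩) (Hom.mk α₁')
      ⟨⟨ha', ha⟩, hα₁'⟩).symm
  · refine (hTQ _ ⟨⟨hb₁, hb⟩, hβ.vpaste hβ'⟩).trans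
      ((GQ.ax_b hb₁ hb' hb hz hy hz' hy' β β').trans ?_)
    exact congrArg₂ (vCell F H) (hTQ (p := ⟨z, hz⟩) (q := ⟨y, hy⟩) (Hom.mk β)
      ⟨⟨hb₁, hb'⟩, hβ⟩).symm (hTQ (p := ⟨z', hz'⟩) (q := ⟨y', hy'⟩) (Hom.mk β')
      ⟨⟨hb', hb⟩, hβ'⟩).symm

lemma cartTrans_idComp {T : SqTrans F H (cart_le_square B)}
    (hTP : ∀ {p q : Arr J} (f : p ⟶ q) (hf : (cart J P).mem f),
        T.sq f (cart_mono hP _ hf) = (GP.iso hf.1.1 p.mem q.mem hf.1.2 f.sq).hom) :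
    SqTrans.IdComp T := fun {X Y q p} hq hp κ hκ =>
  (hTP (p := ⟨q, hq⟩) (q := ⟨p, hp⟩) (Hom.mk ((ρ_ q).hom ≫ κ ≫ (λ_ p).inv))
    ⟨⟨P.id_mem X, P.id_mem Y⟩, hκ.2⟩).trans (GP.ax_a' hq hp κ)

end Arr

section

variable {C : Type u} [Bicategory.{w, v} C]

lemma exists_whiskerLeft_eq {X Y : C} {a : X ⟶ X} (e : a ≅ 𝟙 X) {g h : X ⟶ Y}
    (φ : a ≫ g ⟶ a ≫ h) : ∃ ψ : g ⟶ h, a ◁ ψ = φ :=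
  ⟨(λ_ g).inv ≫ e.inv ▷ g ≫ φ ≫ e.hom ▷ h ≫ (λ_ h).hom, by
    rw [← cancel_mono (e.hom ▷ h), whisker_exchange]
    simp⟩

lemma hpaste_of_vpaste {x y z w x' y' z' w' : C} {a : x ⟶ x'} {b : y ⟶ y'} {c : z ⟶ z'}
    {d : w ⟶ w'} {qt : x ⟶ z} {qb : x' ⟶ z'} {pt : y ⟶ w} {pb : y' ⟶ w'} {jt jt' : x ⟶ y}
    {jb jb' : x' ⟶ y'} {it it' : z ⟶ w} {ib ib' : z' ⟶ w'} {φq : a ≫ qb ⟶ qt ≫ c}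
    {φp : b ≫ pb ⟶ pt ≫ d} {φU : jt' ≫ pt ⟶ qt ≫ it'} {φL : jb' ≫ pb ⟶ qb ≫ ib'}
    {μj : a ≫ jb' ⟶ jt' ≫ b} {μi : c ≫ ib' ⟶ it' ≫ d} {τj : a ≫ jb ⟶ jt ≫ b}
    {τi : c ≫ ib ⟶ it ≫ d} (rjt : jt ≅ jt') (rjb : jb ≅ jb') (rit : it ≅ it') (rib : ib ≅ ib')
    (χU : qt ≫ it ≅ jt ≫ pt) (χL : qb ≫ ib ≅ jb ≫ pb)
    (h : vpaste φq φL ≫ qt ◁ μi = μj ▷ pb ≫ vpaste φU φp)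
    (hU : rjt.hom ▷ pt ≫ φU = χU.inv ≫ qt ◁ rit.hom)
    (hL : rjb.hom ▷ pb ≫ φL = χL.inv ≫ qb ◁ rib.hom)
    (hj : a ◁ rjb.hom ≫ μj = τj ≫ rjt.hom ▷ b) (hi : c ◁ rib.hom ≫ μi = τi ≫ rit.hom ▷ d) :
    hpaste φq τi ≫ χU.hom ▷ d = a ◁ χL.hom ≫ hpaste τj φp := by
  have key : a ◁ χL.inv ≫ hpaste φq τi ≫ (qt ◁ rit.hom) ▷ d =
      hpaste τj φp ≫ (rjt.hom ▷ pt ≫ φU) ▷ d := by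
    dsimp only [hpaste, vpaste] at *
    calc _ = a ◁ χL.inv ⊗≫ φq ▷ ib ⊗≫ qt ◁ (τi ≫ rit.hom ▷ d) ⊗≫ 𝟙 _ := by bicategory
      _ = a ◁ χL.inv ⊗≫ (φq ▷ ib ≫ (qt ≫ c) ◁ rib.hom) ⊗≫ qt ◁ μi ⊗≫ 𝟙 _ := by
          rw [← hi]; bicategory
      _ = a ◁ (χL.inv ≫ qb ◁ rib.hom) ⊗≫ φq ▷ ib' ⊗≫ qt ◁ μi ⊗≫ 𝟙 _ := by
          rw [← whisker_exchange]; bicategory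
      _ = 𝟙 _ ⊗≫ a ◁ rjb.hom ▷ pb ⊗≫ (((α_ a jb' pb).hom ≫ a ◁ φL ≫ (α_ a qb ib').inv ≫
          φq ▷ ib' ≫ (α_ qt c ib').hom) ≫ qt ◁ μi) ⊗≫ 𝟙 _ := by
          rw [← hL]; bicategory
      _ = 𝟙 _ ⊗≫ (a ◁ rjb.hom ≫ μj) ▷ pb ⊗≫ jt' ◁ φp ⊗≫ φU ▷ d ⊗≫ 𝟙 _ := by
          rw [h]; bicategory
      _ = 𝟙 _ ⊗≫ τj ▷ pb ⊗≫ (rjt.hom ▷ (b ≫ pb) ≫ jt' ◁ φp) ⊗≫ φU ▷ d ⊗≫ 𝟙 _ := by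
          rw [hj]; bicategory
      _ = _ := by rw [← whisker_exchange]; bicategory
  rw [hU, ← cancel_epi (a ◁ χL.hom)] at key
  rw [← whiskerLeft_comp_assoc, Iso.hom_inv_id, whiskerLeft_id, Category.id_comp,
    comp_whiskerRight, ← Category.assoc (hpaste τj φp), ← Category.assoc (a ◁ χL.hom),
    cancel_mono] at key
  rw [key]
  simp [← comp_whiskerRight]

lemma conj_cancel {x y z w : C} {l l' m m' : x ⟶ y} {p : y ⟶ w} {q : x ⟶ z} {r r' n n' : z ⟶ w}
    (el : l ≅ l') (em : m ≅ m') (er : r ≅ r') (en : n ≅ n') {φ : l' ≫ p ⟶ q ≫ r'}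
    {ψ : m' ≫ p ⟶ q ≫ n'} {κ : r ⟶ n} {η : l ⟶ m}
    (h : (el.hom ▷ p ≫ φ ≫ q ◁ er.inv) ≫ q ◁ κ = η ▷ p ≫ em.hom ▷ p ≫ ψ ≫ q ◁ en.inv) :
    φ ≫ q ◁ (er.inv ≫ κ ≫ en.hom) = (el.inv ≫ η ≫ em.hom) ▷ p ≫ ψ := by
  rw [← cancel_epi (whiskerRightIso el p).hom, ← cancel_mono (whiskerLeftIso q en).inv]
  simp only [Category.assoc] at h
  simp only [whiskerRightIso_hom, whiskerLeftIso_inv, whiskerLeft_comp, comp_whiskerRight,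
    Category.assoc, hom_inv_whiskerRight_assoc, ← h, whiskerLeft_hom_inv, Category.comp_id]

/-- The 1-cells that are isomorphic to an identity. -/
inductive IsoId : ∀ {X Y : C}, (X ⟶ Y) → Prop
  | mk {X : C} (f : X ⟶ X) (e : f ≅ 𝟙 X) : IsoId f

lemma exists_roof_of_isoId {X Y Z Z' : C} {a : X ⟶ Z} {a' : X ⟶ Z'} {p : Z ⟶ Y} {p' : Z' ⟶ Y}
    (ha : IsoId a) (ha' : IsoId a') (θ : a ≫ p ⟶ a' ≫ p') :
    ∃ (s : Z ⟶ Z') (σ : a' ⟶ a ≫ s) (τ : 𝟙 Z ≫ p ⟶ s ≫ p'), (∀ A : WideSub C, A.mem s) ∧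
      (ρ_ a).inv ▷ p ≫ (α_ a (𝟙 Z) p).hom ≫ a ◁ τ = θ ≫ σ ▷ p' ≫ (α_ a s p').hom := by
  obtain ⟨a, e⟩ := ha
  obtain ⟨a', e'⟩ := ha'
  obtain ⟨τ, hτ⟩ := exists_whiskerLeft_eq e ((α_ a (𝟙 X) p).inv ≫ (ρ_ a).hom ▷ p ≫ θ ≫
    (e'.hom ≫ e.inv ≫ (ρ_ a).inv) ▷ p' ≫ (α_ a (𝟙 X) p').hom)
  exact ⟨𝟙 X, e'.hom ≫ e.inv ≫ (ρ_ a).inv, τ, fun A => A.id_mem X, by simp [hτ]⟩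

lemma IsoId.comp {X Y Z : C} {f : X ⟶ Y} {g : Y ⟶ Z} (hf : IsoId f) (hg : IsoId g) :
    IsoId (f ≫ g) := by
  obtain ⟨f, e⟩ := hf
  obtain ⟨g, e'⟩ := hg
  exact ⟨f ≫ g, whiskerRightIso e g ≪≫ λ_ g ≪≫ e'⟩

lemma isTwoCartesian_of_isoId [IsLocallyGroupoid C] {X Y Z W : C} {j : X ⟶ Y} {q : X ⟶ Z} {p : Y ⟶ W} {i : Z ⟶ W}
    (hq : IsoId q) (hp : IsoId p) (α : q ≫ i ⟶ j ≫ p) : IsTwoCartesian α := by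
  obtain ⟨q, e⟩ := hq
  obtain ⟨p, e'⟩ := hp
  have h := (IsTwoCartesianIn.vertical_id ((λ_ i).inv ≫ e.inv ▷ i ≫ α ≫ j ◁ e'.hom ≫
    (ρ_ j).hom)).adjust e.hom (𝟙 i) (𝟙 j) e'.inv
  simpa [← whiskerLeft_comp, ← comp_whiskerRight_assoc] using h

end

namespace Arr

variable {C : Type u} [Bicategory.{w, v} C] [IsLocallyGroupoid C] {P Q B J : WideSub C}
  {D : Type u'} [Bicategory.{w', v'} D] {F₀ : C → D} {F : PsFun B F₀} {H : PsFun J F₀}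
  {S : WideSub (Arr J)} {hS : S ≤ square J B}

variable (B J) in
/-- The squares whose horizontal edges are in `B ⊓ J`, the lower one being isomorphic to an
identity. -/
def fold : WideSub (Arr J) where
  mem f := (square J (B ⊓ J)).mem f ∧ IsoId f.bot
  id_mem p := ⟨(square J (B ⊓ J)).id_mem p, ⟨_, .refl _⟩⟩
  comp_mem h h' := ⟨(square J (B ⊓ J)).comp_mem h.1 h'.1, h.2.comp h'.2⟩

lemma fold_le_square : fold B J ≤ square J (B ⊓ J) := fun _ _ _ h => h.1

lemma fold_le : fold B J ≤ square J B := fun _ _ _ h => square_mono (B.inf_le_left J) _ h.1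

lemma factors_fold (h : Squaring B J) : Factors (fold B J) (cart J B) (square J B) := by
  rintro p q f ⟨hf, hf'⟩
  obtain ⟨X, a, k, r, β, γ, δ, hk, hr, ha, hβ, e⟩ := h f.sq hf' hf q.mem p.mem
  refine ⟨⟨r, hr⟩, ⟨(ρ_ _).hom ≫ γ⟩, ⟨β⟩, ⟨⟨ha, (B ⊓ J).id_mem _⟩, ⟨_, .refl _⟩⟩, ⟨⟨hk, hf'⟩, hβ⟩,
    ⟨isoMk (asIso δ).symm (λ_ _).symm ?_⟩⟩
  rw [Cyl, e]
  simp [pasteTriangles, precompSquare, hpaste, ← comp_whiskerRight, ← comp_whiskerRight_assoc]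

lemma roofed_fold (stP : StableUnderBaseChange P J) (hP : P ≤ B) :
    Roofed (fold B J) (cart J B) := by
  rintro x y z z' a p a' p' ⟨ha, ha₁⟩ ⟨⟨-, hp⟩, hp₁⟩ ⟨ha', ha₁'⟩ ⟨⟨-, hp'⟩, hp₁'⟩ θ
  obtain ⟨s₀, σ₀, τ₀, hs₀, e⟩ := exists_roof_of_isoId ha₁ ha₁' θ.bot
  obtain ⟨s', σ', τ, rfl, hs', e'⟩ := exists_roof_lift hp₁ hp₁' ((cart J B).id_mem z).2 θ (ρ_ a).inv σ₀
    τ₀ e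
  exact ⟨_, a, 𝟙 z, s', _, σ', τ, ⟨ha, ha₁⟩, (cart J B).id_mem z,
    ⟨⟨hP _ (stP _ hs' (hs₀ P) z'.mem), hs₀ B⟩, hs'⟩, e'⟩

lemma SqTrans.cell_congr (T : SqTrans F H hS) {X Y Z W : C} {j : X ⟶ Y} {q : X ⟶ Z} {p : Y ⟶ W}
    {i : Z ⟶ W} {hq : J.mem q} {hp : J.mem p} {α β : q ≫ i ⟶ j ≫ p} (h : α = β)
    (hα : MemSq S hq hp α) (hβ : MemSq S hq hp β) : T.cell hα = T.cell hβ := by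
  subst h
  rfl

lemma SqTrans.exchange {T : SqTrans F H hS} (hT : T.IdComp)
    (hv : ∀ {X Y X' Y' X'' Y'' : C} {x : X ⟶ X'} {y : Y ⟶ Y'} {x' : X' ⟶ X''} {y' : Y' ⟶ Y''}
      {f : X ⟶ Y} {f' : X' ⟶ Y'} {f'' : X'' ⟶ Y''} (α : x ≫ f' ⟶ f ≫ y)
      (α' : x' ≫ f'' ⟶ f' ≫ y'), T.VComp α α')
    {x y z w x' y' z' w' : C} {a : x ⟶ x'} {b : y ⟶ y'} {c : z ⟶ z'} {d : w ⟶ w'} {qt : x ⟶ z}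
    {qb : x' ⟶ z'} {pt : y ⟶ w} {pb : y' ⟶ w'} {jt : x ⟶ y} {jb : x' ⟶ y'} {it : z ⟶ w}
    {ib : z' ⟶ w'} {φq : a ≫ qb ⟶ qt ≫ c} {φp : b ≫ pb ⟶ pt ≫ d} {φU : jt ≫ pt ⟶ qt ≫ it}
    {φL : jb ≫ pb ⟶ qb ≫ ib} {κj : a ≫ jb ⟶ jt ≫ b} {κi : c ≫ ib ⟶ it ≫ d} {ha : J.mem a}
    {hb : J.mem b} {hc : J.mem c} {hd : J.mem d} {hjt : J.mem jt} {hjb : J.mem jb} {hit : J.mem it}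
    {hib : J.mem ib} (h : vpaste φq φL ≫ qt ◁ κi = κj ▷ pb ≫ vpaste φU φp)
    (hq : MemSq S ha hc φq) (hp : MemSq S hb hd φp) (hU : MemSq S hjt hit φU)
    (hL : MemSq S hjb hib φL)
    (h₁ : MemSq S (J.comp_mem ha hjb) (J.comp_mem hc hib) (vpaste φq φL))
    (h₂ : MemSq S (J.comp_mem hjt hb) (J.comp_mem hit hd) (vpaste φU φp))
    (h₃ : MemSq S (J.comp_mem ha hjb) (J.comp_mem hit hd) (κj ▷ pb ≫ vpaste φU φp))
    (hκi : MemSq S (J.comp_mem hc hib) (J.comp_mem hit hd) ((ρ_ _).hom ≫ κi ≫ (λ_ _).inv))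
    (hκj : MemSq S (J.comp_mem ha hjb) (J.comp_mem hjt hb) ((ρ_ _).hom ≫ κj ≫ (λ_ _).inv)) :
    vpaste (T.cell hq) (T.cell hL) ≫ F.map qt (hS _ hq).1 ◁ H.mapSq hit hc hd hib κi =
      H.mapSq hjt ha hb hjb κj ▷ F.map pb (hS _ hp).2 ≫ vpaste (T.cell hU) (T.cell hp) := by
  have e₁ : MemSq S (J.comp_mem ha hjb) (J.comp_mem hit hd) (vpaste φq φL ≫ qt ◁ κi) := by
    rwa [h]
  have e₂ : T.cell e₁ = T.cell h₃ := T.cell_congr h e₁ h₃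
  rw [hT.cell_right κi h₁ hκi e₁, hT.cell_left κj h₂ hκj h₃, hv φq φL ha hc hjb hib hq hL h₁,
    hv φU φp hjt hit hb hd hU hp h₂] at e₂
  exact conj_cancel (H.mapComp a jb ha hjb) (H.mapComp jt b hjt hb) (H.mapComp c ib hc hib)
    (H.mapComp it d hit hd) e₂

end Arr

section

variable {C : Type u} [Bicategory.{w, v} C] [IsLocallyGroupoid C] {P Q B J : WideSub C}
  {D : Type u'} [Bicategory.{w', v'} D] {F₀ : C → D} {F : PsFun B F₀} {H : PsFun J F₀}

lemma vpaste_of_hpaste {x y z w x' y' z' w' : C} {a : x ⟶ x'} {b : y ⟶ y'} {c : z ⟶ z'}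
    {d : w ⟶ w'} {qt : x ⟶ z} {qb : x' ⟶ z'} {pt : y ⟶ w} {pb : y' ⟶ w'} {jt : x ⟶ y}
    {jb : x' ⟶ y'} {it : z ⟶ w} {ib : z' ⟶ w'} {φq : a ≫ qb ⟶ qt ≫ c} {φp : b ≫ pb ⟶ pt ≫ d}
    {κj : a ≫ jb ⟶ jt ≫ b} {κi : c ≫ ib ⟶ it ≫ d} {t : qt ≫ it ⟶ jt ≫ pt}
    {s : qb ≫ ib ⟶ jb ≫ pb} (h : hpaste φq κi ≫ t ▷ d = a ◁ s ≫ hpaste κj φp) :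
    vpaste φq (inv s) ≫ qt ◁ κi = κj ▷ pb ≫ vpaste (inv t) φp := by
  have h' : a ◁ inv s ≫ hpaste φq κi = hpaste κj φp ≫ inv t ▷ d := by
    rw [← cancel_mono (t ▷ d), Category.assoc, h]
    simp [← comp_whiskerRight, ← whiskerLeft_comp_assoc]
  dsimp only [hpaste, vpaste] at *
  calc _ = 𝟙 _ ⊗≫ (a ◁ inv s ≫ (α_ a qb ib).inv ≫ φq ▷ ib ≫ (α_ qt c ib).hom ≫ qt ◁ κi ≫
        (α_ qt it d).inv) ⊗≫ 𝟙 _ := by bicategory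
    _ = _ := by rw [h']; bicategory

lemma PsFun.selfGluing_iso_inv (F : PsFun B F₀) {X Y Z W : C} {j : X ⟶ Y}
    {q : X ⟶ Z} {p : Y ⟶ W} {i : Z ⟶ W} (hj : B.mem j) (hq : B.mem q) (hp : B.mem p)
    (hi : B.mem i) (β : q ≫ i ⟶ j ≫ p) :
    (F.selfGluing.iso hj hq hp hi β).inv = F.mapSq hq hj hi hp (inv β) := by
  simp [selfGluing, mapSq, map₂Iso]

/-- The gluing datum on the 1-cells that are both horizontal and vertical that is induced by an
isomorphism between the two pseudofunctors. -/
noncomputable abbrev diagGluing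
    (r : PsIso (F.restrict (B.inf_le_left J)) (H.restrict (B.inf_le_right J))) :
    Gluing (F.restrict (B.inf_le_left J)) H :=
  (H.selfGluing.restrict (B.inf_le_right J) fun _ _ _ h => h).conj r.symm (.refl H)

lemma diagGluing_iff (r : PsIso (F.restrict (B.inf_le_left J)) (H.restrict (B.inf_le_right J)))
    {X Y Z W : C} {j : X ⟶ Y} {q : X ⟶ Z} {p : Y ⟶ W} {i : Z ⟶ W} (hj : (B ⊓ J).mem j)
    (hq : J.mem q) (hp : J.mem p) (hi : (B ⊓ J).mem i) (κ : q ≫ i ⟶ j ≫ p)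
    (φ : H.map q hq ≫ F.map i hi.1 ⟶ F.map j hj.1 ≫ H.map p hp) :
    φ ≫ (r.iso j hj).hom ▷ H.map p hp = H.map q hq ◁ (r.iso i hi).hom ≫ H.mapSq hj.2 hq hp hi.2 κ ↔
      φ = ((diagGluing r).iso hj hq hp hi κ).hom := by
  have e : ((diagGluing r).iso hj hq hp hi κ).hom ≫ (r.iso j hj).hom ▷ H.map p hp =
      H.map q hq ◁ (r.iso i hi).hom ≫ H.mapSq hj.2 hq hp hi.2 κ := by
    simp [PsFun.selfGluing_iso_hom]
  rw [← e]
  exact cancel_mono _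

namespace Arr

variable {hP : P ≤ B} {hQ : Q ≤ B} {GP : Gluing (F.restrict hP) H} {GQ : Gluing (F.restrict hQ) H}

lemma exists_squareTrans (hc : CubesCommute F GP GQ) (E : ExtensionConditions P Q B J)
    {T : SqTrans F H (cart_le_square B)}
    (hTP : ∀ {p q : Arr J} (f : p ⟶ q) (hf : (cart J P).mem f),
        T.sq f (cart_mono hP _ hf) = (GP.iso hf.1.1 p.mem q.mem hf.1.2 f.sq).hom)
    (hTQ : ∀ {p q : Arr J} (f : p ⟶ q) (hf : (cart J Q).mem f),
        T.sq f (cart_mono hQ _ hf) = (GQ.iso hf.1.1 p.mem q.mem hf.1.2 f.sq).hom)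
    {r : PsIso (F.restrict (B.inf_le_left J)) (H.restrict (B.inf_le_right J))}
    (hrP : ∀ {X Y : C} (a : X ⟶ Y) (ha : (P ⊓ J).mem a),
      r.iso a ⟨hP _ ha.1, ha.2⟩ = GP.diagInf.iso a ha)
    (hrQ : ∀ {X Y : C} (a : X ⟶ Y) (ha : (Q ⊓ J).mem a),
      r.iso a ⟨hQ _ ha.1, ha.2⟩ = GQ.diagInf.iso a ha) :
    ∃ U : SqTrans F H (S := square J B) (fun _ _ _ h => h),
      (∀ {p q : Arr J} (f : p ⟶ q) (hf : (cart J B).mem f), U.sq f hf.1 = T.sq f hf) ∧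
      ∀ {p q : Arr J} (f : p ⟶ q) (hf : (fold B J).mem f),
        U.sq f (fold_le _ hf) = ((diagGluing r).iso hf.1.1 p.mem q.mem hf.1.2 f.sq).hom := by
  refine Exists.elim (PsTrans.exists_extension (F := topPs J F) (F' := botPs J F)
    (hP := fold_le) (hQ := cart_le_square B)
    ((glueTrans (diagGluing r)).restrict fold_le_square) T
    (fun {X Y Z W j q p i} hj hq hp hi β => ?_) (roofed_fold E.stP E.hP) (factors_fold E.sq)) ?_
  rotate_left
  · rintro U ⟨h₁, h₂⟩
    exact ⟨U, fun f hf => congrArg (fun t => PsTrans.sq t f hf) h₂,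
      fun f hf => congrArg (fun t => PsTrans.sq t f hf) h₁⟩
  have hL : IsTwoCartesian (inv β.bot) := isTwoCartesian_of_isoId hj.2 hi.2 _
  have e : vpaste q.sq (inv β.bot) ≫ q.top ◁ i.sq = j.sq ▷ p.bot ≫ vpaste (inv β.top) p.sq :=
    vpaste_of_hpaste β.cyl
  have hv := hq.2.vpaste hL
  have hv' : IsTwoCartesian (j.sq ▷ p.bot ≫ vpaste (inv β.top) p.sq) := by
    rw [← e]
    simpa using hv.adjust (𝟙 _) (𝟙 _) (𝟙 _) i.sq
  have hv'' : IsTwoCartesian (vpaste (inv β.top) p.sq) := by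
    simpa [← comp_whiskerRight_assoc] using hv'.adjust (inv j.sq) (𝟙 _) (𝟙 _) (𝟙 _)
  have hU : IsTwoCartesian (inv β.top) := hv''.of_vpaste hp.2
  have hB := B.inf_le_left J
  have hJ := B.inf_le_right J
  have x := SqTrans.exchange (T := T) (cartTrans_idComp hTP) (cartTrans_vComp E hTP hTQ) e
    (ha := X.mem) (hb := Y.mem) (hc := Z.mem) (hd := W.mem) (hjt := hj.1.1.2) (hjb := hj.1.2.2)
    (hit := hi.1.1.2) (hib := hi.1.2.2) hq hp ⟨⟨hq.1.1, hp.1.1⟩, hU⟩ ⟨⟨hq.1.2, hp.1.2⟩, hL⟩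
    ⟨⟨hq.1.1, hp.1.2⟩, hv⟩ ⟨⟨hq.1.1, hp.1.2⟩, hv''⟩ ⟨⟨hq.1.1, hp.1.2⟩, hv'⟩
    ⟨⟨B.id_mem _, B.id_mem _⟩, .horizontal_id _⟩ ⟨⟨B.id_mem _, B.id_mem _⟩, .horizontal_id _⟩
  have xU := cartTrans_eq hc E hTP hTQ hrP hrQ (p := ⟨j.top, hj.1.1.2⟩) (q := ⟨i.top, hi.1.1.2⟩)
    (Hom.mk (inv β.top)) ⟨⟨hq.1.1, hp.1.1⟩, hU⟩ hj.1.1.1 hi.1.1.1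
  have xL := cartTrans_eq hc E hTP hTQ hrP hrQ (p := ⟨j.bot, hj.1.2.2⟩) (q := ⟨i.bot, hi.1.2.2⟩)
    (Hom.mk (inv β.bot)) ⟨⟨hq.1.2, hp.1.2⟩, hL⟩ hj.1.2.1 hi.1.2.1
  exact hpaste_of_vpaste (r.iso j.top hj.1.1) (r.iso j.bot hj.1.2) (r.iso i.top hi.1.1)
    (r.iso i.bot hi.1.2) (F.selfGluing.iso hj.1.1.1 hq.1.1 hp.1.1 hi.1.1.1 β.top)
    (F.selfGluing.iso hj.1.2.1 hq.1.2 hp.1.2 hi.1.2.1 β.bot) x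
    (xU.trans (congrArg (· ≫ _) (F.selfGluing_iso_inv _ _ _ _ _).symm))
    (xL.trans (congrArg (· ≫ _) (F.selfGluing_iso_inv _ _ _ _ _).symm))
    ((diagGluing_iff r hj.1.1 X.mem Y.mem hj.1.2 j.sq _).2 rfl).symm
    ((diagGluing_iff r hi.1.1 Z.mem W.mem hi.1.2 i.sq _).2 rfl).symm

end Arr

end

namespace Arr

variable {C : Type u} [Bicategory.{w, v} C] [IsLocallyGroupoid C] {P Q B J : WideSub C}
  {D : Type u'} [Bicategory.{w', v'} D] {F₀ : C → D} {F : PsFun B F₀} {H : PsFun J F₀}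

lemma factors_fold_right (h : Squaring J (J ⊓ B)) :
    Factors (fold B J) (cart J (B ⊓ J)) (square J (B ⊓ J)) := by
  rintro p q f ⟨hf, hf'⟩
  obtain ⟨X, a, k, r, β, γ, δ, hk, hr, ha, hβ, e⟩ := h (inv f.sq) q.mem p.mem hf'.symm hf.symm
  refine ⟨⟨k, hk⟩, ⟨(ρ_ _).hom ≫ inv δ⟩, ⟨inv β⟩, ⟨⟨ha.2.symm, (B ⊓ J).id_mem _⟩, ⟨_, .refl _⟩⟩,
    ⟨⟨hr.symm, hf'⟩, hβ.flip⟩, ⟨isoMk (asIso γ) (λ_ _).symm ?_⟩⟩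
  have e' : f.sq ≫ γ ▷ q.hom = inv (precompSquare a β ≫ δ ▷ f.bot) := by
    refine IsIso.eq_inv_of_inv_hom_id ?_
    rw [Category.assoc, show γ ▷ q.hom ≫ precompSquare a β ≫ δ ▷ f.bot = _ from e.symm,
      IsIso.hom_inv_id]
  rw [Cyl, asIso_hom, e']
  simp [precompSquare, hpaste]

section

variable {hP : P ≤ B} {hQ : Q ≤ B} {GP : Gluing (F.restrict hP) H} {GQ : Gluing (F.restrict hQ) H}
  {T : SqTrans F H (cart_le_square B)}
  {r : PsIso (F.restrict (B.inf_le_left J)) (H.restrict (B.inf_le_right J))}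

lemma iso_eq_diagGluing
    (hr : ∀ {X Y : C} (a : X ⟶ Y) (ha : (P ⊓ J).mem a),
      r.iso a ⟨hP _ ha.1, ha.2⟩ = GP.diagInf.iso a ha) {X Y Z W : C} {j : X ⟶ Y} {q : X ⟶ Z}
    {p : Y ⟶ W} {i : Z ⟶ W} (hj : (P ⊓ J).mem j) (hq : J.mem q) (hp : J.mem p)
    (hi : (P ⊓ J).mem i) (κ : q ≫ i ⟶ j ≫ p) :
    (GP.iso hj.1 hq hp hi.1 κ).hom =
      ((diagGluing r).iso ⟨hP _ hj.1, hj.2⟩ hq hp ⟨hP _ hi.1, hi.2⟩ κ).hom := by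
  refine (diagGluing_iff r _ hq hp _ κ _).1 ?_
  rw [hr j hj, hr i hi]
  exact GP.iso_diagInf hj hq hp hi κ

lemma squareTrans_eq_diagGluing (E : ExtensionConditions P Q B J)
    (hTP : ∀ {p q : Arr J} (f : p ⟶ q) (hf : (cart J P).mem f),
        T.sq f (cart_mono hP _ hf) = (GP.iso hf.1.1 p.mem q.mem hf.1.2 f.sq).hom)
    (hTQ : ∀ {p q : Arr J} (f : p ⟶ q) (hf : (cart J Q).mem f),
        T.sq f (cart_mono hQ _ hf) = (GQ.iso hf.1.1 p.mem q.mem hf.1.2 f.sq).hom)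
    (hrP : ∀ {X Y : C} (a : X ⟶ Y) (ha : (P ⊓ J).mem a),
      r.iso a ⟨hP _ ha.1, ha.2⟩ = GP.diagInf.iso a ha)
    (hrQ : ∀ {X Y : C} (a : X ⟶ Y) (ha : (Q ⊓ J).mem a),
      r.iso a ⟨hQ _ ha.1, ha.2⟩ = GQ.diagInf.iso a ha)
    {U : SqTrans F H (S := square J B) (fun _ _ _ h => h)}
    (hUT : ∀ {p q : Arr J} (f : p ⟶ q) (hf : (cart J B).mem f), U.sq f hf.1 = T.sq f hf)
    (hUr : ∀ {p q : Arr J} (f : p ⟶ q) (hf : (fold B J).mem f),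
        U.sq f (fold_le _ hf) = ((diagGluing r).iso hf.1.1 p.mem q.mem hf.1.2 f.sq).hom)
    {p q : Arr J} (f : p ⟶ q) (hf : (square J (B ⊓ J)).mem f) :
    U.sq f (square_mono (B.inf_le_left J) _ hf) =
      ((diagGluing r).iso hf.1 p.mem q.mem hf.2 f.sq).hom := by
  have h₁ : (T.restrict (cart_mono (B.inf_le_left J)) : PsTrans
      (((topPs J F).restrict (cart_le_square B)).restrict (cart_mono (B.inf_le_left J)))
      (((botPs J F).restrict (cart_le_square B)).restrict (cart_mono (B.inf_le_left J))) _) =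
      (glueTrans (diagGluing r)).restrict (cart_le_square _) :=
    PsTrans.ext_of_factors (cart_mono (WideSub.inf_le_inf_right J hP))
      (cart_mono (WideSub.inf_le_inf_right J hQ))
      (factors_cart E.facJ (fun p i hp hi => E.exists_baseChange p i hp hi.1) E.stPJ E.stQJ)
      (PsTrans.ext_nat fun f hf => (hTP f ⟨⟨hf.1.1.1, hf.1.2.1⟩, hf.2⟩).trans
        (iso_eq_diagGluing hrP hf.1.1 _ _ hf.1.2 f.sq))
      (PsTrans.ext_nat fun f hf => (hTQ f ⟨⟨hf.1.1.1, hf.1.2.1⟩, hf.2⟩).trans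
        (iso_eq_diagGluing hrQ hf.1.1 _ _ hf.1.2 f.sq))
  have h₂ : (U.restrict (square_mono (B.inf_le_left J)) : PsTrans
      ((topPs J F).restrict (square_mono (B.inf_le_left J)))
      ((botPs J F).restrict (square_mono (B.inf_le_left J))) _) = glueTrans (diagGluing r) :=
    PsTrans.ext_of_factors fold_le_square (cart_le_square _) (factors_fold_right E.sqJ)
      (PsTrans.ext_nat fun f hf => hUr f hf)
      (PsTrans.ext_nat fun f hf => (hUT f (cart_mono (B.inf_le_left J) _ hf)).trans
        (congrArg (fun t => PsTrans.sq t f hf) h₁))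
  exact congrArg (fun t => PsTrans.sq t f hf) h₂

lemma squareTrans_vComp (h : Squaring B J) {U : SqTrans F H (S := square J B) (fun _ _ _ h => h)}
    (hU : ∀ {p q : Arr J} (f : p ⟶ q) (hf : (square J (B ⊓ J)).mem f),
      U.sq f (square_mono (B.inf_le_left J) _ hf) =
        ((diagGluing r).iso hf.1 p.mem q.mem hf.2 f.sq).hom)
    (hUT : ∀ {p q : Arr J} (f : p ⟶ q) (hf : (cart J B).mem f), U.sq f hf.1 = T.sq f hf)
    (hT : ∀ {X Y X' Y' X'' Y'' : C} {x : X ⟶ X'} {y : Y ⟶ Y'} {x' : X' ⟶ X''} {y' : Y' ⟶ Y''}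
      {f : X ⟶ Y} {f' : X' ⟶ Y'} {f'' : X'' ⟶ Y''} (α : x ≫ f' ⟶ f ≫ y)
      (α' : x' ≫ f'' ⟶ f' ≫ y'), T.VComp α α')
    {X Y X' Y' X'' Y'' : C} {x : X ⟶ X'} {y : Y ⟶ Y'} {x' : X' ⟶ X''} {y' : Y' ⟶ Y''}
    {f : X ⟶ Y} {f' : X' ⟶ Y'} {f'' : X'' ⟶ Y''} (α : x ≫ f' ⟶ f ≫ y)
    (α' : x' ≫ f'' ⟶ f' ≫ y') : SqTrans.VComp U α α' := by
  intro hx hy hx' hy' hα hα' hv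
  obtain ⟨V, g, k, ρ, β', γ, δ, hk, hρ, hg, hβ', e'⟩ := h α' hα'.2 hα'.1 hy' hx'
  obtain ⟨V₁, g₁, k₁, s, β, γ₁, δ₁, hk₁, hs, hg₁, hβ, e⟩ :=
    h ((α_ x g k).hom ≫ x ◁ δ ≫ α) hk hα.1 hy (J.comp_mem hx hg.2)
  have c : Cyl α (hpaste γ₁ β) (inv δ) (inv δ₁) := by
    have e₁ : α = x ◁ inv δ ≫ (α_ x g k).inv ≫ pasteTriangles γ₁ β δ₁ := by
      rw [← e]
      simp [← whiskerLeft_comp_assoc]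
    rw [Cyl, e₁]
    simp [pasteTriangles, precompSquare, hpaste, ← comp_whiskerRight]
  have c' : Cyl α' (hpaste ((ρ_ x').hom ≫ γ) β') (λ_ f'').inv (inv δ) := by
    rw [Cyl, e']
    simp [pasteTriangles, precompSquare, hpaste, ← comp_whiskerRight, ← comp_whiskerRight_assoc]
  have hid := (B ⊓ J).id_mem X''
  refine SqTrans.VComp.of_cyl U c c' (fun hx hs hx' hρ m m' m'' => ?_)
    (fun hs hy hρ hy' m m' m'' => ?_) (hx := hx) (hx' := hx') (hy := hs) (hy' := hρ) (hz := hy)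
    (hz' := hy') ⟨hg₁.1, hg.1⟩ ⟨hg.1, hid.1⟩ ⟨hg₁.1, hid.1⟩ ⟨hk₁, hk⟩ ⟨hk, hα'.2⟩ ⟨hk₁, hα'.2⟩
    hx hy hx' hy' hα hα' hv
  · refine (hU (p := ⟨_, _⟩) (q := ⟨_, _⟩) (Hom.mk _) ⟨hg₁, hid⟩).trans
      (((diagGluing r).ax_b hg₁ hg hid hx hs hx' hρ _ _).trans ?_)
    exact congrArg₂ (vCell F H) (hU (p := ⟨x, hx⟩) (q := ⟨s, hs⟩) (Hom.mk γ₁) ⟨hg₁, hg⟩).symm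
      (hU (p := ⟨x', hx'⟩) (q := ⟨ρ, hρ⟩) (Hom.mk ((ρ_ x').hom ≫ γ)) ⟨hg, hid⟩).symm
  · refine (hUT (p := ⟨_, _⟩) (q := ⟨_, _⟩) (Hom.mk _) ⟨m'', hβ.vpaste hβ'⟩).trans
      ((hT β β' hs hy hρ hy' ⟨m, hβ⟩ ⟨m', hβ'⟩ ⟨m'', hβ.vpaste hβ'⟩).trans ?_)
    exact congrArg₂ (vCell F H) (hUT (p := ⟨s, hs⟩) (q := ⟨y, hy⟩) (Hom.mk β) ⟨m, hβ⟩).symm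
      (hUT (p := ⟨ρ, hρ⟩) (q := ⟨y', hy'⟩) (Hom.mk β') ⟨m', hβ'⟩).symm

lemma squareTrans_eq_iso (h : Squaring P J)
    (hr : ∀ {X Y : C} (a : X ⟶ Y) (ha : (P ⊓ J).mem a),
      r.iso a ⟨hP _ ha.1, ha.2⟩ = GP.diagInf.iso a ha)
    {U : SqTrans F H (S := square J B) (fun _ _ _ h => h)}
    (hU : ∀ {p q : Arr J} (f : p ⟶ q) (hf : (fold B J).mem f),
        U.sq f (fold_le _ hf) = ((diagGluing r).iso hf.1.1 p.mem q.mem hf.1.2 f.sq).hom)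
    (hUP : ∀ {p q : Arr J} (f : p ⟶ q) (hf : (cart J P).mem f),
      U.sq f (square_mono hP _ hf.1) = (GP.iso hf.1.1 p.mem q.mem hf.1.2 f.sq).hom)
    {p q : Arr J} (f : p ⟶ q) (hf : (square J P).mem f) :
    U.sq f (square_mono hP _ hf) = (GP.iso hf.1 p.mem q.mem hf.2 f.sq).hom := by
  have h₂ : (U.restrict (square_mono hP) : PsTrans ((topPs J F).restrict (square_mono hP))
      ((botPs J F).restrict (square_mono hP)) _) = glueTrans GP :=
    PsTrans.ext_of_factors fold_le (cart_le_square _) (factors_fold h)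
      (PsTrans.ext_nat fun f hf => (hU f ⟨⟨⟨hP _ hf.1.1.1, hf.1.1.2⟩,
        ⟨hP _ hf.1.2.1, hf.1.2.2⟩⟩, hf.2⟩).trans (iso_eq_diagGluing hr hf.1.1 _ _ hf.1.2 f.sq).symm)
      (PsTrans.ext_nat fun f hf => hUP f hf)
  exact congrArg (fun t => PsTrans.sq t f hf) h₂

end

end Arr

lemma eq_id_of_vpaste {E : Type u} [Bicategory.{w, v} E] {x y : E} {f : x ⟶ y} {h k : x ⟶ x}
    {h' k' : y ⟶ y} (m : h ≅ 𝟙 x) (m' : h' ≅ 𝟙 y) (c : k ≅ h ≫ h) (c' : k' ≅ h' ≫ h')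
    (e : h ≫ f ≅ f ≫ h')
    (H : (c.hom ≫ m.hom ▷ h ≫ (λ_ h).hom) ▷ f ≫ e.hom ≫
      f ◁ ((λ_ h').inv ≫ m'.inv ▷ h' ≫ c'.inv) =
      c.hom ▷ f ≫ vpaste e.hom e.hom ≫ f ◁ c'.inv) :
    e.hom = m.hom ▷ f ≫ (λ_ f).hom ≫ (ρ_ f).inv ≫ f ◁ m'.inv := by
  let u : f ⟶ f := (λ_ f).inv ≫ m.inv ▷ f ≫ e.hom ≫ f ◁ m'.hom ≫ (ρ_ f).hom
  have he : e.hom = m.hom ▷ f ≫ (λ_ f).hom ≫ u ≫ (ρ_ f).inv ≫ f ◁ m'.inv := by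
    simp [u, ← whiskerLeft_comp, ← comp_whiskerRight_assoc]
  have hu : u ≫ u = u := by
    have H' : (m.hom ▷ h ≫ (λ_ h).hom) ▷ f ≫ e.hom ≫ f ◁ ((λ_ h').inv ≫ m'.inv ▷ h') =
        vpaste e.hom e.hom := by
      rw [← cancel_epi (whiskerRightIso c f).hom, ← cancel_mono (whiskerLeftIso f c').inv]
      simpa using H
    have e₁ : vpaste e.hom e.hom = ((m.hom ▷ h ≫ (λ_ h).hom) ▷ f ≫ m.hom ▷ f ≫ (λ_ f).hom) ≫
        (u ≫ u) ≫ (ρ_ f).inv ≫ f ◁ m'.inv ≫ f ◁ ((λ_ h').inv ≫ m'.inv ▷ h') := by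
      rw [he]
      dsimp only [vpaste]
      calc _ = 𝟙 _ ⊗≫ h ◁ m.hom ▷ f ⊗≫ h ◁ u ⊗≫ ((h ≫ f) ◁ m'.inv ≫
            (m.hom ▷ f ≫ (λ_ f).hom ≫ u ≫ (ρ_ f).inv ≫ f ◁ m'.inv) ▷ h') ⊗≫ 𝟙 _ := by bicategory
        _ = 𝟙 _ ⊗≫ h ◁ m.hom ▷ f ⊗≫ (h ◁ u ≫ m.hom ▷ f) ⊗≫ u ⊗≫
            f ◁ (m'.inv ▷ 𝟙 y ≫ h' ◁ m'.inv) ⊗≫ 𝟙 _ := by rw [whisker_exchange]; bicategory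
        _ = 𝟙 _ ⊗≫ (h ◁ m.hom ≫ m.hom ▷ 𝟙 x) ▷ f ⊗≫ u ⊗≫ u ⊗≫
            f ◁ (𝟙 y ◁ m'.inv ≫ m'.inv ▷ h') ⊗≫ 𝟙 _ := by
          rw [whisker_exchange m.hom, ← whisker_exchange m'.inv]; bicategory
        _ = _ := by rw [whisker_exchange m.hom]; bicategory
    have e₂ := H'.trans e₁
    rw [he] at e₂
    rw [← cancel_epi ((m.hom ▷ h ≫ (λ_ h).hom) ▷ f ≫ m.hom ▷ f ≫ (λ_ f).hom),
      ← cancel_mono ((ρ_ f).inv ≫ f ◁ m'.inv ≫ f ◁ ((λ_ h').inv ≫ m'.inv ▷ h'))]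
    simpa only [Category.assoc] using e₂.symm
  have : IsIso u := by
    dsimp only [u]
    infer_instance
  have hu' : u = 𝟙 f := by rwa [← cancel_epi u, Category.comp_id]
  rw [he, hu', Category.id_comp]

lemma eq_of_cyl_id {E : Type u} [Bicategory.{w, v} E] {x y : E} {i j : x ⟶ y} {h : x ⟶ x}
    {h' : y ⟶ y} {m : h ≅ 𝟙 x} {m' : h' ≅ 𝟙 y} {η : i ⟶ j} {ι : j ⟶ j} {e' : h ≫ i ⟶ j ≫ h'}
    {e : h ≫ j ⟶ j ≫ h'} (hι : ι = 𝟙 j)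
    (he : e = m.hom ▷ j ≫ (λ_ j).hom ≫ (ρ_ j).inv ≫ j ◁ m'.inv) (H : Cyl e' e η ι) :
    e' = m.hom ▷ i ≫ (λ_ i).hom ≫ η ≫ (ρ_ j).inv ≫ j ◁ m'.inv := by
  rw [Cyl, hι, he, whisker_exchange_assoc] at H
  simpa using H

lemma eq_comp_whiskerRight {E : Type u} [Bicategory.{w, v} E] {X Y Z : E} {f g : X ⟶ Y}
    {k : Y ⟶ Z} {l : X ⟶ Z} {t : X ⟶ Z} {x : l ⟶ f ≫ k} {y : l ⟶ t} {z : t ⟶ g ≫ k} (e : f ≅ g)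
    (h : x ≫ e.hom ▷ k = y ≫ z) : x = y ≫ z ≫ e.inv ▷ k := by
  rw [← Category.assoc, ← h]
  simp [← comp_whiskerRight]

namespace Arr

variable {C : Type u} [Bicategory.{w, v} C] [IsLocallyGroupoid C] {P Q B J : WideSub C}
  {D : Type u'} [Bicategory.{w', v'} D] {F₀ : C → D} {F : PsFun B F₀} {H : PsFun J F₀}

/-- The gluing datum given by a pseudonatural transformation on squares. -/
@[simps iso]
def SqTrans.toGluing (U : SqTrans F H (S := square J B) (fun _ _ _ h => h)) (hid : U.IdComp)
    (hv : ∀ {X Y X' Y' X'' Y'' : C} {x : X ⟶ X'} {y : Y ⟶ Y'} {x' : X' ⟶ X''} {y' : Y' ⟶ Y''}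
      {f : X ⟶ Y} {f' : X' ⟶ Y'} {f'' : X'' ⟶ Y''} (α : x ≫ f' ⟶ f ≫ y)
      (α' : x' ≫ f'' ⟶ f' ≫ y'), U.VComp α α') : Gluing F H where
  iso {X Y Z W j q p i} hj hq hp hi α :=
    (U.nat (X := ⟨q, hq⟩) (Y := ⟨p, hp⟩) (Hom.mk α) ⟨hj, hi⟩).symm
  ax_a {X Y i j} hi hj α := by
    have h := hv (idSquare j) (idSquare j) (J.id_mem X) (J.id_mem Y) (J.id_mem X) (J.id_mem Y)
      ⟨hj, hj⟩ ⟨hj, hj⟩ ⟨hj, hj⟩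
    have h₁ : vpaste (idSquare j) (idSquare j) =
        (λ_ (𝟙 X)).hom ▷ j ≫ idSquare j ≫ j ◁ (λ_ (𝟙 Y)).inv := by
      dsimp only [vpaste, idSquare]
      bicategory
    have h₂ : U.cell (hq := J.comp_mem (J.id_mem X) (J.id_mem X)) (hp := J.comp_mem (J.id_mem Y) (J.id_mem Y)) (α := (λ_ (𝟙 X)).hom ▷ j ≫ idSquare j ≫ j ◁ (λ_ (𝟙 Y)).inv) ⟨hj, hj⟩ = _ := (U.cell_congr h₁.symm _ ⟨hj, hj⟩).trans h
    have i₁ : U.cell (hq := J.comp_mem (J.id_mem X) (J.id_mem X)) (hp := J.comp_mem (J.id_mem Y) (J.id_mem Y)) (α := (λ_ (𝟙 X)).hom ▷ j ≫ idSquare j ≫ j ◁ (λ_ (𝟙 Y)).inv) ⟨hj, hj⟩ = _ := hid.cell_left (λ_ (𝟙 X)).hom (hq := J.id_mem X) (hq' := J.comp_mem (J.id_mem X) (J.id_mem X))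
      (hp := J.comp_mem (J.id_mem Y) (J.id_mem Y))
      (α := idSquare j ≫ j ◁ (λ_ (𝟙 Y)).inv) ⟨hj, hj⟩ ⟨B.id_mem _, B.id_mem _⟩ ⟨hj, hj⟩
    have i₂ := hid.cell_right (λ_ (𝟙 Y)).inv (hq := J.id_mem X) (hp := J.id_mem Y)
      (hp' := J.comp_mem (J.id_mem Y) (J.id_mem Y)) (α := idSquare j) ⟨hj, hj⟩
      ⟨B.id_mem _, B.id_mem _⟩ ⟨hj, hj⟩
    rw [i₂, H.map₂_leftUnitor, H.map₂_leftUnitor_inv] at i₁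
    have key := eq_id_of_vpaste (H.mapId X) (H.mapId Y) (H.mapComp _ _ _ _) (H.mapComp _ _ _ _)
      (U.nat (X := ⟨𝟙 X, J.id_mem X⟩) (Y := ⟨𝟙 Y, J.id_mem Y⟩) (Hom.mk (idSquare j)) ⟨hj, hj⟩).symm
      (i₁.symm.trans h₂)
    have c := U.cyl_map₂ (X := ⟨𝟙 X, J.id_mem X⟩) (Y := ⟨𝟙 Y, J.id_mem Y⟩)
      (f := Hom.mk ((λ_ i).hom ≫ α ≫ (ρ_ j).inv)) (g := Hom.mk (idSquare j)) ⟨hj, hi⟩ ⟨hj, hj⟩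
      (Hom₂.mk (𝟙 j) α (by simp [Cyl]))
    exact eq_of_cyl_id (F.map₂_id j hj) key c
  ax_a' hq hp α := hid hq hp α ⟨B.id_mem _, B.id_mem _⟩
  ax_b h₁ h₂ h₃ hq hp hq' hp' α α' := hv α α' hq hp hq' hp' ⟨h₁, h₂⟩ ⟨h₂, h₃⟩ ⟨h₁, h₃⟩
  ax_b' {X₁ X₂ X₃ Y₁ Y₂ Y₃ p₁ p₂ p₃ j i j' i'} h₁ h₂ h₃ hj hi hj' hi' α α' := by
    have c := U.cyl_mapComp (X := ⟨p₁, h₁⟩) (Y := ⟨p₂, h₂⟩) (Z := ⟨p₃, h₃⟩) (Hom.mk α) (Hom.mk α')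
      ⟨hj, hi⟩ ⟨hj', hi'⟩
    exact eq_comp_whiskerRight (F.mapComp j j' hj hj') c

end Arr

/-- Gluing data on `P` and `J` and on `Q` and `J` extend to `B` and `J`. -/
theorem exists_gluing {C : Type u} [Bicategory.{w, v} C] [IsLocallyGroupoid C] {P Q B J : WideSub C}
    {D : Type u'} [Bicategory.{w', v'} D] {F₀ : C → D} {F : PsFun B F₀} {H : PsFun J F₀}
    {hP : P ≤ B} {hQ : Q ≤ B} {GP : Gluing (F.restrict hP) H} {GQ : Gluing (F.restrict hQ) H}
    (hc : CubesCommute F GP GQ) (E : ExtensionConditions P Q B J) :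
    ∃ G : Gluing F H,
      (∀ {X Y Z W : C} {j : X ⟶ Y} {q : X ⟶ Z} {p : Y ⟶ W} {i : Z ⟶ W} (hj : P.mem j)
        (hq : J.mem q) (hp : J.mem p) (hi : P.mem i) (α : q ≫ i ⟶ j ≫ p),
        (G.iso (hP _ hj) hq hp (hP _ hi) α).hom = (GP.iso hj hq hp hi α).hom) ∧
      ∀ {X Y Z W : C} {j : X ⟶ Y} {q : X ⟶ Z} {p : Y ⟶ W} {i : Z ⟶ W} (hj : Q.mem j)
        (hq : J.mem q) (hp : J.mem p) (hi : Q.mem i) (α : q ≫ i ⟶ j ≫ p),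
        (G.iso (hQ _ hj) hq hp (hQ _ hi) α).hom = (GQ.iso hj hq hp hi α).hom := by
  obtain ⟨r, hrP, hrQ⟩ := hc.exists_diag E
  obtain ⟨T, hTP, hTQ⟩ := Arr.exists_cartTrans hc E
  obtain ⟨U, hUT, hUr⟩ := Arr.exists_squareTrans hc E hTP hTQ hrP hrQ
  have hU := fun {p q : Arr J} (f : p ⟶ q) hf =>
    Arr.squareTrans_eq_diagGluing E hTP hTQ hrP hrQ hUT hUr f hf
  refine ⟨Arr.SqTrans.toGluing U (fun {X Y q p} hq hp κ hκ => ?_)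
    (fun α α' => Arr.squareTrans_vComp E.sq hU hUT (Arr.cartTrans_vComp E hTP hTQ) α α'),
    fun {X Y Z W j q p i} hj hq hp hi α => ?_, fun {X Y Z W j q p i} hj hq hp hi α => ?_⟩
  · exact (hUT (p := ⟨q, hq⟩) (q := ⟨p, hp⟩) (Arr.Hom.mk ((ρ_ q).hom ≫ κ ≫ (λ_ p).inv))
      ⟨hκ, .horizontal_id κ⟩).trans
      (Arr.cartTrans_idComp hTP hq hp κ ⟨hκ, .horizontal_id κ⟩)
  · exact Arr.squareTrans_eq_iso E.sqP hrP hUr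
      (fun f hf => (hUT f (Arr.cart_mono hP _ hf)).trans (hTP f hf)) (p := ⟨q, hq⟩) (q := ⟨p, hp⟩)
      (Arr.Hom.mk α) ⟨hj, hi⟩
  · exact Arr.squareTrans_eq_iso E.sqQ hrQ hUr
      (fun f hf => (hUT f (Arr.cart_mono hQ _ hf)).trans (hTQ f hf)) (p := ⟨q, hq⟩) (q := ⟨p, hp⟩)
      (Arr.Hom.mk α) ⟨hj, hi⟩

lemma CubeCommutes.flip {D : Type u'} [Bicategory.{w', v'} D] {X' Y' Z' W' X Y Z W : D} {a : Z ⟶ W}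
    {b : X ⟶ Y} {a' : Z' ⟶ W'} {b' : X' ⟶ Y'} {p : Y ⟶ W} {q : X ⟶ Z} {p' : Y' ⟶ W'}
    {q' : X' ⟶ Z'} {x : X' ⟶ X} {y : Y' ⟶ Y} {z : Z' ⟶ Z} {w : W' ⟶ W} {I' : x ≫ q ⟶ q' ≫ z}
    {J : z ≫ a ⟶ a' ≫ w} {J' : x ≫ b ⟶ b' ≫ y} {I : y ≫ p ⟶ p' ≫ w} {K' : q' ≫ a' ⟶ b' ≫ p'}
    {K : q ≫ a ⟶ b ≫ p} {L : p' ≫ w ⟶ y ≫ p} {L' : q' ≫ z ⟶ x ≫ q}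
    (h : CubeCommutes I' J K' K J' I) (e : I ≫ L = 𝟙 _) (e' : L' ≫ I' = 𝟙 _) :
    CubeCommutes L' K J' J K' L := by
  dsimp only [CubeCommutes, hpaste] at *
  calc _ = 𝟙 _ ⊗≫ L' ▷ a ⊗≫ x ◁ K ⊗≫ J' ▷ p ⊗≫ b' ◁ (𝟙 (y ≫ p)) ⊗≫ 𝟙 _ := by bicategory
    _ = 𝟙 _ ⊗≫ L' ▷ a ⊗≫ (x ◁ K ≫ (α_ x b p).inv ≫ J' ▷ p ≫ (α_ b' y p).hom ≫ b' ◁ I ≫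
        (α_ b' p' w).inv) ⊗≫ b' ◁ L ⊗≫ 𝟙 _ := by rw [← e]; bicategory
    _ = 𝟙 _ ⊗≫ (L' ≫ I') ▷ a ⊗≫ q' ◁ J ⊗≫ K' ▷ w ⊗≫ b' ◁ L ⊗≫ 𝟙 _ := by
        rw [← h]; bicategory
    _ = _ := by rw [e']; bicategory

lemma lift_filler {E : Type u} [Bicategory.{w, v} E] {T T' X X' Y Y' Z Z' W W' : E} {t : T' ⟶ T}
    {x : X' ⟶ X} {y : Y' ⟶ Y} {z : Z' ⟶ Z} {w : W' ⟶ W} {h : T ⟶ X} {h' : T' ⟶ X'} {q : X ⟶ Z}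
    {q' : X' ⟶ Z'} {j : X ⟶ Y} {j' : X' ⟶ Y'} {p : Y ⟶ W} {p' : Y' ⟶ W'} {i : Z ⟶ W}
    {i' : Z' ⟶ W'} {v : T ⟶ Z} {v' : T' ⟶ Z'} {u : T ⟶ Y} {u' : T' ⟶ Y'}
    {sq : x ≫ q ≅ q' ≫ z} {sj : x ≫ j ≅ j' ≫ y} {si : z ≫ i ⟶ i' ≫ w} {sp : y ≫ p ≅ p' ≫ w}
    {sv : t ≫ v ⟶ v' ≫ z} {su : t ≫ u ⟶ u' ≫ y} {β : q ≫ i ⟶ j ≫ p} {β' : q' ≫ i' ⟶ j' ≫ p'}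
    {θ : v ≫ i ⟶ u ≫ p} {θ' : v' ≫ i' ⟶ u' ≫ p'} {γ : h ≫ q ⟶ v} {δ : h ≫ j ⟶ u}
    {γ' : h' ≫ q' ≅ v'} {δ' : h' ≫ j' ≅ u'}
    (hβ : hpaste sq.hom si ≫ β' ▷ w = x ◁ β ≫ hpaste sj.hom sp.hom)
    (hθ : hpaste sv si ≫ θ' ▷ w = t ◁ θ ≫ hpaste su sp.hom)
    (e' : precompSquare h' β' ≫ δ'.hom ▷ p' = γ'.hom ▷ i' ≫ θ')
    (e : precompSquare h β ≫ δ ▷ p = γ ▷ i ≫ θ) :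
    ((α_ _ _ _).hom ≫ t ◁ γ ≫ sv ≫ γ'.inv ▷ z ≫ (α_ _ _ _).hom ≫ h' ◁ sq.inv ≫
      (α_ _ _ _).inv) ▷ i ≫ precompSquare (h' ≫ x) β =
    precompSquare (t ≫ h) β ≫ ((α_ _ _ _).hom ≫ t ◁ δ ≫ su ≫ δ'.inv ▷ y ≫ (α_ _ _ _).hom ≫
      h' ◁ sj.inv ≫ (α_ _ _ _).inv) ▷ p := by
  have e₁ : γ'.inv ▷ i' ≫ precompSquare h' β' = θ' ≫ δ'.inv ▷ p' := by
    rw [← cancel_epi (whiskerRightIso γ' i').hom, ← cancel_mono (whiskerRightIso δ' p').hom]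
    simp [← e', ← comp_whiskerRight_assoc, ← comp_whiskerRight]
  have h₁ : sq.inv ▷ i ≫ (α_ _ _ _).hom ≫ x ◁ β ≫ (α_ _ _ _).inv ≫ sj.hom ▷ p ≫ (α_ _ _ _).hom ≫
      j' ◁ sp.hom = (α_ _ _ _).hom ≫ q' ◁ si ≫ (α_ _ _ _).inv ≫ β' ▷ w ≫ (α_ _ _ _).hom := by
    dsimp only [hpaste] at hβ
    rw [← cancel_mono (α_ j' p' w).inv]
    simp only [Category.assoc]
    rw [← hβ]
    simp [← comp_whiskerRight_assoc]
  have h₂ : sv ▷ i ≫ (α_ _ _ _).hom ≫ v' ◁ si ≫ (α_ _ _ _).inv ≫ θ' ▷ w =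
      (α_ _ _ _).hom ≫ t ◁ θ ≫ (α_ _ _ _).inv ≫ su ▷ p ≫ (α_ _ _ _).hom ≫ u' ◁ sp.hom ≫
        (α_ _ _ _).inv := by
    dsimp only [hpaste] at hθ
    rw [← cancel_epi (α_ t v i).inv]
    simpa using hθ
  refine (cancel_mono (whiskerRightIso (α_ h' x j ≪≫ whiskerLeftIso h' sj ≪≫
    (α_ h' j' y).symm) p ≪≫ α_ (h' ≫ j') y p ≪≫ whiskerLeftIso (h' ≫ j') sp).hom).1 ?_
  dsimp only [precompSquare, Iso.trans_hom, Iso.symm_hom,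
    Bicategory.whiskerRightIso, Bicategory.whiskerLeftIso] at *
  calc _ = 𝟙 _ ⊗≫ t ◁ γ ▷ i ⊗≫ sv ▷ i ⊗≫ γ'.inv ▷ z ▷ i ⊗≫ h' ◁ (sq.inv ▷ i ≫ (α_ _ _ _).hom ≫
        x ◁ β ≫ (α_ _ _ _).inv ≫ sj.hom ▷ p ≫ (α_ _ _ _).hom ≫ j' ◁ sp.hom) ⊗≫ 𝟙 _ := by
        bicategory
    _ = 𝟙 _ ⊗≫ t ◁ γ ▷ i ⊗≫ sv ▷ i ⊗≫ (γ'.inv ▷ (z ≫ i) ≫ (h' ≫ q') ◁ si) ⊗≫ h' ◁ β' ▷ w ⊗≫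
        𝟙 _ := by rw [h₁]; bicategory
    _ = 𝟙 _ ⊗≫ t ◁ γ ▷ i ⊗≫ sv ▷ i ⊗≫ v' ◁ si ⊗≫ (γ'.inv ▷ i' ≫ (α_ _ _ _).hom ≫ h' ◁ β' ≫
        (α_ _ _ _).inv) ▷ w ⊗≫ 𝟙 _ := by rw [← whisker_exchange]; bicategory
    _ = 𝟙 _ ⊗≫ t ◁ γ ▷ i ⊗≫ (sv ▷ i ≫ (α_ _ _ _).hom ≫ v' ◁ si ≫ (α_ _ _ _).inv ≫ θ' ▷ w) ⊗≫
        δ'.inv ▷ p' ▷ w ⊗≫ 𝟙 _ := by rw [e₁]; bicategory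
    _ = 𝟙 _ ⊗≫ t ◁ (γ ▷ i ≫ θ) ⊗≫ su ▷ p ⊗≫ (u' ◁ sp.hom ≫ δ'.inv ▷ (p' ≫ w)) ⊗≫ 𝟙 _ := by
        rw [h₂]; bicategory
    _ = 𝟙 _ ⊗≫ t ◁ h ◁ β ⊗≫ t ◁ δ ▷ p ⊗≫ su ▷ p ⊗≫ δ'.inv ▷ (y ≫ p) ⊗≫ h' ◁ (𝟙 (j' ≫ y)) ▷ p ⊗≫
        (h' ≫ j') ◁ sp.hom ⊗≫ 𝟙 _ := by rw [← e, whisker_exchange]; bicategory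
    _ = _ := by rw [← sj.inv_hom_id]; bicategory

lemma cyl_cancel {E : Type u} [Bicategory.{w, v} E] {T T' X X' Z Z' : E} {t : T' ⟶ T}
    {x : X' ⟶ X} {z : Z' ⟶ Z} {h k : T ⟶ X} {h' k' : T' ⟶ X'} {q : X ⟶ Z} {q' : X' ⟶ Z'}
    {sq : x ≫ q ⟶ q' ≫ z} [IsIso sq] {sh : t ≫ h ⟶ h' ≫ x} {sk : t ≫ k ⟶ k' ≫ x} {ξ : h ⟶ k}
    {ξ' : h' ⟶ k'} (e : Cyl (hpaste sh sq) (hpaste sk sq) (ξ ▷ q) (ξ' ▷ q')) :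
    (sh ≫ ξ' ▷ x) ▷ q = (t ◁ ξ ≫ sk) ▷ q := by
  have h : t ◁ ξ ▷ q ≫ (α_ t k q).inv ≫ sk ▷ q ≫ (α_ k' x q).hom ≫ k' ◁ sq =
      (α_ t h q).inv ≫ sh ▷ q ≫ (α_ h' x q).hom ≫ (h' ◁ sq ≫ ξ' ▷ (q' ≫ z)) ≫
        𝟙 _ := by
    have e' := congrArg (· ≫ (α_ k' q' z).hom) e
    simpa [hpaste] using e'.symm
  rw [whisker_exchange] at h
  refine (cancel_epi (α_ t _ q).inv).1 ((cancel_mono (α_ k' x q ≪≫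
    whiskerLeftIso k' (asIso sq)).hom).1 ?_)
  simpa using h.symm

section

variable {C : Type u} [Bicategory.{w, v} C] [IsLocallyGroupoid C]

namespace Arr

variable {J : WideSub C}

/-- The face of a cube opposite to a 2-Cartesian face is determined by pasting. -/
lemma vpaste_sq {X Y Z W : Arr J} {j : X ⟶ Y} {q : X ⟶ Z} {p : Y ⟶ W} {i : Z ⟶ W}
    (β : q ≫ i ⟶ j ≫ p) :
    vpaste j.sq β.bot ≫ j.top ◁ p.sq = q.sq ▷ i.bot ≫ vpaste β.top i.sq := by
  have h := vpaste_of_hpaste (CubeCommutes.transpose β.cyl (L := inv β.bot) (L' := inv β.top)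
    (by simp) (by simp))
  simpa using h

lemma isTwoCartesian_sq {X Y Z W : Arr J} {j : X ⟶ Y} {q : X ⟶ Z} {p : Y ⟶ W} {i : Z ⟶ W}
    (β : q ≫ i ⟶ j ≫ p) (ht : IsTwoCartesian β.top) (hb : IsTwoCartesian β.bot)
    (hi : IsTwoCartesian i.sq) : IsTwoCartesian j.sq := by
  have h := (ht.vpaste hi).adjust q.sq (𝟙 _) (𝟙 _) (inv p.sq)
  have e := vpaste_sq β
  rw [whiskerLeft_id, Category.id_comp, id_whiskerRight, Category.id_comp, ← Category.assoc] at h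
  erw [← e] at h
  rw [Category.assoc, ← whiskerLeft_comp, IsIso.hom_inv_id, whiskerLeft_id, Category.comp_id] at h
  exact h.of_vpaste hb

lemma isTwoCartesian_of_top_bot {X Y Z W : Arr J} {j : X ⟶ Y} {q : X ⟶ Z} {p : Y ⟶ W} {i : Z ⟶ W}
    (β : q ≫ i ⟶ j ≫ p) (ht : IsTwoCartesian β.top) (hb : IsTwoCartesian β.bot) :
    IsTwoCartesian β := by
  refine .mk' (fun {T u v} θ => ?_) (fun {T h h'} φ ψ e => ?_) (fun {T h h'} ξ ξ' e e' => ?_)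
  · obtain ⟨h, γ, δ, e⟩ := ht.lift θ.top
    obtain ⟨h₀, γ₀, δ₀, e₀⟩ := hb.lift θ.bot
    obtain ⟨ξ, h₁, h₂⟩ := hb.full _ _ (lift_filler (sq := asIso q.sq) (sj := asIso j.sq)
      (sp := asIso p.sq) (γ' := asIso γ) (δ' := asIso δ) β.cyl θ.cyl e e₀)
    refine ⟨⟨ξ⟩, Hom₂.mk γ γ₀ ?_, Hom₂.mk δ δ₀ ?_, Hom₂.ext e e₀⟩
    · simp [Cyl, hpaste, h₁, ← comp_whiskerRight, ← whiskerLeft_comp]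
    · simp [Cyl, hpaste, h₂]
  · obtain ⟨ξ, h₁, h₂⟩ := ht.full φ.top ψ.top (congrArg Hom₂.top e)
    obtain ⟨ξ₀, h₁', h₂'⟩ := hb.full φ.bot ψ.bot (congrArg Hom₂.bot e)
    have c₁ := φ.cyl
    have c₂ := ψ.cyl
    rw [Cyl, comp_sq, comp_sq, ← h₁, ← h₁'] at c₁
    rw [Cyl, comp_sq, comp_sq, ← h₂, ← h₂'] at c₂
    exact ⟨Hom₂.mk ξ ξ₀ (hb.faithful _ _ (cyl_cancel c₁) (cyl_cancel c₂)), Hom₂.ext h₁ h₁',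
      Hom₂.ext h₂ h₂'⟩
  · exact Hom₂.ext (ht.faithful _ _ (congrArg Hom₂.top e) (congrArg Hom₂.top e'))
      (hb.faithful _ _ (congrArg Hom₂.bot e) (congrArg Hom₂.bot e'))

end Arr

end

section

variable {C : Type u} [Bicategory.{w, v} C] {D : Type u'} [Bicategory.{w', v'} D]
  {B I J : WideSub C} {F₀ : C → D} {F : PsFun B F₀} {H : PsFun I F₀} {K : PsFun J F₀}

variable (J) in
/-- The gluing datum on squares of squares given by the upper faces. -/
def Gluing.top (G : Gluing F H) : Gluing (Arr.topPs J F) (Arr.topPs J H) where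
  iso hj hq hp hi β := G.iso hj.1 hq.1 hp.1 hi.1 β.top
  ax_a hi hj α := G.ax_a hi.1 hj.1 α.top
  ax_a' hq hp α := G.ax_a' hq.1 hp.1 α.top
  ax_b h₁ h₂ h₃ hq hp hq' hp' α α' :=
    G.ax_b h₁.1 h₂.1 h₃.1 hq.1 hp.1 hq'.1 hp'.1 α.top α'.top
  ax_b' h₁ h₂ h₃ hj hi hj' hi' α α' :=
    G.ax_b' h₁.1 h₂.1 h₃.1 hj.1 hi.1 hj'.1 hi'.1 α.top α'.top

variable (J) in
/-- The gluing datum on squares of squares given by the lower faces. -/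
def Gluing.bot (G : Gluing F H) : Gluing (Arr.botPs J F) (Arr.botPs J H) where
  iso hj hq hp hi β := G.iso hj.2 hq.2 hp.2 hi.2 β.bot
  ax_a hi hj α := G.ax_a hi.2 hj.2 α.bot
  ax_a' hq hp α := G.ax_a' hq.2 hp.2 α.bot
  ax_b h₁ h₂ h₃ hq hp hq' hp' α α' :=
    G.ax_b h₁.2 h₂.2 h₃.2 hq.2 hp.2 hq'.2 hp'.2 α.bot α'.bot
  ax_b' h₁ h₂ h₃ hj hi hj' hi' α α' :=
    G.ax_b' h₁.2 h₂.2 h₃.2 hj.2 hi.2 hj'.2 hi'.2 α.bot α'.bot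

/-- The 2-cells that three gluing data attach to the faces of the cube `c` commute. -/
def Cube.Commutes (c : Cube B I J) (GI : Gluing F H) (GJ : Gluing F K) (G : Gluing H K) : Prop :=
  CubeCommutes (G.iso c.hq' c.hx c.hz c.hq c.I').hom (GJ.iso c.ha' c.hz c.hw c.ha c.J).hom
    (GI.iso c.hb' c.hq' c.hp' c.ha' c.K').hom (GI.iso c.hb c.hq c.hp c.ha c.K).hom
    (GJ.iso c.hb' c.hx c.hy c.hb c.J').hom (G.iso c.hp' c.hy c.hw c.hp c.I).hom

variable [IsLocallyGroupoid C]

/-- The cube obtained by exchanging the last two directions. -/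
@[simps]
noncomputable def Cube.flip (c : Cube B I J) : Cube B J I where
  ha := c.ha
  hb := c.ha'
  ha' := c.hb
  hb' := c.hb'
  hp := c.hw
  hq := c.hz
  hp' := c.hy
  hq' := c.hx
  hx := c.hq'
  hy := c.hp'
  hz := c.hq
  hw := c.hp
  I' := inv c.I'
  J := c.K
  K' := c.J'
  K := c.J
  J' := c.K'
  I := inv c.I
  comm := c.comm.flip (by simp) (by simp)

lemma Gluing.flip_iso_inv (G : Gluing F H) {X Y Z W : C} {j : X ⟶ Y} {q : X ⟶ Z} {p : Y ⟶ W}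
    {i : Z ⟶ W} (hj : I.mem j) (hq : B.mem q) (hp : B.mem p) (hi : I.mem i) (α : j ≫ p ⟶ q ≫ i) :
    G.flip.iso hj hq hp hi (inv α) = (G.iso hq hj hi hp α).symm := by
  simp [flip_iso]

lemma Cube.commutes_flip {c : Cube B I J} {GI : Gluing F H} {GJ : Gluing F K} {G : Gluing H K} :
    c.flip.Commutes GJ GI G.flip ↔ c.Commutes GI GJ G := by
  change CubeCommutes (G.flip.iso c.hx c.hq' c.hq c.hz (inv c.I')).hom
    (GI.iso c.hb c.hq c.hp c.ha c.K).hom (GJ.iso c.hb' c.hx c.hy c.hb c.J').hom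
    (GJ.iso c.ha' c.hz c.hw c.ha c.J).hom (GI.iso c.hb' c.hq' c.hp' c.ha' c.K').hom
    (G.flip.iso c.hy c.hp' c.hp c.hw (inv c.I)).hom ↔ _
  rw [G.flip_iso_inv, G.flip_iso_inv]
  exact ⟨fun h => h.flip (by simp) (by simp), fun h => CubeCommutes.flip h (by simp) (by simp)⟩

namespace Arr

/-- The cube that corresponds to a square of squares. -/
abbrev toCube {X Y Z W : Arr J} {j : X ⟶ Y} {q : X ⟶ Z} {p : Y ⟶ W} {i : Z ⟶ W}
    (hj : (square J B).mem j) (hq : (square J I).mem q) (hp : (square J I).mem p)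
    (hi : (square J B).mem i) (β : q ≫ i ⟶ j ≫ p) : Cube B I J where
  ha := hi.2
  hb := hj.2
  ha' := hi.1
  hb' := hj.1
  hp := hp.2
  hq := hq.2
  hp' := hp.1
  hq' := hq.1
  hx := X.mem
  hy := Y.mem
  hz := Z.mem
  hw := W.mem
  I' := q.sq
  J := i.sq
  K' := β.top
  K := β.bot
  J' := j.sq
  I := p.sq
  comm := β.cyl

/-- The cube that corresponds to a square of squares commutes. -/
abbrev Commutes (GI : Gluing F H) (GJ : Gluing F K) (G : Gluing H K) {X Y Z W : Arr J} {j : X ⟶ Y}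
    {q : X ⟶ Z} {p : Y ⟶ W} {i : Z ⟶ W} (β : q ≫ i ⟶ j ≫ p) : Prop :=
  Compat (glueTrans GJ) (glueTrans G) (GI.top J) (GI.bot J) β

lemma exists_decomposition (hc : ∀ c : Cube B I J, Nonempty (CubeDecomposition c)) {X Y Z W : Arr J}
    {j : X ⟶ Y} {q : X ⟶ Z} {p : Y ⟶ W} {i : Z ⟶ W} (hj : (square J B).mem j)
    (hq : (square J I).mem q) (hp : (square J I).mem p) (hi : (square J B).mem i)
    (β : q ≫ i ⟶ j ≫ p) :
    ∃ (V : Arr J) (f : X ⟶ V) (k : V ⟶ Y) (r : V ⟶ Z) (L : r ≫ i ⟶ k ≫ p) (γ : q ⟶ f ≫ r)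
      (δ : f ≫ k ⟶ j), (square J (B ⊓ I)).mem f ∧ (square J B).mem k ∧ (square J I).mem r ∧
        IsTwoCartesian L.top ∧ IsTwoCartesian L.bot ∧ β = pasteTriangles γ L δ := by
  obtain ⟨d⟩ := hc (toCube hj hq hp hi β)
  exact ⟨⟨d.v, d.mem_v⟩, ⟨d.M⟩, ⟨d.J''⟩, ⟨d.I''⟩, Hom₂.mk d.L' d.L d.inner, Hom₂.mk d.γ' d.γ d.left,
    Hom₂.mk d.δ' d.δ d.back.symm, ⟨d.mem_f', d.mem_f⟩, ⟨d.mem_k', d.mem_k⟩, ⟨d.mem_r', d.mem_r⟩,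
    d.cartesian', d.cartesian, Hom₂.ext d.top d.bottom⟩

end Arr

end

section

variable {C : Type u} [Bicategory.{w, v} C] [IsLocallyGroupoid C] {Q B I J : WideSub C}

lemma StableUnderBaseChange.mem_of_iso (h : StableUnderBaseChange I Q) {X Y : C} {f g : X ⟶ Y}
    (e : f ⟶ g) (hf : I.mem f) : I.mem g :=
  h _ (IsTwoCartesianIn.vertical_id e) hf (Q.id_mem Y)

/-- Two squares, one of which is 2-Cartesian, with the same lower and right edges. -/
lemma exists_comparison {X Y Z W X' : C} {j : X ⟶ Y} {q : X ⟶ Z} {p : Y ⟶ W} {i : Z ⟶ W}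
    {k : X' ⟶ Y} {r : X' ⟶ Z} {α : r ≫ i ⟶ k ≫ p} (hα : IsTwoCartesian α) (β : q ≫ i ⟶ j ≫ p) :
    ∃ (e : X ⟶ X') (γ : q ⟶ e ≫ r) (δ : e ≫ k ⟶ j), β = pasteTriangles γ α δ := by
  obtain ⟨e, γ, δ, h⟩ := hα.lift β
  exact ⟨e, inv γ, δ, by rw [pasteTriangles, h, ← comp_whiskerRight_assoc]; simp⟩

lemma hom_of_pasteTriangles_eq {X X' X'' Y Z W : C} {k : X' ⟶ Y} {r : X' ⟶ Z} {p : Y ⟶ W} {i : Z ⟶ W}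
    {β : r ≫ i ⟶ k ≫ p} (hβ : IsTwoCartesian β) {f : X ⟶ X''} {e : X'' ⟶ X'} {f' : X ⟶ X'}
    {r' : X'' ⟶ Z} {k' : X'' ⟶ Y} {γ : r' ⟶ e ≫ r} {δ : e ≫ k ⟶ k'} {q : X ⟶ Z} {j : X ⟶ Y}
    {γ₁ : q ⟶ f ≫ r'} {δ₁ : f ≫ k' ⟶ j} {γ₂ : q ⟶ f' ≫ r} {δ₂ : f' ≫ k ⟶ j}
    (h : pasteTriangles γ₁ (pasteTriangles γ β δ) δ₁ = pasteTriangles γ₂ β δ₂) :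
    Nonempty (f ≫ e ⟶ f') := by
  obtain ⟨ξ, -, -⟩ := hβ.full (h := f ≫ e) (h' := f') ((α_ _ _ _).hom ≫ f ◁ inv γ ≫ inv γ₁ ≫ γ₂)
    ((α_ _ _ _).hom ≫ f ◁ δ ≫ δ₁ ≫ inv δ₂) (by
      rw [← cancel_epi ((γ₁ ≫ f ◁ γ ≫ (α_ _ _ _).inv) ▷ i), ← cancel_mono (δ₂ ▷ p)]
      have e₁ : (γ₁ ≫ f ◁ γ ≫ (α_ _ _ _).inv) ▷ i ≫ ((α_ _ _ _).hom ≫ f ◁ inv γ ≫ inv γ₁ ≫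
          γ₂) ▷ i = γ₂ ▷ i := by
        rw [← comp_whiskerRight]
        simp [← whiskerLeft_comp_assoc]
      have e₂ : ((α_ _ _ _).hom ≫ f ◁ δ ≫ δ₁ ≫ inv δ₂) ▷ p ≫ δ₂ ▷ p =
          ((α_ _ _ _).hom ≫ f ◁ δ ≫ δ₁) ▷ p := by
        rw [← comp_whiskerRight]
        simp
      simp only [Category.assoc]
      rw [e₂, reassoc_of% e₁]
      refine Eq.trans h.symm ?_
      dsimp only [pasteTriangles, precompSquare]
      bicategory)
  exact ⟨ξ⟩

lemma squaring_inf (hB : Squaring B J) (hI : Squaring I J) (h : StableUnderBaseChange I Q) :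
    Squaring (B ⊓ I) J := by
  intro X Y Z W j q p i α hi hj hp hq
  obtain ⟨X₁, f₁, k₁, r₁, β₁, γ₁, δ₁, hk₁, hr₁, hf₁, hβ₁, e₁⟩ := hB α hi.1 hj.1 hp hq
  obtain ⟨X₂, f₂, k₂, r₂, β₂, γ₂, δ₂, hk₂, hr₂, hf₂, hβ₂, e₂⟩ := hI α hi.2 hj.2 hp hq
  have swap_mem : ∀ {X Y : C} {e : X ⟶ Y}, IsTwoCartesian (swap e) → I.mem e := fun he =>
    h _ he (I.id_mem _) (Q.id_mem _)
  obtain ⟨e, γ, δ, he⟩ := exists_comparison hβ₁ β₂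
  obtain ⟨e', γ', δ', he'⟩ := exists_comparison hβ₂ β₁
  have mem_e := swap_mem ((he ▸ hβ₂).swap_of_pasteTriangles hβ₁)
  have mem_e' := swap_mem ((he' ▸ hβ₁).swap_of_pasteTriangles hβ₂)
  obtain ⟨ξ⟩ := hom_of_pasteTriangles_eq hβ₁ ((congrArg (pasteTriangles γ₂ · δ₂) he).symm.trans
    (e₂.symm.trans e₁))
  exact ⟨X₁, f₁, k₁, r₁, β₁, γ₁, δ₁, ⟨hk₁, h.mem_of_iso δ' (I.comp_mem mem_e' hk₂)⟩, hr₁,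
    ⟨⟨hf₁.1, h.mem_of_iso ξ (I.comp_mem hf₂.1 mem_e)⟩, hf₁.2⟩, hβ₁, e₁⟩

end

/-- Conditions under which the extended gluing data form commutative cubes. -/
structure CubeConditions {C : Type u} [Bicategory.{w, v} C] (P Q B I J : WideSub C) : Prop where
  left : ExtensionConditions P Q B I
  right : ExtensionConditions P Q B J
  sq : Squaring I J
  sq' : Squaring J I
  cube : ∀ c : Cube B I J, Nonempty (CubeDecomposition c)
  cube' : ∀ c : Cube B J I, Nonempty (CubeDecomposition c)
  gen : Generates (P ⊓ I ⊓ J) (Q ⊓ I ⊓ J) (B ⊓ I ⊓ J)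

lemma WideSub.inf_right_comm {C : Type u} [Bicategory.{w, v} C] (P I J : WideSub C) :
    P ⊓ I ⊓ J = P ⊓ J ⊓ I := by
  have e : @(P ⊓ I ⊓ J).mem = @(P ⊓ J ⊓ I).mem := by
    funext X Y f
    exact propext and_right_comm
  revert e
  generalize P ⊓ I ⊓ J = A
  generalize P ⊓ J ⊓ I = A'
  obtain ⟨m, _, _⟩ := A
  obtain ⟨m', _, _⟩ := A'
  rintro rfl
  rfl

lemma CubeConditions.symm {C : Type u} [Bicategory.{w, v} C] {P Q B I J : WideSub C}
    (E : CubeConditions P Q B I J) : CubeConditions P Q B J I where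
  left := E.right
  right := E.left
  sq := E.sq'
  sq' := E.sq
  cube := E.cube'
  cube' := E.cube
  gen := by
    rw [P.inf_right_comm, Q.inf_right_comm, B.inf_right_comm]
    exact E.gen

section

variable {C : Type u} [Bicategory.{w, v} C] [IsLocallyGroupoid C]

lemma IsTwoCartesianIn.of_adjust_horizontal {X Y Z W : C} {j j' : X ⟶ Y} {q : X ⟶ Z} {p : Y ⟶ W}
    {i i' : Z ⟶ W} {α : q ≫ i ⟶ j ≫ p} {ι : i' ⟶ i} {ζ : j ⟶ j'}
    (h : IsTwoCartesian (q ◁ ι ≫ α ≫ ζ ▷ p)) : IsTwoCartesian α := by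
  have h' := h.adjust_horizontal (inv ι) (inv ζ)
  simpa [← whiskerLeft_comp_assoc, ← comp_whiskerRight] using h'

variable {D : Type u'} [Bicategory.{w', v'} D] {P Q B I J : WideSub C} {F₀ : C → D}
  {F : PsFun B F₀} {H : PsFun I F₀} {K : PsFun J F₀} {GI : Gluing F H} {GJ : Gluing F K}
  {G : Gluing H K}

namespace CubeConditions

open Arr

/-- Base changes of 2-Cartesian squares, at the level of the upper and of the lower edges. -/
lemma exists_baseChange (E : CubeConditions P Q B I J) {Y W V : Arr J} (p : Y ⟶ W) (b : V ⟶ W)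
    (hp : (square J I).mem p) (hb : (cart J Q).mem b) :
    ∃ (U : Arr J) (b' : U ⟶ Y) (p' : U ⟶ V) (β : p' ≫ b ⟶ b' ≫ p), (square J Q).mem b' ∧
      (square J I).mem p' ∧ IsTwoCartesian β.top ∧ IsTwoCartesian β.bot := by
  obtain ⟨U₁, j₁, q₁, β₁, h₁, hq₁⟩ := E.left.exists_baseChange p.top b.top hp.1 hb.1.1
  obtain ⟨U₀, j₀, q₀, β₀, h₀, hq₀⟩ := E.left.exists_baseChange p.bot b.bot hp.2 hb.1.2
  have hj₁ := E.left.stQ β₁ h₁ hb.1.1 hp.1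
  have hj₀ := E.left.stQ β₀ h₀ hb.1.2 hp.2
  obtain ⟨u, γ, δ, e⟩ := h₀.lift (u := j₁ ≫ Y.hom) (v := q₁ ≫ V.hom)
    ((α_ _ _ _).hom ≫ q₁ ◁ b.sq ≫ (α_ _ _ _).inv ≫ β₁ ▷ W.hom ≫ (α_ _ _ _).hom ≫ j₁ ◁ inv p.sq ≫
      (α_ _ _ _).inv)
  have hc : Cyl (hpaste γ b.sq) (hpaste δ p.sq) β₀ β₁ := by
    have e' := congrArg (· ≫ (α_ _ _ _).hom ≫ j₁ ◁ p.sq ≫ (α_ _ _ _).inv) e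
    dsimp only [precompSquare] at e'
    simp only [Category.assoc, Iso.inv_hom_id_assoc, ← whiskerLeft_comp_assoc, IsIso.inv_hom_id,
      whiskerLeft_id, Category.id_comp, Iso.hom_inv_id, Category.comp_id] at e'
    simp only [Cyl, hpaste, Category.assoc]
    rw [← e']
    simp
  have hδ : IsTwoCartesian δ := by
    have h := isTwoCartesian_sq (J := ⊤) (X := ⟨u, trivial⟩) (Y := ⟨Y.hom, trivial⟩)
      (Z := ⟨V.hom, trivial⟩) (W := ⟨W.hom, trivial⟩) (j := ⟨δ⟩) (q := ⟨γ⟩) (p := ⟨p.sq⟩)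
      (i := ⟨b.sq⟩) (Hom₂.mk β₁ β₀ hc) h₁ h₀ hb.2
    exact h
  exact ⟨⟨u, E.right.st (inv δ) hδ.flip Y.mem hj₀⟩, ⟨δ⟩, ⟨γ⟩, Hom₂.mk β₁ β₀ hc, ⟨hj₁, hj₀⟩,
    ⟨hq₁, hq₀⟩, h₁, h₀⟩

variable (E : CubeConditions P Q B I J)
  (hP : ∀ c : Cube P I J, (c.mono E.left.hP (fun _ _ _ h => h) fun _ _ _ h => h).Commutes GI GJ G)
  (hQ : ∀ c : Cube Q I J, (c.mono E.left.hQ (fun _ _ _ h => h) fun _ _ _ h => h).Commutes GI GJ G)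
include E hP hQ

/-- Cubes of which four faces are 2-Cartesian. -/
lemma commutes_of_cart {X Y Z W : Arr J} {j : X ⟶ Y} {q : X ⟶ Z} {p : Y ⟶ W} {i : Z ⟶ W}
    (β : q ≫ i ⟶ j ≫ p) (hj : (square J B).mem j) (hq : (square J I).mem q)
    (hp : (square J I).mem p) (hi : (cart J B).mem i) (ht : IsTwoCartesian β.top)
    (hb : IsTwoCartesian β.bot) : Commutes GI GJ G β := by
  have cl : PastingClosed _ _ (Commutes GI GJ G) := Compat.pastingClosed _ _ _ _
  obtain ⟨V, a, b, ha, hbQ, ⟨ι⟩⟩ := E.right.factors_cart i hi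
  obtain ⟨U, b', p', β', hb', hp', ht', hb₁⟩ := E.exists_baseChange p b hp hbQ
  obtain ⟨a', α, δ, hα, e⟩ := (isTwoCartesian_of_top_bot β ht hb).exists_factor_bottom ι.hom
    (isTwoCartesian_of_top_bot β' ht' hb₁)
  have hαt : IsTwoCartesian α.top := by
    have h : IsTwoCartesian (q.top ◁ ι.hom.top ≫ hpaste α.top β'.top ≫ δ.top ▷ p.top) := by
      rw [← e] at ht
      exact ht
    exact h.of_adjust_horizontal.of_hpaste ht'
  have hαb : IsTwoCartesian α.bot := by
    have h : IsTwoCartesian (q.bot ◁ ι.hom.bot ≫ hpaste α.bot β'.bot ≫ δ.bot ▷ p.bot) := by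
      rw [← e] at hb
      exact hb
    exact h.of_adjust_horizontal.of_hpaste hb₁
  have ha' : (square J P).mem a' := ⟨E.left.stP _ hαt ha.1.1 hp'.1, E.left.stP _ hαb ha.1.2 hp'.2⟩
  have h₁ : Commutes GI GJ G α := fun _ hq hp _ => hP (toCube ha' hq hp ha.1 α)
  have h₂ : Commutes GI GJ G β' := fun _ hq hp _ => hQ (toCube hb' hq hp hbQ.1 β')
  have mP := square_mono (J := J) E.left.hP
  have mQ := square_mono (J := J) E.left.hQ
  have h := cl.adjust (𝟙 q) ι.hom δ (𝟙 p) ((square J B).comp_mem (mP _ ha') (mQ _ hb')) hj hq hq hp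
    hp ((square J B).comp_mem (mP _ ha.1) (mQ _ hbQ.1)) hi.1
    (cl.hpaste hq hp' hp (mP _ ha') (mP _ ha.1) (mQ _ hb') (mQ _ hbQ.1) h₁ h₂)
  simpa [e] using h

end CubeConditions

end

section

variable {C : Type u} [Bicategory.{w, v} C]

/-- The 1-cell `f` is faithful on 2-cells. -/
def IsFaithful {X Y : C} (f : X ⟶ Y) : Prop :=
  ∀ {T : C} {h h' : T ⟶ X} (ξ ξ' : h ⟶ h'), ξ ▷ f = ξ' ▷ f → ξ = ξ'

lemma IsFaithful.of_section {X Y : C} {f : X ⟶ Y} {k : Y ⟶ X} (δ : f ≫ k ≅ 𝟙 X) : IsFaithful f := by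
  intro T h h' ξ ξ' e
  have key : ∀ ξ : h ⟶ h', ξ = (ρ_ h).inv ≫ h ◁ δ.inv ≫ (α_ _ _ _).inv ≫ (ξ ▷ f) ▷ k ≫
      (α_ _ _ _).hom ≫ h' ◁ δ.hom ≫ (ρ_ h').hom := by
    intro ξ
    have h₁ := whisker_exchange ξ δ.inv
    rw [← cancel_mono (ρ_ h').inv, ← cancel_epi (ρ_ h).hom, ← cancel_mono (h' ◁ δ.inv)]
    simpa using h₁.symm
  rw [key ξ, key ξ', e]

variable [IsLocallyGroupoid C]

lemma isTwoCartesian_id {X Y : C} {f : X ⟶ Y} (hf : IsFaithful f)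
    (hf' : ∀ {T : C} {h h' : T ⟶ X} (ψ : h ≫ f ⟶ h' ≫ f), ∃ ξ : h ⟶ h', ξ ▷ f = ψ) :
    IsTwoCartesian (𝟙 (𝟙 X ≫ f)) := by
  refine .mk' (fun {T u v} θ => ?_) (fun {T h h'} φ ψ e => ?_) (fun {T h h'} ξ ξ' e _ => ?_)
  · obtain ⟨ξ, rfl⟩ := hf' θ
    exact ⟨v, (ρ_ v).hom, (ρ_ v).hom ≫ ξ, by simp [precompSquare]⟩
  · obtain rfl : φ = ψ := hf _ _ (by simpa [precompSquare] using e)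
    exact ⟨(ρ_ h).inv ≫ φ ≫ (ρ_ h').hom, by simp, by simp⟩
  · simpa using e

/-- The diagonal of a faithful 1-cell is fully faithful. -/
lemma isTwoCartesian_id_of_diagonal {X Y V : C} {g : X ⟶ Y} (hg : IsFaithful g) {r k : V ⟶ X}
    {L : r ≫ g ⟶ k ≫ g} (hL : IsTwoCartesian L) {f : X ⟶ V} (δ : f ≫ k ≅ 𝟙 X) :
    IsTwoCartesian (𝟙 (𝟙 X ≫ f)) := by
  refine isTwoCartesian_id (IsFaithful.of_section δ) fun {T h h'} ψ => ?_
  let ξ : h ⟶ h' := (ρ_ h).inv ≫ h ◁ δ.inv ≫ (α_ _ _ _).inv ≫ ψ ▷ k ≫ (α_ _ _ _).hom ≫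
    h' ◁ δ.hom ≫ (ρ_ h').hom
  have e : (ξ ▷ f) ▷ k = ψ ▷ k := by
    have h₁ : ξ ▷ 𝟙 X = h ◁ δ.inv ≫ (α_ _ _ _).inv ≫ ψ ▷ k ≫ (α_ _ _ _).hom ≫ h' ◁ δ.hom := by
      simp [ξ]
    have h₂ := whisker_exchange ξ δ.inv
    rw [h₁] at h₂
    rw [← cancel_epi (α_ h f k).inv, ← cancel_epi (h ◁ δ.inv), ← cancel_mono (α_ h' f k).hom]
    simpa [← whiskerLeft_comp] using h₂
  refine ⟨ξ, hL.faithful _ _ (hg _ _ ?_) e⟩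
  rw [← cancel_mono (precompSquare (h' ≫ f) L), whiskerRight_precompSquare, e,
    whiskerRight_precompSquare]

end

section

variable {D : Type u'} [Bicategory.{w', v'} D]

lemma eq_of_conj {X Y : D} {f g : X ⟶ Y} {a b : X ⟶ X} {m : a ≅ 𝟙 X} {n : b ≅ 𝟙 X} {d : f ⟶ g}
    {φ : a ≫ f ⟶ b ≫ g}
    (h : φ = m.hom ▷ f ≫ (λ_ f).hom ≫ d ≫ (λ_ g).inv ≫ n.inv ▷ g) :
    d = ((λ_ f).inv ≫ m.inv ▷ f) ≫ φ ≫ n.hom ▷ g ≫ (λ_ g).hom := by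
  rw [h]
  simp [← comp_whiskerRight_assoc]

lemma eq_comp_of_comp_eq {X Y Z : D} {f : X ⟶ Z} {g g' : X ⟶ Y} {p : Y ⟶ Z} {e : g ≅ g'}
    {φ : f ⟶ g ≫ p} {k : X ⟶ Z} {a : f ⟶ k} {b : k ⟶ g' ≫ p} (h : φ ≫ e.hom ▷ p = a ≫ b) :
    φ = (a ≫ b) ≫ e.inv ▷ p := by
  rw [← h]
  simp [← comp_whiskerRight]

/-- Pseudo-natural transformations are compatible with the action on squares. -/
lemma PsTrans.cyl_mapSq {C : Type u} [Bicategory.{w, v} C] {A : WideSub C} {F₀ F₀' : C → D}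
    {F : PsFun A F₀} {F' : PsFun A F₀'} {α : ∀ X, F₀ X ⟶ F₀' X} (t : PsTrans F F' α)
    {X Y Z W : C} {j : X ⟶ Y} {q : X ⟶ Z} {p : Y ⟶ W} {i : Z ⟶ W} (hj : A.mem j) (hq : A.mem q)
    (hp : A.mem p) (hi : A.mem i) (β : q ≫ i ⟶ j ≫ p) :
    Cyl (TwoGlue.hpaste (t.sq q hq) (t.sq i hi)) (TwoGlue.hpaste (t.sq j hj) (t.sq p hp))
      (F'.mapSq hj hq hp hi β) (F.mapSq hj hq hp hi β) :=
  (t.cyl_mapComp_inv q i hq hi).comp ((t.cyl_map₂ _ _ β).comp (t.cyl_mapComp j p hj hp))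

end

section

variable {C : Type u} [Bicategory.{w, v} C] [IsLocallyGroupoid C] {D : Type u'}
  [Bicategory.{w', v'} D] {P Q B I J : WideSub C} {F₀ : C → D} {F : PsFun B F₀} {H : PsFun I F₀}
  {K : PsFun J F₀} (GI : Gluing F H) (GJ : Gluing F K) (G : Gluing H K)

/-- The two 2-cells attached to a square whose horizontal edges are in two subcategories agree. -/
abbrev Agree {X Y Z W : C} {j : X ⟶ Y} {q : X ⟶ Z} {p : Y ⟶ W} {i : Z ⟶ W}
    (α : q ≫ i ⟶ j ≫ p) : Prop :=
  Compat GI.diagInf.toTrans (PsIso.refl K).toTrans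
    (GJ.restrict (B.inf_le_left I) fun _ _ _ h => h)
    (G.restrict (B.inf_le_right I) fun _ _ _ h => h) α

variable {GI GJ G}

lemma agree_iff {X Y Z W : C} {j : X ⟶ Y} {q : X ⟶ Z} {p : Y ⟶ W} {i : Z ⟶ W}
    {α : q ≫ i ⟶ j ≫ p} : Agree GI GJ G α ↔ ∀ (hj : (B ⊓ I).mem j) (hq : J.mem q) (hp : J.mem p)
      (hi : (B ⊓ I).mem i), Cyl (GJ.iso hj.1 hq hp hi.1 α).hom (G.iso hj.2 hq hp hi.2 α).hom
        (GI.diagInf.iso i hi).hom (GI.diagInf.iso j hj).hom := by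
  rw [Agree, compat_toTrans_iff]
  refine forall₄_congr fun hj hq hp hi => ?_
  simp [Cyl, PsIso.refl, eq_comm]

namespace Arr

lemma agree_of_commutes {X Y : Arr J} {M : X ⟶ Y} (h : Commutes GI GJ G (𝟙 (𝟙 X ≫ M))) :
    Agree GI GJ G M.sq := by
  rw [agree_iff]
  intro hj hX hY hi
  have h' := h ((square J B).id_mem X) ((square J I).id_mem X) ⟨hj.2, hi.2⟩ ⟨hj.1, hi.1⟩
  have c₁ := (Cyl.leftUnitor_inv _).comp (((glueTrans G).cyl_mapId_inv X).whiskerRight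
    ((glueTrans GJ).sq M ⟨hj.1, hi.1⟩))
  have c₂ := (((glueTrans GJ).cyl_mapId X).whiskerRight
    ((glueTrans G).sq M ⟨hj.2, hi.2⟩)).comp (Cyl.leftUnitor _)
  exact Cyl.of_eq (c₁.comp (h'.comp c₂)) (eq_of_conj (GI.iso_id_left M.bot hi))
    (eq_of_conj (GI.iso_id_left M.top hj))

lemma commutes_of_agree {X Y Z W : Arr J} {j : X ⟶ Y} {q : X ⟶ Z} {p : Y ⟶ W} {i : Z ⟶ W}
    (β : q ≫ i ⟶ j ≫ p) (hj : (square J (B ⊓ I)).mem j) (hi : (square J (B ⊓ I)).mem i)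
    (aj : Agree GI GJ G j.sq) (ai : Agree GI GJ G i.sq) : Commutes GI GJ G β := by
  intro hj' hq hp hi'
  have hqp := fun hj hi => PsTrans.cyl_mapSq (glueTrans G) hj hq hp hi β
  have cj := (agree_iff.1 aj) hj.1 X.mem Y.mem hj.2
  have ci := (agree_iff.1 ai) hi.1 Z.mem W.mem hi.2
  have c := ((Cyl.whiskerLeft ((glueTrans G).sq q hq) ci).comp (hqp ⟨hj.1.2, hj.2.2⟩ ⟨hi.1.2, hi.2.2⟩)).comp
    (Cyl.whiskerRight (Cyl.symm (η := GI.diagInf.iso j.bot hj.2) (η' := GI.diagInf.iso j.top hj.1) cj)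
      ((glueTrans G).sq p hp))
  exact Cyl.of_eq c (eq_comp_of_comp_eq (GI.iso_diagInf hj.2 hq.2 hp.2 hi.2 β.bot))
    (eq_comp_of_comp_eq (GI.iso_diagInf hj.1 hq.1 hp.1 hi.1 β.top))

lemma agree_one (X : Arr J) : Agree GI GJ G (𝟙 X : X ⟶ X).sq := by
  have cl : PastingClosed _ _ (Agree GI GJ G) := Compat.pastingClosed _ _ _ _
  have h := cl.horizontal_id (𝟙 X.hom) X.mem X.mem
  rw [Category.id_comp] at h
  exact h

lemma cartesian_of_section {X V : Arr J} {f : X ⟶ V} {k : V ⟶ X} (δ : f ≫ k ⟶ 𝟙 X)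
    (hk : IsTwoCartesian k.sq) : IsTwoCartesian f.sq := by
  have h : IsTwoCartesian (TwoGlue.hpaste f.sq k.sq) :=
    isTwoCartesian_of_hom₂ (inv δ) (by
      have h := IsTwoCartesianIn.horizontal_id (𝟙 X.hom)
      rw [Category.id_comp] at h
      exact h)
  exact h.of_hpaste hk

lemma exists_diagonal (E : CubeConditions P Q B I J)
    (hP : ∀ c : Cube P I J, (c.mono E.left.hP (fun _ _ _ h => h) fun _ _ _ h => h).Commutes GI GJ G)
    (hQ : ∀ c : Cube Q I J, (c.mono E.left.hQ (fun _ _ _ h => h) fun _ _ _ h => h).Commutes GI GJ G)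
    {X Y : Arr J} {M : X ⟶ Y} (hM : (cart J (B ⊓ I)).mem M) :
    ∃ (V : Arr J) (f : X ⟶ V) (r k : V ⟶ X) (L : r ≫ M ⟶ k ≫ M) (δ : f ≫ k ⟶ 𝟙 X),
      (cart J (B ⊓ I)).mem f ∧ IsTwoCartesian L.top ∧ IsTwoCartesian L.bot ∧
        (Agree GI GJ G f.sq → Agree GI GJ G M.sq) := by
  have cl : PastingClosed _ _ (Commutes GI GJ G) := Compat.pastingClosed _ _ _ _
  have hB := square_mono (J := J) (B.inf_le_left I) _ hM.1
  have hI := square_mono (J := J) (B.inf_le_right I) _ hM.1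
  obtain ⟨V, f, k, r, L, γ, δ, hf, hk, hr, ht, hb, e⟩ := exists_decomposition E.cube
    ((square J B).id_mem X) ((square J I).id_mem X) hI hB (𝟙 (𝟙 X ≫ M))
  have hL := E.commutes_of_cart hP hQ L hk hr hI ⟨hB, hM.2⟩ ht hb
  refine ⟨V, f, r, k, L, δ, ⟨hf, cartesian_of_section δ (isTwoCartesian_sq L ht hb hM.2)⟩, ht, hb,
    fun h => agree_of_commutes ?_⟩
  rw [e]
  have hf' := square_mono (J := J) (B.inf_le_left I) _ hf
  refine cl.pasteTriangles hB ((square J B).id_mem X) hI ((square J I).id_mem X) hk hr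
    ⟨hf', square_mono (J := J) (B.inf_le_right I) _ hf⟩ hL (commutes_of_agree _ hf
      ((square J (B ⊓ I)).id_mem V) h (agree_one V))

lemma agree_of_isTwoCartesian_id (E : CubeConditions P Q B I J)
    (hP : ∀ c : Cube P I J, (c.mono E.left.hP (fun _ _ _ h => h) fun _ _ _ h => h).Commutes GI GJ G)
    (hQ : ∀ c : Cube Q I J, (c.mono E.left.hQ (fun _ _ _ h => h) fun _ _ _ h => h).Commutes GI GJ G)
    {X Y : Arr J} {M : X ⟶ Y} (hM : (cart J (B ⊓ I)).mem M)
    (ht : IsTwoCartesian (𝟙 (𝟙 X.src ≫ M.top))) (hb : IsTwoCartesian (𝟙 (𝟙 X.tgt ≫ M.bot))) :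
    Agree GI GJ G M.sq := by
  have hB := square_mono (J := J) (B.inf_le_left I) _ hM.1
  have hI := square_mono (J := J) (B.inf_le_right I) _ hM.1
  exact agree_of_commutes (E.commutes_of_cart hP hQ _ ((square J B).id_mem X)
    ((square J I).id_mem X) hI ⟨hB, hM.2⟩ ht hb)

/-- 2-Cartesian squares with horizontal edges in two subcategories. -/
lemma agree_of_cart (E : CubeConditions P Q B I J)
    (hP : ∀ c : Cube P I J, (c.mono E.left.hP (fun _ _ _ h => h) fun _ _ _ h => h).Commutes GI GJ G)
    (hQ : ∀ c : Cube Q I J, (c.mono E.left.hQ (fun _ _ _ h => h) fun _ _ _ h => h).Commutes GI GJ G)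
    {X Y : Arr J} {M : X ⟶ Y} (hM : (cart J (B ⊓ I)).mem M) : Agree GI GJ G M.sq := by
  obtain ⟨V, f, r, k, L, δ, hf, -, -, h⟩ := exists_diagonal E hP hQ hM
  obtain ⟨V', f', r', k', L', δ', hf', ht, hb, h'⟩ := exists_diagonal E hP hQ hf
  refine h (h' (agree_of_isTwoCartesian_id E hP hQ hf' ?_ ?_))
  · exact isTwoCartesian_id_of_diagonal (IsFaithful.of_section (asIso δ.top)) ht (asIso δ'.top)
  · exact isTwoCartesian_id_of_diagonal (IsFaithful.of_section (asIso δ.bot)) hb (asIso δ'.bot)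

end Arr

end

section

variable {C : Type u} [Bicategory.{w, v} C] [IsLocallyGroupoid C] {D : Type u'}
  [Bicategory.{w', v'} D] {P Q B I J : WideSub C} {F₀ : C → D} {F : PsFun B F₀} {H : PsFun I F₀}
  {K : PsFun J F₀} {GI : Gluing F H} {GJ : Gluing F K} {G : Gluing H K}

lemma Cube.commutes_mono_flip {hP : P ≤ B}
    (h : ∀ c : Cube P I J, (c.mono hP (fun _ _ _ h => h) fun _ _ _ h => h).Commutes GI GJ G)
    (c : Cube P J I) : (c.mono hP (fun _ _ _ h => h) fun _ _ _ h => h).Commutes GJ GI G.flip := by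
  have e : (c.flip.mono hP (fun _ _ _ h => h) fun _ _ _ h => h).flip =
      c.mono hP (fun _ _ _ h => h) fun _ _ _ h => h := by
    cases c
    simp [Cube.flip, Cube.mono]
  exact e ▸ Cube.commutes_flip.2 (h c.flip)

namespace CubeConditions

open Arr

lemma agree (E : CubeConditions P Q B I J)
    (hP : ∀ c : Cube P I J, (c.mono E.left.hP (fun _ _ _ h => h) fun _ _ _ h => h).Commutes GI GJ G)
    (hQ : ∀ c : Cube Q I J, (c.mono E.left.hQ (fun _ _ _ h => h) fun _ _ _ h => h).Commutes GI GJ G)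
    {X Y Z W : C} {j : X ⟶ Y} {q : X ⟶ Z} {p : Y ⟶ W} {i : Z ⟶ W}
    (α : q ≫ i ⟶ j ≫ p) : Agree GI GJ G α := by
  have cl : PastingClosed _ _ (Agree GI GJ G) := Compat.pastingClosed _ _ _ _
  intro hj hq hp hi
  obtain ⟨X', f, k, r, β, γ, δ, hk, hr, hf, hβ, rfl⟩ :=
    squaring_inf E.right.sq E.sq E.left.st α hi hj hp hq
  have hβ' : Agree GI GJ G β := agree_of_cart E hP hQ (X := ⟨r, hr⟩) (Y := ⟨p, hp⟩) (M := ⟨β⟩)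
    ⟨⟨hk, hi⟩, hβ⟩
  refine cl.pasteTriangles hi hj hp hq hk hr hf hβ' (cl.swap_of_generates (fun _ _ _ h => h)
    (WideSub.inf_le_inf_right J (WideSub.inf_le_inf_right I E.left.hP))
    (WideSub.inf_le_inf_right J (WideSub.inf_le_inf_right I E.left.hQ)) E.gen ?_ ?_ f hf) hj hq hp hi
  · intro X Y f hf
    let M : (⟨f, hf.2⟩ : Arr J) ⟶ ⟨𝟙 Y, J.id_mem Y⟩ := ⟨swap f⟩
    have hM : (square J P).mem M := ⟨hf.1.1, P.id_mem Y⟩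
    exact agree_of_commutes (M := M) fun _ hq hp _ =>
      hP (toCube ((square J P).id_mem _) hq hp hM (𝟙 (𝟙 _ ≫ M)))
  · intro X Y f hf
    let M : (⟨f, hf.2⟩ : Arr J) ⟶ ⟨𝟙 Y, J.id_mem Y⟩ := ⟨swap f⟩
    have hM : (square J Q).mem M := ⟨hf.1.1, Q.id_mem Y⟩
    exact agree_of_commutes (M := M) fun _ hq hp _ =>
      hQ (toCube ((square J Q).id_mem _) hq hp hM (𝟙 (𝟙 _ ≫ M)))

lemma commutes_of_decomposition (E : CubeConditions P Q B I J)
    (hP : ∀ c : Cube P I J, (c.mono E.left.hP (fun _ _ _ h => h) fun _ _ _ h => h).Commutes GI GJ G)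
    (hQ : ∀ c : Cube Q I J, (c.mono E.left.hQ (fun _ _ _ h => h) fun _ _ _ h => h).Commutes GI GJ G)
    {X Y Z W : Arr J} {j : X ⟶ Y} {q : X ⟶ Z} {p : Y ⟶ W} {i : Z ⟶ W}
    (h : ∀ {V : Arr J} {k : V ⟶ Y} {r : V ⟶ Z} (L : r ≫ i ⟶ k ≫ p), (square J B).mem k →
      (square J I).mem r → IsTwoCartesian L.top → IsTwoCartesian L.bot → Commutes GI GJ G L)
    (β : q ≫ i ⟶ j ≫ p) : Commutes GI GJ G β := by
  have cl : PastingClosed _ _ (Commutes GI GJ G) := Compat.pastingClosed _ _ _ _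
  intro hj hq hp hi
  obtain ⟨V, f, k, r, L, γ, δ, hf, hk, hr, ht, hb, rfl⟩ := exists_decomposition E.cube hj hq hp hi β
  exact cl.pasteTriangles hi hj hp hq hk hr ⟨square_mono (J := J) (B.inf_le_left I) _ hf,
    square_mono (J := J) (B.inf_le_right I) _ hf⟩ (h L hk hr ht hb) (commutes_of_agree _ hf
      ((square J (B ⊓ I)).id_mem V) (E.agree hP hQ _) (E.agree hP hQ _)) hj hq hp hi

/-- The 2-cells attached to the faces of a cube commute if they do for cubes with edges in one of
two subcategories. -/
theorem commutes (E : CubeConditions P Q B I J)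
    (hP : ∀ c : Cube P I J, (c.mono E.left.hP (fun _ _ _ h => h) fun _ _ _ h => h).Commutes GI GJ G)
    (hQ : ∀ c : Cube Q I J, (c.mono E.left.hQ (fun _ _ _ h => h) fun _ _ _ h => h).Commutes GI GJ G)
    (c : Cube B I J) : c.Commutes GI GJ G := by
  refine E.commutes_of_decomposition hP hQ (X := ⟨c.x, c.hx⟩) (Y := ⟨c.y, c.hy⟩) (Z := ⟨c.z, c.hz⟩)
    (W := ⟨c.w, c.hw⟩) (j := ⟨c.J'⟩) (q := ⟨c.I'⟩) (p := ⟨c.I⟩) (i := ⟨c.J⟩)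
    (fun {V k r} L hk hr ht hb => ?_) (Hom₂.mk c.K' c.K c.comm) ⟨c.hb', c.hb⟩ ⟨c.hq', c.hq⟩
    ⟨c.hp', c.hp⟩ ⟨c.ha', c.ha⟩
  intro hk hr hp hi
  refine (Cube.commutes_flip (c := toCube hk hr hp hi L)).1 ?_
  let c' := (toCube hk hr hp hi L).flip
  refine E.symm.commutes_of_decomposition (Cube.commutes_mono_flip hP) (Cube.commutes_mono_flip hQ)
    (X := ⟨c'.x, c'.hx⟩) (Y := ⟨c'.y, c'.hy⟩) (Z := ⟨c'.z, c'.hz⟩)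
    (W := ⟨c'.w, c'.hw⟩) (j := ⟨c'.J'⟩) (q := ⟨c'.I'⟩) (p := ⟨c'.I⟩) (i := ⟨c'.J⟩)
    (fun {V k r} L hk hr ht' hb' => ?_) (Hom₂.mk c'.K' c'.K c'.comm) ⟨c'.hb', c'.hb⟩ ⟨c'.hq', c'.hq⟩
    ⟨c'.hp', c'.hp⟩ ⟨c'.ha', c'.ha⟩
  exact E.symm.commutes_of_cart (Cube.commutes_mono_flip hP) (Cube.commutes_mono_flip hQ) L hk hr
    ⟨c'.hp', c'.hp⟩ ⟨⟨c'.ha', c'.ha⟩, hb⟩ ht' hb'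

end CubeConditions

end

lemma CubeCommutes.conj {D : Type u'} [Bicategory.{w', v'} D] {X' Y' Z' W' X Y Z W : D}
    {a c : Z ⟶ W} {b d : X ⟶ Y} {a' c' : Z' ⟶ W'} {b' d' : X' ⟶ Y'} {p r : Y ⟶ W} {q s : X ⟶ Z}
    {p' r' : Y' ⟶ W'} {q' s' : X' ⟶ Z'} {x : X' ⟶ X} {y : Y' ⟶ Y} {z : Z' ⟶ Z} {w : W' ⟶ W}
    {I' : x ≫ q ⟶ q' ≫ z} {J : z ≫ a ⟶ a' ≫ w} {J' : x ≫ b ⟶ b' ≫ y} {I : y ≫ p ⟶ p' ≫ w}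
    {K' : q' ≫ a' ≅ b' ≫ p'} {K : q ≫ a ≅ b ≫ p} {L' : x ≫ s ⟶ s' ≫ z} {M : z ≫ c ⟶ c' ≫ w}
    {M' : x ≫ d ⟶ d' ≫ y} {L : y ≫ r ⟶ r' ≫ w} {ea : a ≅ c} {eb : b ≅ d} {ea' : a' ≅ c'}
    {eb' : b' ≅ d'} {ep : p ≅ r} {eq : q ≅ s} {ep' : p' ≅ r'} {eq' : q' ≅ s'}
    (h : CubeCommutes I' J K'.hom K.hom J' I) (hI' : Cyl I' L' eq.hom eq'.hom)
    (hJ : Cyl J M ea.hom ea'.hom) (hJ' : Cyl J' M' eb.hom eb'.hom) (hI : Cyl I L ep.hom ep'.hom) :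
    CubeCommutes L' M
      ((whiskerRightIso eq' a' ≪≫ whiskerLeftIso s' ea').symm ≪≫ K' ≪≫ whiskerRightIso eb' p' ≪≫
        whiskerLeftIso d' ep').hom
      ((whiskerRightIso eq a ≪≫ whiskerLeftIso s ea).symm ≪≫ K ≪≫ whiskerRightIso eb p ≪≫
        whiskerLeftIso d ep).hom M' L := by
  have c₁ := Cyl.symm (η := whiskerRightIso eq a ≪≫ whiskerLeftIso s ea)
    (η' := whiskerRightIso eq' a' ≪≫ whiskerLeftIso s' ea')
    ((hI'.whiskerRight J).comp (hJ.whiskerLeft L'))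
  have h' : Cyl (hpaste I' J) (hpaste J' I) K.hom K'.hom := h
  exact c₁.comp (h'.comp ((hJ'.whiskerRight I).comp (hI.whiskerLeft M')))

section

variable {C : Type u} [Bicategory.{w, v} C] {D : Type u'} [Bicategory.{w', v'} D]
  {B I J : WideSub C} {F₀ : C → D} {F F' : PsFun B F₀} {H H' : PsFun I F₀} {K : PsFun J F₀}

lemma Gluing.cyl_conj_refl (G : Gluing F H) (e : PsIso F F') {X Y Z W : C} {j : X ⟶ Y} {q : X ⟶ Z}
    {p : Y ⟶ W} {i : Z ⟶ W} (hj : B.mem j) (hq : I.mem q) (hp : I.mem p) (hi : B.mem i)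
    (α : q ≫ i ⟶ j ≫ p) : Cyl (G.iso hj hq hp hi α).hom
      ((G.conj e (.refl H)).iso hj hq hp hi α).hom (e.iso i hi).hom (e.iso j hj).hom := by
  simp [Cyl, conj]

lemma Gluing.conj_refl_refl (G : Gluing F H) {X Y Z W : C} {j : X ⟶ Y} {q : X ⟶ Z}
    {p : Y ⟶ W} {i : Z ⟶ W} (hj : B.mem j) (hq : I.mem q) (hp : I.mem p) (hi : B.mem i)
    (α : q ≫ i ⟶ j ≫ p) :
    (G.conj (.refl F) (.refl H)).iso hj hq hp hi α = G.iso hj hq hp hi α := by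
  ext
  simp [conj]

lemma Cube.Commutes.conj {c : Cube B I J} {GI : Gluing F H} {GJ : Gluing F K} {G : Gluing H K}
    (h : c.Commutes GI GJ G) (e : PsIso F F') (d : PsIso H H') :
    c.Commutes (GI.conj e d) (GJ.conj e (.refl K)) (G.conj d (.refl K)) :=
  CubeCommutes.conj h (G.cyl_conj_refl d _ _ _ _ _) (GJ.cyl_conj_refl e _ _ _ _ _)
    (GJ.cyl_conj_refl e _ _ _ _ _) (G.cyl_conj_refl d _ _ _ _ _)

end

section

variable {C : Type u} [Bicategory.{w, v} C] {D : Type u'} [Bicategory.{w', v'} D] {m : ℕ}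
  {A : Fin (m + 2) → WideSub C} {B : WideSub C} {F₀ : C → D}

namespace GD

variable (F : PsFun B F₀) (K : ∀ i : Fin m, PsFun (A i.succ.succ) F₀)

/-- A family of pseudofunctors from one on `B` and those on the subcategories `A 2`, …. -/
def consPs : ∀ i : Fin (m + 1), PsFun (coarsen B A i) F₀ :=
  Fin.cases F K

variable {F K} (G : ∀ i, Gluing F (K i)) (GK : ∀ {i j : Fin m}, i < j → Gluing (K i) (K j))

/-- A family of gluing data from those that involve `B` and those that do not. -/
def consGluing : ∀ {i j : Fin (m + 1)}, i < j → Gluing (consPs F K i) (consPs F K j) :=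
  fun {i j} => Fin.cases (motive := fun i => i < j → Gluing (consPs F K i) (consPs F K j))
    (Fin.cases (motive := fun j => 0 < j → Gluing F (consPs F K j))
      (fun h => (lt_irrefl _ h).elim) (fun j _ => G j) j)
    (fun i => Fin.cases (motive := fun j => i.succ < j → Gluing (K i) (consPs F K j))
      (fun h => (Fin.not_lt_zero _ h).elim) (fun _ h => GK (Fin.succ_lt_succ_iff.1 h)) j) i

/-- Gluing data relative to `B, A 2, …`. -/
def cons (h : ∀ {i j} (hij : i < j) (c : Cube B (A i.succ.succ) (A j.succ.succ)),
      c.Commutes (G i) (G j) (GK hij))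
    (h' : ∀ {i j k} (hij : i < j) (hjk : j < k)
      (c : Cube (A i.succ.succ) (A j.succ.succ) (A k.succ.succ)),
      c.Commutes (GK hij) (GK (hij.trans hjk)) (GK hjk)) : GD D (coarsen B A) where
  obj := F₀
  ps := consPs F K
  G := consGluing G GK
  cube {i j k} hij hjk := by
    induction k using Fin.cases with
    | zero => exact (Fin.not_lt_zero _ hjk).elim
    | succ k =>
      induction j using Fin.cases with
      | zero => exact (Fin.not_lt_zero _ hij).elim
      | succ j =>
        induction i using Fin.cases with
        | zero => exact h (Fin.succ_lt_succ_iff.1 hjk)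
        | succ i => exact h' (Fin.succ_lt_succ_iff.1 hij) (Fin.succ_lt_succ_iff.1 hjk)

end GD

end

section

variable {C : Type u} [Bicategory.{w, v} C] [IsLocallyGroupoid C] {D : Type u'}
  [Bicategory.{w', v'} D] {m : ℕ} {A : Fin (m + 2) → WideSub C} {B : WideSub C} (hA₁ : A 0 ≤ B)
  (hA₂ : A 1 ≤ B)

lemma comparisonObj_G_zero_one (E : GD D (coarsen B A)) (h : (0 : Fin (m + 2)) < 1) :
    (comparisonObj B A hA₁ hA₂ E).G h = (E.ps 0).selfGluing.restrict hA₁ hA₂ :=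
  congrArg (fun G : Gluing (E.ps 0) (E.ps 0) => G.restrict hA₁ hA₂) (E.full_self 0)

lemma comparisonObj_G_zero (E : GD D (coarsen B A)) (k : Fin m)
    (h : (0 : Fin (m + 2)) < k.succ.succ) : (comparisonObj B A hA₁ hA₂ E).G h =
      (E.G (Fin.succ_pos k)).restrict hA₁ fun _ _ _ h => h :=
  congrArg (fun G : Gluing (E.ps 0) (E.ps k.succ) => G.restrict hA₁ fun _ _ _ h => h)
    (E.full_of_lt (Fin.succ_pos k))

lemma comparisonObj_G_one (E : GD D (coarsen B A)) (k : Fin m)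
    (h : (1 : Fin (m + 2)) < k.succ.succ) : (comparisonObj B A hA₁ hA₂ E).G h =
      (E.G (Fin.succ_pos k)).restrict hA₂ fun _ _ _ h => h :=
  congrArg (fun G : Gluing (E.ps 0) (E.ps k.succ) => G.restrict hA₂ fun _ _ _ h => h)
    (E.full_of_lt (Fin.succ_pos k))

lemma comparisonObj_G_succ (E : GD D (coarsen B A)) {i j : Fin m} (h : i.succ.succ < j.succ.succ) :
    (comparisonObj B A hA₁ hA₂ E).G h = (E.G (Fin.succ_lt_succ_iff.1 h)).restrict
      (fun _ _ _ h => h) fun _ _ _ h => h :=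
  congrArg (fun G : Gluing (E.ps i.succ) (E.ps j.succ) => G.restrict (fun _ _ _ h => h)
    fun _ _ _ h => h) (E.full_of_lt (Fin.succ_lt_succ_iff.1 h))

/-- Gluing data with the same action on objects as `y` whose image under the comparison is
isomorphic to `y`. -/
structure ComparisonLift (y : GD D A) where
  ps : ∀ i, PsFun (coarsen B A i) y.obj
  G : ∀ {i j}, i < j → Gluing (ps i) (ps j)
  cube : ∀ {i j k} (hij : i < j) (hjk : j < k)
    (c : Cube (coarsen B A i) (coarsen B A j) (coarsen B A k)),
    c.Commutes (G hij) (G (hij.trans hjk)) (G hjk)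
  iso : ∀ i, PsIso (y.ps i) ((comparisonObj B A hA₁ hA₂ ⟨y.obj, ps, G, cube⟩).ps i)
  compat : ∀ {i j} (h : i < j) {X Y Z W : C} {b : X ⟶ Y} {q : X ⟶ Z} {p : Y ⟶ W} {a : Z ⟶ W}
    (α : q ≫ a ⟶ b ≫ p), Compat (iso i).toTrans (iso j).toTrans (y.G h)
      ((comparisonObj B A hA₁ hA₂ ⟨y.obj, ps, G, cube⟩).G h) α

lemma compat_conj_refl {F₀ : C → D} {P J : WideSub C} {F : PsFun B F₀} {F' : PsFun P F₀}
    {H : PsFun J F₀} {hP : P ≤ B} (e : PsIso F' (F.restrict hP)) (G : Gluing F' H) (G' : Gluing F H)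
    {X Y Z W : C} {b : X ⟶ Y} {q : X ⟶ Z} {p : Y ⟶ W} {a : Z ⟶ W} (α : q ≫ a ⟶ b ≫ p)
    (h : ∀ hb hq hp ha, (G'.iso (hP _ hb) hq hp (hP _ ha) α).hom =
      ((G.conj e (.refl H)).iso hb hq hp ha α).hom) :
    Compat e.toTrans (PsIso.refl H).toTrans G (G'.restrict hP fun _ _ _ h => h) α :=
  (compat_toTrans_iff _ _ _ _ _).2 fun hb hq hp ha => by
    have h' := h hb hq hp ha
    change _ ≫ _ ≫ (G'.iso (hP _ hb) hq hp (hP _ ha) α).hom = _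
    rw [h']
    simp [Gluing.conj]

theorem exists_comparisonLift (h₁ : ∀ i : Fin m, ExtensionConditions (A 0) (A 1) B (A i.succ.succ))
    (h₂ : ∀ i j : Fin m, i < j →
      CubeConditions (A 0) (A 1) B (A i.succ.succ) (A j.succ.succ))
    (hfac : Factors (A 0) (A 1) B) (hfib : HasFiberProductsAgreeing (A 1) B) (y : GD D A) :
    Nonempty (ComparisonLift hA₁ hA₂ y) := by
  have h01 : (0 : Fin (m + 2)) < 1 := Fin.zero_lt_one
  have h1 : ∀ i : Fin m, 1 < i.succ.succ := fun i => Fin.succ_lt_succ_iff.2 (Fin.succ_pos i)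
  have hs : ∀ {i j : Fin m}, i < j → i.succ.succ < j.succ.succ := fun h =>
    Fin.succ_lt_succ_iff.2 (Fin.succ_lt_succ_iff.2 h)
  obtain ⟨F, e₁, e₂, he⟩ := (y.G h01).exists_psFun hA₁ hA₂ hfac hfib
  let K : ∀ i : Fin m, PsFun (A i.succ.succ) y.obj := fun i => y.ps i.succ.succ
  let GP : ∀ i, Gluing (F.restrict hA₁) (K i) := fun i => (y.G (Fin.succ_pos _)).conj e₁ (.refl _)
  let GQ : ∀ i, Gluing (F.restrict hA₂) (K i) := fun i => (y.G (h1 i)).conj e₂ (.refl _)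
  have hsq : ∀ {X Y Z W : C} {j : X ⟶ Y} {q : X ⟶ Z} {p : Y ⟶ W} {i : Z ⟶ W} (hj : (A 0).mem j)
      (hq : (A 1).mem q) (hp : (A 1).mem p) (hi : (A 0).mem i) (β : q ≫ i ⟶ j ≫ p),
      F.mapSq (hA₁ _ hj) (hA₂ _ hq) (hA₂ _ hp) (hA₁ _ hi) β =
        (((y.G h01).conj e₁ e₂).iso hj hq hp hi β).hom := by
    intro X Y Z W j q p i hj hq hp hi β
    rw [Gluing.conj_iso, Iso.trans_hom, Iso.symm_hom, Iso.eq_inv_comp]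
    simpa using he hj hq hp hi β
  have hc : ∀ i, CubesCommute F (GP i) (GQ i) := by
    intro i c
    have h := Cube.Commutes.conj (c := c) (y.cube h01 (h1 i) c) e₁ e₂
    dsimp only [Cube.Commutes] at h
    rw [← hsq, ← hsq] at h
    exact h
  choose G hGP hGQ using fun i => exists_gluing (hc i) (h₁ i)
  have hB : ∀ {i j} (h : i < j) (c : Cube B (A i.succ.succ) (A j.succ.succ)),
      c.Commutes (G i) (G j) (y.G (hs h)) := by
    intro i j h
    refine (h₂ i j h).commutes (fun c => ?_) (fun c => ?_)
    · have h' := Cube.Commutes.conj (c := c) (y.cube (Fin.succ_pos _) (hs h) c) e₁ (.refl _)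
      dsimp only [Cube.Commutes] at h' ⊢
      rw [Gluing.conj_refl_refl, Gluing.conj_refl_refl] at h'
      rw [hGP i c.hb' c.hq' c.hp' c.ha', hGP i c.hb c.hq c.hp c.ha, hGP j c.ha' c.hz c.hw c.ha,
        hGP j c.hb' c.hx c.hy c.hb]
      exact h'
    · have h' := Cube.Commutes.conj (c := c) (y.cube (h1 i) (hs h) c) e₂ (.refl _)
      dsimp only [Cube.Commutes] at h' ⊢
      rw [Gluing.conj_refl_refl, Gluing.conj_refl_refl] at h'
      rw [hGQ i c.hb' c.hq' c.hp' c.ha', hGQ i c.hb c.hq c.hp c.ha, hGQ j c.ha' c.hz c.hw c.ha,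
        hGQ j c.hb' c.hx c.hy c.hb]
      exact h'
  let x : GD D (coarsen B A) := GD.cons G (fun h => y.G (hs h)) hB
    fun hij hjk c => y.cube (hs hij) (hs hjk) c
  let e : ∀ i, PsIso (y.ps i) ((comparisonObj B A hA₁ hA₂ x).ps i) :=
    Fin.cases e₁ (Fin.cases e₂ fun i => .refl (K i))
  refine ⟨⟨x.ps, x.G, x.cube, e, fun {i j} h {X Y Z W b q p a} α => ?_⟩⟩
  induction j using Fin.cases with
  | zero => exact (Fin.not_lt_zero _ h).elim
  | succ j =>
    induction i using Fin.cases with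
    | zero =>
      induction j using Fin.cases with
      | zero =>
        exact (congrArg (fun G' => Compat e₁.toTrans e₂.toTrans (y.G h) G' α)
          (comparisonObj_G_zero_one hA₁ hA₂ x h)).mpr ((compat_toTrans_iff _ _ _ _ _).2
            fun hb hq hp ha => he hb hq hp ha α)
      | succ j =>
        exact (congrArg (fun G' => Compat e₁.toTrans (PsIso.refl (K j)).toTrans (y.G h) G' α)
          (comparisonObj_G_zero hA₁ hA₂ x j h)).mpr (compat_conj_refl e₁ _ (G j) α
            fun hb hq hp ha => hGP j hb hq hp ha α)
    | succ i =>
      induction j using Fin.cases with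
      | zero => exact (Fin.not_lt_zero _ (Fin.succ_lt_succ_iff.1 h)).elim
      | succ j =>
        induction i using Fin.cases with
        | zero =>
          exact (congrArg (fun G' => Compat e₂.toTrans (PsIso.refl (K j)).toTrans (y.G h) G' α)
            (comparisonObj_G_one hA₁ hA₂ x j h)).mpr (compat_conj_refl e₂ _ (G j) α
              fun hb hq hp ha => hGQ j hb hq hp ha α)
        | succ i =>
          exact (congrArg (fun G' => Compat (PsIso.refl (K i)).toTrans (PsIso.refl (K j)).toTrans
            (y.G h) G' α) (comparisonObj_G_succ hA₁ hA₂ x h)).mpr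
              (compat_conj_refl (hP := fun _ _ _ h => h) (.refl (K i)) _ (y.G h) α
                fun hb hq hp ha => by rw [Gluing.conj_refl_refl])

end

section

variable {C : Type u} [Bicategory.{w, v} C] {D : Type u'} [Bicategory.{w', v'} D]

lemma PsIso.toTrans_comp_symm {P : WideSub C} {F₀ : C → D} {F F' : PsFun P F₀} (e : PsIso F F')
    {X Y : C} (f : X ⟶ Y) (hf : P.mem f) :
    F.map f hf ◁ (λ_ (𝟙 (F₀ Y))).hom ≫ ((PsTrans.id F).nat f hf).hom =
      ((e.toTrans.comp e.symm.toTrans).nat f hf).hom ≫ (λ_ (𝟙 (F₀ X))).hom ▷ F.map f hf := by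
  simp [PsTrans.id, PsTrans.comp, toTrans, symm, hpaste]

lemma symm_conj_eq {X Y Z W : D} {q q' : X ⟶ Z} {p p' : Y ⟶ W} {i i' : Z ⟶ W} {j j' : X ⟶ Y}
    {d : q ≅ q'} {e : i ≅ i'} {e' : j ≅ j'} {d' : p ≅ p'} {φ : q ≫ i ⟶ j ≫ p}
    {φ' : q' ≫ i' ⟶ j' ≫ p'}
    (h : d.hom ▷ i ≫ q' ◁ e.hom ≫ φ' = φ ≫ e'.hom ▷ p ≫ j' ◁ d'.hom) :
    d.inv ▷ i' ≫ q ◁ e.inv ≫ φ = φ' ≫ e'.inv ▷ p' ≫ j ◁ d'.inv := by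
  rw [← cancel_epi (q' ◁ e.hom), ← cancel_epi (d.hom ▷ i), reassoc_of% h, whisker_exchange_assoc]
  simp [← whisker_exchange_assoc]

lemma Compat.symm [IsLocallyGroupoid C] {P Q : WideSub C} {F₀ : C → D} {F F' : PsFun P F₀} {H H' : PsFun Q F₀}
    {e : PsIso F F'} {d : PsIso H H'} {G : Gluing F H} {G' : Gluing F' H'} {X Y Z W : C}
    {j : X ⟶ Y} {q : X ⟶ Z} {p : Y ⟶ W} {i : Z ⟶ W} {β : q ≫ i ⟶ j ≫ p}
    (h : Compat e.toTrans d.toTrans G G' β) : Compat e.symm.toTrans d.symm.toTrans G' G β := by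
  rw [compat_toTrans_iff] at h ⊢
  intro hj hq hp hi
  exact symm_conj_eq (h hj hq hp hi)

/-- Changing the components of a 1-cell by an equality. -/
def GD.Hom.copy {n : ℕ} {A : Fin n → WideSub C} {E E' : GD D A} (s : Hom E E')
    (app : ∀ X, E.obj X ⟶ E'.obj X) (h : s.app = app) : Hom E E' where
  app := app
  tr i := h ▸ s.tr i
  compat := by
    subst h
    exact s.compat

lemma GD.Hom.copy_eq {n : ℕ} {A : Fin n → WideSub C} {E E' : GD D A} (s : Hom E E')
    (app : ∀ X, E.obj X ⟶ E'.obj X) (h : s.app = app) : s.copy app h = s := by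
  subst h
  rfl

end

section

variable {C : Type u} [Bicategory.{w, v} C] [IsLocallyGroupoid C] {D : Type u'}
  [Bicategory.{w', v'} D] {m : ℕ} {A : Fin (m + 2) → WideSub C} {B : WideSub C} {hA₁ : A 0 ≤ B}
  {hA₂ : A 1 ≤ B}

namespace ComparisonLift

variable {y : GD D A} (L : ComparisonLift hA₁ hA₂ y)

/-- The gluing data of a lift. -/
abbrev toGD : GD D (coarsen B A) := ⟨y.obj, L.ps, L.G, L.cube⟩

/-- The canonical 1-cell to the image of a lift. -/
noncomputable def hom : y ⟶ comparisonObj B A hA₁ hA₂ L.toGD :=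
  GD.Hom.mk (fun X => 𝟙 (y.obj X)) (fun i => (L.iso i).toTrans)
    fun h _ _ _ _ _ _ _ _ hb hq hp ha α => (compat_iff_cyl _ _ _ _ _ _).2
      (L.compat h α hb hq hp ha)

/-- The inverse of the canonical 1-cell to the image of a lift. -/
noncomputable def inv : comparisonObj B A hA₁ hA₂ L.toGD ⟶ y :=
  GD.Hom.mk (fun X => 𝟙 (y.obj X)) (fun i => (L.iso i).symm.toTrans)
    fun h _ _ _ _ _ _ _ _ hb hq hp ha α => (compat_iff_cyl _ _ _ _ _ _).2
      ((L.compat h α).symm hb hq hp ha)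

variable [Strict D]

lemma hom_inv : L.hom ≫ L.inv = 𝟙 y :=
  GD.hom_eq (GD.Hom₂.mk (fun X => (λ_ (𝟙 (y.obj X))).hom)
    fun i _ _ f hf => (L.iso i).toTrans_comp_symm f hf) (fun X => Strict.id_comp (𝟙 (y.obj X)))
    fun X => congrArg Iso.hom (Strict.leftUnitor_eqToIso (𝟙 (y.obj X)))

lemma inv_hom : L.inv ≫ L.hom = 𝟙 (comparisonObj B A hA₁ hA₂ L.toGD) :=
  GD.hom_eq (GD.Hom₂.mk (fun X => (λ_ (𝟙 (y.obj X))).hom)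
    fun i _ _ f hf => (L.iso i).symm.toTrans_comp_symm f hf)
    (fun X => Strict.id_comp (𝟙 (y.obj X)))
    fun X => congrArg Iso.hom (Strict.leftUnitor_eqToIso (𝟙 (y.obj X)))

end ComparisonLift

end

section

variable {C : Type u} [Bicategory.{w, v} C] [IsLocallyGroupoid C] {D : Type u'}
  [Bicategory.{w', v'} D] {m : ℕ} {A : Fin (m + 2) → WideSub C} {B : WideSub C} {hA₁ : A 0 ≤ B}
  {hA₂ : A 1 ≤ B} [Strict D] (hΦ : IsTwoFullyFaithful (comparison (D := D) B A hA₁ hA₂))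

lemma GD.conj_eqToHom_app {n : ℕ} {A : Fin n → WideSub C} {E E' : GD D A}
    {s s' t t' : GD.Hom E E'} (h : s = s') (Ξ : s' ⟶ t') (h' : t' = t) (X : C) :
    GD.Hom₂.app (eqToHom h ≫ Ξ ≫ eqToHom h') X =
      eqToHom (congrFun (congrArg GD.Hom.app h) X) ≫ GD.Hom₂.app Ξ X ≫
        eqToHom (congrFun (congrArg GD.Hom.app h') X) := by
  subst h h'
  simp

lemma GD.comp_eqToHom_app {n : ℕ} {A : Fin n → WideSub C} {E E' : GD D A}
    {s t t' : GD.Hom E E'} (Ξ : s ⟶ t) (h : t = t') (X : C) :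
    GD.Hom₂.app (Ξ ≫ eqToHom h) X =
      GD.Hom₂.app Ξ X ≫ eqToHom (congrFun (congrArg GD.Hom.app h) X) := by
  subst h
  simp

lemma GD.eqToHom_comp_app {n : ℕ} {A : Fin n → WideSub C} {E E' : GD D A}
    {s s' t : GD.Hom E E'} (h : s = s') (Ξ : s' ⟶ t) (X : C) :
    GD.Hom₂.app (eqToHom h ≫ Ξ) X =
      eqToHom (congrFun (congrArg GD.Hom.app h) X) ≫ GD.Hom₂.app Ξ X := by
  subst h
  simp

namespace ComparisonLift

lemma whiskerRight_unit_comp_eqToHom {X Y : D} {f g : X ⟶ Y} (η : f ⟶ g)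
    (h : g ≫ 𝟙 Y = 𝟙 X ≫ g) (h' : f ≫ 𝟙 Y = 𝟙 X ≫ f) :
    η ▷ 𝟙 Y ≫ eqToHom h = eqToHom h' ≫ 𝟙 X ◁ η := by
  simp [Strict.leftUnitor_eqToIso, Strict.rightUnitor_eqToIso]

lemma eqToHom_unit_whisker {X Y : D} {f g : X ⟶ Y} (η : f ⟶ g) (h : f = 𝟙 X ≫ f ≫ 𝟙 Y)
    (h' : 𝟙 X ≫ g ≫ 𝟙 Y = g) : eqToHom h ≫ 𝟙 X ◁ (η ▷ 𝟙 Y) ≫ eqToHom h' = η := by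
  simp [Strict.leftUnitor_eqToIso, Strict.rightUnitor_eqToIso]

include hΦ in
lemma exists_map_eq {E E' : GD D (coarsen B A)}
    (s : comparisonObj B A hA₁ hA₂ E ⟶ comparisonObj B A hA₁ hA₂ E') :
    ∃ t : GD.Hom E E', comparisonMap B A hA₁ hA₂ t = s :=
  (hΦ.bijective E E').2 s

include hΦ in
lemma exists_map₂_eq {E E' : GD D (coarsen B A)} {s t : GD.Hom E E'}
    (Ξ : comparisonMap B A hA₁ hA₂ s ⟶ comparisonMap B A hA₁ hA₂ t) :
    ∃ Θ : s ⟶ t, comparisonMap₂ B A hA₁ hA₂ Θ = Ξ :=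
  (hΦ.full E E').map_surjective Ξ

/-- The 1-cell with given components that is mapped to a given 1-cell. -/
noncomputable def lift {E E' : GD D (coarsen B A)}
    (s : comparisonObj B A hA₁ hA₂ E ⟶ comparisonObj B A hA₁ hA₂ E')
    (app : ∀ X, E.obj X ⟶ E'.obj X) (h : GD.Hom.app s = app) : E ⟶ E' :=
  GD.Hom.copy (exists_map_eq hΦ s).choose app
    (((congrArg GD.Hom.app (exists_map_eq hΦ s).choose_spec)).trans h)

lemma map_lift {E E' : GD D (coarsen B A)}
    (s : comparisonObj B A hA₁ hA₂ E ⟶ comparisonObj B A hA₁ hA₂ E')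
    (app : ∀ X, E.obj X ⟶ E'.obj X) (h : GD.Hom.app s = app) :
    comparisonMap B A hA₁ hA₂ (lift hΦ s app h) = s :=
  (congrArg (comparisonMap B A hA₁ hA₂) (GD.Hom.copy_eq _ _ _)).trans
    (exists_map_eq hΦ s).choose_spec

include hΦ in
lemma hom_ext {E E' : GD D (coarsen B A)} {s t : E ⟶ E'}
    (h : comparisonMap B A hA₁ hA₂ s = comparisonMap B A hA₁ hA₂ t) : s = t :=
  (hΦ.bijective E E').1 h

lemma map_comp {E E' E'' : GD D (coarsen B A)} (s : E ⟶ E') (t : E' ⟶ E'') :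
    comparisonMap B A hA₁ hA₂ (s ≫ t) =
      (show comparisonObj B A hA₁ hA₂ E ⟶ comparisonObj B A hA₁ hA₂ E' from
        comparisonMap B A hA₁ hA₂ s) ≫
      (show comparisonObj B A hA₁ hA₂ E' ⟶ comparisonObj B A hA₁ hA₂ E'' from
        comparisonMap B A hA₁ hA₂ t) := rfl

variable (L : ∀ y : GD D A, ComparisonLift hA₁ hA₂ y)

lemma conj_app {y y' : GD D A} (s : y ⟶ y') :
    GD.Hom.app ((L y).inv ≫ s ≫ (L y').hom) = GD.Hom.app s := by
  funext X
  exact (Strict.id_comp (GD.Hom.app s X ≫ 𝟙 _)).trans (Strict.comp_id _)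

lemma conj_comp_inv {y y' : GD D A} (s : y ⟶ y') :
    ((L y).inv ≫ s ≫ (L y').hom) ≫ (L y').inv = (L y).inv ≫ s := by
  simp only [Strict.assoc, hom_inv, Strict.comp_id]

lemma conj_comp {y y' y'' : GD D A} (s : y ⟶ y') (t : y' ⟶ y'') :
    ((L y).inv ≫ s ≫ (L y').hom) ≫ (L y').inv ≫ t ≫ (L y'').hom =
      (L y).inv ≫ (s ≫ t) ≫ (L y'').hom := by
  rw [← Strict.assoc ((L y).inv ≫ s ≫ (L y').hom), conj_comp_inv]
  simp only [Strict.assoc]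

/-- The action of the quasi-inverse on 1-cells. -/
noncomputable def inverseMap {y y' : GD D A} (s : y ⟶ y') : (L y).toGD ⟶ (L y').toGD :=
  lift hΦ ((L y).inv ≫ s ≫ (L y').hom) (GD.Hom.app (E := y) (E' := y') s)
    (conj_app L s)

lemma map_inverseMap {y y' : GD D A} (s : y ⟶ y') :
    comparisonMap B A hA₁ hA₂ (inverseMap hΦ L s) = (L y).inv ≫ s ≫ (L y').hom :=
  map_lift hΦ _ _ _

lemma exists_inverseMap₂ {y y' : GD D A} {s s' : y ⟶ y'} (Ξ : s ⟶ s') :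
    ∃ Θ : inverseMap hΦ L s ⟶ inverseMap hΦ L s', GD.Hom₂.app Θ =
      GD.Hom₂.app (E := y) (E' := y') (s := s) (t := s') Ξ := by
  obtain ⟨Θ, h⟩ := exists_map₂_eq hΦ (eqToHom (map_inverseMap hΦ L s) ≫
    (L y).inv ◁ (Ξ ▷ (L y').hom) ≫ eqToHom (map_inverseMap hΦ L s').symm)
  refine ⟨Θ, (congrArg GD.Hom₂.app h).trans (funext fun X => ?_)⟩
  refine (GD.conj_eqToHom_app _ _ _ X).trans ?_
  exact eqToHom_unit_whisker (GD.Hom₂.app (E := y) (E' := y') (s := s) (t := s') Ξ X) _ _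

/-- The action of the quasi-inverse on 2-cells. -/
noncomputable def inverseMap₂ {y y' : GD D A} {s s' : y ⟶ y'} (Ξ : s ⟶ s') :
    inverseMap hΦ L s ⟶ inverseMap hΦ L s' :=
  GD.Hom₂.mk (GD.Hom₂.app (E := y) (E' := y') (s := s) (t := s') Ξ) fun i _ _ f hf => by
    obtain ⟨Θ, h⟩ := exists_inverseMap₂ hΦ L Ξ
    rw [← h]
    exact GD.Hom₂.nat Θ i f hf

lemma inverseMap_id (y : GD D A) : inverseMap hΦ L (𝟙 y) = 𝟙 (L y).toGD := by
  refine hom_ext hΦ ((map_inverseMap hΦ L (𝟙 y)).trans ?_)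
  rw [Strict.id_comp, inv_hom]
  rfl

lemma inverseMap_comp {y y' y'' : GD D A} (s : y ⟶ y') (t : y' ⟶ y'') :
    inverseMap hΦ L (s ≫ t) = inverseMap hΦ L s ≫ inverseMap hΦ L t := by
  refine hom_ext hΦ ?_
  rw [map_comp, map_inverseMap, map_inverseMap, map_inverseMap]
  exact (conj_comp L s t).symm

/-- The quasi-inverse of the comparison. -/
noncomputable def inverse : StrictPseudofunctor (GD D A) (GD D (coarsen B A)) := .mk''
  { obj := fun y => (L y).toGD
    map := inverseMap hΦ L
    map₂ := inverseMap₂ hΦ L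
    map₂_id := fun _ => rfl
    map₂_comp := fun _ _ => rfl
    map_id := inverseMap_id hΦ L
    map_comp := inverseMap_comp hΦ L
    map₂_whisker_left := fun {y _ y''} s {t t'} Ξ => GD.hom₂_ext fun X => by
      refine Eq.trans ?_ (GD.conj_eqToHom_app _ _ _ X).symm
      exact eqToHom_rfl_comp _
    map₂_whisker_right := fun {y _ y'' s s'} Ξ t => GD.hom₂_ext fun X => by
      refine Eq.trans ?_ (GD.conj_eqToHom_app _ _ _ X).symm
      exact eqToHom_rfl_comp _ }

lemma inverse_comp_forget : (inverse hΦ L).comp (forgetGD (coarsen B A)) = forgetGD A :=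
  strictPseudofunctor_ext rfl

/-- The unit of the comparison. -/
noncomputable def unit : TwoNatTrans (StrictPseudofunctor.id (GD D A))
    ((inverse hΦ L).comp (comparison B A hA₁ hA₂)) where
  app y := (L y).hom
  naturality {y y'} s := by
    refine Eq.trans ?_ (congrArg (fun a => (L y).hom ≫ a) (map_inverseMap hΦ L s)).symm
    rw [← Strict.assoc, hom_inv, Strict.id_comp]
    rfl
  naturality₂ {y y' s s'} Ξ := GD.hom₂_ext fun X => by
    refine (GD.comp_eqToHom_app _ _ X).trans (Eq.trans ?_ (GD.eqToHom_comp_app _ _ X).symm)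
    exact whiskerRight_unit_comp_eqToHom _ _ _

/-- The components of the counit. -/
noncomputable def counitApp (x : GD D (coarsen B A)) :
    (L (comparisonObj B A hA₁ hA₂ x)).toGD ⟶ x :=
  lift hΦ (L (comparisonObj B A hA₁ hA₂ x)).inv (fun X => 𝟙 (x.obj X)) rfl

lemma map_counitApp (x : GD D (coarsen B A)) : comparisonMap B A hA₁ hA₂ (counitApp hΦ L x) =
    (L (comparisonObj B A hA₁ hA₂ x)).inv :=
  map_lift hΦ _ _ _

lemma counitApp_naturality {x x' : GD D (coarsen B A)} (s : x ⟶ x') :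
    inverseMap hΦ L (comparisonMap B A hA₁ hA₂ s) ≫ counitApp hΦ L x' =
      counitApp hΦ L x ≫ s := by
  refine hom_ext hΦ ?_
  rw [map_comp, map_comp, map_inverseMap, map_counitApp, map_counitApp]
  exact conj_comp_inv L _

/-- The counit of the comparison. -/
noncomputable def counit : TwoNatTrans ((comparison B A hA₁ hA₂).comp (inverse hΦ L))
    (StrictPseudofunctor.id (GD D (coarsen B A))) where
  app x := counitApp hΦ L x
  naturality s := counitApp_naturality hΦ L s
  naturality₂ {x x' s s'} Ξ := GD.hom₂_ext fun X => by
    refine (GD.comp_eqToHom_app _ _ X).trans (Eq.trans ?_ (GD.eqToHom_comp_app _ _ X).symm)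
    exact whiskerRight_unit_comp_eqToHom _ _ _

end ComparisonLift

open ComparisonLift in
include hΦ in
theorem comparison_isOverEquivalence (L : ∀ y : GD D A, ComparisonLift hA₁ hA₂ y) :
    IsOverEquivalence (forgetGD (coarsen B A)) (forgetGD A)
      (comparison (D := D) B A hA₁ hA₂) := by
  refine ⟨comparison_comp_forget B A hA₁ hA₂, inverse hΦ L, inverse_comp_forget hΦ L,
    ⟨unit hΦ L, fun y => ⟨(L y).inv, (L y).hom_inv, (L y).inv_hom⟩,
      fun y => IsIdentity.id (⟨y.obj⟩ : TwoFun C D)⟩,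
    ⟨counit hΦ L, fun x => ⟨lift hΦ (E := x) (E' := (L (comparisonObj B A hA₁ hA₂ x)).toGD)
      (L (comparisonObj B A hA₁ hA₂ x)).hom (fun X => 𝟙 (x.obj X)) rfl, ?_, ?_⟩,
      fun x => IsIdentity.id (⟨x.obj⟩ : TwoFun C D)⟩⟩
  · refine hom_ext hΦ ?_
    exact (map_comp _ _).trans ((congrArg₂ (fun (a : comparisonObj B A hA₁ hA₂ (L _).toGD ⟶ _)
      (b : _ ⟶ comparisonObj B A hA₁ hA₂ (L _).toGD) => a ≫ b) (map_counitApp hΦ L x)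
      (map_lift hΦ _ _ _)).trans (inv_hom _))
  · refine hom_ext hΦ ?_
    exact (map_comp _ _).trans ((congrArg₂ (fun (a : comparisonObj B A hA₁ hA₂ x ⟶
      comparisonObj B A hA₁ hA₂ (L _).toGD) (b : _ ⟶ comparisonObj B A hA₁ hA₂ x) => a ≫ b)
      (map_lift hΦ _ _ _) (map_counitApp hΦ L x)).trans (hom_inv _))

end

end TwoGlue

theorem mainTheorem2 {C : Type u} [Bicategory.{w, v} C] [Bicategory.Strict C]
    [IsLocallyGroupoid C] {D : Type u'} [Bicategory.{w', v'} D] [Bicategory.Strict D]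
    (m : ℕ) (A : Fin (m + 2) → WideSub C) (B : WideSub C) (hA₁ : A 0 ≤ B) (hA₂ : A 1 ≤ B)
    (h_i : Factors (A 0) (A 1) B)
    (h_ii : HasFiberProductsAgreeing (A 1) B)
    (h_iii : ∀ i : Fin m, HasBaseChanges (A i.succ.succ) (A 1) ∧
      StableUnderBaseChange (A i.succ.succ) (A 1))
    (h_iv : ∀ j : Fin m, StableUnderBaseChange (A 0) (A j.succ.succ) ∧
      StableUnderBaseChange (A 1) (A j.succ.succ))
    (h_v : ∀ i : Fin m, Squaring B (A i.succ.succ))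
    (h_vi : ∀ i : Fin m, Generates (A 0 ⊓ A i.succ.succ) (A 1 ⊓ A i.succ.succ)
      (B ⊓ A i.succ.succ)) :
    IsTwoFullyFaithful (comparison (D := D) B A hA₁ hA₂) ∧
    ((∀ j : Fin m, Squaring (A 0) (A j.succ.succ) ∧ Squaring (A 1) (A j.succ.succ)) →
      Cubing (coarsen B A) →
      (∀ i : Fin m, Factors (A 0 ⊓ A i.succ.succ) (A 1 ⊓ A i.succ.succ) (B ⊓ A i.succ.succ)) →
      (∀ i : Fin m, HasFiberProductsAgreeing (A 1 ⊓ A i.succ.succ) (B ⊓ A i.succ.succ)) →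
      (∀ i : Fin m, HasBaseChanges (A 1 ⊓ A i.succ.succ) (A 0)) →
      (∀ j : Fin m,
        (StableUnderBaseChange (A 0 ⊓ A j.succ.succ) B ∧
          StableUnderBaseChange (A 0 ⊓ A j.succ.succ) (A j.succ.succ)) ∧
        (StableUnderBaseChange (A 1 ⊓ A j.succ.succ) B ∧
          StableUnderBaseChange (A 1 ⊓ A j.succ.succ) (A j.succ.succ))) →
      (∀ i j : Fin m, i < j →
        Generates (A 0 ⊓ A i.succ.succ ⊓ A j.succ.succ) (A 1 ⊓ A i.succ.succ ⊓ A j.succ.succ)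
          (B ⊓ A i.succ.succ ⊓ A j.succ.succ)) →
      IsOverEquivalence (forgetGD (coarsen B A)) (forgetGD A) (comparison (D := D) B A hA₁ hA₂)) := by
  refine ⟨comparison_isTwoFullyFaithful hA₁ hA₂ h_i h_ii h_iii h_iv h_v h_vi, 
    fun h_iv' h_v' h_vi' h_vii h_viii h_ix h_x => ?_⟩
  have E₁ : ∀ i : Fin m, ExtensionConditions (A 0) (A 1) B (A i.succ.succ) := fun i =>
    { hP := hA₁
      hQ := hA₂
      fac := h_i
      fib := h_ii
      bc := (h_iii i).1
      st := (h_iii i).2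
      stP := (h_iv i).1
      stQ := (h_iv i).2
      sq := h_v i
      sqP := (h_iv' i).1
      sqQ := (h_iv' i).2
      sqJ := (h_v'.1 i.succ 0 (Fin.succ_ne_zero i)).2
      facJ := h_vi' i
      fibJ := h_vii i
      bcQ := h_viii i
      stPB := (h_ix i).1.1
      stQB := (h_ix i).2.1
      stPJ := (h_ix i).1.2
      stQJ := (h_ix i).2.2 }
  have E₂ : ∀ i j : Fin m, i < j →
      CubeConditions (A 0) (A 1) B (A i.succ.succ) (A j.succ.succ) := fun i j h =>
    have hij : i.succ ≠ j.succ := fun e => h.ne (Fin.succ_injective m e)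
    { left := E₁ i
      right := E₁ j
      sq := (h_v'.1 i.succ j.succ hij).1
      sq' := (h_v'.1 j.succ i.succ hij.symm).1
      cube := h_v'.2 0 i.succ j.succ (Fin.succ_ne_zero i).symm hij (Fin.succ_ne_zero j).symm
      cube' := h_v'.2 0 j.succ i.succ (Fin.succ_ne_zero j).symm hij.symm (Fin.succ_ne_zero i).symm
      gen := h_x i j h }
  exact comparison_isOverEquivalence
    (comparison_isTwoFullyFaithful hA₁ hA₂ h_i h_ii h_iii h_iv h_v h_vi)
    fun y => (exists_comparisonLift hA₁ hA₂ E₁ E₂ h_i h_ii y).some
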